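/- **Notation.** Let $d\ge 1$ and let $\mathbb T^d=\mathbb R^d/\mathbb Z^d$ be the flat torus with its Haar probability measure and its geodesic distance $\mathsf d(x,y)=\min_{k\in\mathbb Z^d}|x-y-k|$. For $0<\alpha\le 1$ and $0<p\le\infty$, a function $f\in L^p(\mathbb T^d)$ belongs to $F^\alpha_p$ if $$[f]_{F^\alpha_p}:=\inf\Big\{\|g\|_{L^p}\;:\; g:\mathbb T^d\to[0,\infty] \text{ measurable},\ |f(x)-f(y)|\le \mathsf d(x,y)^\alpha\,(g(x)+g(y))\ \ \forall x,y\in\mathbb T^d\Big\}<\infty .$$ **Theorem.** For every $d\ge1$ there are constants $C_1>0$ and $C_2>2$, depending only on $d$, with the following property. Let $T>0$, $\beta>0$, and let $b\in L^1([0,T]\times\mathbb T^d;\mathbb R^d)$ be a vector field whose spatial distributional derivatives are functions such that $$\sup_{t\in[0,T]}\int_{\mathbb T^d}\exp\{\beta|\nabla b_t(x)|\}\,dx=K<\infty,\qquad \|\operatorname{div} b\|_{L^\infty([0,T]\times\mathbb T^d)}=L<\infty .$$ Let $0<\alpha\le1$, $1\le p<\infty$ and $u_0\in F^\alpha_p$.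 Then the transport equation $\partial_tu+b\cdot\nabla u=0$, $u(0,\cdot)=u_0$, has a unique distributional solution $u\in L^\infty([0,T];L^p(\mathbb T^d))$, that is, a unique bounded and weakly continuous curve $[0,T]\ni t\mapsto u_t\in L^p(\mathbb T^d)$ such that for all $t\in[0,T]$ and $\varphi\in C^\infty(\mathbb T^d)$ $$\int_{\mathbb T^d}u_t\varphi\,dx-\int_{\mathbb T^d}u_0\varphi\,dx=\int_0^t\!\int_{\mathbb T^d}u_s\,\big(b_s\cdot\nabla\varphi+\varphi\operatorname{div}b_s\big)\,dx\,ds ,$$ and it satisfies, for every $t\in[0,T]$, $u_t\in F^\alpha_{p_t}$ and $$[u_t]_{F^\alpha_{p_t}}\le [u_0]_{F^\alpha_p}\,\big(e^{Lt}C_2K\big)^{1/p_t},\qquad p_t:=\frac{p}{1+\beta^{-1}\alpha\,p\,C_1\,t}.$$ -/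

import Mathlib

open MeasureTheory Set
open scoped ENNReal NNReal

namespace TorusTransport

noncomputable section

/-- The flat torus `ℝᵈ / ℤᵈ`; its `volume` is the Haar probability measure. -/
abbrev Torus (d : ℕ) : Type := UnitAddTorus (Fin d)

/-- The geodesic distance of the flat torus. The norm of `UnitAddCircle` is the distance to the
nearest integer, so this is `min {|x - y - k| : k ∈ ℤᵈ}` with the Euclidean norm `|·|`
(the metric instance on `UnitAddTorus` is the sup one and is not used). -/
def torusDist {d : ℕ} (x y : Torus d) : ℝ :=
  Real.sqrt (∑ i, ‖x i - y i‖ ^ 2)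

/-- `φ ∈ C^∞(𝕋ᵈ)`: the periodic lift of `φ` to `ℝᵈ` is smooth. -/
def IsSmooth {d : ℕ} (φ : Torus d → ℝ) : Prop :=
  ContDiff ℝ (⊤ : ℕ∞) (fun v : Fin d → ℝ => φ (fun i => (v i : UnitAddCircle)))

/-- The classical partial derivative `∂_j φ` on the torus. -/
def partialDeriv {d : ℕ} (j : Fin d) (φ : Torus d → ℝ) (x : Torus d) : ℝ :=
  deriv (fun s : ℝ => φ (x + Pi.single j (s : UnitAddCircle))) 0

/-- `G` is the distributional gradient of the vector field `f`, `G x i j = ∂_j f_i (x)`, both being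
integrable functions on the torus. -/
structure IsWeakGradient {d : ℕ} (f : Torus d → EuclideanSpace ℝ (Fin d))
    (G : Torus d → Matrix (Fin d) (Fin d) ℝ) : Prop where
  integrable : Integrable f volume
  integrable_grad : ∀ i j, Integrable (fun x => G x i j) volume
  integral_eq : ∀ (i j : Fin d) (φ : Torus d → ℝ), IsSmooth φ →
    ∫ x, f x i * partialDeriv j φ x = -∫ x, G x i j * φ x

/-- The Euclidean (Frobenius) norm of a matrix. -/
def matNorm {d : ℕ} (A : Matrix (Fin d) (Fin d) ℝ) : ℝ :=
  Real.sqrt (∑ i, ∑ j, A i j ^ 2)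

/-- Lebesgue measure on `[0,T] × 𝕋ᵈ`. -/
def spaceTime (d : ℕ) (T : ℝ) : Measure (ℝ × Torus d) :=
  (volume.restrict (Icc 0 T)).prod volume

/-- The seminorm `[f]_{F^α_p}`: the infimum of `‖g‖_{L^p}` over measurable `g : 𝕋ᵈ → [0,∞]` with
`|f x - f y| ≤ dist(x,y)^α (g x + g y)` for all `x, y`; it is `∞` if there is no such `g` in `L^p`.
As `g` may be infinite on a null set, it only depends on the almost everywhere class of `f`. -/
def seminormF {d : ℕ} (α : ℝ) (p : ℝ≥0∞) (f : Torus d → ℝ) : ℝ≥0∞ :=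
  ⨅ (g : Torus d → ℝ≥0∞) (_ : AEMeasurable g volume)
    (_ : ∀ x y, ENNReal.ofReal |f x - f y| ≤
      ENNReal.ofReal (torusDist x y ^ α) * (g x + g y)),
    eLpNorm g p volume

/-- The class `F^α_p`. -/
def MemF {d : ℕ} (α : ℝ) (p : ℝ≥0∞) (f : Torus d → ℝ) : Prop :=
  MemLp f p volume ∧ seminormF α p f < ∞

/-- `u ∈ L^∞([0,T]; L^p(𝕋ᵈ))` is a distributional solution of `∂ₜu + b·∇u = 0`, `u(0,·) = u₀`, where
`Db` is the spatial gradient of `b`: a bounded, weakly continuous curve in `L^p` such that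
`∫ uₜ φ - ∫ u₀ φ = ∫₀ᵗ ∫ uₛ (bₛ·∇φ + (div bₛ) φ) dx ds` for all `t ∈ [0,T]` and `φ ∈ C^∞(𝕋ᵈ)`. -/
structure IsTransportSolution {d : ℕ} (T p : ℝ) (b : ℝ → Torus d → EuclideanSpace ℝ (Fin d))
    (Db : ℝ → Torus d → Matrix (Fin d) (Fin d) ℝ) (u₀ : Torus d → ℝ)
    (u : ℝ → Torus d → ℝ) : Prop where
  aestronglyMeasurable : AEStronglyMeasurable (fun z : ℝ × Torus d => u z.1 z.2) (spaceTime d T)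
  memLp : ∀ t ∈ Icc 0 T, MemLp (u t) (ENNReal.ofReal p) volume
  bounded : ∃ M : ℝ≥0, ∀ t ∈ Icc 0 T, eLpNorm (u t) (ENNReal.ofReal p) volume ≤ M
  weaklyContinuous : ∀ q : ℝ≥0∞, ENNReal.HolderConjugate (ENNReal.ofReal p) q →
    ∀ ψ : Torus d → ℝ, MemLp ψ q volume → ContinuousOn (fun t => ∫ x, u t x * ψ x) (Icc 0 T)
  integrable : ∀ φ : Torus d → ℝ, IsSmooth φ →
    Integrable (fun z : ℝ × Torus d => u z.1 z.2 *
      ((∑ i, b z.1 z.2 i * partialDeriv i φ z.2) + (Db z.1 z.2).trace * φ z.2)) (spaceTime d T)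
  integral_eq : ∀ φ : Torus d → ℝ, IsSmooth φ → ∀ t ∈ Icc 0 T,
    (∫ x, u t x * φ x) - ∫ x, u₀ x * φ x =
      ∫ s in (0 : ℝ)..t, ∫ x, u s x *
        ((∑ i, b s x i * partialDeriv i φ x) + (Db s x).trace * φ x)

end

end TorusTransport

open TorusTransport

open Filter Topology


namespace TorusTransport

noncomputable section

instance isProbabilityMeasure_unitAddCircle :
    IsProbabilityMeasure (volume : Measure UnitAddCircle) := ⟨UnitAddCircle.measure_univ⟩

variable {d : ℕ}

/-- The covering map `ℝᵈ → 𝕋ᵈ`. -/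
def proj (v : Fin d → ℝ) : Torus d := fun i => (v i : UnitAddCircle)

lemma proj_add (v w : Fin d → ℝ) : proj (v + w) = proj v + proj w := rfl

lemma proj_sub (v w : Fin d → ℝ) : proj (v - w) = proj v - proj w := rfl

lemma proj_neg (v : Fin d → ℝ) : proj (-v) = -proj v := rfl

lemma proj_zero : proj (0 : Fin d → ℝ) = 0 := rfl

lemma proj_single (j : Fin d) (s : ℝ) :
    proj (Pi.single j s : Fin d → ℝ) = Pi.single j (s : UnitAddCircle) := by
  ext i
  by_cases h : i = j
  · subst h; simp [proj]
  · simp [proj, h]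

lemma isOpenQuotientMap_proj : IsOpenQuotientMap (proj : (Fin d → ℝ) → Torus d) :=
  IsOpenQuotientMap.piMap (f := fun (_ : Fin d) (s : ℝ) => (s : UnitAddCircle))
    fun _ => QuotientAddGroup.isOpenQuotientMap_mk

lemma continuous_proj : Continuous (proj : (Fin d → ℝ) → Torus d) :=
  isOpenQuotientMap_proj.continuous

lemma surjective_proj : Function.Surjective (proj : (Fin d → ℝ) → Torus d) :=
  isOpenQuotientMap_proj.surjective

lemma measurable_proj : Measurable (proj : (Fin d → ℝ) → Torus d) := continuous_proj.measurable

lemma norm_coe_unitAddCircle_le (s : ℝ) : ‖(s : UnitAddCircle)‖ ≤ |s| := by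
  rw [UnitAddCircle.norm_eq]
  simpa using round_le s 0

lemma norm_proj_apply_le (v : Fin d → ℝ) (i : Fin d) : ‖proj v i‖ ≤ |v i| :=
  norm_coe_unitAddCircle_le _

lemma norm_proj_le (v : Fin d → ℝ) : ‖proj v‖ ≤ ‖v‖ := by
  refine (pi_norm_le_iff_of_nonneg (norm_nonneg _)).2 fun i => ?_
  exact (norm_proj_apply_le v i).trans (norm_le_pi_norm v i)

lemma norm_unitAddCircle_le_half (x : UnitAddCircle) : ‖x‖ ≤ 1 / 2 := by
  simpa using AddCircle.norm_le_half_period (1 : ℝ) (x := x) one_ne_zero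

/-- Every point of the torus has a shortest lift. -/
lemma exists_lift (x : Torus d) : ∃ v : Fin d → ℝ, proj v = x ∧ ∀ i, |v i| = ‖x i‖ := by
  have h : ∀ i, ∃ s : ℝ, (s : UnitAddCircle) = x i ∧ |s| = ‖x i‖ := by
    intro i
    obtain ⟨s, hs⟩ := QuotientAddGroup.mk_surjective (x i)
    refine ⟨s - round s, ?_, ?_⟩
    · rw [← hs]
      have : ((s - round s : ℝ) : UnitAddCircle) = (s : UnitAddCircle) := by
        rw [AddCircle.coe_sub, sub_eq_self, AddCircle.coe_eq_zero_iff]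
        exact ⟨round s, by simp⟩
      exact this
    · rw [← hs]; exact (UnitAddCircle.norm_eq).symm
  choose v hv using h
  exact ⟨v, funext fun i => (hv i).1, fun i => (hv i).2⟩

/-! ### Smooth functions on the torus -/

lemma IsSmooth.contDiff {φ : Torus d → ℝ} (h : IsSmooth φ) :
    ContDiff ℝ (⊤ : ℕ∞) (fun v : Fin d → ℝ => φ (proj v)) := h

lemma isSmooth_iff {φ : Torus d → ℝ} :
    IsSmooth φ ↔ ContDiff ℝ (⊤ : ℕ∞) (fun v : Fin d → ℝ => φ (proj v)) := Iff.rfl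

lemma IsSmooth.continuous {φ : Torus d → ℝ} (h : IsSmooth φ) : Continuous φ :=
  isOpenQuotientMap_proj.isQuotientMap.continuous_iff.2 h.contDiff.continuous

lemma isSmooth_const (c : ℝ) : IsSmooth (fun _ : Torus d => c) := contDiff_const

lemma IsSmooth.mul {φ ψ : Torus d → ℝ} (h : IsSmooth φ) (h' : IsSmooth ψ) :
    IsSmooth (fun x => φ x * ψ x) := ContDiff.mul h.contDiff h'.contDiff

lemma IsSmooth.comp_add {φ : Torus d → ℝ} (h : IsSmooth φ) (y : Torus d) :
    IsSmooth (fun x => φ (x + y)) := by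
  obtain ⟨u, rfl⟩ := surjective_proj y
  have := h.contDiff.comp (contDiff_id.add (contDiff_const (c := u)))
  exact this

lemma IsSmooth.comp_neg {φ : Torus d → ℝ} (h : IsSmooth φ) : IsSmooth (fun x => φ (-x)) :=
  h.contDiff.comp contDiff_neg

lemma IsSmooth.comp_sub_left {φ : Torus d → ℝ} (h : IsSmooth φ) (x : Torus d) :
    IsSmooth (fun y => φ (x - y)) := by
  have := (h.comp_add x).comp_neg
  simpa [sub_eq_add_neg, add_comm] using this

lemma partialDeriv_proj (j : Fin d) {φ : Torus d → ℝ} (h : IsSmooth φ) (v : Fin d → ℝ) :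
    partialDeriv j φ (proj v) = fderiv ℝ (fun w => φ (proj w)) v (Pi.single j 1) := by
  have h1 : (fun s : ℝ => φ (proj v + Pi.single j (s : UnitAddCircle))) =
      fun s : ℝ => φ (proj (v + s • Pi.single j (1 : ℝ))) := by
    funext s
    rw [proj_add]
    congr 2
    rw [← proj_single]
    congr 1
    ext i
    by_cases hi : i = j
    · subst hi; simp
    · simp [hi]
  unfold partialDeriv
  rw [h1]
  have hd : HasFDerivAt (fun w => φ (proj w)) (fderiv ℝ (fun w => φ (proj w)) v) v :=
    (h.contDiff.differentiable (by simp) v).hasFDerivAt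
  have := hd.hasLineDerivAt (Pi.single j 1)
  exact this.deriv

lemma IsSmooth.partialDeriv {φ : Torus d → ℝ} (h : IsSmooth φ) (j : Fin d) :
    IsSmooth (partialDeriv j φ) := by
  rw [isSmooth_iff]
  simp_rw [partialDeriv_proj j h]
  exact (h.contDiff.fderiv_right (by simp)).clm_apply contDiff_const

/-- The gradient, as a linear form. -/
def gradForm (φ : Torus d → ℝ) (x : Torus d) : (Fin d → ℝ) →L[ℝ] ℝ :=
  ∑ j, partialDeriv j φ x • ContinuousLinearMap.proj j

lemma gradForm_apply (φ : Torus d → ℝ) (x : Torus d) (w : Fin d → ℝ) :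
    gradForm φ x w = ∑ j, partialDeriv j φ x * w j := by
  simp [gradForm]

lemma gradForm_single (φ : Torus d → ℝ) (x : Torus d) (j : Fin d) :
    gradForm φ x (Pi.single j 1) = partialDeriv j φ x := by
  simp [gradForm_apply, Pi.single_apply]

lemma IsSmooth.hasFDerivAt {φ : Torus d → ℝ} (h : IsSmooth φ) (v : Fin d → ℝ) :
    HasFDerivAt (fun w => φ (proj w)) (gradForm φ (proj v)) v := by
  have hd : HasFDerivAt (fun w => φ (proj w)) (fderiv ℝ (fun w => φ (proj w)) v) v :=
    (h.contDiff.differentiable (by simp) v).hasFDerivAt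
  convert hd using 1
  ext w
  rw [gradForm_apply]
  conv_rhs => rw [← Finset.univ_sum_single w, map_sum]
  refine Finset.sum_congr rfl fun j _ => ?_
  rw [partialDeriv_proj j h]
  have : (Pi.single j (w j) : Fin d → ℝ) = w j • Pi.single j 1 := by
    ext i
    by_cases hi : i = j
    · subst hi; simp
    · simp [hi]
  rw [this, map_smul, smul_eq_mul, mul_comm]

lemma IsSmooth.hasFDerivAt_add {φ : Torus d → ℝ} (h : IsSmooth φ) (x : Torus d)
    (v : Fin d → ℝ) : HasFDerivAt (fun w => φ (x + proj w)) (gradForm φ (x + proj v)) v := by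
  obtain ⟨u, rfl⟩ := surjective_proj x
  have h1 := (h.hasFDerivAt (u + v)).comp v ((hasFDerivAt_id v).const_add u)
  exact h1

lemma hasFDerivAt_partialDeriv_eq {φ : Torus d → ℝ} {x : Torus d} {A : (Fin d → ℝ) →L[ℝ] ℝ}
    (h : HasFDerivAt (fun w => φ (x + proj w)) A 0) (j : Fin d) :
    partialDeriv j φ x = A (Pi.single j 1) := by
  have h1 := (h.hasLineDerivAt (Pi.single j 1)).deriv
  rw [← h1]
  unfold partialDeriv
  congr 1
  funext s
  rw [← proj_single]
  congr 3
  ext i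
  by_cases hi : i = j
  · subst hi; simp
  · simp [hi]

lemma IsSmooth.hasDerivAt_line {φ : Torus d → ℝ} (h : IsSmooth φ) (x : Torus d)
    (w : Fin d → ℝ) (τ : ℝ) :
    HasDerivAt (fun τ : ℝ => φ (x + proj (τ • w))) (gradForm φ (x + proj (τ • w)) w) τ := by
  have h1 := (h.hasFDerivAt_add x (τ • w)).comp_hasDerivAt τ
    ((hasDerivAt_id τ).smul_const w)
  rw [one_smul] at h1
  exact h1

lemma exists_bound_of_continuous {V : Type*} [NormedAddCommGroup V] {f : Torus d → V}
    (h : Continuous f) : ∃ C : ℝ, 0 ≤ C ∧ ∀ x, ‖f x‖ ≤ C := by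
  obtain ⟨C, hC⟩ := (isCompact_univ (X := Torus d)).exists_bound_of_continuousOn h.continuousOn
  exact ⟨max C 0, le_max_right _ _, fun x => (hC x (mem_univ x)).trans (le_max_left _ _)⟩

lemma integrable_of_continuous {V : Type*} [NormedAddCommGroup V] {f : Torus d → V}
    (h : Continuous f) : Integrable f volume :=
  h.integrable_of_hasCompactSupport (HasCompactSupport.of_compactSpace f)

lemma partialDeriv_mul (j : Fin d) {φ ψ : Torus d → ℝ} (h : IsSmooth φ) (h' : IsSmooth ψ)
    (x : Torus d) : partialDeriv j (fun x => φ x * ψ x) x =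
      partialDeriv j φ x * ψ x + φ x * partialDeriv j ψ x := by
  have h1 := (h.hasFDerivAt_add x 0).mul (h'.hasFDerivAt_add x 0)
  rw [hasFDerivAt_partialDeriv_eq h1]
  simp [gradForm_single, proj_zero]
  ring

lemma partialDeriv_const (j : Fin d) (c : ℝ) (x : Torus d) :
    partialDeriv j (fun _ => c) x = 0 := by
  simp [partialDeriv]

lemma partialDeriv_comp_sub_left (j : Fin d) {φ : Torus d → ℝ} (h : IsSmooth φ)
    (x y : Torus d) :
    partialDeriv j (fun y => φ (x - y)) y = -partialDeriv j φ (x - y) := by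
  have h1 := (h.hasFDerivAt_add (x - y) (-0)).comp (0 : Fin d → ℝ) ((hasFDerivAt_id 0).neg)
  have h2 : ((fun w => φ (x - y + proj w)) ∘ fun w => -w) = fun w => φ (x - (y + proj w)) := by
    funext w
    simp only [Function.comp, proj_neg]
    congr 1; abel
  rw [h2] at h1
  rw [hasFDerivAt_partialDeriv_eq (φ := fun y => φ (x - y)) h1]
  simp [gradForm_single, proj_zero]

lemma integral_partialDeriv (j : Fin d) {φ : Torus d → ℝ} (h : IsSmooth φ) :
    ∫ x, partialDeriv j φ x = 0 := by
  obtain ⟨C, hC0, hC⟩ := exists_bound_of_continuous (h.partialDeriv j).continuous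
  have h1 := (hasDerivAt_integral_of_dominated_loc_of_deriv_le (μ := (volume : Measure (Torus d)))
    (F := fun (s : ℝ) x => φ (x + proj (s • (Pi.single j 1 : Fin d → ℝ))))
    (F' := fun s x => gradForm φ (x + proj (s • (Pi.single j 1 : Fin d → ℝ))) (Pi.single j 1))
    (x₀ := (0 : ℝ)) (bound := fun _ => C)
    (univ_mem) (Eventually.of_forall fun s =>
      (h.continuous.comp (continuous_add_const _)).aestronglyMeasurable)
    (integrable_of_continuous (h.continuous.comp (continuous_add_const _)))
    ((by
      have : Continuous fun x => partialDeriv j φ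
          (x + proj ((0 : ℝ) • (Pi.single j 1 : Fin d → ℝ))) :=
        (h.partialDeriv j).continuous.comp (continuous_add_const _)
      simpa [gradForm_apply, Pi.single_apply] using this.aestronglyMeasurable))
    (Eventually.of_forall fun x s _ => by simpa [gradForm_apply, Pi.single_apply] using hC _)
    (integrable_const _)
    (Eventually.of_forall fun x s _ => h.hasDerivAt_line x _ s)).2
  have h2 : (fun s : ℝ => ∫ x : Torus d, φ (x + proj (s • (Pi.single j 1 : Fin d → ℝ)))) =
      fun _ => ∫ x, φ x := by
    funext s
    exact integral_add_right_eq_self φ _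
  rw [h2] at h1
  have h3 := h1.unique (hasDerivAt_const _ _)
  simpa [gradForm_apply, Pi.single_apply, proj_zero] using h3

end

end TorusTransport


namespace TorusTransport

noncomputable section

variable {d : ℕ}

instance isNegInvariant_torus : (volume : Measure (Torus d)).IsNegInvariant :=
  Measure.IsAddHaarMeasure.isNegInvariant_of_regular _

/-! ### Convolution on the torus -/

/-- The convolution `ρ ⋆ f` on the torus. -/
def mollify {V : Type*} [NormedAddCommGroup V] [NormedSpace ℝ V] (ρ : Torus d → ℝ)
    (f : Torus d → V) (x : Torus d) : V := ∫ y, ρ (x - y) • f y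

section

variable {V : Type*} [NormedAddCommGroup V] [NormedSpace ℝ V]

lemma mollify_eq (ρ : Torus d → ℝ) (f : Torus d → V) (x : Torus d) :
    mollify ρ f x = ∫ y, ρ y • f (x - y) := by
  rw [mollify, ← integral_sub_left_eq_self (fun y => ρ y • f (x - y)) volume x]
  simp

lemma integrable_mollify_integrand {ρ : Torus d → ℝ} (hρ : Continuous ρ) {f : Torus d → V}
    (hf : Integrable f) (x : Torus d) : Integrable (fun y => ρ (x - y) • f y) := by
  obtain ⟨C, _, hC⟩ := exists_bound_of_continuous hρ
  exact hf.bdd_smul C (hρ.comp (continuous_const.sub continuous_id)).aestronglyMeasurable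
    (Eventually.of_forall fun y => hC _)

lemma norm_mollify_le {ρ : Torus d → ℝ} {C : ℝ} (hC : ∀ x, |ρ x| ≤ C) {f : Torus d → V}
    (hf : Integrable f) (x : Torus d) : ‖mollify ρ f x‖ ≤ C * ∫ y, ‖f y‖ := by
  rw [← integral_const_mul]
  refine (norm_integral_le_of_norm_le (hf.norm.const_mul C) (Eventually.of_forall fun y => ?_))
  rw [norm_smul]
  exact mul_le_mul_of_nonneg_right (hC _) (norm_nonneg _)

end

lemma hasFDerivAt_mollify {ρ : Torus d → ℝ} (hρ : IsSmooth ρ) {f : Torus d → ℝ}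
    (hf : Integrable f) (v : Fin d → ℝ) :
    HasFDerivAt (fun w => mollify ρ f (proj w))
      (∑ j, mollify (partialDeriv j ρ) f (proj v) •
        (ContinuousLinearMap.proj j : (Fin d → ℝ) →L[ℝ] ℝ)) v := by
  have hb : ∀ j, ∃ C : ℝ, 0 ≤ C ∧ ∀ x, ‖partialDeriv j ρ x‖ ≤ C := fun j =>
    exists_bound_of_continuous (hρ.partialDeriv j).continuous
  choose C hC0 hC using hb
  have hcont : Continuous fun y => gradForm ρ (proj v - y) := by
    unfold gradForm
    exact continuous_finsetSum _ fun j _ =>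
      ((hρ.partialDeriv j).continuous.comp (continuous_const.sub continuous_id)).smul
        continuous_const
  have hproj : ∀ j : Fin d, ‖(ContinuousLinearMap.proj j : (Fin d → ℝ) →L[ℝ] ℝ)‖ ≤ 1 := fun j =>
    ContinuousLinearMap.opNorm_le_bound _ zero_le_one fun w => by
      simpa using norm_le_pi_norm w j
  have h1 := hasFDerivAt_integral_of_dominated_of_fderiv_le
    (μ := (volume : Measure (Torus d))) (𝕜 := ℝ)
    (F := fun (w : Fin d → ℝ) y => ρ (proj w - y) • f y)
    (F' := fun w y => f y • gradForm ρ (proj w - y)) (x₀ := v)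
    (bound := fun y => ‖f y‖ * ∑ j, C j) univ_mem
    (Eventually.of_forall fun w =>
      (integrable_mollify_integrand hρ.continuous hf _).aestronglyMeasurable)
    (integrable_mollify_integrand hρ.continuous hf _)
    (hf.aestronglyMeasurable.smul hcont.aestronglyMeasurable)
    (Eventually.of_forall fun y w _ => by
      rw [norm_smul]
      refine mul_le_mul_of_nonneg_left ?_ (norm_nonneg _)
      refine (norm_sum_le _ _).trans (Finset.sum_le_sum fun j _ => ?_)
      rw [norm_smul]
      exact (mul_le_mul (hC j _) (hproj j) (norm_nonneg _) (hC0 j)).trans (mul_one _).le)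
    (hf.norm.mul_const _)
    (Eventually.of_forall fun y w _ => by
      have h2 := (hρ.hasFDerivAt_add (-y) w).mul_const (f y)
      simpa [sub_eq_add_neg, add_comm] using h2)
  refine HasFDerivAt.congr_fderiv h1 ?_
  have hint : ∀ j, Integrable (fun y => partialDeriv j ρ (proj v - y) • f y) := fun j =>
    integrable_mollify_integrand (hρ.partialDeriv j).continuous hf _
  have h3 : ∀ y, f y • gradForm ρ (proj v - y) = ∑ j, (partialDeriv j ρ (proj v - y) • f y) •
      (ContinuousLinearMap.proj j : (Fin d → ℝ) →L[ℝ] ℝ) := by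
    intro y
    simp only [gradForm, Finset.smul_sum, smul_smul, smul_eq_mul, mul_comm]
  change ∫ y, f y • gradForm ρ (proj v - y) = _
  rw [integral_congr_ae (Eventually.of_forall h3)]
  rw [integral_finsetSum _ fun j _ => (hint j).smul_const _]
  refine Finset.sum_congr rfl fun j _ => ?_
  rw [integral_smul_const]
  rfl

lemma IsSmooth.mollify {ρ : Torus d → ℝ} (hρ : IsSmooth ρ) {f : Torus d → ℝ}
    (hf : Integrable f) : IsSmooth (mollify ρ f) := by
  rw [isSmooth_iff, contDiff_infty]
  intro n
  induction n generalizing ρ with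
  | zero =>
    rw [Nat.cast_zero, contDiff_zero]
    exact continuous_iff_continuousAt.2 fun v => (hasFDerivAt_mollify hρ hf v).continuousAt
  | succ n ih =>
    have h := contDiff_succ_iff_fderiv_apply (𝕜 := ℝ) (n := n)
      (f := fun v => TorusTransport.mollify ρ f (proj v))
    refine h.2 ⟨fun v => (hasFDerivAt_mollify hρ hf v).differentiableAt, by simp, fun w => ?_⟩
    have : (fun v => fderiv ℝ (fun v => TorusTransport.mollify ρ f (proj v)) v w) =
        fun v => ∑ j, TorusTransport.mollify (TorusTransport.partialDeriv j ρ) f (proj v) * w j := by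
      funext v
      rw [(hasFDerivAt_mollify hρ hf v).fderiv]
      simp
    rw [this]
    exact ContDiff.sum fun j _ => (ih (hρ.partialDeriv j)).mul contDiff_const

lemma partialDeriv_mollify {ρ : Torus d → ℝ} (hρ : IsSmooth ρ) {f : Torus d → ℝ}
    (hf : Integrable f) (j : Fin d) :
    partialDeriv j (mollify ρ f) = mollify (partialDeriv j ρ) f := by
  funext x
  obtain ⟨v, rfl⟩ := surjective_proj x
  rw [partialDeriv_proj j (hρ.mollify hf), (hasFDerivAt_mollify hρ hf v).fderiv]
  simp [Pi.single_apply]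

lemma IsWeakGradient.mollify_partialDeriv {f : Torus d → EuclideanSpace ℝ (Fin d)}
    {G : Torus d → Matrix (Fin d) (Fin d) ℝ} (h : IsWeakGradient f G) {ρ : Torus d → ℝ}
    (hρ : IsSmooth ρ) (i j : Fin d) (x : Torus d) :
    mollify (partialDeriv j ρ) (fun y => f y i) x = mollify ρ (fun y => G y i j) x := by
  have h1 := h.integral_eq i j (fun y => ρ (x - y)) (hρ.comp_sub_left x)
  simp_rw [partialDeriv_comp_sub_left j hρ, mul_neg, integral_neg, neg_inj] at h1
  simpa only [mollify, smul_eq_mul, mul_comm] using h1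

lemma integrable_apply {f : Torus d → EuclideanSpace ℝ (Fin d)} (hf : Integrable f) (i : Fin d) :
    Integrable (fun y => f y i) :=
  (EuclideanSpace.proj (𝕜 := ℝ) i).integrable_comp hf

lemma mollify_apply {ρ : Torus d → ℝ} (hρ : Continuous ρ)
    {f : Torus d → EuclideanSpace ℝ (Fin d)} (hf : Integrable f) (x : Torus d) (i : Fin d) :
    mollify ρ f x i = mollify ρ (fun y => f y i) x := by
  have := (EuclideanSpace.proj (𝕜 := ℝ) i).integral_comp_comm
    (integrable_mollify_integrand hρ hf x)
  exact this.symm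

/-! ### Mollifiers -/

/-- A smooth even probability density, supported in the ball of radius `r`, at its natural scale. -/
structure IsMollifier (C : ℝ) (r : ℝ) (ρ : Torus d → ℝ) : Prop where
  smooth : IsSmooth ρ
  nonneg : ∀ x, 0 ≤ ρ x
  even : ∀ x, ρ (-x) = ρ x
  integral_eq_one : ∫ x, ρ x = 1
  support : ∀ x, ρ x ≠ 0 → ‖x‖ ≤ r
  le : ∀ x, ρ x ≤ C / r ^ d
  partialDeriv_support : ∀ j x, partialDeriv j ρ x ≠ 0 → ‖x‖ ≤ r
  partialDeriv_le : ∀ j x, |partialDeriv j ρ x| ≤ C / r ^ (d + 1)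

/-- A smooth cutoff of the circle at scale `r`. -/
def circleBump (r : ℝ) (θ : UnitAddCircle) : ℝ :=
  Real.smoothTransition (2 - Real.sin (Real.pi * ‖θ‖) ^ 2 / r ^ 2)

lemma circleBump_coe (r s : ℝ) : circleBump r (s : UnitAddCircle) =
    Real.smoothTransition (2 - Real.sin (Real.pi * s) ^ 2 / r ^ 2) := by
  have : Real.sin (Real.pi * ‖(s : UnitAddCircle)‖) ^ 2 = Real.sin (Real.pi * s) ^ 2 := by
    rw [UnitAddCircle.norm_eq]
    have h1 : Real.sin (Real.pi * |s - round s|) ^ 2 = Real.sin (Real.pi * (s - round s)) ^ 2 := by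
      rcases abs_cases (s - round s) with h | h <;> rw [h.1]
      rw [mul_neg, Real.sin_neg, neg_sq]
    rw [h1, mul_sub, mul_comm Real.pi (round s : ℝ), Real.sin_sub_int_mul_pi, mul_pow]
    rw [← zpow_natCast ((-1 : ℝ) ^ round s), ← zpow_mul, mul_comm (round s), zpow_mul]
    simp
  rw [circleBump, this]

lemma circleBump_nonneg (r : ℝ) (θ : UnitAddCircle) : 0 ≤ circleBump r θ :=
  Real.smoothTransition.nonneg _

lemma circleBump_le_one (r : ℝ) (θ : UnitAddCircle) : circleBump r θ ≤ 1 :=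
  Real.smoothTransition.le_one _

lemma continuous_circleBump (r : ℝ) : Continuous (circleBump r) := by
  unfold circleBump
  exact Real.smoothTransition.continuous.comp (by fun_prop)

lemma norm_le_of_circleBump_ne_zero {r : ℝ} (hr : 0 < r) {θ : UnitAddCircle}
    (h : circleBump r θ ≠ 0) : ‖θ‖ ≤ r := by
  by_contra! hθ
  apply h
  apply Real.smoothTransition.zero_of_nonpos
  have h1 : 2 * ‖θ‖ ≤ Real.sin (Real.pi * ‖θ‖) := by
    have := Real.mul_le_sin (x := Real.pi * ‖θ‖) (by positivity)
      (by nlinarith [norm_unitAddCircle_le_half θ, Real.pi_pos])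
    have h2 : 2 / Real.pi * (Real.pi * ‖θ‖) = 2 * ‖θ‖ := by field_simp
    linarith
  have h2 : 2 ≤ Real.sin (Real.pi * ‖θ‖) ^ 2 / r ^ 2 := by
    rw [le_div_iff₀ (by positivity)]
    nlinarith
  linarith

lemma circleBump_eq_one {r : ℝ} (hr : 0 < r) {θ : UnitAddCircle} (h : ‖θ‖ ≤ r / Real.pi) :
    circleBump r θ = 1 := by
  apply Real.smoothTransition.one_of_one_le
  have h0 : Real.pi * ‖θ‖ ≤ r := by
    rw [le_div_iff₀ Real.pi_pos] at h; linarith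
  have h1 : |Real.sin (Real.pi * ‖θ‖)| ≤ r := by
    refine (Real.abs_sin_le_abs).trans ?_
    rwa [abs_of_nonneg (by positivity)]
  have h2 : Real.sin (Real.pi * ‖θ‖) ^ 2 / r ^ 2 ≤ 1 := by
    rw [div_le_one (by positivity)]
    exact sq_le_sq' (by linarith [neg_abs_le (Real.sin (Real.pi * ‖θ‖))])
      ((le_abs_self _).trans h1)
  linarith

lemma le_integral_circleBump {r : ℝ} (hr : 0 < r) (hr1 : r ≤ 1) :
    r / 2 ≤ ∫ θ, circleBump r θ := by
  have hi : Integrable (circleBump r) volume :=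
    (continuous_circleBump r).integrable_of_hasCompactSupport (HasCompactSupport.of_compactSpace _)
  have h1 : ∫ θ, (Metric.closedBall (0 : UnitAddCircle) (r / Real.pi)).indicator 1 θ ≤
      ∫ θ, circleBump r θ := by
    refine integral_mono ?_ hi fun θ => ?_
    · exact (integrable_const (1 : ℝ)).indicator Metric.isClosed_closedBall.measurableSet
    · by_cases h : θ ∈ Metric.closedBall (0 : UnitAddCircle) (r / Real.pi)
      · rw [indicator_of_mem h, circleBump_eq_one hr (by simpa using h)]; simp
      · rw [indicator_of_notMem h]; exact circleBump_nonneg _ _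
  refine le_trans ?_ h1
  rw [integral_indicator_one Metric.isClosed_closedBall.measurableSet, Measure.real,
    AddCircle.volume_closedBall, ENNReal.toReal_ofReal (by positivity)]
  have h3 : Real.pi < 4 := by linarith [Real.pi_lt_d2]
  have h2 : 2 * (r / Real.pi) ≤ 1 := by
    rw [← mul_div_assoc, div_le_one Real.pi_pos]; linarith [Real.pi_gt_three]
  rw [min_eq_right h2, ← mul_div_assoc, div_le_div_iff₀ two_pos Real.pi_pos]
  nlinarith

lemma exists_abs_deriv_smoothTransition_le :
    ∃ A : ℝ, 0 ≤ A ∧ ∀ s, |deriv Real.smoothTransition s| ≤ A ∧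
      (deriv Real.smoothTransition s ≠ 0 → 0 ≤ s) := by
  have hc : Continuous (deriv Real.smoothTransition) :=
    (Real.smoothTransition.contDiff (n := 1)).continuous_deriv le_rfl
  obtain ⟨A, hA⟩ := (isCompact_Icc (a := (0 : ℝ)) (b := 1)).exists_bound_of_continuousOn
    hc.continuousOn
  have h0 : ∀ s < 0, deriv Real.smoothTransition s = 0 := fun s hs => by
    have : Real.smoothTransition =ᶠ[𝓝 s] fun _ => 0 := by
      filter_upwards [Iio_mem_nhds hs] with t ht
      exact Real.smoothTransition.zero_of_nonpos (le_of_lt ht)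
    rw [this.deriv_eq]; simp
  have h1 : ∀ s > 1, deriv Real.smoothTransition s = 0 := fun s hs => by
    have : Real.smoothTransition =ᶠ[𝓝 s] fun _ => 1 := by
      filter_upwards [Ioi_mem_nhds hs] with t ht
      exact Real.smoothTransition.one_of_one_le (le_of_lt ht)
    rw [this.deriv_eq]; simp
  refine ⟨max A 0, le_max_right _ _, fun s => ⟨?_, fun h => ?_⟩⟩
  · rcases lt_or_ge s 0 with hs | hs
    · rw [h0 s hs]; simp
    rcases lt_or_ge 1 s with hs' | hs'
    · rw [h1 s hs']; simp
    · exact (hA s ⟨hs, hs'⟩).trans (le_max_left _ _)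
  · by_contra! hs
    exact h (h0 s hs)

lemma exists_abs_deriv_circleBump_le : ∃ A : ℝ, 0 ≤ A ∧ ∀ r, 0 < r → ∀ s : ℝ,
    ∃ D, HasDerivAt (fun s : ℝ => circleBump r (s : UnitAddCircle)) D s ∧ |D| ≤ A / r := by
  obtain ⟨A, hA0, hA⟩ := exists_abs_deriv_smoothTransition_le
  refine ⟨A * (4 * Real.pi), by positivity, fun r hr s => ?_⟩
  simp_rw [circleBump_coe]
  set q := 2 - Real.sin (Real.pi * s) ^ 2 / r ^ 2 with hq
  have h1 : HasDerivAt Real.smoothTransition (deriv Real.smoothTransition q) q :=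
    ((Real.smoothTransition.contDiff (n := 1)).differentiable (by simp) q).hasDerivAt
  have h2 : HasDerivAt (fun s => 2 - Real.sin (Real.pi * s) ^ 2 / r ^ 2)
      (-(2 * Real.sin (Real.pi * s) * (Real.cos (Real.pi * s) * Real.pi) / r ^ 2)) s := by
    have h3 : HasDerivAt (fun s => Real.sin (Real.pi * s)) (Real.cos (Real.pi * s) * Real.pi) s := by
      simpa using ((hasDerivAt_id s).const_mul Real.pi).sin
    have h4 := ((h3.pow 2).div_const (r ^ 2)).const_sub 2
    simpa using h4
  refine ⟨_, HasDerivAt.comp (h₂ := Real.smoothTransition) s h1 h2, ?_⟩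
  by_cases h : deriv Real.smoothTransition q = 0
  · rw [h]; simp; positivity
  have h3 := (hA q).2 h
  have h4 : |Real.sin (Real.pi * s)| ≤ 2 * r := by
    have : Real.sin (Real.pi * s) ^ 2 / r ^ 2 ≤ 2 := by linarith
    rw [div_le_iff₀ (by positivity)] at this
    exact abs_le_of_sq_le_sq (by nlinarith) (by positivity)
  have h5 : |Real.sin (Real.pi * s)| * |Real.cos (Real.pi * s)| ≤ 2 * r * 1 :=
    mul_le_mul h4 (Real.abs_cos_le_one _) (abs_nonneg _) (by positivity)
  have h6 : |2 * Real.sin (Real.pi * s) * (Real.cos (Real.pi * s) * Real.pi) / r ^ 2| ≤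
      4 * Real.pi / r := by
    rw [abs_div, abs_mul, abs_mul, abs_mul, abs_of_pos Real.pi_pos, abs_two,
      abs_of_pos (show (0 : ℝ) < r ^ 2 by positivity), div_le_div_iff₀ (by positivity) hr]
    nlinarith [mul_le_mul_of_nonneg_right h5 (show 0 ≤ 2 * Real.pi * r by positivity)]
  rw [abs_mul, abs_neg, mul_div_assoc A]
  exact mul_le_mul (hA q).1 h6 (abs_nonneg _) hA0

/-- The product mollifier at scale `r`. -/
def mollifier (d : ℕ) (r : ℝ) (x : Torus d) : ℝ :=
  ∏ i, (circleBump r (x i) / ∫ θ, circleBump r θ)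

lemma exists_isMollifier (d : ℕ) :
    ∃ C : ℝ, 0 < C ∧ ∀ r, 0 < r → r ≤ 1 → IsMollifier C r (mollifier d r) := by
  obtain ⟨A, hA0, hA⟩ := exists_abs_deriv_circleBump_le
  refine ⟨2 ^ d * (1 + A), by positivity, fun r hr hr1 => ?_⟩
  set Z := ∫ θ, circleBump r θ with hZ
  have hZr : r / 2 ≤ Z := le_integral_circleBump hr hr1
  have hZ0 : 0 < Z := by linarith
  have hle : ∀ θ, circleBump r θ / Z ≤ 2 / r := fun θ => by
    rw [div_le_div_iff₀ hZ0 hr]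
    nlinarith [circleBump_le_one r θ, circleBump_nonneg r θ]
  have hnn : ∀ θ, 0 ≤ circleBump r θ / Z := fun θ => div_nonneg (circleBump_nonneg _ _) hZ0.le
  have hsupp : ∀ x : Torus d, mollifier d r x ≠ 0 → ‖x‖ ≤ r := fun x hx => by
    refine (pi_norm_le_iff_of_nonneg hr.le).2 fun i => ?_
    refine norm_le_of_circleBump_ne_zero hr fun h => hx ?_
    exact Finset.prod_eq_zero (Finset.mem_univ i) (by rw [h, zero_div])
  refine ⟨?_, ?_, ?_, ?_, hsupp, ?_, ?_, ?_⟩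
  · rw [isSmooth_iff]
    unfold mollifier
    refine contDiff_prod fun i _ => ContDiff.div_const ?_ _
    simp only [proj, circleBump_coe]
    refine Real.smoothTransition.contDiff.comp ?_
    fun_prop
  · exact fun x => Finset.prod_nonneg fun i _ => hnn _
  · intro x
    simp [mollifier, circleBump]
  · unfold mollifier
    rw [integral_fintype_prod_volume_eq_prod (fun (_ : Fin d) θ => circleBump r θ / Z)]
    rw [integral_div, div_self hZ0.ne', Finset.prod_const_one]
  · intro x
    calc mollifier d r x ≤ ∏ _i : Fin d, 2 / r :=
          Finset.prod_le_prod (fun i _ => hnn _) fun i _ => hle _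
      _ = 2 ^ d / r ^ d := by simp
      _ ≤ _ := by
          gcongr
          nlinarith [show (0 : ℝ) < 2 ^ d by positivity]
  · intro j x hx
    by_contra! hr'
    apply hx
    unfold partialDeriv
    have hcont : Continuous fun s : ℝ => ‖x + Pi.single j (s : UnitAddCircle)‖ := by
      have : (fun s : ℝ => ‖x + Pi.single j (s : UnitAddCircle)‖) =
          fun s => ‖x + proj (Pi.single j s : Fin d → ℝ)‖ := by
        funext s; rw [proj_single]
      rw [this]
      exact (continuous_const.add (continuous_proj.comp (continuous_single j))).norm
    have : (fun s : ℝ => mollifier d r (x + Pi.single j (s : UnitAddCircle))) =ᶠ[𝓝 0]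
        fun _ => 0 := by
      have h0 : r < ‖x + Pi.single j ((0 : ℝ) : UnitAddCircle)‖ := by simpa using hr'
      filter_upwards [hcont.continuousAt.eventually (lt_mem_nhds h0)] with s hs
      by_contra h
      exact absurd (hsupp _ h) (not_le.2 hs)
    rw [this.deriv_eq]; simp
  · intro j x
    obtain ⟨v, rfl⟩ := surjective_proj x
    obtain ⟨D, hD, hDle⟩ := hA r hr (v j)
    set P := ∏ i ∈ Finset.univ.erase j, (circleBump r (proj v i) / Z) with hP
    have h1 : (fun s : ℝ => mollifier d r (proj v + Pi.single j (s : UnitAddCircle))) =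
        fun s => circleBump r ((v j + s : ℝ) : UnitAddCircle) / Z * P := by
      funext s
      unfold mollifier
      rw [← Finset.mul_prod_erase _ _ (Finset.mem_univ j)]
      congr 1
      · simp [proj, hZ]
      · refine Finset.prod_congr rfl fun i hi => ?_
        simp [Finset.ne_of_mem_erase hi, hZ]
    have h2 : HasDerivAt (fun s : ℝ => circleBump r ((v j + s : ℝ) : UnitAddCircle) / Z * P)
        (D / Z * P) 0 := by
      have h3 : HasDerivAt (fun s : ℝ => circleBump r ((v j + s : ℝ) : UnitAddCircle)) D 0 := by
        have := HasDerivAt.comp_const_add (v j) 0 (by simpa using hD)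
        exact this
      exact (h3.div_const Z).mul_const P
    unfold partialDeriv
    rw [h1, h2.deriv]
    have hP0 : 0 ≤ P := Finset.prod_nonneg fun i _ => hnn _
    have hPle : P ≤ (2 / r) ^ (d - 1) := by
      calc P ≤ ∏ _i ∈ Finset.univ.erase j, 2 / r :=
            Finset.prod_le_prod (fun i _ => hnn _) fun i _ => hle _
        _ = (2 / r) ^ (d - 1) := by rw [Finset.prod_const]; simp
    have hDZ : |D / Z| ≤ A / r * (2 / r) := by
      rw [abs_div, abs_of_pos hZ0, div_le_iff₀ hZ0]
      have : 1 ≤ 2 / r * Z := by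
        rw [div_mul_eq_mul_div, one_le_div hr]; linarith
      calc |D| ≤ A / r := hDle
        _ ≤ A / r * (2 / r * Z) := le_mul_of_one_le_right (by positivity) this
        _ = _ := by ring
    rw [abs_mul, abs_of_nonneg hP0]
    have hd : d = (d - 1) + 1 := by have := j.pos; omega
    calc |D / Z| * P ≤ A / r * (2 / r) * (2 / r) ^ (d - 1) :=
          mul_le_mul hDZ hPle hP0 (by positivity)
      _ = A / r * (2 / r) ^ d := by
          conv_rhs => rw [hd, pow_succ]
          ring
      _ = 2 ^ d * A / r ^ (d + 1) := by rw [div_pow, pow_succ]; field_simp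
      _ ≤ _ := by gcongr; linarith

end

end TorusTransport


namespace TorusTransport

noncomputable section

variable {d : ℕ}

/-! ### The Hardy–Littlewood maximal function -/

lemma volume_closedBall_torus_le (x : Torus d) {r : ℝ} (hr : 0 ≤ r) :
    volume (Metric.closedBall x r) ≤ ENNReal.ofReal ((2 * r) ^ d) := by
  rw [volume_pi, Measure.pi_closedBall _ _ hr]
  calc ∏ i, volume (Metric.closedBall (x i) r) ≤ ∏ _i : Fin d, ENNReal.ofReal (2 * r) := by
        refine Finset.prod_le_prod' fun i _ => ?_
        rw [AddCircle.volume_closedBall]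
        exact ENNReal.ofReal_le_ofReal (min_le_right _ _)
    _ = _ := by simp [ENNReal.ofReal_pow (show (0 : ℝ) ≤ 2 * r by positivity)]

lemma norm_torus_le_half (x : Torus d) : ‖x‖ ≤ 1 / 2 :=
  (pi_norm_le_iff_of_nonneg (by norm_num)).2 fun i => norm_unitAddCircle_le_half (x i)

/-- The dyadic maximal function on the torus. -/
def maxFun (F : Torus d → ℝ≥0∞) (x : Torus d) : ℝ≥0∞ :=
  ⨆ k : ℕ, ENNReal.ofReal ((2 ^ k) ^ d) * ∫⁻ y in Metric.closedBall x ((2 ^ k)⁻¹ : ℝ), F y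

lemma lintegral_closedBall_le_maxFun (F : Torus d → ℝ≥0∞) (x : Torus d) {s : ℝ} (hs : 0 < s) :
    ∫⁻ y in Metric.closedBall x s, F y ≤ ENNReal.ofReal ((2 * s) ^ d) * maxFun F x := by
  obtain ⟨k, hk1, hk2⟩ : ∃ k : ℕ, Metric.closedBall x s ⊆ Metric.closedBall x ((2 ^ k)⁻¹ : ℝ) ∧
      ((2 : ℝ) ^ k)⁻¹ ≤ 2 * s := by
    rcases le_or_gt s 1 with h1 | h1
    · obtain ⟨n, hn1, hn2⟩ := exists_nat_pow_near_of_lt_one hs h1 (y := (1 / 2 : ℝ))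
        (by norm_num) (by norm_num)
      refine ⟨n, Metric.closedBall_subset_closedBall ?_, ?_⟩
      · simpa using hn2
      · rw [pow_succ] at hn1
        have : (1 / 2 : ℝ) ^ n = ((2 : ℝ) ^ n)⁻¹ := by simp
        rw [this] at hn1; linarith
    · refine ⟨0, fun y _ => ?_, by simp; linarith⟩
      have := norm_torus_le_half (y - x)
      rw [Metric.mem_closedBall, dist_eq_norm]
      norm_num; linarith
  calc ∫⁻ y in Metric.closedBall x s, F y
      ≤ ∫⁻ y in Metric.closedBall x ((2 ^ k)⁻¹ : ℝ), F y := lintegral_mono_set hk1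
    _ = ENNReal.ofReal (((2 ^ k)⁻¹) ^ d) * (ENNReal.ofReal ((2 ^ k) ^ d) *
          ∫⁻ y in Metric.closedBall x ((2 ^ k)⁻¹ : ℝ), F y) := by
        rw [← mul_assoc, ← ENNReal.ofReal_mul (by positivity), ← mul_pow,
          inv_mul_cancel₀ (by positivity)]
        simp
    _ ≤ _ := by
        gcongr
        exact le_iSup (fun k : ℕ => ENNReal.ofReal ((2 ^ k) ^ d) *
          ∫⁻ y in Metric.closedBall x ((2 ^ k)⁻¹ : ℝ), F y) k

lemma one_le_maxFun {F : Torus d → ℝ≥0∞} (hF : ∀ x, 1 ≤ F x) (x : Torus d) : 1 ≤ maxFun F x := by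
  refine le_trans ?_ (le_iSup _ 0)
  have : Metric.closedBall x (((2 : ℝ) ^ 0)⁻¹) = univ := by
    refine eq_univ_of_forall fun y => ?_
    have := norm_torus_le_half (y - x)
    rw [Metric.mem_closedBall, dist_eq_norm]
    norm_num; linarith
  rw [this]
  simp only [pow_zero, one_pow, ENNReal.ofReal_one, one_mul, Measure.restrict_univ]
  calc (1 : ℝ≥0∞) = ∫⁻ _x : Torus d, 1 := by simp
    _ ≤ _ := lintegral_mono fun y => hF y

lemma measurable_maxFun_param {ι : Type*} [MeasurableSpace ι] {F : ι → Torus d → ℝ≥0∞}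
    (hF : Measurable (Function.uncurry F)) :
    Measurable fun z : ι × Torus d => maxFun (F z.1) z.2 := by
  refine Measurable.iSup fun k => Measurable.const_mul ?_ _
  have h1 : ∀ z : ι × Torus d, ∫⁻ y in Metric.closedBall z.2 ((2 ^ k)⁻¹ : ℝ), F z.1 y =
      ∫⁻ y, {p : (ι × Torus d) × Torus d | dist p.2 p.1.2 ≤ (2 ^ k)⁻¹}.indicator
        (fun p => F p.1.1 p.2) (z, y) := by
    intro z
    rw [← lintegral_indicator Metric.isClosed_closedBall.measurableSet]
    rfl
  simp_rw [h1]
  refine Measurable.lintegral_prod_right' (f := {p : (ι × Torus d) × Torus d |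
    dist p.2 p.1.2 ≤ (2 ^ k)⁻¹}.indicator (fun p => F p.1.1 p.2)) ?_
  refine Measurable.indicator (hF.comp (by fun_prop : Measurable
    fun p : (ι × Torus d) × Torus d => (p.1.1, p.2))) ?_
  exact measurableSet_le (by fun_prop) measurable_const

lemma measurable_maxFun {F : Torus d → ℝ≥0∞} (hF : Measurable F) : Measurable (maxFun F) := by
  have h1 : Measurable (Function.uncurry fun _ : ℝ => F) :=
    hF.comp (measurable_snd : Measurable fun z : ℝ × Torus d => z.2)
  have h2 := measurable_maxFun_param h1
  have h3 : Measurable fun x : Torus d => ((0 : ℝ), x) := measurable_prodMk_left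
  have h4 := h2.comp h3
  exact h4

lemma maxFun_weak_type (F : Torus d → ℝ≥0∞) (a : ℝ≥0∞) :
    a * volume {x | a < maxFun F x} ≤ ENNReal.ofReal (8 ^ d) * ∫⁻ x, F x := by
  set S := {x | a < maxFun F x} with hS
  have hk : ∀ x ∈ S, ∃ k : ℕ, a < ENNReal.ofReal ((2 ^ k) ^ d) *
      ∫⁻ y in Metric.closedBall x ((2 ^ k)⁻¹ : ℝ), F y := fun x hx => lt_iSup_iff.1 hx
  choose! k hk using hk
  obtain ⟨u, huS, hdisj, hcov⟩ := Vitali.exists_disjoint_subfamily_covering_enlargement_closedBall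
    S id (fun x => ((2 : ℝ) ^ k x)⁻¹) 1
    (fun x _ => inv_le_one_of_one_le₀ (one_le_pow₀ one_le_two)) 4 (by norm_num)
  have hcount : u.Countable := hdisj.countable_of_nonempty_interior fun x _ =>
    ⟨x, Metric.ball_subset_interior_closedBall (Metric.mem_ball_self (by positivity))⟩
  have hsub : S ⊆ ⋃ b ∈ u, Metric.closedBall b (4 * ((2 : ℝ) ^ k b)⁻¹) := by
    intro x hx
    obtain ⟨b, hb, hsub⟩ := hcov x hx
    exact mem_biUnion hb (hsub (Metric.mem_closedBall_self (by positivity)))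
  have hone : ∀ b ∈ u, a * volume (Metric.closedBall b (4 * ((2 : ℝ) ^ k b)⁻¹)) ≤
      ENNReal.ofReal (8 ^ d) * ∫⁻ y in Metric.closedBall b ((2 ^ k b)⁻¹ : ℝ), F y := by
    intro b hb
    calc a * volume (Metric.closedBall b (4 * ((2 : ℝ) ^ k b)⁻¹))
        ≤ (ENNReal.ofReal ((2 ^ k b) ^ d) * ∫⁻ y in Metric.closedBall b ((2 ^ k b)⁻¹ : ℝ), F y) *
          ENNReal.ofReal ((2 * (4 * ((2 : ℝ) ^ k b)⁻¹)) ^ d) :=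
          mul_le_mul' (hk b (huS hb)).le (volume_closedBall_torus_le _ (by positivity))
      _ = _ := by
          rw [mul_right_comm, ← ENNReal.ofReal_mul (by positivity), ← mul_pow]
          congr 3
          field_simp
          norm_num
  calc a * volume S ≤ a * ∑' b : u, volume (Metric.closedBall (b : Torus d)
        (4 * ((2 : ℝ) ^ k b)⁻¹)) := by
        gcongr
        exact (measure_mono hsub).trans (measure_biUnion_le _ hcount _)
    _ = ∑' b : u, a * volume (Metric.closedBall (b : Torus d) (4 * ((2 : ℝ) ^ k b)⁻¹)) :=
        ENNReal.tsum_mul_left.symm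
    _ ≤ ∑' b : u, ENNReal.ofReal (8 ^ d) *
          ∫⁻ y in Metric.closedBall (b : Torus d) ((2 ^ k b)⁻¹ : ℝ), F y :=
        ENNReal.tsum_le_tsum fun b => hone b b.2
    _ = ENNReal.ofReal (8 ^ d) *
          ∫⁻ y in ⋃ b ∈ u, Metric.closedBall b ((2 ^ k b)⁻¹ : ℝ), F y := by
        rw [ENNReal.tsum_mul_left, lintegral_biUnion hcount
          (s := fun b => Metric.closedBall b ((2 ^ k b)⁻¹ : ℝ))
          (fun b _ => Metric.isClosed_closedBall.measurableSet) hdisj]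
    _ ≤ _ := mul_le_mul_right (setLIntegral_le_lintegral _ _) _

lemma ennreal_sqrt_le_tsum (m : ℝ≥0∞) :
    m ^ (1 / 2 : ℝ) ≤ 1 + ∑' j : ℕ, {m : ℝ≥0∞ | 4 ^ j < m}.indicator
      (fun _ => (2 : ℝ≥0∞) ^ (j + 1)) m := by
  rcases le_or_gt m 1 with h1 | h1
  · exact (ENNReal.rpow_le_one h1 (by norm_num)).trans le_self_add
  have key : ∀ j : ℕ, (4 : ℝ≥0∞) ^ j < m → (2 : ℝ≥0∞) ^ (j + 1) ≤
      ∑' j : ℕ, {m : ℝ≥0∞ | 4 ^ j < m}.indicator (fun _ => (2 : ℝ≥0∞) ^ (j + 1)) m := by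
    intro j hj
    refine le_trans ?_ (ENNReal.le_tsum j)
    rw [indicator_of_mem (show m ∈ {m : ℝ≥0∞ | 4 ^ j < m} from hj)]
  refine le_trans ?_ le_add_self
  rcases eq_or_ne m ∞ with rfl | hm
  · have h4 : ∀ j : ℕ, (4 : ℝ≥0∞) ^ j < ∞ := fun j => ENNReal.pow_lt_top (by norm_num)
    have htop : (∞ : ℝ≥0∞) ^ (1 / 2 : ℝ) = ∞ := ENNReal.top_rpow_of_pos (by norm_num)
    rw [htop]
    refine le_of_tendsto' (ENNReal.tendsto_pow_atTop_nhds_top_iff.2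
      (by norm_num : (1 : ℝ≥0∞) < 2)) fun j => ?_
    exact le_trans (pow_le_pow_right₀ (by norm_num) (Nat.le_succ j)) (key j (h4 j))
  · have hex : ∃ j : ℕ, m ≤ 4 ^ j := by
      obtain ⟨j, hj⟩ := ((ENNReal.tendsto_pow_atTop_nhds_top_iff.2
        (by norm_num : (1 : ℝ≥0∞) < 4)).eventually (lt_mem_nhds hm.lt_top)).exists
      exact ⟨j, hj.le⟩
    classical
    have hspec := Nat.find_spec hex
    have hpos : Nat.find hex ≠ 0 := fun h => by
      rw [h, pow_zero] at hspec; exact absurd hspec (not_le.2 h1)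
    obtain ⟨i, hi⟩ := Nat.exists_eq_succ_of_ne_zero hpos
    have hlt : (4 : ℝ≥0∞) ^ i < m := not_le.1 (Nat.find_min hex (by omega))
    refine le_trans ?_ (key i hlt)
    rw [hi, Nat.succ_eq_add_one] at hspec
    calc m ^ (1 / 2 : ℝ) ≤ ((4 : ℝ≥0∞) ^ (i + 1)) ^ (1 / 2 : ℝ) :=
          ENNReal.rpow_le_rpow hspec (by norm_num)
      _ = 2 ^ (i + 1) := by
          rw [show (4 : ℝ≥0∞) = 2 ^ 2 by norm_num, ← pow_mul, mul_comm, pow_mul,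
            ← ENNReal.rpow_natCast, ← ENNReal.rpow_mul]
          norm_num

/-- Kolmogorov's inequality for the maximal function. -/
lemma lintegral_sqrt_maxFun_le {F : Torus d → ℝ≥0∞} (hF : Measurable F) :
    ∫⁻ x, maxFun F x ^ (1 / 2 : ℝ) ≤ 1 + 4 * (ENNReal.ofReal (8 ^ d) * ∫⁻ x, F x) := by
  set A := ENNReal.ofReal (8 ^ d) * ∫⁻ x, F x
  have hm := measurable_maxFun hF
  have hms : ∀ j : ℕ, MeasurableSet {x | (4 : ℝ≥0∞) ^ j < maxFun F x} := fun j =>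
    measurableSet_lt measurable_const hm
  have hpt : ∀ x, maxFun F x ^ (1 / 2 : ℝ) ≤ 1 + ∑' j : ℕ,
      {x | (4 : ℝ≥0∞) ^ j < maxFun F x}.indicator (fun _ => (2 : ℝ≥0∞) ^ (j + 1)) x :=
    fun x => ennreal_sqrt_le_tsum _
  have hterm : ∀ j : ℕ, (2 : ℝ≥0∞) ^ (j + 1) * volume {x | (4 : ℝ≥0∞) ^ j < maxFun F x} ≤
      2 * A * (2⁻¹) ^ j := by
    intro j
    have h1 := maxFun_weak_type F (4 ^ j)
    have h2 : (2 : ℝ≥0∞) ^ (j + 1) = 2 * (2⁻¹) ^ j * 4 ^ j := by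
      rw [show (4 : ℝ≥0∞) = 2 * 2 by norm_num, mul_pow, pow_succ, mul_assoc 2, ← mul_assoc (2⁻¹ ^ j),
        ← mul_pow, ENNReal.inv_mul_cancel (by simp) (by simp), one_pow, one_mul, mul_comm]
    calc (2 : ℝ≥0∞) ^ (j + 1) * volume {x | (4 : ℝ≥0∞) ^ j < maxFun F x}
        = 2 * (2⁻¹) ^ j * (4 ^ j * volume {x | (4 : ℝ≥0∞) ^ j < maxFun F x}) := by
          rw [h2, mul_assoc]
      _ ≤ 2 * (2⁻¹) ^ j * A := by gcongr
      _ = _ := by ring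
  calc ∫⁻ x, maxFun F x ^ (1 / 2 : ℝ)
      ≤ ∫⁻ x, (1 + ∑' j : ℕ, {x | (4 : ℝ≥0∞) ^ j < maxFun F x}.indicator
          (fun _ => (2 : ℝ≥0∞) ^ (j + 1)) x) := lintegral_mono hpt
    _ = 1 + ∑' j : ℕ, (2 : ℝ≥0∞) ^ (j + 1) * volume {x | (4 : ℝ≥0∞) ^ j < maxFun F x} := by
        rw [lintegral_add_left measurable_const, lintegral_tsum fun j =>
          (measurable_const.indicator (hms j)).aemeasurable]
        simp [lintegral_indicator_const (hms _)]
    _ ≤ 1 + ∑' j : ℕ, 2 * A * (2⁻¹) ^ j := by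
        gcongr 1 + ?_
        exact ENNReal.tsum_le_tsum hterm
    _ = _ := by
        rw [ENNReal.tsum_mul_left, ENNReal.tsum_geometric, ENNReal.one_sub_inv_two, inv_inv]
        ring

end

end TorusTransport


namespace TorusTransport

noncomputable section

/-! ### Integral inequalities of Grönwall and Osgood type -/

lemma gronwall_forward {r : ℝ → ℝ} (hr : Continuous r) (hr0 : ∀ t, 0 ≤ r t) {s A Λ ε : ℝ}
    (hA : 0 ≤ A) (hΛ : 0 ≤ Λ) (hε : 0 ≤ ε)
    (h : ∀ t, s ≤ t → r t ≤ A + ∫ σ in s..t, (Λ * r σ + ε)) {t : ℝ} (ht : s ≤ t) :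
    r t ≤ (A + ε * (t - s)) * Real.exp (Λ * (t - s)) := by
  have hc : Continuous fun σ => Λ * r σ + ε := by fun_prop
  set R : ℝ → ℝ := fun t => A + ∫ σ in s..t, (Λ * r σ + ε) with hR
  have hd : ∀ t, HasDerivAt R (Λ * r t + ε) t := fun t =>
    (intervalIntegral.integral_hasDerivAt_right (hc.intervalIntegrable _ _)
      (hc.stronglyMeasurableAtFilter _ _) hc.continuousAt).const_add A
  have hR0 : ∀ t, s ≤ t → 0 ≤ R t := fun t ht => (hr0 t).trans (h t ht)
  have h1 := norm_le_gronwallBound_of_norm_deriv_right_le (f := R) (f' := fun t => Λ * r t + ε)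
    (δ := A) (K := Λ) (ε := ε) (a := s) (b := t)
    (fun t _ => (hd t).continuousAt.continuousWithinAt)
    (fun t _ => (hd t).hasDerivWithinAt) (by simp [hR, abs_of_nonneg hA])
    (fun x hx => by
      rw [Real.norm_of_nonneg (add_nonneg (mul_nonneg hΛ (hr0 x)) hε),
        Real.norm_of_nonneg (hR0 x hx.1)]
      have h5 : r x ≤ R x := h x hx.1
      linarith [mul_le_mul_of_nonneg_left h5 hΛ]) t ⟨ht, le_rfl⟩
  rw [Real.norm_of_nonneg (hR0 t ht)] at h1
  refine (h t ht).trans (h1.trans ?_)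
  have hts : 0 ≤ t - s := sub_nonneg.2 ht
  rcases hΛ.eq_or_lt with h0 | h0
  · rw [← h0, gronwallBound_K0]; simp
  · rw [gronwallBound_of_K_ne_0 h0.ne', add_mul]
    refine add_le_add le_rfl ?_
    have h2 : Real.exp (Λ * (t - s)) - 1 ≤ Λ * (t - s) * Real.exp (Λ * (t - s)) := by
      have := Real.add_one_le_exp (-(Λ * (t - s)))
      have h3 := mul_le_mul_of_nonneg_right this (Real.exp_pos (Λ * (t - s))).le
      rw [← Real.exp_add, neg_add_cancel, Real.exp_zero] at h3
      linarith
    calc ε / Λ * (Real.exp (Λ * (t - s)) - 1)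
        ≤ ε / Λ * (Λ * (t - s) * Real.exp (Λ * (t - s))) := by gcongr
      _ = _ := by field_simp

lemma gronwall_abs {r : ℝ → ℝ} (hr : Continuous r) (hr0 : ∀ t, 0 ≤ r t) {s A Λ ε : ℝ}
    (hA : 0 ≤ A) (hΛ : 0 ≤ Λ) (hε : 0 ≤ ε)
    (h : ∀ t, r t ≤ A + |∫ σ in s..t, (Λ * r σ + ε)|) (t : ℝ) :
    r t ≤ (A + ε * |t - s|) * Real.exp (Λ * |t - s|) := by
  have hnn : ∀ σ, 0 ≤ Λ * r σ + ε := fun σ => add_nonneg (mul_nonneg hΛ (hr0 σ)) hε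
  rcases le_total s t with hst | hst
  · rw [abs_of_nonneg (sub_nonneg.2 hst)]
    refine gronwall_forward hr hr0 hA hΛ hε (fun t ht => ?_) hst
    have := h t
    rwa [abs_of_nonneg (intervalIntegral.integral_nonneg_of_forall ht hnn)] at this
  · have h1 := gronwall_forward (r := fun t => r (-t)) (hr.comp continuous_neg)
      (fun t => hr0 _) (s := -s) (t := -t) hA hΛ hε (fun t ht => ?_) (neg_le_neg hst)
    · rw [abs_of_nonpos (sub_nonpos.2 hst)]
      simpa [sub_eq_add_neg, add_comm] using h1
    · have h2 := h (-t)
      have h3 : ∫ σ in (-s)..t, (Λ * r (-σ) + ε) = ∫ σ in (-t)..s, (Λ * r σ + ε) := by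
        rw [intervalIntegral.integral_comp_neg (fun σ => Λ * r σ + ε), neg_neg]
      rw [h3]
      rwa [intervalIntegral.integral_symm, abs_neg, abs_of_nonneg
        (intervalIntegral.integral_nonneg_of_forall (by linarith) hnn)] at h2

/-- The increments of `r` are controlled by a log-Lipschitz modulus of continuity, written as the
infimum of the affine majorants `C (λ r + e^{-λ})`, up to an error `ε`. -/
structure OsgoodIneq (C ε : ℝ) (r : ℝ → ℝ) : Prop where
  continuous : Continuous r
  nonneg : ∀ t, 0 ≤ r t
  le : ∀ s t lam : ℝ, 1 ≤ lam →
    r t ≤ r s + |∫ σ in s..t, (C * (lam * r σ + Real.exp (-lam)) + ε)|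

lemma OsgoodIneq.le_of_short {C ε : ℝ} {r : ℝ → ℝ} (h : OsgoodIneq C ε r) (hC : 0 < C)
    (hε : 0 ≤ ε) {s t lam : ℝ} (hlam : 1 ≤ lam) (hst : C * |t - s| ≤ 1 / 2) :
    r t ≤ (r s + (C * Real.exp (-lam) + ε) * |t - s|) * Real.exp (lam / 2) := by
  have h1 := gronwall_abs h.continuous h.nonneg (h.nonneg s) (Λ := C * lam)
    (ε := C * Real.exp (-lam) + ε) (by positivity) (by positivity) (s := s)
    (fun t => by
      refine (h.le s t lam hlam).trans (le_of_eq ?_)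
      congr 3; funext σ; ring) t
  refine h1.trans ?_
  have := h.nonneg s
  gcongr
  nlinarith

lemma OsgoodIneq.exists_short {C : ℝ} (hC : 0 < C) {η : ℝ} (hη : 0 < η) :
    ∃ δ > 0, ∀ r : ℝ → ℝ, ∀ ε, 0 ≤ ε → ε ≤ δ → OsgoodIneq C ε r → ∀ s t,
      C * |t - s| ≤ 1 / 2 → r s ≤ δ → r t ≤ η := by
  obtain ⟨lam, hlam1, hlam⟩ : ∃ lam : ℝ, 1 ≤ lam ∧ Real.exp (-(lam / 2)) ≤ η := by
    have : Tendsto (fun lam : ℝ => Real.exp (-(lam / 2))) atTop (𝓝 0) :=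
      Real.tendsto_exp_neg_atTop_nhds_zero.comp (tendsto_id.atTop_div_const two_pos)
    obtain ⟨lam, h1, h2⟩ := ((eventually_ge_atTop 1).and
      (this.eventually (ge_mem_nhds hη))).exists
    exact ⟨lam, h1, h2⟩
  refine ⟨η / 2 / (Real.exp (lam / 2) * (1 + 1 / (2 * C))), by positivity,
    fun r ε hε hεδ h s t hst hrs => ?_⟩
  set δ := η / 2 / (Real.exp (lam / 2) * (1 + 1 / (2 * C))) with hδ
  refine (h.le_of_short hC hε hlam1 hst).trans ?_
  have hst' : |t - s| ≤ 1 / (2 * C) := by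
    rw [le_div_iff₀ (by positivity)]; linarith
  have h1 : Real.exp (-lam) * Real.exp (lam / 2) ≤ η := by
    rw [← Real.exp_add, show -lam + lam / 2 = -(lam / 2) by ring]; exact hlam
  have h2 : (δ + δ * (1 / (2 * C))) * Real.exp (lam / 2) = η / 2 := by
    rw [hδ]; field_simp
  calc (r s + (C * Real.exp (-lam) + ε) * |t - s|) * Real.exp (lam / 2)
      = (r s + ε * |t - s|) * Real.exp (lam / 2) +
        (C * |t - s|) * (Real.exp (-lam) * Real.exp (lam / 2)) := by ring
    _ ≤ (δ + δ * (1 / (2 * C))) * Real.exp (lam / 2) + 1 / 2 * η := by gcongr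
    _ = η := by rw [h2]; ring

lemma OsgoodIneq.exists_long {C : ℝ} (hC : 0 < C) (R : ℝ) {η : ℝ} (hη : 0 < η) :
    ∃ δ > 0, ∀ r : ℝ → ℝ, ∀ ε, 0 ≤ ε → ε ≤ δ → OsgoodIneq C ε r → ∀ s t,
      |t - s| ≤ R → r s ≤ δ → r t ≤ η := by
  have key : ∀ N : ℕ, ∀ η : ℝ, 0 < η → ∃ δ > 0, ∀ r : ℝ → ℝ, ∀ ε, 0 ≤ ε → ε ≤ δ →
      OsgoodIneq C ε r → ∀ s t, C * |t - s| ≤ N / 2 → r s ≤ δ → r t ≤ η := by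
    intro N
    induction N with
    | zero =>
      intro η hη
      refine ⟨η, hη, fun r ε _ _ _ s t hst hrs => ?_⟩
      have : |t - s| ≤ 0 := by
        by_contra! h
        have := mul_pos hC h
        norm_num at hst; linarith
      have : t = s := sub_eq_zero.1 (abs_nonpos_iff.1 this)
      rwa [this]
    | succ N ih =>
      intro η hη
      obtain ⟨δ₁, hδ₁, h₁⟩ := OsgoodIneq.exists_short hC hη
      obtain ⟨δ₂, hδ₂, h₂⟩ := ih δ₁ hδ₁
      refine ⟨min δ₁ δ₂, lt_min hδ₁ hδ₂, fun r ε hε hεδ h s t hst hrs => ?_⟩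
      have hN : (0 : ℝ) < (N : ℝ) + 1 := by positivity
      push_cast at hst
      refine h₁ r ε hε (hεδ.trans (min_le_left _ _)) h (s + (t - s) * (N / (N + 1))) t ?_
        (h₂ r ε hε (hεδ.trans (min_le_right _ _)) h s _ ?_ (hrs.trans (min_le_right _ _)))
      · have : t - (s + (t - s) * (N / (N + 1))) = (t - s) * (1 / (N + 1)) := by
          field_simp; ring
        rw [this, abs_mul, abs_of_pos (show (0 : ℝ) < 1 / (N + 1) by positivity), ← mul_assoc,
          mul_one_div, div_le_iff₀ hN]
        linarith
      · have : s + (t - s) * (N / (N + 1)) - s = (t - s) * (N / (N + 1)) := by ring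
        rw [this, abs_mul, abs_of_nonneg (show (0 : ℝ) ≤ N / (N + 1) by positivity), ← mul_assoc,
          ← mul_div_assoc, div_le_iff₀ hN]
        have : (0 : ℝ) ≤ N := by positivity
        nlinarith
  obtain ⟨N, hN⟩ := exists_nat_ge (2 * (C * R))
  obtain ⟨δ, hδ, h⟩ := key N η hη
  refine ⟨δ, hδ, fun r ε hε hεδ hr s t hst hrs => h r ε hε hεδ hr s t ?_ hrs⟩
  have := mul_le_mul_of_nonneg_left hst hC.le
  linarith

lemma OsgoodIneq.eq_zero {C : ℝ} (hC : 0 < C) {r : ℝ → ℝ} (h : OsgoodIneq C 0 r) {s : ℝ}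
    (hs : r s = 0) (t : ℝ) : r t = 0 := by
  refine le_antisymm (le_of_forall_pos_le_add fun η hη => ?_) (h.nonneg t)
  obtain ⟨δ, hδ, h1⟩ := OsgoodIneq.exists_long hC |t - s| hη
  rw [zero_add]
  exact h1 r 0 le_rfl hδ.le h s t le_rfl (hs.le.trans hδ.le)

/-! ### Carathéodory differential equations -/

variable {E : Type*} [NormedAddCommGroup E] [NormedSpace ℝ E]

/-- `Y` is a trajectory of the time dependent vector field `a`, equal to `x` at time `s`. -/
structure IsIntegralSol (a : ℝ → E → E) (s : ℝ) (x : E) (Y : ℝ → E) : Prop where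
  continuous : Continuous Y
  eq : ∀ t, Y t = x + ∫ σ in s..t, a σ (Y σ)

lemma continuous_add_primitive {f : ℝ → E} (hf : Integrable f) (x : E) (s : ℝ) :
    Continuous fun t => x + ∫ σ in s..t, f σ :=
  continuous_const.add (intervalIntegral.continuous_primitive
    (fun _ _ => hf.intervalIntegrable) s)

/-- Trajectories are stable under pointwise limits. -/
lemma exists_integralSol_of_tendsto {a : ℝ → E → E} {m : ℝ → ℝ} {s : ℝ} {x : E}
    {f : ℕ → ℝ → E} {Y : ℝ → E} {Yn : ℕ → ℝ → E}
    (hf : ∀ n, AEStronglyMeasurable (f n) volume) (hm : Integrable m)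
    (hfm : ∀ n σ, ‖f n σ‖ ≤ m σ) (hYn : ∀ n t, Yn (n + 1) t = x + ∫ σ in s..t, f n σ)
    (hY : ∀ t, Tendsto (fun n => Yn n t) atTop (𝓝 (Y t)))
    (hlim : ∀ σ, Tendsto (fun n => f n σ) atTop (𝓝 (a σ (Y σ)))) : IsIntegralSol a s x Y := by
  have hmeas : AEStronglyMeasurable (fun σ => a σ (Y σ)) volume :=
    aestronglyMeasurable_of_tendsto_ae _ hf (Eventually.of_forall hlim)
  have hint : Integrable (fun σ => a σ (Y σ)) volume :=
    hm.mono' hmeas (Eventually.of_forall fun σ =>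
      le_of_tendsto (hlim σ).norm (Eventually.of_forall fun n => hfm n σ))
  have heq : ∀ t, Y t = x + ∫ σ in s..t, a σ (Y σ) := by
    intro t
    refine tendsto_nhds_unique ((hY t).comp (tendsto_add_atTop_nat 1)) ?_
    have : (fun n => Yn n t) ∘ (fun n => n + 1) = fun n => x + ∫ σ in s..t, f n σ := by
      funext n; exact hYn n t
    rw [this]
    refine tendsto_const_nhds.add ?_
    exact intervalIntegral.tendsto_integral_filter_of_dominated_convergence m
      (Eventually.of_forall fun n => (hf n).restrict)
      (Eventually.of_forall fun n => Eventually.of_forall fun σ _ => hfm n σ)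
      hm.intervalIntegrable (Eventually.of_forall fun σ _ => hlim σ)
  refine ⟨?_, heq⟩
  have := continuous_add_primitive hint x s
  have h2 : Y = fun t => x + ∫ σ in s..t, a σ (Y σ) := funext heq
  rw [h2]; simpa only [← heq] using this

/-- Picard's theorem for Lipschitz fields that are merely integrable in time. -/
lemma exists_integralSol_of_lipschitz [CompleteSpace E] {a : ℝ → E → E} {m : ℝ → ℝ} {Λ : ℝ} (hΛ : 0 ≤ Λ)
    (hmeas : ∀ Y : ℝ → E, Continuous Y → AEStronglyMeasurable (fun σ => a σ (Y σ)) volume)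
    (hm : Integrable m) (ham : ∀ σ v, ‖a σ v‖ ≤ m σ)
    (hlip : ∀ σ v w, ‖a σ v - a σ w‖ ≤ Λ * ‖v - w‖) (s : ℝ) (x : E) :
    ∃ Y, IsIntegralSol a s x Y := by
  let Yn : ℕ → ℝ → E := fun n => Nat.rec (fun _ => x)
    (fun _ Y t => x + ∫ σ in s..t, a σ (Y σ)) n
  have hY0 : Yn 0 = fun _ => x := rfl
  have hYs : ∀ n, Yn (n + 1) = fun t => x + ∫ σ in s..t, a σ (Yn n σ) := fun n => rfl
  have hint : ∀ Y : ℝ → E, Continuous Y → Integrable (fun σ => a σ (Y σ)) volume :=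
    fun Y hY => hm.mono' (hmeas Y hY) (Eventually.of_forall fun σ => ham _ _)
  have hcont : ∀ n, Continuous (Yn n) := by
    intro n
    induction n with
    | zero => exact continuous_const
    | succ n ih => rw [hYs]; exact continuous_add_primitive (hint _ ih) x s
  set M := ∫ σ, m σ with hM
  have hm0 : ∀ σ, 0 ≤ m σ := fun σ => (norm_nonneg _).trans (ham σ 0)
  have hstep : ∀ n t, ‖Yn (n + 1) t - Yn n t‖ ≤ M * ((Λ * |t - s|) ^ n / n.factorial) := by
    intro n
    induction n with
    | zero =>
      intro t
      rw [hYs, hY0]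
      simp only [add_sub_cancel_left, pow_zero, Nat.factorial_zero, Nat.cast_one, div_one, mul_one]
      refine intervalIntegral.norm_integral_le_integral_norm_uIoc.trans ?_
      calc ∫ σ in Set.uIoc s t, ‖a σ x‖ ≤ ∫ σ in Set.uIoc s t, m σ :=
            integral_mono (hint _ continuous_const).norm.integrableOn hm.integrableOn
              fun σ => ham σ x
        _ ≤ M := setIntegral_le_integral hm (Eventually.of_forall hm0)
    | succ n ih =>
      intro t
      have h1 : Yn (n + 1 + 1) t - Yn (n + 1) t =
          ∫ σ in s..t, (a σ (Yn (n + 1) σ) - a σ (Yn n σ)) := by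
        rw [intervalIntegral.integral_sub (hint (Yn (n + 1)) (hcont (n + 1))).intervalIntegrable
          (hint (Yn n) (hcont n)).intervalIntegrable]
        have h2 : Yn (n + 1) t = x + ∫ σ in s..t, a σ (Yn n σ) := rfl
        have h3 : Yn (n + 1 + 1) t = x + ∫ σ in s..t, a σ (Yn (n + 1) σ) := rfl
        rw [h2, h3, add_sub_add_left_eq_sub]
      rw [h1]
      refine intervalIntegral.norm_integral_le_integral_norm_uIoc.trans ?_
      calc ∫ σ in Set.uIoc s t, ‖a σ (Yn (n + 1) σ) - a σ (Yn n σ)‖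
          ≤ ∫ σ in Set.uIoc s t, Λ * (M * (Λ ^ n / n.factorial)) * |σ - s| ^ n := by
            refine integral_mono ((hint (Yn (n + 1)) (hcont (n + 1))).sub
              (hint (Yn n) (hcont n))).norm.integrableOn
              ?_ fun σ => ?_
            · have hcc : Continuous fun σ : ℝ =>
                  Λ * (M * (Λ ^ n / n.factorial)) * |σ - s| ^ n := by fun_prop
              exact (intervalIntegrable_iff.1 (hcc.intervalIntegrable s t))
            · refine (hlip _ _ _).trans ?_
              have := mul_le_mul_of_nonneg_left (ih σ) hΛ
              refine this.trans (le_of_eq ?_)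
              rw [mul_pow]; ring
        _ = _ := by
            rw [integral_const_mul, integral_pow_abs_sub_uIoc, Nat.factorial_succ]
            push_cast
            rw [mul_pow, pow_succ Λ]
            field_simp
  have hlim : ∀ t, ∃ y, Tendsto (fun n => Yn n t) atTop (𝓝 y) := by
    intro t
    refine cauchySeq_tendsto_of_complete (cauchySeq_of_dist_le_of_summable
      (fun n => M * ((Λ * |t - s|) ^ n / n.factorial)) (fun n => ?_)
      ((Real.summable_pow_div_factorial _).mul_left M))
    rw [dist_comm, dist_eq_norm]
    exact hstep n t
  choose Y hY using hlim
  refine ⟨Y, exists_integralSol_of_tendsto (f := fun n σ => a σ (Yn n σ)) (Yn := Yn)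
    (fun n => hmeas _ (hcont n)) hm (fun n σ => ham _ _) (fun n t => by rw [hYs]) hY fun σ => ?_⟩
  have hc : Continuous (a σ) := (LipschitzWith.of_dist_le_mul (K := ⟨Λ, hΛ⟩) fun v w => by
    rw [dist_eq_norm, dist_eq_norm]; exact hlip σ v w).continuous
  exact (hc.tendsto _).comp (hY σ)

end

end TorusTransport


namespace TorusTransport

noncomputable section

variable {d : ℕ}

/-! ### Euclidean displacements on the torus -/

/-- The class on the torus of a Euclidean vector. -/
def eproj (w : EuclideanSpace ℝ (Fin d)) : Torus d := proj w.ofLp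

lemma eproj_add (v w : EuclideanSpace ℝ (Fin d)) : eproj (v + w) = eproj v + eproj w := rfl

lemma eproj_neg (v : EuclideanSpace ℝ (Fin d)) : eproj (-v) = -eproj v := rfl

lemma eproj_sub (v w : EuclideanSpace ℝ (Fin d)) : eproj (v - w) = eproj v - eproj w := rfl

lemma eproj_zero : eproj (0 : EuclideanSpace ℝ (Fin d)) = 0 := rfl

lemma continuous_eproj : Continuous (eproj : EuclideanSpace ℝ (Fin d) → Torus d) :=
  continuous_proj.comp (PiLp.continuous_ofLp 2 _)

lemma torusDist_add_eproj_le (x : Torus d) (w : EuclideanSpace ℝ (Fin d)) :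
    torusDist x (x + eproj w) ≤ ‖w‖ := by
  rw [torusDist, EuclideanSpace.norm_eq]
  refine Real.sqrt_le_sqrt (Finset.sum_le_sum fun i _ => ?_)
  have : x i - (x + eproj w) i = -(proj w.ofLp i) := by simp [eproj]
  rw [this, norm_neg, Real.norm_eq_abs]
  have := norm_proj_apply_le w.ofLp i
  gcongr

lemma exists_elift (x y : Torus d) :
    ∃ w : EuclideanSpace ℝ (Fin d), y = x + eproj w ∧ ‖w‖ = torusDist x y ∧
      ∀ i, |w i| = ‖y i - x i‖ := by
  obtain ⟨v, hv, hv'⟩ := exists_lift (y - x)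
  refine ⟨WithLp.toLp 2 v, ?_, ?_, hv'⟩
  · simp [eproj, hv]
  · rw [torusDist, EuclideanSpace.norm_eq]
    congr 1
    refine Finset.sum_congr rfl fun i _ => ?_
    rw [Real.norm_eq_abs, norm_sub_rev]
    exact congrArg (· ^ 2) (hv' i)

lemma torusDist_nonneg (x y : Torus d) : 0 ≤ torusDist x y := Real.sqrt_nonneg _

lemma torusDist_le (x y : Torus d) : torusDist x y ≤ Real.sqrt d * dist x y := by
  rw [torusDist, ← Real.sqrt_sq (dist_nonneg (x := x) (y := y)), ← Real.sqrt_mul (by positivity)]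
  refine Real.sqrt_le_sqrt ?_
  calc ∑ i, ‖x i - y i‖ ^ 2 ≤ ∑ _i : Fin d, dist x y ^ 2 := by
        refine Finset.sum_le_sum fun i _ => ?_
        have := norm_le_pi_norm (x - y) i
        rw [dist_eq_norm]
        gcongr
        exact this
    _ = _ := by simp

lemma norm_eproj_le (w : EuclideanSpace ℝ (Fin d)) : ‖eproj w‖ ≤ ‖w‖ := by
  refine (norm_proj_le _).trans ((pi_norm_le_iff_of_nonneg (norm_nonneg _)).2 fun i => ?_)
  exact PiLp.norm_apply_le w i

lemma exists_elift_small (x y : Torus d) :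
    ∃ w : EuclideanSpace ℝ (Fin d), y = x + eproj w ∧ ‖w‖ ≤ Real.sqrt d * dist x y := by
  obtain ⟨w, h1, h2, _⟩ := exists_elift x y
  exact ⟨w, h1, h2 ▸ torusDist_le x y⟩

/-! ### Velocity fields with a log-Lipschitz modulus of continuity -/

structure IsVelocity (C : ℝ) (m : ℝ → ℝ) (b : ℝ → Torus d → EuclideanSpace ℝ (Fin d)) :
    Prop where
  pos : 0 < C
  measurable : Measurable (Function.uncurry b)
  integrable : Integrable m
  norm_le : ∀ t x, ‖b t x‖ ≤ m t
  osc : ∀ t x w lam, 1 ≤ lam →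
    ‖b t (x + eproj w) - b t x‖ ≤ C * (lam * ‖w‖ + Real.exp (-lam))

lemma exists_logLip_lt {C : ℝ} (hC : 0 < C) {ε : ℝ} (hε : 0 < ε) :
    ∃ lam ≥ 1, ∃ δ > 0, ∀ r ≤ δ, C * (lam * r + Real.exp (-lam)) ≤ ε := by
  obtain ⟨lam, h1, h2⟩ := ((eventually_ge_atTop 1).and
    (Real.tendsto_exp_neg_atTop_nhds_zero.eventually
      (ge_mem_nhds (show 0 < ε / (2 * C) by positivity)))).exists
  have h0 : 0 < lam := by linarith
  refine ⟨lam, h1, ε / (2 * C * lam), by positivity, fun r hr => ?_⟩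
  calc C * (lam * r + Real.exp (-lam)) ≤ C * (lam * (ε / (2 * C * lam)) + ε / (2 * C)) := by gcongr
    _ = ε := by field_simp; ring

section Velocity

variable {C : ℝ} {m m' : ℝ → ℝ} {b b' : ℝ → Torus d → EuclideanSpace ℝ (Fin d)}

lemma IsVelocity.nonneg (hb : IsVelocity C m b) (t : ℝ) : 0 ≤ m t :=
  (norm_nonneg _).trans (hb.norm_le t 0)

lemma IsVelocity.continuous (hb : IsVelocity C m b) (t : ℝ) : Continuous (b t) := by
  rw [Metric.continuous_iff]
  intro x ε hε
  obtain ⟨lam, hlam, δ, hδ, h⟩ := exists_logLip_lt hb.pos (half_pos hε)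
  refine ⟨δ / (Real.sqrt d + 1), by positivity, fun y hy => ?_⟩
  obtain ⟨w, rfl, hw⟩ := exists_elift_small x y
  rw [dist_eq_norm]
  refine lt_of_le_of_lt ((hb.osc t x w lam hlam).trans (h _ ?_)) (half_lt_self hε)
  rw [dist_comm, lt_div_iff₀ (by positivity)] at hy
  nlinarith [dist_nonneg (x := x) (y := x + eproj w), Real.sqrt_nonneg (d : ℝ)]

/-- `Z` is a trajectory of `b` on the torus, equal to `x` at time `s`. -/
structure IsTraj (b : ℝ → Torus d → EuclideanSpace ℝ (Fin d)) (s : ℝ) (x : Torus d)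
    (Z : ℝ → Torus d) : Prop where
  continuous : Continuous Z
  eq : ∀ t, Z t = x + eproj (∫ σ in s..t, b σ (Z σ))

lemma IsVelocity.measurable_comp (hb : IsVelocity C m b) {Z : ℝ → Torus d} (hZ : Continuous Z) :
    Measurable fun σ => b σ (Z σ) := by
  have := hb.measurable.comp (measurable_id.prodMk hZ.measurable)
  exact this

lemma IsVelocity.integrable_comp (hb : IsVelocity C m b) {Z : ℝ → Torus d} (hZ : Continuous Z) :
    Integrable fun σ => b σ (Z σ) :=
  hb.integrable.mono' (hb.measurable_comp hZ).aestronglyMeasurable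
    (Eventually.of_forall fun σ => hb.norm_le σ _)

lemma IsTraj.self {s : ℝ} {x : Torus d} {Z : ℝ → Torus d} (hZ : IsTraj b s x Z) : Z s = x := by
  rw [hZ.eq s, intervalIntegral.integral_same, eproj_zero, add_zero]

lemma IsTraj.eq_add (hb : IsVelocity C m b) {s : ℝ} {x : Torus d} {Z : ℝ → Torus d}
    (hZ : IsTraj b s x Z) (t r : ℝ) : Z r = Z t + eproj (∫ σ in t..r, b σ (Z σ)) := by
  have hi := hb.integrable_comp hZ.continuous
  rw [hZ.eq r, hZ.eq t, add_assoc, ← eproj_add, intervalIntegral.integral_add_adjacent_intervals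
    hi.intervalIntegrable hi.intervalIntegrable]

lemma IsTraj.shift (hb : IsVelocity C m b) {s : ℝ} {x : Torus d} {Z : ℝ → Torus d}
    (hZ : IsTraj b s x Z) (t : ℝ) : IsTraj b t (Z t) Z :=
  ⟨hZ.continuous, fun r => hZ.eq_add hb t r⟩

/-- The Euclidean displacement between two trajectories. -/
def gap (b b' : ℝ → Torus d → EuclideanSpace ℝ (Fin d)) (Z Z' : ℝ → Torus d) (s : ℝ)
    (w : EuclideanSpace ℝ (Fin d)) (t : ℝ) : EuclideanSpace ℝ (Fin d) :=
  w + ∫ σ in s..t, (b' σ (Z' σ) - b σ (Z σ))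

lemma gap_self (Z Z' : ℝ → Torus d) (s : ℝ) (w : EuclideanSpace ℝ (Fin d)) :
    gap b b' Z Z' s w s = w := by simp [gap]

lemma gap_sub (hb : IsVelocity C m b) (hb' : IsVelocity C m' b') {Z Z' : ℝ → Torus d}
    (hZ : Continuous Z) (hZ' : Continuous Z') (s : ℝ) (w : EuclideanSpace ℝ (Fin d)) (t r : ℝ) :
    gap b b' Z Z' s w r = gap b b' Z Z' s w t + ∫ σ in t..r, (b' σ (Z' σ) - b σ (Z σ)) := by
  have hi : Integrable fun σ => b' σ (Z' σ) - b σ (Z σ) :=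
    (hb'.integrable_comp hZ').sub (hb.integrable_comp hZ)
  rw [gap, gap, add_assoc, intervalIntegral.integral_add_adjacent_intervals
    hi.intervalIntegrable hi.intervalIntegrable]

lemma IsTraj.eq_gap (hb : IsVelocity C m b) (hb' : IsVelocity C m' b') {s : ℝ} {x : Torus d}
    {w : EuclideanSpace ℝ (Fin d)} {Z Z' : ℝ → Torus d} (hZ : IsTraj b s x Z)
    (hZ' : IsTraj b' s (x + eproj w) Z') (t : ℝ) : Z' t = Z t + eproj (gap b b' Z Z' s w t) := by
  rw [gap, intervalIntegral.integral_sub (hb'.integrable_comp hZ'.continuous).intervalIntegrable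
    (hb.integrable_comp hZ.continuous).intervalIntegrable, hZ'.eq t, hZ.eq t, eproj_add, eproj_sub]
  abel

lemma IsTraj.osgoodIneq_gap (hb : IsVelocity C m b) (hb' : IsVelocity C m' b') {e : ℝ}
    (he : ∀ t x, ‖b' t x - b t x‖ ≤ e) {s : ℝ} {x : Torus d}
    {w : EuclideanSpace ℝ (Fin d)} {Z Z' : ℝ → Torus d} (hZ : IsTraj b s x Z)
    (hZ' : IsTraj b' s (x + eproj w) Z') : OsgoodIneq C e fun t => ‖gap b b' Z Z' s w t‖ := by
  have hi : Integrable fun σ => b' σ (Z' σ) - b σ (Z σ) :=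
    (hb'.integrable_comp hZ'.continuous).sub (hb.integrable_comp hZ.continuous)
  have hcont : Continuous fun t => gap b b' Z Z' s w t := continuous_add_primitive hi w s
  refine ⟨hcont.norm, fun t => norm_nonneg _, fun t r lam hlam => ?_⟩
  have hC := hb.pos
  have h1 : ∀ σ, ‖b' σ (Z' σ) - b σ (Z σ)‖ ≤
      C * (lam * ‖gap b b' Z Z' s w σ‖ + Real.exp (-lam)) + e := by
    intro σ
    rw [← sub_add_sub_cancel (b' σ (Z' σ)) (b σ (Z' σ)) (b σ (Z σ)), add_comm]
    refine (norm_add_le _ _).trans (add_le_add ?_ (he _ _))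
    rw [hZ.eq_gap hb hb' hZ' σ]
    exact hb.osc _ _ _ _ hlam
  rw [gap_sub hb hb' hZ.continuous hZ'.continuous s w t r]
  refine (norm_add_le _ _).trans (add_le_add le_rfl ?_)
  refine intervalIntegral.norm_integral_le_abs_of_norm_le (Eventually.of_forall fun σ => h1 σ) ?_
  have hcc : Continuous fun σ => C * (lam * ‖gap b b' Z Z' s w σ‖ + Real.exp (-lam)) + e := by
    fun_prop
  exact hcc.intervalIntegrable _ _

/-- Stability of trajectories with respect to the field and to the initial datum, with a modulus
that only depends on the constant `C`. -/
lemma exists_gap_le {C : ℝ} (hC : 0 < C) (R : ℝ) {η : ℝ} (hη : 0 < η) :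
    ∃ δ > 0, ∀ (m m' : ℝ → ℝ) (b b' : ℝ → Torus d → EuclideanSpace ℝ (Fin d)),
      IsVelocity C m b → IsVelocity C m' b' → (∀ t x, ‖b' t x - b t x‖ ≤ δ) →
      ∀ s t x w Z Z', |t - s| ≤ R → IsTraj b s x Z → IsTraj b' s (x + eproj w) Z' → ‖w‖ ≤ δ →
        ‖gap b b' Z Z' s w t‖ ≤ η := by
  obtain ⟨δ, hδ, h⟩ := OsgoodIneq.exists_long hC R hη
  refine ⟨δ, hδ, fun m m' b b' hb hb' he s t x w Z Z' hst hZ hZ' hw => ?_⟩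
  exact h _ δ hδ.le le_rfl (hZ.osgoodIneq_gap hb hb' he hZ') s t hst (by rwa [gap_self])

lemma IsTraj.unique (hb : IsVelocity C m b) {s : ℝ} {x : Torus d} {Z Z' : ℝ → Torus d}
    (hZ : IsTraj b s x Z) (hZ' : IsTraj b s x Z') : Z' = Z := by
  funext t
  have hZ'' : IsTraj b s (x + eproj 0) Z' := by rwa [eproj_zero, add_zero]
  have h := (hZ.osgoodIneq_gap hb hb (e := 0) (fun t x => by simp) hZ'').eq_zero hb.pos (s := s)
    (by rw [gap_self, norm_zero]) t
  rw [hZ.eq_gap hb hb hZ'' t, norm_eq_zero.1 h, eproj_zero, add_zero]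

/-- All initial value problems for `b` can be solved. -/
def HasFlow (b : ℝ → Torus d → EuclideanSpace ℝ (Fin d)) : Prop :=
  ∀ s x, ∃ Z, IsTraj b s x Z

open Classical in
/-- The flow of `b`: `flow b s t x` is the position at time `t` of the particle that is at `x` at
time `s`. -/
def flow (b : ℝ → Torus d → EuclideanSpace ℝ (Fin d)) (s t : ℝ) (x : Torus d) : Torus d :=
  if h : ∃ Z, IsTraj b s x Z then h.choose t else x

lemma HasFlow.isTraj (h : HasFlow b) (s : ℝ) (x : Torus d) :
    IsTraj b s x fun t => flow b s t x := by
  have h1 := (h s x).choose_spec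
  have h2 : (fun t => flow b s t x) = (h s x).choose := by
    funext t; rw [flow, dif_pos (h s x)]
  rw [h2]; exact h1

lemma HasFlow.self (h : HasFlow b) (s : ℝ) (x : Torus d) : flow b s s x = x := (h.isTraj s x).self

lemma HasFlow.comp (h : HasFlow b) (hb : IsVelocity C m b) (s t r : ℝ) (x : Torus d) :
    flow b t r (flow b s t x) = flow b s r x :=
  congrFun (((h.isTraj s x).shift hb t).unique hb (h.isTraj t _)) r

lemma HasFlow.continuous (h : HasFlow b) (hb : IsVelocity C m b) :
    Continuous fun z : ℝ × ℝ × Torus d => flow b z.1 z.2.1 z.2.2 := by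
  refine continuous_iff_continuousAt.2 fun ⟨s₀, t₀, x₀⟩ => ?_
  rw [ContinuousAt, Metric.tendsto_nhds]
  intro ε hε
  obtain ⟨δ, hδ, hgap⟩ := exists_gap_le (d := d) hb.pos (|t₀ - s₀| + 1) (half_pos hε)
  have h1 : Tendsto (fun z : ℝ × ℝ × Torus d => |∫ σ in z.1..s₀, m σ| + dist z.2.2 x₀)
      (𝓝 (s₀, t₀, x₀)) (𝓝 0) := by
    have hc : Continuous fun z : ℝ × ℝ × Torus d => |∫ σ in z.1..s₀, m σ| + dist z.2.2 x₀ := by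
      have h2 : Continuous fun s => ∫ σ in s..s₀, m σ := by
        simp_rw [intervalIntegral.integral_symm s₀]
        exact (intervalIntegral.continuous_primitive
          (fun _ _ => hb.integrable.intervalIntegrable) s₀).neg
      exact ((h2.comp continuous_fst).abs).add (by fun_prop)
    simpa using hc.tendsto (s₀, t₀, x₀)
  have h3 : Tendsto (fun z : ℝ × ℝ × Torus d => dist (flow b s₀ z.2.1 x₀) (flow b s₀ t₀ x₀))
      (𝓝 (s₀, t₀, x₀)) (𝓝 0) := by
    have hc : Continuous fun z : ℝ × ℝ × Torus d =>
        dist (flow b s₀ z.2.1 x₀) (flow b s₀ t₀ x₀) :=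
      (((h.isTraj s₀ x₀).continuous.comp (continuous_fst.comp continuous_snd))).dist
        continuous_const
    simpa using hc.tendsto (s₀, t₀, x₀)
  have h4 : ∀ᶠ z : ℝ × ℝ × Torus d in 𝓝 (s₀, t₀, x₀), |z.2.1 - s₀| ≤ |t₀ - s₀| + 1 := by
    have hc : Continuous fun z : ℝ × ℝ × Torus d => |z.2.1 - s₀| := by fun_prop
    exact (hc.tendsto (s₀, t₀, x₀)).eventually (ge_mem_nhds (by simp))
  filter_upwards [h1.eventually (gt_mem_nhds (show 0 < δ / (Real.sqrt d + 1) by positivity)),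
    h3.eventually (gt_mem_nhds (half_pos hε)), h4] with z hz1 hz2 hz3
  obtain ⟨s, t, x⟩ := z
  simp only at hz1 hz2 hz3 ⊢
  have h5 : dist x₀ (flow b s s₀ x) ≤ |∫ σ in s..s₀, m σ| + dist x x₀ := by
    rw [(h.isTraj s x).eq s₀, dist_comm, dist_eq_norm, add_sub_right_comm, add_comm, dist_eq_norm]
    refine (norm_add_le _ _).trans (add_le_add ((norm_eproj_le _).trans ?_) le_rfl)
    exact intervalIntegral.norm_integral_le_abs_of_norm_le
      (Eventually.of_forall fun σ => hb.norm_le _ _) hb.integrable.intervalIntegrable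
  obtain ⟨w, hw1, hw2⟩ := exists_elift_small x₀ (flow b s s₀ x)
  have hw3 : ‖w‖ ≤ δ := by
    rw [lt_div_iff₀ (by positivity)] at hz1
    nlinarith [dist_nonneg (x := x₀) (y := flow b s s₀ x), Real.sqrt_nonneg (d : ℝ)]
  have h6 := hgap m m b b hb hb (fun t x => by simpa using hδ.le) s₀ t x₀ w _ _ hz3
    (h.isTraj s₀ x₀) (h.isTraj s₀ _) hw3
  have h7 := (h.isTraj s₀ x₀).eq_gap hb hb (h.isTraj s₀ (x₀ + eproj w)) t
  rw [← h.comp hb s s₀ t x, hw1]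
  refine (dist_triangle _ (flow b s₀ t x₀) _).trans_lt ?_
  have h8 : dist (flow b s₀ t (x₀ + eproj w)) (flow b s₀ t x₀) ≤ ε / 2 := by
    rw [h7, dist_eq_norm, add_sub_cancel_left]
    exact (norm_eproj_le _).trans h6
  linarith

lemma hasFlow_of_lipschitz (hb : IsVelocity C m b) {Λ : ℝ} (hΛ : 0 ≤ Λ)
    (hlip : ∀ t x w, ‖b t (x + eproj w) - b t x‖ ≤ Λ * ‖w‖) : HasFlow b := by
  intro s x
  obtain ⟨Y, hY⟩ := exists_integralSol_of_lipschitz (a := fun σ v => b σ (x + eproj v)) hΛ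
    (fun Y hY => (hb.measurable_comp
      (continuous_const.add (continuous_eproj.comp hY))).aestronglyMeasurable)
    hb.integrable (fun σ v => hb.norm_le _ _) (fun σ v w => by
      have := hlip σ (x + eproj w) (v - w)
      rwa [add_assoc, ← eproj_add, add_sub_cancel] at this) s 0
  refine ⟨fun t => x + eproj (Y t), continuous_const.add (continuous_eproj.comp hY.continuous),
    fun t => ?_⟩
  congr 2
  rw [hY.eq t, zero_add]

lemma hasFlow_of_tendsto (hb : IsVelocity C m b)
    {bn : ℕ → ℝ → Torus d → EuclideanSpace ℝ (Fin d)} (hbn : ∀ n, IsVelocity C m (bn n))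
    (hflow : ∀ n, HasFlow (bn n)) {e : ℕ → ℝ} (he : Tendsto e atTop (𝓝 0))
    (hle : ∀ n t x, ‖bn n t x - b t x‖ ≤ e n) : HasFlow b := by
  intro s x
  set f : ℕ → ℝ → EuclideanSpace ℝ (Fin d) := fun n σ => bn n σ (flow (bn n) s σ x) with hf
  set Y : ℕ → ℝ → EuclideanSpace ℝ (Fin d) := fun n t => ∫ σ in s..t, f n σ with hYdef
  have hcauchy : ∀ t, ∃ y, Tendsto (fun n => Y n t) atTop (𝓝 y) := by
    intro t
    refine cauchySeq_tendsto_of_complete (Metric.cauchySeq_iff.2 fun η hη => ?_)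
    obtain ⟨δ, hδ, hgap⟩ := exists_gap_le (d := d) hb.pos |t - s| (half_pos hη)
    obtain ⟨N, hN⟩ := eventually_atTop.1 (he.eventually (ge_mem_nhds (half_pos hδ)))
    refine ⟨N, fun k hk n hn => lt_of_le_of_lt ?_ (half_lt_self hη)⟩
    have h1 := hgap m m (bn n) (bn k) (hbn n) (hbn k) (fun t x => by
      have h2 := hle n t x
      have h3 := hle k t x
      have h4 := hN n hn
      have h5 := hN k hk
      rw [← sub_sub_sub_cancel_right _ _ (b t x)]
      exact (norm_sub_le _ _).trans (by linarith)) s t x 0 _ _ le_rfl ((hflow n).isTraj s x)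
      (by rw [eproj_zero, add_zero]; exact (hflow k).isTraj s x) (by simpa using hδ.le)
    rw [gap, zero_add, intervalIntegral.integral_sub
      ((hbn k).integrable_comp ((hflow k).isTraj s x).continuous).intervalIntegrable
      ((hbn n).integrable_comp ((hflow n).isTraj s x).continuous).intervalIntegrable] at h1
    rwa [dist_eq_norm]
  choose y hy using hcauchy
  have hlim : ∀ σ, Tendsto (fun n => f n σ) atTop (𝓝 (b σ (x + eproj (y σ)))) := by
    intro σ
    have h1 : Tendsto (fun n => b σ (flow (bn n) s σ x)) atTop (𝓝 (b σ (x + eproj (y σ)))) := by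
      have h2 : ∀ n, flow (bn n) s σ x = x + eproj (Y n σ) := fun n =>
        ((hflow n).isTraj s x).eq σ
      simp_rw [h2]
      exact (((hb.continuous σ).comp (continuous_const.add continuous_eproj)).tendsto _).comp
        (hy σ)
    have h3 : Tendsto (fun n => f n σ - b σ (flow (bn n) s σ x)) atTop (𝓝 0) :=
      squeeze_zero_norm (fun n => hle n _ _) he
    simpa using h3.add h1
  have hsol := exists_integralSol_of_tendsto (a := fun σ v => b σ (x + eproj v)) (s := s)
    (x := 0) (f := f) (Y := y) (Yn := fun n => Y (n - 1)) (m := m)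
    (fun n => ((hbn n).measurable_comp
      ((hflow n).isTraj s x).continuous).aestronglyMeasurable) hb.integrable
    (fun n σ => (hbn n).norm_le _ _) (fun n t => by simp [hYdef])
    (fun t => (hy t).comp (tendsto_sub_atTop_nat 1)) hlim
  refine ⟨fun t => x + eproj (y t), continuous_const.add (continuous_eproj.comp hsol.continuous),
    fun t => ?_⟩
  congr 2
  rw [hsol.eq t, zero_add]

end Velocity

end

end TorusTransport


namespace TorusTransport

noncomputable section

variable {d : ℕ}

/-! ### Averages over small cubes -/

/-- The uniform probability measure on the unit cube centred at the origin. -/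
def cubeMeasure (d : ℕ) : Measure (Fin d → ℝ) :=
  Measure.pi fun _ => volume.restrict (Ioc (-(1 / 2)) (-(1 / 2) + 1))

lemma cubeMeasure_eq : cubeMeasure d =
    volume.restrict (univ.pi fun _ => Ioc (-(1 / 2)) (-(1 / 2) + 1)) := by
  rw [cubeMeasure, volume_pi, Measure.restrict_pi_pi]

lemma measurePreserving_proj : MeasurePreserving (proj : (Fin d → ℝ) → Torus d) (cubeMeasure d) :=
  measurePreserving_pi _ _ fun _ => UnitAddCircle.measurePreserving_mk (-(1 / 2))

instance : IsProbabilityMeasure (cubeMeasure d) := by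
  have : IsProbabilityMeasure
      ((volume : Measure ℝ).restrict (Ioc (-(1 / 2)) (-(1 / 2) + 1))) := ⟨by simp⟩
  unfold cubeMeasure
  infer_instance

lemma ae_cubeMeasure : ∀ᵐ v ∂cubeMeasure d, ∀ i, |v i| ≤ 1 / 2 := by
  rw [cubeMeasure_eq, ae_restrict_iff' (MeasurableSet.univ_pi fun _ => measurableSet_Ioc)]
  refine Eventually.of_forall fun v hv i => ?_
  have := hv i (mem_univ i)
  rw [abs_le]
  constructor <;> linarith [this.1, this.2]

lemma lintegral_cube_le {h : Torus d → ℝ≥0∞} (hh : Measurable h) (x : Torus d) {σ : ℝ}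
    (hσ : 0 < σ) (hσ1 : σ ≤ 1) :
    ∫⁻ v, h (x + proj (σ • v)) ∂cubeMeasure d ≤
      ENNReal.ofReal ((σ ^ d)⁻¹) * ∫⁻ z in Metric.closedBall x (σ / 2), h z := by
  set S : Set (Fin d → ℝ) := univ.pi fun _ => Ioc (-(σ / 2)) (σ / 2) with hS
  have hSm : MeasurableSet S := MeasurableSet.univ_pi fun _ => measurableSet_Ioc
  set Q : Set (Fin d → ℝ) := univ.pi fun _ => Ioc (-(1 / 2)) (-(1 / 2) + 1) with hQ
  have hQm : MeasurableSet Q := MeasurableSet.univ_pi fun _ => measurableSet_Ioc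
  set g : (Fin d → ℝ) → ℝ≥0∞ := S.indicator fun u => h (x + proj u) with hg
  have hmeas : Measurable fun u => h (x + proj u) := by
    have := measurable_proj (d := d)
    fun_prop
  have hgm : Measurable g := hmeas.indicator hSm
  have h1 : ∫⁻ v, h (x + proj (σ • v)) ∂cubeMeasure d ≤ ∫⁻ v, g (σ • v) := by
    rw [cubeMeasure_eq, ← lintegral_indicator hQm]
    refine lintegral_mono fun v => ?_
    by_cases hv : v ∈ Q
    · rw [indicator_of_mem hv, hg, indicator_of_mem]
      intro i _
      have := hv i (mem_univ i)
      simp only [Pi.smul_apply, smul_eq_mul]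
      constructor <;> nlinarith [this.1, this.2]
    · rw [indicator_of_notMem hv]; exact zero_le
  have h2 : ∫⁻ v, g (σ • v) = ENNReal.ofReal ((σ ^ d)⁻¹) * ∫⁻ u, g u := by
    have h3 : Measurable fun v : Fin d → ℝ => σ • v := measurable_const_smul σ
    rw [← lintegral_map hgm h3, Measure.map_addHaar_smul _ hσ.ne', lintegral_smul_measure]
    simp [abs_of_pos (show 0 < (σ ^ d)⁻¹ by positivity)]
  have h3 : ∫⁻ u, g u ≤ ∫⁻ z in Metric.closedBall x (σ / 2), h z := by
    have h4 : ∫⁻ u, g u ≤ ∫⁻ u, (Metric.closedBall (0 : Torus d) (σ / 2)).indicator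
        (fun z => h (x + z)) (proj u) ∂cubeMeasure d := by
      rw [cubeMeasure_eq, ← lintegral_indicator hQm]
      refine lintegral_mono fun u => ?_
      by_cases hu : u ∈ S
      · have huQ : u ∈ Q := fun i _ => by
          have := hu i (mem_univ i)
          constructor <;> linarith [this.1, this.2]
        rw [hg, indicator_of_mem hu, indicator_of_mem huQ, indicator_of_mem]
        rw [mem_closedBall_zero_iff]
        refine (norm_proj_le u).trans ((pi_norm_le_iff_of_nonneg (by positivity)).2 fun i => ?_)
        have := hu i (mem_univ i)
        rw [Real.norm_eq_abs, abs_le]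
        constructor <;> linarith [this.1, this.2]
      · rw [hg, indicator_of_notMem hu]; exact zero_le
    refine h4.trans ?_
    have h5 : Measurable ((Metric.closedBall (0 : Torus d) (σ / 2)).indicator
        (fun z => h (x + z))) :=
      (hh.comp (measurable_const_add x)).indicator Metric.isClosed_closedBall.measurableSet
    rw [measurePreserving_proj.lintegral_comp h5,
      ← lintegral_indicator Metric.isClosed_closedBall.measurableSet,
      ← lintegral_add_left_eq_self ((Metric.closedBall x (σ / 2)).indicator h) x]
    refine lintegral_mono fun z => ?_
    by_cases hz : z ∈ Metric.closedBall (0 : Torus d) (σ / 2)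
    · rw [indicator_of_mem hz, indicator_of_mem]
      simpa using hz
    · rw [indicator_of_notMem hz]; exact zero_le
  exact h1.trans (h2.le.trans (mul_le_mul_right h3 _))

lemma IsMollifier.mono {C C' r : ℝ} (hr : 0 < r) {ρ : Torus d → ℝ} (h : IsMollifier C r ρ)
    (hC : C ≤ C') : IsMollifier C' r ρ where
  smooth := h.smooth
  nonneg := h.nonneg
  even := h.even
  integral_eq_one := h.integral_eq_one
  support := h.support
  le x := (h.le x).trans (by gcongr)
  partialDeriv_support := h.partialDeriv_support
  partialDeriv_le j x := (h.partialDeriv_le j x).trans (by gcongr)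

lemma IsMollifier.integrable {C r : ℝ} {ρ : Torus d → ℝ} (h : IsMollifier C r ρ) :
    Integrable ρ := integrable_of_continuous h.smooth.continuous

lemma IsMollifier.lintegral_eq_one {C r : ℝ} {ρ : Torus d → ℝ} (h : IsMollifier C r ρ) :
    ∫⁻ x, ENNReal.ofReal (ρ x) = 1 := by
  rw [← ofReal_integral_eq_lintegral_ofReal h.integrable (Eventually.of_forall h.nonneg),
    h.integral_eq_one, ENNReal.ofReal_one]

lemma IsMollifier.lintegral_mul_le {C r : ℝ} {ρ : Torus d → ℝ} (h : IsMollifier C r ρ)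
    (g : Torus d → ℝ≥0∞) (x : Torus d) : ∫⁻ y, ENNReal.ofReal (ρ y) * g (x - y) ≤
      ENNReal.ofReal (C / r ^ d) * ∫⁻ z in Metric.closedBall x r, g z := by
  rw [← lintegral_indicator Metric.isClosed_closedBall.measurableSet,
    ← lintegral_sub_left_eq_self ((Metric.closedBall x r).indicator g) x,
    ← lintegral_const_mul' _ _ ENNReal.ofReal_ne_top]
  refine lintegral_mono fun y => ?_
  by_cases hy : ρ y = 0
  · rw [hy]; simp
  · rw [indicator_of_mem]
    · exact mul_le_mul_left (ENNReal.ofReal_le_ofReal (h.le y)) _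
    · simpa using h.support y hy

/-- The average of `g` over the cube of side `σ` centred at `x + a`, smeared by `ρ`. -/
def smearedAverage (ρ : Torus d → ℝ) (g : Torus d → ℝ≥0∞) (σ : ℝ) (a : Fin d → ℝ) (x : Torus d) :
    ℝ≥0∞ :=
  ∫⁻ v, (∫⁻ y, ENNReal.ofReal (ρ y) * g (x + proj (a + σ • v) - y)) ∂cubeMeasure d

lemma measurable_smearedAverage_integrand {ρ : Torus d → ℝ} (hρ : Continuous ρ)
    {g : Torus d → ℝ≥0∞} (hg : Measurable g) (σ : ℝ) (a : Fin d → ℝ) (x : Torus d) :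
    Measurable fun z : (Fin d → ℝ) × Torus d =>
      ENNReal.ofReal (ρ z.2) * g (x + proj (a + σ • z.1) - z.2) := by
  have h1 := measurable_proj (d := d)
  have h2 := hρ.measurable
  have h3 : Measurable fun z : (Fin d → ℝ) × Torus d => x + proj (a + σ • z.1) - z.2 :=
    (measurable_const.add (h1.comp (measurable_const.add
      (measurable_fst.const_smul σ)))).sub measurable_snd
  exact (h2.comp measurable_snd).ennreal_ofReal.mul (hg.comp h3)

lemma smearedAverage_const_add_mul {C r : ℝ} {ρ : Torus d → ℝ} (hρ : IsMollifier C r ρ)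
    (κ : ℝ≥0∞) {κ' : ℝ≥0∞} (hκ' : κ' ≠ ∞) (g : Torus d → ℝ≥0∞) (σ : ℝ) (a : Fin d → ℝ)
    (x : Torus d) :
    smearedAverage ρ (fun z => κ + κ' * g z) σ a x = κ + κ' * smearedAverage ρ g σ a x := by
  have hm : Measurable fun y => ENNReal.ofReal (ρ y) :=
    hρ.smooth.continuous.measurable.ennreal_ofReal
  have h1 : ∀ u : Torus d, ∫⁻ y, ENNReal.ofReal (ρ y) * (κ + κ' * g (u - y)) =
      κ + κ' * ∫⁻ y, ENNReal.ofReal (ρ y) * g (u - y) := by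
    intro u
    simp_rw [mul_add]
    rw [lintegral_add_left (hm.mul_const κ), lintegral_mul_const _ hm,
      hρ.lintegral_eq_one, one_mul, ← lintegral_const_mul' _ _ hκ']
    simp_rw [mul_left_comm]
  simp_rw [smearedAverage, h1]
  rw [lintegral_add_left measurable_const, lintegral_const_mul' _ _ hκ']
  simp

lemma smearedAverage_le {C r : ℝ} (hC : 1 ≤ C) {ρ : Torus d → ℝ}
    (hρ : IsMollifier C r ρ) {g : Torus d → ℝ≥0∞} (hg : Measurable g) {σ : ℝ} (hσ : 0 < σ)
    (hσ1 : σ ≤ 1) {a : Fin d → ℝ} (ha : ‖a‖ ≤ σ / 2) (x : Torus d) :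
    ∃ σ' ≥ σ, smearedAverage ρ g σ a x ≤
      ENNReal.ofReal (C / σ' ^ d) * ∫⁻ z in Metric.closedBall x (2 * σ'), g z := by
  rcases le_or_gt σ r with hle | hlt
  · refine ⟨r, hle, ?_⟩
    calc smearedAverage ρ g σ a x
        ≤ ∫⁻ _v, (ENNReal.ofReal (C / r ^ d) * ∫⁻ z in Metric.closedBall x (2 * r), g z)
            ∂cubeMeasure d := by
          refine lintegral_mono_ae ?_
          filter_upwards [ae_cubeMeasure] with v hv
          refine (hρ.lintegral_mul_le g _).trans (mul_le_mul_right (lintegral_mono_set ?_) _)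
          refine Metric.closedBall_subset_closedBall' ?_
          rw [dist_eq_norm, add_sub_cancel_left]
          have h1 : ‖a + σ • v‖ ≤ σ / 2 + σ * (1 / 2) := by
            refine (norm_add_le _ _).trans (add_le_add ha ?_)
            rw [norm_smul, Real.norm_of_nonneg hσ.le]
            gcongr
            exact (pi_norm_le_iff_of_nonneg (by norm_num)).2 hv
          linarith [norm_proj_le (a + σ • v)]
      _ = _ := by simp
  · refine ⟨σ, le_rfl, ?_⟩
    have hm := measurable_smearedAverage_integrand hρ.smooth.continuous hg σ a x
    have hm1 : Measurable fun y => ENNReal.ofReal (ρ y) :=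
      hρ.smooth.continuous.measurable.ennreal_ofReal
    calc smearedAverage ρ g σ a x
        = ∫⁻ y, ∫⁻ v, ENNReal.ofReal (ρ y) * g (x + proj (a + σ • v) - y) ∂cubeMeasure d :=
          lintegral_lintegral_swap hm.aemeasurable
      _ ≤ ∫⁻ y, ENNReal.ofReal (ρ y) * (ENNReal.ofReal (C / σ ^ d) *
            ∫⁻ z in Metric.closedBall x (2 * σ), g z) := by
          refine lintegral_mono fun y => ?_
          rw [lintegral_const_mul' _ _ ENNReal.ofReal_ne_top]
          rcases eq_or_ne (ρ y) 0 with hy | hy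
          · rw [hy]; simp
          refine mul_le_mul_right ?_ _
          have h2 : ∀ v : Fin d → ℝ, x + proj (a + σ • v) - y = (x - y + proj a) + proj (σ • v) :=
            fun v => by rw [proj_add]; abel
          simp_rw [h2]
          refine (lintegral_cube_le hg _ hσ hσ1).trans (mul_le_mul' ?_ (lintegral_mono_set ?_))
          · rw [← one_div]
            exact ENNReal.ofReal_le_ofReal (by gcongr)
          · refine Metric.closedBall_subset_closedBall' ?_
            have h3 : x - y + proj a - x = proj a - y := by abel
            rw [dist_eq_norm, h3]
            have h4 := norm_sub_le (proj a) y
            linarith [hρ.support y hy, norm_proj_le a]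
      _ = _ := by
          rw [lintegral_mul_const _ hm1, hρ.lintegral_eq_one, one_mul]

lemma smearedAverage_le_maxFun {C r : ℝ} (hC : 1 ≤ C) {ρ : Torus d → ℝ}
    (hρ : IsMollifier C r ρ) {g : Torus d → ℝ≥0∞} (hg : Measurable g) {σ : ℝ} (hσ : 0 < σ)
    (hσ1 : σ ≤ 1) {a : Fin d → ℝ} (ha : ‖a‖ ≤ σ / 2) (x : Torus d) :
    smearedAverage ρ g σ a x ≤ ENNReal.ofReal (C * 4 ^ d) * maxFun g x := by
  obtain ⟨σ', hσ', h⟩ := smearedAverage_le hC hρ hg hσ hσ1 ha x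
  have hσ0 : 0 < σ' := hσ.trans_le hσ'
  refine h.trans ((mul_le_mul_right (lintegral_closedBall_le_maxFun g x
    (show 0 < 2 * σ' by positivity)) _).trans (le_of_eq ?_))
  rw [← mul_assoc, ← ENNReal.ofReal_mul (by positivity), ← mul_assoc, mul_pow]
  congr 2
  field_simp
  norm_num

lemma smearedAverage_le_lintegral {C r : ℝ} (hC : 1 ≤ C) {ρ : Torus d → ℝ}
    (hρ : IsMollifier C r ρ) {g : Torus d → ℝ≥0∞} (hg : Measurable g) {σ : ℝ} (hσ : 0 < σ)
    (hσ1 : σ ≤ 1) {a : Fin d → ℝ} (ha : ‖a‖ ≤ σ / 2) (x : Torus d) :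
    smearedAverage ρ g σ a x ≤ ENNReal.ofReal (C / σ ^ d) * ∫⁻ z, g z := by
  obtain ⟨σ', hσ', h⟩ := smearedAverage_le hC hρ hg hσ hσ1 ha x
  refine h.trans (mul_le_mul' (ENNReal.ofReal_le_ofReal ?_) (setLIntegral_le_lintegral _ _))
  gcongr

lemma smearedAverage_mono {ρ : Torus d → ℝ} {g g' : Torus d → ℝ≥0∞} (h : ∀ x, g x ≤ g' x) (σ : ℝ)
    (a : Fin d → ℝ) (x : Torus d) : smearedAverage ρ g σ a x ≤ smearedAverage ρ g' σ a x :=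
  lintegral_mono fun _ => lintegral_mono fun _ => mul_le_mul_right (h _) _

/-- A Jensen type inequality: an average of `N` is at most `ℓ` if the average of `e^N` is at most
`e^ℓ`. -/
lemma smearedAverage_le_of_exp {C r : ℝ} {ρ : Torus d → ℝ} (hρ : IsMollifier C r ρ)
    {N : Torus d → ℝ} {ℓ : ℝ} (hℓ : 1 ≤ ℓ)
    {σ : ℝ} {a : Fin d → ℝ} {x : Torus d}
    (h : smearedAverage ρ (fun z => ENNReal.ofReal (Real.exp (N z))) σ a x ≤
      ENNReal.ofReal (Real.exp ℓ)) :
    smearedAverage ρ (fun z => ENNReal.ofReal (N z)) σ a x ≤ ENNReal.ofReal ℓ := by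
  have h1 : ∀ z, ENNReal.ofReal (N z) ≤ ENNReal.ofReal (ℓ - 1) +
      ENNReal.ofReal (Real.exp (-ℓ)) * ENNReal.ofReal (Real.exp (N z)) := by
    intro z
    rw [← ENNReal.ofReal_mul (by positivity), ← ENNReal.ofReal_add (by linarith) (by positivity),
      ← Real.exp_add]
    refine ENNReal.ofReal_le_ofReal ?_
    linarith [Real.add_one_le_exp (-ℓ + N z)]
  refine (smearedAverage_mono h1 σ a x).trans ?_
  rw [smearedAverage_const_add_mul hρ _ ENNReal.ofReal_ne_top]
  refine (add_le_add le_rfl (mul_le_mul_right h _)).trans ?_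
  rw [← ENNReal.ofReal_mul (by positivity), ← Real.exp_add, neg_add_cancel, Real.exp_zero,
    ← ENNReal.ofReal_add (by linarith) zero_le_one, sub_add_cancel]

end

end TorusTransport


namespace TorusTransport

noncomputable section

variable {d : ℕ}

/-! ### Pointwise estimates for mollified Sobolev vector fields -/

/-- Matrix-vector product in Euclidean space. -/
def matApply (A : Matrix (Fin d) (Fin d) ℝ) (w : EuclideanSpace ℝ (Fin d)) :
    EuclideanSpace ℝ (Fin d) := WithLp.toLp 2 (A.mulVec w.ofLp)

lemma matApply_apply (A : Matrix (Fin d) (Fin d) ℝ) (w : EuclideanSpace ℝ (Fin d)) (i : Fin d) :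
    matApply A w i = ∑ j, A i j * w j := rfl

lemma matNorm_nonneg (A : Matrix (Fin d) (Fin d) ℝ) : 0 ≤ matNorm A := Real.sqrt_nonneg _

lemma norm_matApply_le (A : Matrix (Fin d) (Fin d) ℝ) (w : EuclideanSpace ℝ (Fin d)) :
    ‖matApply A w‖ ≤ matNorm A * ‖w‖ := by
  rw [matNorm, EuclideanSpace.norm_eq, EuclideanSpace.norm_eq, ← Real.sqrt_mul (by positivity),
    Finset.sum_mul]
  refine Real.sqrt_le_sqrt (Finset.sum_le_sum fun i _ => ?_)
  simp only [Real.norm_eq_abs, sq_abs, matApply_apply]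
  exact Finset.sum_mul_sq_le_sq_mul_sq _ _ _

lemma measurable_matNorm {ι : Type*} [MeasurableSpace ι] {G : ι → Matrix (Fin d) (Fin d) ℝ}
    (hG : ∀ i j, Measurable fun x => G x i j) : Measurable fun x => matNorm (G x) := by
  unfold matNorm
  exact (Finset.measurable_sum _ fun i _ => Finset.measurable_sum _ fun j _ =>
    (hG i j).pow_const 2).sqrt

lemma continuous_mollify {ρ : Torus d → ℝ} (hρ : IsSmooth ρ)
    {f : Torus d → EuclideanSpace ℝ (Fin d)} (hf : Integrable f) : Continuous (mollify ρ f) := by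
  have h : Continuous fun x => (mollify ρ f x).ofLp := by
    refine continuous_pi fun i => ?_
    simp_rw [mollify_apply hρ.continuous hf]
    exact (hρ.mollify (integrable_apply hf i)).continuous
  exact (PiLp.continuous_toLp 2 _).comp h

lemma contDiff_mollify_line {f : Torus d → EuclideanSpace ℝ (Fin d)} (hf : Integrable f)
    {ρ : Torus d → ℝ} (hρ : IsSmooth ρ) (x : Torus d) (u : EuclideanSpace ℝ (Fin d)) :
    ContDiff ℝ 1 fun θ : ℝ => mollify ρ f (x + eproj (θ • u)) := by
  rw [contDiff_euclidean]
  intro i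
  simp_rw [mollify_apply hρ.continuous hf]
  have h1 := ((hρ.mollify (integrable_apply hf i)).comp_add x).contDiff.of_le
    (show ((1 : ℕ∞) : WithTop ℕ∞) ≤ ((⊤ : ℕ∞) : WithTop ℕ∞) by exact_mod_cast le_top)
  have h2 := h1.comp ((contDiff_id (𝕜 := ℝ) (E := ℝ)).smul (contDiff_const (c := u.ofLp)))
  simpa [Function.comp_def, eproj, add_comm] using h2

lemma deriv_mollify_line {f : Torus d → EuclideanSpace ℝ (Fin d)}
    {G : Torus d → Matrix (Fin d) (Fin d) ℝ} (hG : IsWeakGradient f G)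
    {ρ : Torus d → ℝ} (hρ : IsSmooth ρ) (x : Torus d) (u : EuclideanSpace ℝ (Fin d)) (θ : ℝ) :
    deriv (fun θ : ℝ => mollify ρ f (x + eproj (θ • u))) θ =
      mollify ρ (fun y => matApply (G y) u) (x + eproj (θ • u)) := by
  have hf := hG.integrable
  have h0 := ((contDiff_mollify_line hf hρ x u).differentiable one_ne_zero θ).hasDerivAt
  have hint : Integrable fun y => matApply (G y) u := by
    have h1 : Integrable fun y => (G y).mulVec u.ofLp := by
      refine Integrable.of_eval fun i => ?_
      have h3 : Integrable fun x => ∑ j, G x i j * u j :=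
        integrable_finsetSum _ fun j _ => (hG.integrable_grad i j).mul_const _
      exact h3
    exact (PiLp.continuousLinearEquiv 2 ℝ (fun _ : Fin d => ℝ)).symm.toContinuousLinearMap.integrable_comp h1
  ext i
  have h1 := (EuclideanSpace.proj (𝕜 := ℝ) i).hasFDerivAt.comp_hasDerivAt θ h0
  have h2 : HasDerivAt (fun θ : ℝ => mollify ρ f (x + eproj (θ • u)) i)
      (gradForm (mollify ρ fun y => f y i) (x + proj (θ • u.ofLp)) u.ofLp) θ := by
    simp_rw [mollify_apply hρ.continuous hf]
    exact (hρ.mollify (integrable_apply hf i)).hasDerivAt_line x u.ofLp θ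
  refine (h1.unique h2).trans ?_
  rw [gradForm_apply, mollify_apply hρ.continuous hint]
  simp_rw [partialDeriv_mollify hρ (integrable_apply hf i), hG.mollify_partialDeriv hρ,
    matApply_apply]
  simp only [mollify, smul_eq_mul, Finset.mul_sum]
  rw [integral_finsetSum]
  · refine Finset.sum_congr rfl fun j _ => ?_
    rw [← integral_mul_const]
    simp only [mul_assoc]
    rfl
  · intro j _
    have := (integrable_mollify_integrand hρ.continuous (hG.integrable_grad i j)
      (x + eproj (θ • u))).mul_const (u j)
    simpa [mul_assoc] using this

lemma enorm_mollify_line_le {f : Torus d → EuclideanSpace ℝ (Fin d)}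
    {G : Torus d → Matrix (Fin d) (Fin d) ℝ} (hG : IsWeakGradient f G)
    {ρ : Torus d → ℝ} (hρ : IsSmooth ρ) (hρ0 : ∀ x, 0 ≤ ρ x) (x : Torus d)
    (u : EuclideanSpace ℝ (Fin d)) :
    ‖mollify ρ f (x + eproj u) - mollify ρ f x‖ₑ ≤ ‖u‖ₑ * ∫⁻ θ in Icc (0 : ℝ) 1,
      ∫⁻ y, ENNReal.ofReal (ρ y) * ENNReal.ofReal (matNorm (G (x + eproj (θ • u) - y))) := by
  have h1 := enorm_sub_le_lintegral_deriv_of_contDiffOn_Icc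
    ((contDiff_mollify_line hG.integrable hρ x u).contDiffOn (s := Icc 0 1)) zero_le_one
  simp only [one_smul, zero_smul, eproj_zero, add_zero] at h1
  refine h1.trans ?_
  rw [← lintegral_const_mul' _ _ enorm_ne_top]
  refine lintegral_mono fun θ => ?_
  rw [deriv_mollify_line hG hρ, mollify_eq]
  refine (enorm_integral_le_lintegral_enorm _).trans ?_
  rw [← lintegral_const_mul' _ _ enorm_ne_top]
  refine lintegral_mono fun y => ?_
  rw [enorm_smul, mul_left_comm]
  have h2 : ‖ρ y‖ₑ = ENNReal.ofReal (ρ y) := by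
    rw [← ofReal_norm, Real.norm_of_nonneg (hρ0 y)]
  rw [h2]
  refine mul_le_mul_right ?_ _
  rw [← ofReal_norm, ← ofReal_norm u, ← ENNReal.ofReal_mul (norm_nonneg _),
    mul_comm ‖u‖]
  exact ENNReal.ofReal_le_ofReal (norm_matApply_le _ _)

lemma norm_le_sqrt_mul {w : EuclideanSpace ℝ (Fin d)} {s : ℝ} (hs : 0 ≤ s)
    (h : ∀ i, |w i| ≤ s) : ‖w‖ ≤ Real.sqrt d * s := by
  rw [EuclideanSpace.norm_eq, ← Real.sqrt_sq hs, ← Real.sqrt_mul (by positivity)]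
  refine Real.sqrt_le_sqrt ?_
  calc ∑ i, ‖w i‖ ^ 2 ≤ ∑ _i : Fin d, s ^ 2 := by
        refine Finset.sum_le_sum fun i _ => ?_
        rw [Real.norm_eq_abs]
        gcongr
        exact h i
    _ = _ := by simp

/-- The average distance between the value of the mollified field at `x` and its values on a cube
of side `s` close to `x`. -/
lemma lintegral_cube_enorm_sub_le {f : Torus d → EuclideanSpace ℝ (Fin d)}
    {G : Torus d → Matrix (Fin d) (Fin d) ℝ} (hG : IsWeakGradient f G)
    (hGm : ∀ i j, Measurable fun x => G x i j)
    {ρ : Torus d → ℝ} (hρ : IsSmooth ρ) (hρ0 : ∀ x, 0 ≤ ρ x) (x : Torus d)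
    {s : ℝ} (hs : 0 ≤ s) {a : Fin d → ℝ} (ha : ‖a‖ ≤ s / 2) :
    ∫⁻ v, ‖mollify ρ f (x + proj (a + s • v)) - mollify ρ f x‖ₑ ∂cubeMeasure d ≤
      ENNReal.ofReal (Real.sqrt d * s) * ∫⁻ θ in Icc (0 : ℝ) 1,
        smearedAverage ρ (fun z => ENNReal.ofReal (matNorm (G z))) (θ * s) (θ • a) x := by
  have hNm := measurable_matNorm hGm
  have h1 : ∀ᵐ v ∂cubeMeasure d, ‖mollify ρ f (x + proj (a + s • v)) - mollify ρ f x‖ₑ ≤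
      ENNReal.ofReal (Real.sqrt d * s) * ∫⁻ θ in Icc (0 : ℝ) 1, ∫⁻ y, ENNReal.ofReal (ρ y) *
        ENNReal.ofReal (matNorm (G (x + proj (θ • a + (θ * s) • v) - y))) := by
    filter_upwards [ae_cubeMeasure] with v hv
    have h2 := enorm_mollify_line_le hG hρ hρ0 x (WithLp.toLp 2 (a + s • v))
    refine h2.trans ?_
    have h3 : ‖(WithLp.toLp 2 (a + s • v) : EuclideanSpace ℝ (Fin d))‖ ≤ Real.sqrt d * s := by
      refine norm_le_sqrt_mul hs fun i => ?_
      have h4 : |a i| ≤ s / 2 := (norm_le_pi_norm a i).trans ha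
      have h5 : |s * v i| ≤ s * (1 / 2) := by
        rw [abs_mul, abs_of_nonneg hs]
        exact mul_le_mul_of_nonneg_left (hv i) hs
      have h6 := abs_add_le (a i) (s * v i)
      simp only [Pi.add_apply, Pi.smul_apply, smul_eq_mul]
      linarith
    refine mul_le_mul' ?_ (le_of_eq ?_)
    · rw [← ofReal_norm]
      exact ENNReal.ofReal_le_ofReal h3
    · have h7 : ∀ θ : ℝ, eproj (θ • (WithLp.toLp 2 (a + s • v) : EuclideanSpace ℝ (Fin d))) =
          proj (θ • a + (θ * s) • v) := by
        intro θ
        simp [eproj, smul_add, smul_smul]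
      simp_rw [h7]
  refine (lintegral_mono_ae h1).trans ?_
  rw [lintegral_const_mul' _ _ ENNReal.ofReal_ne_top]
  refine mul_le_mul_right (le_of_eq ?_) _
  unfold smearedAverage
  refine lintegral_lintegral_swap ?_
  refine Measurable.aemeasurable ?_
  have hp := measurable_proj (d := d)
  have h3 : Measurable fun z : ((Fin d → ℝ) × ℝ) × Torus d =>
      x + proj (z.1.2 • a + (z.1.2 * s) • z.1.1) - z.2 := by
    refine (measurable_const.add (hp.comp ?_)).sub measurable_snd
    fun_prop
  have h4 : Measurable fun z : ((Fin d → ℝ) × ℝ) × Torus d => ENNReal.ofReal (ρ z.2) *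
      ENNReal.ofReal (matNorm (G (x + proj (z.1.2 • a + (z.1.2 * s) • z.1.1) - z.2))) :=
    (hρ.continuous.measurable.comp measurable_snd).ennreal_ofReal.mul
      (hNm.comp h3).ennreal_ofReal
  exact h4.lintegral_prod_right'

/-- The two point estimate in terms of averages of the gradient around each of the two points. -/
lemma enorm_mollify_sub_le {f : Torus d → EuclideanSpace ℝ (Fin d)}
    {G : Torus d → Matrix (Fin d) (Fin d) ℝ} (hG : IsWeakGradient f G)
    (hGm : ∀ i j, Measurable fun x => G x i j)
    {ρ : Torus d → ℝ} (hρ : IsSmooth ρ) (hρ0 : ∀ x, 0 ≤ ρ x) (x : Torus d) (w : Fin d → ℝ) :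
    ‖mollify ρ f (x + proj w) - mollify ρ f x‖ₑ ≤ ENNReal.ofReal (Real.sqrt d * ‖w‖) *
      ((∫⁻ θ in Icc (0 : ℝ) 1, smearedAverage ρ (fun z => ENNReal.ofReal (matNorm (G z)))
        (θ * ‖w‖) (θ • ((2 : ℝ)⁻¹ • w)) x) +
      ∫⁻ θ in Icc (0 : ℝ) 1, smearedAverage ρ (fun z => ENNReal.ofReal (matNorm (G z)))
        (θ * ‖w‖) (θ • (-((2 : ℝ)⁻¹ • w))) (x + proj w)) := by
  have ha : ‖(2 : ℝ)⁻¹ • w‖ ≤ ‖w‖ / 2 := by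
    rw [norm_smul]; norm_num; linarith
  have h1 := lintegral_cube_enorm_sub_le hG hGm hρ hρ0 x (norm_nonneg w) ha
  have h2 := lintegral_cube_enorm_sub_le hG hGm hρ hρ0 (x + proj w) (norm_nonneg w)
    (by rwa [norm_neg] : ‖-((2 : ℝ)⁻¹ • w)‖ ≤ ‖w‖ / 2)
  rw [mul_add]
  refine le_trans ?_ (add_le_add h1 h2)
  have hcont := continuous_mollify hρ hG.integrable
  have hm : Measurable fun v : Fin d → ℝ =>
      ‖mollify ρ f (x + proj ((2 : ℝ)⁻¹ • w + ‖w‖ • v)) - mollify ρ f x‖ₑ := by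
    have hp := continuous_proj (d := d)
    have : Continuous fun v : Fin d → ℝ =>
        mollify ρ f (x + proj ((2 : ℝ)⁻¹ • w + ‖w‖ • v)) - mollify ρ f x :=
      (hcont.comp (continuous_const.add (hp.comp (by fun_prop)))).sub continuous_const
    exact this.enorm.measurable
  rw [← lintegral_add_left hm]
  have h3 : ‖mollify ρ f (x + proj w) - mollify ρ f x‖ₑ =
      ∫⁻ _v, ‖mollify ρ f (x + proj w) - mollify ρ f x‖ₑ ∂cubeMeasure d := by simp
  rw [h3]
  refine lintegral_mono fun v => ?_
  have h4 : x + proj w + proj (-((2 : ℝ)⁻¹ • w) + ‖w‖ • v) =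
      x + proj ((2 : ℝ)⁻¹ • w + ‖w‖ • v) := by
    rw [add_assoc, ← proj_add]
    congr 2
    have : w = (2 : ℝ)⁻¹ • w + (2 : ℝ)⁻¹ • w := by rw [← add_smul]; norm_num
    nth_rewrite 1 [this]
    abel
  rw [h4]
  rw [← sub_add_sub_cancel (mollify ρ f (x + proj w))
    (mollify ρ f (x + proj ((2 : ℝ)⁻¹ • w + ‖w‖ • v))) (mollify ρ f x)]
  refine (enorm_add_le _ _).trans (le_of_eq ?_)
  rw [enorm_sub_rev (mollify ρ f (x + proj w)), add_comm]

end

end TorusTransport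


namespace TorusTransport

noncomputable section

variable {d : ℕ}

/-! ### Modulus of continuity and Lusin-Lipschitz estimates -/

lemma smearedAverage_le_div {C r β ℓ : ℝ} {ρ : Torus d → ℝ} (hρ : IsMollifier C r ρ) (hβ : 0 < β)
    {N : Torus d → ℝ} (hℓ : 1 ≤ ℓ) {σ : ℝ} {a : Fin d → ℝ} {x : Torus d}
    (h : smearedAverage ρ (fun z => ENNReal.ofReal (Real.exp (β * N z))) σ a x ≤
      ENNReal.ofReal (Real.exp ℓ)) :
    smearedAverage ρ (fun z => ENNReal.ofReal (N z)) σ a x ≤ ENNReal.ofReal (ℓ / β) := by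
  have h1 := smearedAverage_le_of_exp hρ hℓ h
  have h2 : (fun z => ENNReal.ofReal (N z)) =
      fun z => 0 + ENNReal.ofReal β⁻¹ * ENNReal.ofReal (β * N z) := by
    funext z
    rw [zero_add, ← ENNReal.ofReal_mul (by positivity), inv_mul_cancel_left₀ hβ.ne']
  rw [h2, smearedAverage_const_add_mul hρ _ ENNReal.ofReal_ne_top, zero_add, div_eq_inv_mul,
    ENNReal.ofReal_mul (by positivity)]
  exact mul_le_mul_right h1 _

section Estimates

variable {c r β : ℝ} {f : Torus d → EuclideanSpace ℝ (Fin d)}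
  {G : Torus d → Matrix (Fin d) (Fin d) ℝ} {ρ : Torus d → ℝ}

/-- The exponential of the gradient. -/
def expGrad (β : ℝ) (G : Torus d → Matrix (Fin d) (Fin d) ℝ) (x : Torus d) : ℝ≥0∞ :=
  ENNReal.ofReal (Real.exp (β * matNorm (G x)))

lemma measurable_expGrad (hGm : ∀ i j, Measurable fun x => G x i j) : Measurable (expGrad β G) :=
  ((measurable_matNorm hGm).const_mul β).exp.ennreal_ofReal

lemma one_le_expGrad (hβ : 0 < β) (x : Torus d) : 1 ≤ expGrad β G x := by
  rw [expGrad, ENNReal.one_le_ofReal]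
  exact Real.one_le_exp (mul_nonneg hβ.le (matNorm_nonneg _))

/-- The Lusin-Lipschitz constant of a Sobolev field. -/
def lusinLip (c β : ℝ) (G : Torus d → Matrix (Fin d) (Fin d) ℝ) (x : Torus d) : ℝ :=
  Real.sqrt d / β * Real.log (c * 4 ^ d * (maxFun (expGrad β G) x).toReal)

lemma one_le_toReal_maxFun (hβ : 0 < β) {x : Torus d} (hx : maxFun (expGrad β G) x ≠ ∞) :
    1 ≤ (maxFun (expGrad β G) x).toReal := by
  have h := one_le_maxFun (one_le_expGrad (G := G) hβ) x
  rwa [← ENNReal.toReal_one, ENNReal.toReal_le_toReal ENNReal.one_ne_top hx]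

lemma one_le_log_of_three_le {z : ℝ} (hz : 3 ≤ z) : 1 ≤ Real.log z := by
  rw [Real.le_log_iff_exp_le (by linarith)]
  linarith [Real.exp_one_lt_d9]

lemma three_le_mul {a b : ℝ} (ha : 3 ≤ a) (hb : 1 ≤ b) : 3 ≤ a * b := by nlinarith

lemma one_le_log_maxFun (hc : 3 ≤ c) (hβ : 0 < β) {x : Torus d}
    (hx : maxFun (expGrad β G) x ≠ ∞) :
    1 ≤ Real.log (c * 4 ^ d * (maxFun (expGrad β G) x).toReal) :=
  one_le_log_of_three_le (three_le_mul (three_le_mul hc (one_le_pow₀ (by norm_num)))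
    (one_le_toReal_maxFun hβ hx))

lemma smearedAverage_le_log_maxFun (hc : 3 ≤ c) (hβ : 0 < β) (hρ : IsMollifier c r ρ)
    (hGm : ∀ i j, Measurable fun x => G x i j) {x : Torus d} (hx : maxFun (expGrad β G) x ≠ ∞)
    {σ : ℝ} (hσ : 0 < σ) (hσ1 : σ ≤ 1) {a : Fin d → ℝ} (ha : ‖a‖ ≤ σ / 2) :
    smearedAverage ρ (fun z => ENNReal.ofReal (matNorm (G z))) σ a x ≤
      ENNReal.ofReal (Real.log (c * 4 ^ d * (maxFun (expGrad β G) x).toReal) / β) := by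
  have h1 := one_le_toReal_maxFun hβ hx
  refine smearedAverage_le_div hρ hβ (one_le_log_maxFun hc hβ hx) ?_
  rw [Real.exp_log (by positivity), ENNReal.ofReal_mul (by positivity), ENNReal.ofReal_toReal hx]
  exact smearedAverage_le_maxFun (by linarith) hρ (measurable_expGrad hGm) hσ hσ1 ha x

lemma setLIntegral_unit_le {h : ℝ → ℝ≥0∞} {A : ℝ≥0∞} (hA : ∀ θ, 0 < θ → θ ≤ 1 → h θ ≤ A) :
    ∫⁻ θ in Icc (0 : ℝ) 1, h θ ≤ A := by
  calc ∫⁻ θ in Icc (0 : ℝ) 1, h θ = ∫⁻ θ in Ioc (0 : ℝ) 1, h θ :=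
        setLIntegral_congr Ioc_ae_eq_Icc.symm
    _ ≤ ∫⁻ _θ in Ioc (0 : ℝ) 1, A :=
        setLIntegral_mono' measurableSet_Ioc fun θ hθ => hA θ hθ.1 hθ.2
    _ = A := by simp

lemma norm_smul_half_le {θ : ℝ} (hθ : 0 < θ) (w : Fin d → ℝ) :
    ‖θ • ((2 : ℝ)⁻¹ • w)‖ ≤ θ * ‖w‖ / 2 := by
  rw [norm_smul, norm_smul, Real.norm_of_nonneg hθ.le]
  norm_num
  linarith

lemma norm_smul_neg_half_le {θ : ℝ} (hθ : 0 < θ) (w : Fin d → ℝ) :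
    ‖θ • (-((2 : ℝ)⁻¹ • w))‖ ≤ θ * ‖w‖ / 2 := by
  rw [smul_neg, norm_neg]
  exact norm_smul_half_le hθ w

lemma norm_ofLp_le (w : EuclideanSpace ℝ (Fin d)) : ‖w.ofLp‖ ≤ ‖w‖ :=
  (pi_norm_le_iff_of_nonneg (norm_nonneg _)).2 fun i => PiLp.norm_apply_le w i

/-- Mollified fields are Lusin-Lipschitz, with a bound that does not depend on the mollifier. -/
lemma norm_mollify_sub_le_lusinLip (hc : 3 ≤ c) (hβ : 0 < β) (hρ : IsMollifier c r ρ)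
    (hG : IsWeakGradient f G) (hGm : ∀ i j, Measurable fun x => G x i j) {x y : Torus d}
    (hx : maxFun (expGrad β G) x ≠ ∞) (hy : maxFun (expGrad β G) y ≠ ∞) :
    ‖mollify ρ f x - mollify ρ f y‖ ≤ torusDist x y * (lusinLip c β G x + lusinLip c β G y) := by
  obtain ⟨w, rfl, hw, hwi⟩ := exists_elift x y
  rcases eq_or_ne w.ofLp 0 with h0 | h0
  · have hz : eproj w = 0 := by rw [eproj, h0, proj_zero]
    have hl := one_le_log_maxFun (d := d) hc hβ hx
    rw [hz, add_zero, sub_self, norm_zero]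
    have : 0 ≤ lusinLip c β G x := by unfold lusinLip; positivity
    exact mul_nonneg (torusDist_nonneg _ _) (by linarith)
  have hpos : 0 < ‖w.ofLp‖ := norm_pos_iff.2 h0
  have hle : ‖w.ofLp‖ ≤ 1 := (pi_norm_le_iff_of_nonneg zero_le_one).2 fun i => by
    rw [Real.norm_eq_abs, hwi i]
    exact (norm_unitAddCircle_le_half _).trans (by norm_num)
  have h1 := enorm_mollify_sub_le hG hGm hρ.smooth hρ.nonneg x w.ofLp
  have hA := one_le_log_maxFun (d := d) hc hβ hx
  have hB := one_le_log_maxFun (d := d) hc hβ hy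
  have h2 : ‖mollify ρ f (x + eproj w) - mollify ρ f x‖ₑ ≤ ENNReal.ofReal (Real.sqrt d * ‖w.ofLp‖) *
      (ENNReal.ofReal (Real.log (c * 4 ^ d * (maxFun (expGrad β G) x).toReal) / β) +
       ENNReal.ofReal (Real.log (c * 4 ^ d * (maxFun (expGrad β G) (x + eproj w)).toReal) / β)) := by
    refine h1.trans (mul_le_mul_right (add_le_add ?_ ?_) _)
    · refine setLIntegral_unit_le fun θ h0 h1 => ?_
      exact smearedAverage_le_log_maxFun hc hβ hρ hGm hx (by positivity)
        (by nlinarith) (norm_smul_half_le h0 _)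
    · refine setLIntegral_unit_le fun θ h0 h1 => ?_
      exact smearedAverage_le_log_maxFun hc hβ hρ hGm hy (by positivity)
        (by nlinarith) (norm_smul_neg_half_le h0 _)
  rw [← ENNReal.ofReal_add (by positivity) (by positivity), ← ENNReal.ofReal_mul (by positivity),
    ← ofReal_norm, ENNReal.ofReal_le_ofReal_iff (by positivity)] at h2
  rw [norm_sub_rev]
  refine h2.trans ?_
  rw [← hw, lusinLip, lusinLip, ← mul_add, ← add_div]
  have h3 := norm_ofLp_le w
  calc _ ≤ √↑d * ‖w‖ * ((Real.log (c * 4 ^ d * (maxFun (expGrad β G) x).toReal) +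
        Real.log (c * 4 ^ d * (maxFun (expGrad β G) (x + eproj w)).toReal)) / β) := by gcongr
    _ = _ := by ring

/-- The constant in the log-Lipschitz estimate. -/
def logLipConst (d : ℕ) (c β K : ℝ) : ℝ :=
  2 * Real.sqrt d / β * (Real.log (c * K) + 2 * d) + 1

lemma logLipConst_pos (hc : 3 ≤ c) (hβ : 0 < β) {K : ℝ} (hK : 1 ≤ K) :
    0 < logLipConst d c β K := by
  have := one_le_log_of_three_le (three_le_mul hc hK)
  unfold logLipConst
  positivity

lemma lintegral_neg_log : ∫⁻ θ in Icc (0 : ℝ) 1, ENNReal.ofReal (-Real.log θ) = 1 := by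
  have h1 : IntegrableOn (fun θ => -Real.log θ) (Icc 0 1) := by
    rw [integrableOn_Icc_iff_integrableOn_Ioc]
    exact (intervalIntegral.intervalIntegrable_log' (a := 0) (b := 1)).neg.1
  rw [← ofReal_integral_eq_lintegral_ofReal h1 ?_]
  · rw [integral_Icc_eq_integral_Ioc, ← intervalIntegral.integral_of_le zero_le_one,
      intervalIntegral.integral_neg, integral_log]
    simp
  · refine (ae_restrict_iff' measurableSet_Icc).2 (Eventually.of_forall fun θ hθ => ?_)
    have := Real.log_nonpos hθ.1 hθ.2
    simpa using this

/-- Mollified fields are uniformly log-Lipschitz. -/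
lemma norm_mollify_sub_le_osc (hc : 3 ≤ c) (hβ : 0 < β) (hρ : IsMollifier c r ρ)
    (hG : IsWeakGradient f G) (hGm : ∀ i j, Measurable fun x => G x i j) {K : ℝ} (hK1 : 1 ≤ K)
    (hK : ∫⁻ x, expGrad β G x ≤ ENNReal.ofReal K) (x : Torus d) (w : EuclideanSpace ℝ (Fin d))
    {lam : ℝ} (hlam : 1 ≤ lam) :
    ‖mollify ρ f (x + eproj w) - mollify ρ f x‖ ≤
      logLipConst d c β K * (lam * ‖w‖ + Real.exp (-lam)) := by
  have hC := logLipConst_pos (d := d) hc hβ hK1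
  obtain ⟨w', hw, hw', hwi⟩ := exists_elift x (x + eproj w)
  have hww : ‖w'‖ ≤ ‖w‖ := hw' ▸ torusDist_add_eproj_le x w
  rw [hw]
  rcases eq_or_ne w'.ofLp 0 with h0 | h0
  · rw [eproj, h0, proj_zero, add_zero, sub_self, norm_zero]
    positivity
  set s := ‖w'.ofLp‖ with hs
  have hpos : 0 < s := norm_pos_iff.2 h0
  have hle : s ≤ 1 := (pi_norm_le_iff_of_nonneg zero_le_one).2 fun i => by
    rw [Real.norm_eq_abs, hwi i]
    exact (norm_unitAddCircle_le_half _).trans (by norm_num)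
  have h1 := enorm_mollify_sub_le hG hGm hρ.smooth hρ.nonneg x w'.ofLp
  have hl := one_le_log_of_three_le (three_le_mul hc hK1)
  have hls := Real.log_nonpos hpos.le hle
  have hav : ∀ (z : Torus d) (σ : ℝ) (a : Fin d → ℝ), 0 < σ → σ ≤ 1 → ‖a‖ ≤ σ / 2 →
      smearedAverage ρ (fun z => ENNReal.ofReal (matNorm (G z))) σ a z ≤
        ENNReal.ofReal ((Real.log (c * K) - d * Real.log σ) / β) := by
    intro z σ a h0 h1 ha
    refine smearedAverage_le_div hρ hβ ?_ ?_
    · have := mul_nonpos_of_nonneg_of_nonpos (Nat.cast_nonneg (α := ℝ) d) (Real.log_nonpos h0.le h1)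
      linarith
    · refine (smearedAverage_le_lintegral (by linarith) hρ (measurable_expGrad hGm) h0 h1 ha
        z).trans ((mul_le_mul_right hK _).trans (le_of_eq ?_))
      rw [← ENNReal.ofReal_mul (by positivity), Real.exp_sub, Real.exp_log (by positivity),
        mul_comm (d : ℝ), Real.exp_mul, Real.exp_log h0, Real.rpow_natCast]
      congr 1
      ring
  have hint : ∀ (z : Torus d) (a : Fin d → ℝ), (∀ θ : ℝ, 0 < θ → ‖θ • a‖ ≤ θ * s / 2) →
      ∫⁻ θ in Icc (0 : ℝ) 1, smearedAverage ρ (fun z => ENNReal.ofReal (matNorm (G z)))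
        (θ * s) (θ • a) z ≤ ENNReal.ofReal ((Real.log (c * K) - d * Real.log s + d) / β) := by
    intro z a ha
    calc _ = ∫⁻ θ in Ioc (0 : ℝ) 1, smearedAverage ρ (fun z => ENNReal.ofReal (matNorm (G z)))
          (θ * s) (θ • a) z := setLIntegral_congr Ioc_ae_eq_Icc.symm
      _ ≤ ∫⁻ θ in Ioc (0 : ℝ) 1, (ENNReal.ofReal ((Real.log (c * K) - d * Real.log s) / β) +
            ENNReal.ofReal (d / β) * ENNReal.ofReal (-Real.log θ)) := by
          refine setLIntegral_mono' measurableSet_Ioc fun θ hθ => ?_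
          have h3 := Real.log_nonpos hθ.1.le hθ.2
          refine (hav z _ _ (mul_pos hθ.1 hpos) (by nlinarith [hθ.1, hθ.2]) (ha θ hθ.1)).trans
            (le_of_eq ?_)
          rw [← ENNReal.ofReal_mul (by positivity), ← ENNReal.ofReal_add,
            Real.log_mul hθ.1.ne' hpos.ne']
          · congr 1; ring
          · have := mul_nonpos_of_nonneg_of_nonpos (Nat.cast_nonneg (α := ℝ) d) hls
            exact div_nonneg (by linarith) hβ.le
          · exact mul_nonneg (by positivity) (by linarith)
      _ = _ := by
          rw [lintegral_add_left measurable_const, lintegral_const_mul' _ _ ENNReal.ofReal_ne_top,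
            setLIntegral_congr Ioc_ae_eq_Icc, setLIntegral_congr Ioc_ae_eq_Icc, lintegral_neg_log,
            setLIntegral_const]
          simp only [Real.volume_Icc, sub_zero, ENNReal.ofReal_one, mul_one]
          rw [← ENNReal.ofReal_add]
          · congr 1; ring
          · have := mul_nonpos_of_nonneg_of_nonpos (Nat.cast_nonneg (α := ℝ) d) hls
            exact div_nonneg (by linarith) hβ.le
          · positivity
  have h2 := h1.trans (mul_le_mul_right (add_le_add (hint x _ fun θ h => norm_smul_half_le h _)
    (hint _ _ fun θ h => norm_smul_neg_half_le h _)) _)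
  have hd0 := mul_nonpos_of_nonneg_of_nonpos (Nat.cast_nonneg (α := ℝ) d) hls
  have hq : 0 ≤ (Real.log (c * K) - d * Real.log s + d) / β :=
    div_nonneg (by linarith [Nat.cast_nonneg (α := ℝ) d]) hβ.le
  rw [← ENNReal.ofReal_add hq hq, ← ENNReal.ofReal_mul (by positivity),
    ← ofReal_norm, ENNReal.ofReal_le_ofReal_iff (by positivity)] at h2
  refine h2.trans ?_
  have hslog : s * -Real.log s ≤ lam * s + Real.exp (-lam) := by
    have h3 := Real.add_one_le_exp (-Real.log s - lam)
    rw [Real.exp_sub, Real.exp_neg, Real.exp_log hpos] at h3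
    rw [Real.exp_neg]
    have h4 : s * (-Real.log s - lam + 1) ≤ s * (s⁻¹ / Real.exp lam) :=
      mul_le_mul_of_nonneg_left h3 hpos.le
    have h5 : s * (s⁻¹ / Real.exp lam) = (Real.exp lam)⁻¹ := by field_simp
    nlinarith
  have hsw : s ≤ ‖w‖ := (norm_ofLp_le w').trans hww
  have hex := Real.exp_pos (-lam)
  calc √↑d * s * ((Real.log (c * K) - d * Real.log s + d) / β +
        (Real.log (c * K) - d * Real.log s + d) / β)
      = 2 * √↑d / β * ((Real.log (c * K) + d) * s + d * (s * -Real.log s)) := by ring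
    _ ≤ 2 * √↑d / β * ((Real.log (c * K) + d) * (lam * s + Real.exp (-lam)) +
          d * (lam * s + Real.exp (-lam))) := by
        gcongr
        nlinarith
    _ = 2 * √↑d / β * (Real.log (c * K) + 2 * d) * (lam * s + Real.exp (-lam)) := by ring
    _ ≤ logLipConst d c β K * (lam * s + Real.exp (-lam)) := by
        gcongr
        unfold logLipConst
        linarith
    _ ≤ _ := by gcongr

/-- Lipschitz bound of a mollified field. -/
lemma norm_mollify_sub_le_lipschitz (hc : 0 < c) (hr : 0 < r) (hβ : 0 < β)
    (hρ : IsMollifier c r ρ)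
    (hG : IsWeakGradient f G) {K : ℝ} (hK1 : 1 ≤ K)
    (hK : ∫⁻ x, expGrad β G x ≤ ENNReal.ofReal K) (x : Torus d) (w : EuclideanSpace ℝ (Fin d)) :
    ‖mollify ρ f (x + eproj w) - mollify ρ f x‖ ≤ c / r ^ d * (K / β) * ‖w‖ := by
  have h1 := enorm_mollify_line_le hG hρ.smooth hρ.nonneg x w
  have h2 : ∀ z, ∫⁻ y, ENNReal.ofReal (ρ y) * ENNReal.ofReal (matNorm (G (z - y))) ≤
      ENNReal.ofReal (c / r ^ d * (K / β)) := by
    intro z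
    refine (hρ.lintegral_mul_le (fun y => ENNReal.ofReal (matNorm (G y))) z).trans ?_
    rw [ENNReal.ofReal_mul (by positivity)]
    refine mul_le_mul_right ((setLIntegral_le_lintegral _ _).trans ?_) _
    have h3 : ∀ y, ENNReal.ofReal (matNorm (G y)) ≤ ENNReal.ofReal β⁻¹ * expGrad β G y := by
      intro y
      rw [expGrad, ← ENNReal.ofReal_mul (by positivity)]
      refine ENNReal.ofReal_le_ofReal ?_
      rw [← div_eq_inv_mul, le_div_iff₀ hβ]
      linarith [Real.add_one_le_exp (β * matNorm (G y))]
    refine (lintegral_mono h3).trans ?_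
    rw [lintegral_const_mul' _ _ ENNReal.ofReal_ne_top, div_eq_inv_mul,
      ENNReal.ofReal_mul (by positivity)]
    exact mul_le_mul_right hK _
  have h4 := h1.trans (mul_le_mul_right (setLIntegral_unit_le fun θ _ _ => h2 _) _)
  rw [← ofReal_norm, ← ofReal_norm w, ← ENNReal.ofReal_mul (norm_nonneg _),
    ENNReal.ofReal_le_ofReal_iff (by positivity)] at h4
  linarith

end Estimates

/-! ### Approximation by mollification -/

section Approximation

variable {V : Type*} [NormedAddCommGroup V] [NormedSpace ℝ V] {c r : ℝ} {ρ : Torus d → ℝ}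

lemma lintegral_enorm_mollify_le (hρ : IsMollifier c r ρ) {f : Torus d → V} (hf : Integrable f) :
    ∫⁻ x, ‖mollify ρ f x‖ₑ ≤ ∫⁻ x, ‖f x‖ₑ := by
  have hm : Measurable fun y => ENNReal.ofReal (ρ y) :=
    hρ.smooth.continuous.measurable.ennreal_ofReal
  calc ∫⁻ x, ‖mollify ρ f x‖ₑ ≤ ∫⁻ x, ∫⁻ y, ENNReal.ofReal (ρ (x - y)) * ‖f y‖ₑ := by
        refine lintegral_mono fun x => (enorm_integral_le_lintegral_enorm _).trans
          (le_of_eq (lintegral_congr fun y => ?_))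
        rw [enorm_smul, ← ofReal_norm (ρ (x - y)), Real.norm_of_nonneg (hρ.nonneg _)]
    _ = ∫⁻ y, ∫⁻ x, ENNReal.ofReal (ρ (x - y)) * ‖f y‖ₑ := by
        refine lintegral_lintegral_swap ?_
        exact (hm.comp (measurable_fst.sub measurable_snd)).aemeasurable.mul
          hf.aestronglyMeasurable.enorm.comp_snd
    _ = ∫⁻ y, ‖f y‖ₑ := by
        refine lintegral_congr fun y => ?_
        rw [lintegral_mul_const' _ _ enorm_ne_top,
          lintegral_sub_right_eq_self (fun x => ENNReal.ofReal (ρ x)), hρ.lintegral_eq_one,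
          one_mul]

lemma norm_mollify_sub_self_le (hρ : IsMollifier c r ρ) [CompleteSpace V] {f : Torus d → V}
    (hf : Integrable f) {ω : ℝ} (hω : ∀ x y : Torus d, dist x y ≤ r → ‖f y - f x‖ ≤ ω)
    (x : Torus d) : ‖mollify ρ f x - f x‖ ≤ ω := by
  have h2 : Integrable fun y => ρ y • f (x - y) :=
    (hf.comp_sub_left x).bdd_smul _ hρ.smooth.continuous.aestronglyMeasurable
      (Eventually.of_forall (exists_bound_of_continuous hρ.smooth.continuous).choose_spec.2)
  have h1 : mollify ρ f x - f x = ∫ y, ρ y • (f (x - y) - f x) := by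
    simp_rw [smul_sub]
    rw [integral_sub h2 (hρ.integrable.smul_const _), integral_smul_const, hρ.integral_eq_one,
      one_smul, mollify_eq]
  rw [h1]
  have h3 : ∫ y, ρ y * ω = ω := by rw [integral_mul_const, hρ.integral_eq_one, one_mul]
  rw [← h3]
  refine norm_integral_le_of_norm_le (hρ.integrable.mul_const ω) (Eventually.of_forall fun y => ?_)
  rw [norm_smul, Real.norm_of_nonneg (hρ.nonneg y)]
  by_cases hy : ρ y = 0
  · simp [hy]
  · refine mul_le_mul_of_nonneg_left (hω _ _ ?_) (hρ.nonneg y)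
    rw [dist_eq_norm, sub_sub_cancel]
    exact hρ.support y hy

lemma mollify_comm [CompleteSpace V] {ρ' : Torus d → ℝ} (hρ : Continuous ρ) (hρ' : Continuous ρ') {f : Torus d → V}
    (hf : Integrable f) (x : Torus d) :
    mollify ρ (mollify ρ' f) x = mollify ρ' (mollify ρ f) x := by
  have key : ∀ (ρ ρ' : Torus d → ℝ), Continuous ρ → Continuous ρ' →
      mollify ρ (mollify ρ' f) x = ∫ y, (∫ z, ρ z * ρ' (x - y - z)) • f y := by
    intro ρ ρ' hρ hρ'
    obtain ⟨C, _, hC⟩ := exists_bound_of_continuous hρ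
    obtain ⟨C', _, hC'⟩ := exists_bound_of_continuous hρ'
    rw [mollify_eq]
    simp_rw [mollify, ← integral_smul]
    rw [integral_integral_swap]
    · refine integral_congr_ae (Eventually.of_forall fun y => ?_)
      simp only
      rw [← integral_smul_const]
      refine integral_congr_ae (Eventually.of_forall fun z => ?_)
      simp only [smul_smul]
      rw [sub_right_comm]
    · have h1 : Continuous fun z : Torus d × Torus d => ρ z.1 * ρ' (x - z.1 - z.2) := by fun_prop
      have h2 := (hf.comp_snd (volume : Measure (Torus d))).bdd_smul (C * C')
        h1.aestronglyMeasurable (Eventually.of_forall fun z => by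
          rw [norm_mul]
          exact mul_le_mul (hC _) (hC' _) (norm_nonneg _) ((norm_nonneg _).trans (hC 0)))
      refine h2.congr (Eventually.of_forall fun z => ?_)
      simp [Function.uncurry, smul_smul]
  rw [key ρ ρ' hρ hρ', key ρ' ρ hρ' hρ]
  refine integral_congr_ae (Eventually.of_forall fun y => ?_)
  simp only
  congr 1
  rw [← integral_sub_left_eq_self (fun z => ρ z * ρ' (x - y - z)) volume (x - y)]
  refine integral_congr_ae (Eventually.of_forall fun z => ?_)
  simp only [sub_sub_cancel]
  ring

lemma mollify_sub (hρ : Continuous ρ) {f g : Torus d → V} (hf : Integrable f) (hg : Integrable g)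
    (x : Torus d) : mollify ρ (fun y => f y - g y) x = mollify ρ f x - mollify ρ g x := by
  simp only [mollify, smul_sub]
  exact integral_sub (integrable_mollify_integrand hρ hf x) (integrable_mollify_integrand hρ hg x)

/-- Mollifications converge in `L¹`. -/
lemma tendsto_lintegral_mollify_sub [CompleteSpace V] {r : ℕ → ℝ} {ρ : ℕ → Torus d → ℝ}
    (hρ : ∀ n, IsMollifier c (r n) (ρ n)) (hr : Tendsto r atTop (𝓝 0)) {f : Torus d → V}
    (hf : Integrable f) : Tendsto (fun n => ∫⁻ x, ‖mollify (ρ n) f x - f x‖ₑ) atTop (𝓝 0) := by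
  rw [ENNReal.tendsto_nhds_zero]
  intro ε hε
  rcases eq_or_ne ε ∞ with rfl | hε'
  · exact Eventually.of_forall fun n => le_top
  have hε3 : ε / 3 ≠ 0 := by simp [hε.ne']
  obtain ⟨g, hg, hgint⟩ := (memLp_one_iff_integrable.2 hf).exists_boundedContinuous_eLpNorm_sub_le
    ENNReal.one_ne_top hε3
  have hgi : Integrable g := memLp_one_iff_integrable.1 hgint
  rw [eLpNorm_one_eq_lintegral_enorm] at hg
  have huc := CompactSpace.uniformContinuous_of_continuous g.continuous
  obtain ⟨δ, hδ, hδ'⟩ := Metric.uniformContinuous_iff.1 huc (ε / 3).toReal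
    (ENNReal.toReal_pos hε3 (by finiteness))
  filter_upwards [hr.eventually (gt_mem_nhds hδ)] with n hn
  have hcont := (hρ n).smooth.continuous
  have h1 : ∀ x, ‖mollify (ρ n) f x - f x‖ₑ ≤ (‖mollify (ρ n) (fun y => (f - g) y) x‖ₑ +
      ‖(f - g) x‖ₑ) + ε / 3 := by
    intro x
    have h2 : mollify (ρ n) f x - f x = (mollify (ρ n) (fun y => (f - g) y) x - (f - g) x) +
        (mollify (ρ n) g x - g x) := by
      simp only [Pi.sub_apply]
      rw [mollify_sub hcont hf hgi]
      abel
    rw [h2]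
    refine (enorm_add_le _ _).trans (add_le_add enorm_sub_le ?_)
    rw [← ofReal_norm, ← ENNReal.ofReal_toReal (show ε / 3 ≠ ∞ by finiteness)]
    refine ENNReal.ofReal_le_ofReal (norm_mollify_sub_self_le (hρ n) hgi (fun x y hxy => ?_) x)
    rw [← dist_eq_norm, dist_comm]
    exact (hδ' (hxy.trans_lt hn)).le
  refine (lintegral_mono h1).trans ?_
  rw [lintegral_add_right _ measurable_const, lintegral_add_right' _ (hf.sub hgi).1.enorm]
  have h4 := lintegral_enorm_mollify_le (hρ n) (hf.sub hgi)
  calc _ ≤ ε / 3 + ε / 3 + ε / 3 := by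
        refine add_le_add (add_le_add (h4.trans hg) hg) ?_
        simp
    _ = ε := ENNReal.add_thirds ε

end Approximation

end

end TorusTransport


namespace TorusTransport

noncomputable section

variable {d : ℕ}

/-! ### Time dependent Sobolev fields and their continuous representatives -/

/-- A constant for which all the standard mollifiers satisfy `IsMollifier`. -/
def mollConst (d : ℕ) : ℝ := max 3 (exists_isMollifier d).choose

lemma three_le_mollConst (d : ℕ) : 3 ≤ mollConst d := le_max_left _ _

lemma isMollifier_mollifier {r : ℝ} (hr : 0 < r) (hr1 : r ≤ 1) :
    IsMollifier (mollConst d) r (mollifier d r) :=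
  ((exists_isMollifier d).choose_spec.2 r hr hr1).mono hr (le_max_right _ _)

/-- The standard mollifier at scale `e^{-n}`. -/
def stdMollifier (d n : ℕ) : Torus d → ℝ := mollifier d (Real.exp (-n))

lemma isMollifier_stdMollifier (n : ℕ) :
    IsMollifier (mollConst d) (Real.exp (-n)) (stdMollifier d n) :=
  isMollifier_mollifier (Real.exp_pos _) (Real.exp_le_one_iff.2 (by simp))

lemma tendsto_exp_neg_nat : Tendsto (fun n : ℕ => Real.exp (-n)) atTop (𝓝 0) :=
  Real.tendsto_exp_neg_atTop_nhds_zero.comp tendsto_natCast_atTop_atTop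

/-- A jointly measurable representative of a field with exponentially integrable gradient and
bounded divergence, vanishing outside of the time interval `[0,T]`. -/
structure IsSobolevField (T β K L : ℝ) (b : ℝ → Torus d → EuclideanSpace ℝ (Fin d))
    (G : ℝ → Torus d → Matrix (Fin d) (Fin d) ℝ) : Prop where
  pos : 0 < β
  measurable : Measurable (Function.uncurry b)
  measurable_grad : ∀ i j, Measurable fun z : ℝ × Torus d => G z.1 z.2 i j
  isWeakGradient : ∀ t, IsWeakGradient (b t) (G t)
  lintegral_exp_le : ∀ t, ∫⁻ x, expGrad β (G t) x ≤ ENNReal.ofReal K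
  trace_le : ∀ t, ∀ᵐ x, |(G t x).trace| ≤ L
  integrable : Integrable (fun z : ℝ × Torus d => b z.1 z.2) (volume.prod volume)
  eq_zero : ∀ t ∉ Icc 0 T, b t = 0

/-- Spatial mollification of a field. -/
def approxField (b : ℝ → Torus d → EuclideanSpace ℝ (Fin d)) (n : ℕ) (t : ℝ) :
    Torus d → EuclideanSpace ℝ (Fin d) := mollify (stdMollifier d n) (b t)

/-- The continuous representative of a field. -/
def velocity (b : ℝ → Torus d → EuclideanSpace ℝ (Fin d)) (t : ℝ) (x : Torus d) :
    EuclideanSpace ℝ (Fin d) := limUnder atTop fun n => approxField b n t x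

/-- The rate of convergence of the mollified fields. -/
def approxRate (d : ℕ) (β K : ℝ) (n : ℕ) : ℝ :=
  logLipConst d (mollConst d) β K *
    ((n + 1) * (Real.sqrt d * Real.exp (-n)) + Real.exp (-(n + 1)))

lemma tendsto_approxRate (β K : ℝ) : Tendsto (approxRate d β K) atTop (𝓝 0) := by
  have h1 : Tendsto (fun n : ℕ => ((n : ℝ)) * Real.exp (-n)) atTop (𝓝 0) := by
    have := Real.tendsto_pow_mul_exp_neg_atTop_nhds_zero 1
    simpa [Function.comp_def] using this.comp tendsto_natCast_atTop_atTop
  have h2 := tendsto_exp_neg_nat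
  have h3 := (((h1.add h2).mul_const (Real.sqrt d)).add (h2.mul_const (Real.exp (-1)))).const_mul
    (logLipConst d (mollConst d) β K)
  have h4 : logLipConst d (mollConst d) β K * ((0 + 0) * Real.sqrt d + 0 * Real.exp (-1)) = 0 := by
    ring
  rw [h4] at h3
  refine h3.congr fun n => ?_
  rw [approxRate, neg_add, Real.exp_add]
  ring

/-- The common bound for the mollified fields. -/
def fieldBound (T β K : ℝ) (b : ℝ → Torus d → EuclideanSpace ℝ (Fin d)) (t : ℝ) : ℝ :=
  (∫ x, ‖b t x‖) + (Icc 0 T).indicator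
    (fun _ => logLipConst d (mollConst d) β K * (Real.sqrt d + 1)) t

namespace IsSobolevField

variable {T β K L : ℝ} {b : ℝ → Torus d → EuclideanSpace ℝ (Fin d)}
    {G : ℝ → Torus d → Matrix (Fin d) (Fin d) ℝ}

lemma measurable_grad_slice (hb : IsSobolevField T β K L b G) (t : ℝ) (i j : Fin d) :
    Measurable fun x => G t x i j :=
  (hb.measurable_grad i j).comp measurable_prodMk_left

lemma measurable_trace (hb : IsSobolevField T β K L b G) :
    Measurable fun z : ℝ × Torus d => (G z.1 z.2).trace :=
  Finset.measurable_sum _ fun i _ => hb.measurable_grad i i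

lemma one_le (hb : IsSobolevField T β K L b G) : 1 ≤ K := by
  have h1 : (1 : ℝ≥0∞) ≤ ∫⁻ x, expGrad β (G 0) x := by
    calc (1 : ℝ≥0∞) = ∫⁻ _x : Torus d, 1 := by simp
      _ ≤ _ := lintegral_mono fun x => one_le_expGrad hb.pos x
  exact ENNReal.one_le_ofReal.1 (h1.trans (hb.lintegral_exp_le 0))

lemma nonneg (hb : IsSobolevField T β K L b G) : 0 ≤ L := by
  obtain ⟨x, hx⟩ := (hb.trace_le 0).exists
  exact (abs_nonneg _).trans hx

lemma logLipConst_pos (hb : IsSobolevField T β K L b G) :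
    0 < logLipConst d (mollConst d) β K :=
  TorusTransport.logLipConst_pos (three_le_mollConst d) hb.pos hb.one_le

lemma approxField_osc (hb : IsSobolevField T β K L b G) (n : ℕ) (t : ℝ) (x : Torus d)
    (w : EuclideanSpace ℝ (Fin d)) {lam : ℝ} (hlam : 1 ≤ lam) :
    ‖approxField b n t (x + eproj w) - approxField b n t x‖ ≤
      logLipConst d (mollConst d) β K * (lam * ‖w‖ + Real.exp (-lam)) :=
  norm_mollify_sub_le_osc (three_le_mollConst d) hb.pos (isMollifier_stdMollifier n)
    (hb.isWeakGradient t) (hb.measurable_grad_slice t) hb.one_le (hb.lintegral_exp_le t) x w hlam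

lemma continuous_approxField (hb : IsSobolevField T β K L b G) (n : ℕ) (t : ℝ) :
    Continuous (approxField b n t) :=
  continuous_mollify (isMollifier_stdMollifier n).smooth (hb.isWeakGradient t).integrable

lemma norm_mollify_approxField_sub_le (hb : IsSobolevField T β K L b G) (n k : ℕ) (t : ℝ)
    (x : Torus d) :
    ‖mollify (stdMollifier d n) (approxField b k t) x - approxField b k t x‖ ≤
      approxRate d β K n := by
  refine norm_mollify_sub_self_le (isMollifier_stdMollifier n)
    (integrable_of_continuous (hb.continuous_approxField k t)) (fun x y hxy => ?_) x
  obtain ⟨w, rfl, hw⟩ := exists_elift_small x y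
  refine (hb.approxField_osc k t x w (lam := n + 1) (by simp)).trans ?_
  have := hb.logLipConst_pos
  unfold approxRate
  gcongr
  exact hw.trans (by gcongr)

lemma norm_approxField_sub_le (hb : IsSobolevField T β K L b G) (n k : ℕ) (t : ℝ) (x : Torus d) :
    ‖approxField b n t x - approxField b k t x‖ ≤ approxRate d β K n + approxRate d β K k := by
  have h1 := hb.norm_mollify_approxField_sub_le n k t x
  have h2 := hb.norm_mollify_approxField_sub_le k n t x
  have h3 : mollify (stdMollifier d n) (approxField b k t) x =
      mollify (stdMollifier d k) (approxField b n t) x :=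
    mollify_comm (isMollifier_stdMollifier n).smooth.continuous
      (isMollifier_stdMollifier k).smooth.continuous (hb.isWeakGradient t).integrable x
  rw [h3] at h1
  rw [← sub_sub_sub_cancel_left _ _ (mollify (stdMollifier d k) (approxField b n t) x)]
  exact (norm_sub_le _ _).trans (add_le_add h1 h2)

lemma tendsto_approxField (hb : IsSobolevField T β K L b G) (t : ℝ) (x : Torus d) :
    Tendsto (fun n => approxField b n t x) atTop (𝓝 (velocity b t x)) := by
  refine CauchySeq.tendsto_limUnder (Metric.cauchySeq_iff.2 fun ε hε => ?_)
  obtain ⟨N, hN⟩ := eventually_atTop.1 ((tendsto_approxRate (d := d) β K).eventually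
    (gt_mem_nhds (half_pos hε)))
  refine ⟨N, fun n hn k hk => ?_⟩
  rw [dist_eq_norm]
  linarith [hb.norm_approxField_sub_le n k t x, hN n hn, hN k hk]

lemma norm_approxField_sub_velocity_le (hb : IsSobolevField T β K L b G) (n : ℕ) (t : ℝ)
    (x : Torus d) : ‖approxField b n t x - velocity b t x‖ ≤ approxRate d β K n := by
  have h1 := ((tendsto_const_nhds (x := approxField b n t x)).sub
    (hb.tendsto_approxField t x)).norm
  have h2 := (tendsto_approxRate (d := d) β K).const_add (approxRate d β K n)
  rw [add_zero] at h2
  exact le_of_tendsto_of_tendsto' h1 h2 fun k => hb.norm_approxField_sub_le n k t x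

lemma velocity_ae_eq (hb : IsSobolevField T β K L b G) (t : ℝ) : velocity b t =ᵐ[volume] b t := by
  have hf := (hb.isWeakGradient t).integrable
  have h1 := tendsto_lintegral_mollify_sub (fun n => isMollifier_stdMollifier (d := d) n)
    tendsto_exp_neg_nat hf
  have h2 : ∀ n, ∫⁻ x, ‖velocity b t x - b t x‖ₑ ≤
      ENNReal.ofReal (approxRate d β K n) + ∫⁻ x, ‖mollify (stdMollifier d n) (b t) x - b t x‖ₑ := by
    intro n
    calc ∫⁻ x, ‖velocity b t x - b t x‖ₑ ≤ ∫⁻ x, (ENNReal.ofReal (approxRate d β K n) +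
          ‖mollify (stdMollifier d n) (b t) x - b t x‖ₑ) := by
          refine lintegral_mono fun x => ?_
          rw [← sub_add_sub_cancel (velocity b t x) (approxField b n t x) (b t x)]
          refine (enorm_add_le _ _).trans (add_le_add ?_ le_rfl)
          rw [enorm_sub_rev, ← ofReal_norm]
          exact ENNReal.ofReal_le_ofReal (hb.norm_approxField_sub_velocity_le n t x)
      _ = _ := by rw [lintegral_add_left measurable_const]; simp
  have h3 := (ENNReal.tendsto_ofReal (tendsto_approxRate (d := d) β K)).add h1
  rw [ENNReal.ofReal_zero, add_zero] at h3
  have h4 : ∫⁻ x, ‖velocity b t x - b t x‖ₑ = 0 := le_antisymm (ge_of_tendsto' h3 h2) zero_le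
  have h5 : AEStronglyMeasurable (velocity b t) volume :=
    aestronglyMeasurable_of_tendsto_ae atTop
      (fun n => (hb.continuous_approxField n t).aestronglyMeasurable)
      (Eventually.of_forall fun x => hb.tendsto_approxField t x)
  filter_upwards [(lintegral_eq_zero_iff' (h5.sub hf.1).enorm).1 h4] with x hx
  simpa [sub_eq_zero] using hx

lemma measurable_approxField (hb : IsSobolevField T β K L b G) (n : ℕ) :
    Measurable (Function.uncurry (approxField b n)) := by
  have h1 : StronglyMeasurable fun q : (ℝ × Torus d) × Torus d =>
      stdMollifier d n (q.1.2 - q.2) • b q.1.1 q.2 := by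
    have h2 := (isMollifier_stdMollifier (d := d) n).smooth.continuous.measurable
    have h3 : Measurable fun q : (ℝ × Torus d) × Torus d => b q.1.1 q.2 :=
      hb.measurable.comp ((measurable_fst.comp measurable_fst).prodMk measurable_snd)
    exact ((h2.comp ((measurable_snd.comp measurable_fst).sub measurable_snd)).smul
      h3).stronglyMeasurable
  exact h1.integral_prod_right'.measurable

lemma measurable_velocity (hb : IsSobolevField T β K L b G) :
    Measurable (Function.uncurry (velocity b)) :=
  measurable_of_tendsto_metrizable hb.measurable_approxField
    (tendsto_pi_nhds.2 fun z => hb.tendsto_approxField z.1 z.2)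

lemma integrable_fieldBound (hb : IsSobolevField T β K L b G) :
    Integrable (fieldBound T β K b) := by
  refine hb.integrable.integral_norm_prod_left.add ?_
  exact (integrable_indicator_iff measurableSet_Icc).2 (integrableOn_const (by simp))

lemma norm_approxField_le (hb : IsSobolevField T β K L b G) (n : ℕ) (t : ℝ) (x : Torus d) :
    ‖approxField b n t x‖ ≤ fieldBound T β K b t := by
  rw [fieldBound]
  by_cases ht : t ∈ Icc 0 T
  · rw [indicator_of_mem ht]
    have hf := (hb.isWeakGradient t).integrable
    have hc := integrable_of_continuous (hb.continuous_approxField n t)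
    have h1 : ∀ y, ‖approxField b n t x‖ ≤ ‖approxField b n t y‖ +
        logLipConst d (mollConst d) β K * (Real.sqrt d + 1) := by
      intro y
      obtain ⟨w, rfl, hw⟩ := exists_elift_small x y
      have h2 := hb.approxField_osc n t x w le_rfl
      have h3 : ‖w‖ ≤ Real.sqrt d := by
        refine hw.trans ?_
        have : dist x (x + eproj w) ≤ 1 := by
          rw [dist_eq_norm]
          exact (norm_torus_le_half _).trans (by norm_num)
        exact mul_le_of_le_one_right (Real.sqrt_nonneg _) this
      have h4 := norm_sub_norm_le (approxField b n t x) (approxField b n t (x + eproj w))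
      rw [norm_sub_rev] at h4
      have h5 : logLipConst d (mollConst d) β K * (1 * ‖w‖ + Real.exp (-1)) ≤
          logLipConst d (mollConst d) β K * (Real.sqrt d + 1) := by
        have := hb.logLipConst_pos
        gcongr
        · linarith
        · exact Real.exp_le_one_iff.2 (by norm_num)
      linarith
    have h2 : ‖approxField b n t x‖ ≤ (∫ y, ‖approxField b n t y‖) +
        logLipConst d (mollConst d) β K * (Real.sqrt d + 1) := by
      have := integral_mono (integrable_const _) (hc.norm.add (integrable_const _)) h1
      simp only [Pi.add_apply] at this
      rw [integral_add hc.norm (integrable_const _)] at this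
      simpa using this
    refine h2.trans (add_le_add ?_ le_rfl)
    have h3 : ∫⁻ x, ‖approxField b n t x‖ₑ ≤ ∫⁻ x, ‖b t x‖ₑ :=
      lintegral_enorm_mollify_le (isMollifier_stdMollifier (d := d) n) hf
    rw [← ofReal_integral_norm_eq_lintegral_enorm hc,
      ← ofReal_integral_norm_eq_lintegral_enorm hf] at h3
    exact (ENNReal.ofReal_le_ofReal_iff (by positivity)).1 h3
  · rw [indicator_of_notMem ht, approxField, hb.eq_zero t ht]
    simp [mollify]

lemma isVelocity_approxField (hb : IsSobolevField T β K L b G) (n : ℕ) :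
    IsVelocity (logLipConst d (mollConst d) β K) (fieldBound T β K b) (approxField b n) where
  pos := hb.logLipConst_pos
  measurable := hb.measurable_approxField n
  integrable := hb.integrable_fieldBound
  norm_le := hb.norm_approxField_le n
  osc t x w _ hlam := hb.approxField_osc n t x w hlam

lemma isVelocity (hb : IsSobolevField T β K L b G) :
    IsVelocity (logLipConst d (mollConst d) β K) (fieldBound T β K b) (velocity b) where
  pos := hb.logLipConst_pos
  measurable := hb.measurable_velocity
  integrable := hb.integrable_fieldBound
  norm_le t x := le_of_tendsto' (hb.tendsto_approxField t x).norm fun n =>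
    hb.norm_approxField_le n t x
  osc t x w _ hlam := le_of_tendsto' ((hb.tendsto_approxField t (x + eproj w)).sub
    (hb.tendsto_approxField t x)).norm fun n => hb.approxField_osc n t x w hlam

lemma approxField_lipschitz (hb : IsSobolevField T β K L b G) (n : ℕ) (t : ℝ) (x : Torus d)
    (w : EuclideanSpace ℝ (Fin d)) : ‖approxField b n t (x + eproj w) - approxField b n t x‖ ≤
      mollConst d / Real.exp (-n) ^ d * (K / β) * ‖w‖ :=
  norm_mollify_sub_le_lipschitz (by linarith [three_le_mollConst d]) (Real.exp_pos _) hb.pos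
    (isMollifier_stdMollifier n) (hb.isWeakGradient t) hb.one_le (hb.lintegral_exp_le t) x w

lemma hasFlow_approxField (hb : IsSobolevField T β K L b G) (n : ℕ) :
    HasFlow (approxField b n) := by
  refine hasFlow_of_lipschitz (hb.isVelocity_approxField n) ?_ (hb.approxField_lipschitz n)
  have h1 := three_le_mollConst d
  have h2 := hb.one_le
  have h3 := hb.pos
  positivity

lemma hasFlow (hb : IsSobolevField T β K L b G) : HasFlow (velocity b) :=
  hasFlow_of_tendsto hb.isVelocity hb.isVelocity_approxField hb.hasFlow_approxField
    (tendsto_approxRate (d := d) β K) hb.norm_approxField_sub_velocity_le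

/-- The divergence of the mollified field. -/
lemma sum_partialDeriv_approxField (hb : IsSobolevField T β K L b G) (n : ℕ) (t : ℝ)
    (x : Torus d) : ∑ i, partialDeriv i (fun y => approxField b n t y i) x =
      mollify (stdMollifier d n) (fun y => (G t y).trace) x := by
  have h := (isMollifier_stdMollifier (d := d) n).smooth
  have h1 : ∀ i, (fun x => approxField b n t x i) = mollify (stdMollifier d n) fun y => b t y i :=
    fun i => funext fun x => mollify_apply h.continuous (hb.isWeakGradient t).integrable x i
  simp_rw [h1, partialDeriv_mollify h (integrable_apply (hb.isWeakGradient t).integrable _),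
    (hb.isWeakGradient t).mollify_partialDeriv h, mollify, Matrix.trace, Finset.smul_sum]
  rw [integral_finsetSum]
  · rfl
  · exact fun i _ => integrable_mollify_integrand h.continuous
      ((hb.isWeakGradient t).integrable_grad i i) x

lemma integrable_trace (hb : IsSobolevField T β K L b G) (t : ℝ) :
    Integrable fun x => (G t x).trace :=
  integrable_finsetSum _ fun i _ => (hb.isWeakGradient t).integrable_grad i i

lemma abs_mollify_trace_le (hb : IsSobolevField T β K L b G) (n : ℕ) (t : ℝ) (x : Torus d) :
    |mollify (stdMollifier d n) (fun y => (G t y).trace) x| ≤ L := by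
  have hρ := isMollifier_stdMollifier (d := d) n
  have h3 : ∫ y, stdMollifier d n (x - y) * L = L := by
    rw [integral_mul_const, integral_sub_left_eq_self (stdMollifier d n), hρ.integral_eq_one,
      one_mul]
  rw [mollify, ← Real.norm_eq_abs]
  conv_rhs => rw [← h3]
  refine norm_integral_le_of_norm_le ((hρ.integrable.comp_sub_left x).mul_const L) ?_
  filter_upwards [hb.trace_le t] with y hy
  rw [norm_smul, Real.norm_of_nonneg (hρ.nonneg _)]
  exact mul_le_mul_of_nonneg_left hy (hρ.nonneg _)

lemma norm_velocity_sub_le (hb : IsSobolevField T β K L b G) (t : ℝ) {x y : Torus d}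
    (hx : maxFun (expGrad β (G t)) x ≠ ∞) (hy : maxFun (expGrad β (G t)) y ≠ ∞) :
    ‖velocity b t x - velocity b t y‖ ≤ torusDist x y *
      (lusinLip (mollConst d) β (G t) x + lusinLip (mollConst d) β (G t) y) :=
  le_of_tendsto' ((hb.tendsto_approxField t x).sub (hb.tendsto_approxField t y)).norm fun n =>
    norm_mollify_sub_le_lusinLip (three_le_mollConst d) hb.pos (isMollifier_stdMollifier n)
      (hb.isWeakGradient t) (hb.measurable_grad_slice t) hx hy

end IsSobolevField

end

end TorusTransport


namespace TorusTransport

noncomputable section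

variable {d : ℕ}

/-! ### Choice of representatives -/

lemma IsWeakGradient.congr {f f' : Torus d → EuclideanSpace ℝ (Fin d)}
    {G G' : Torus d → Matrix (Fin d) (Fin d) ℝ} (h : IsWeakGradient f G) (hf : f =ᵐ[volume] f')
    (hG : ∀ᵐ x, G x = G' x) : IsWeakGradient f' G' where
  integrable := h.integrable.congr hf
  integrable_grad i j := (h.integrable_grad i j).congr (by
    filter_upwards [hG] with x hx; rw [hx])
  integral_eq i j φ hφ := by
    have h1 := h.integral_eq i j φ hφ
    rw [integral_congr_ae (g := fun x => f' x i * partialDeriv j φ x)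
      (by filter_upwards [hf] with x hx; rw [hx]),
      integral_congr_ae (f := fun x => G x i j * φ x) (g := fun x => G' x i j * φ x)
      (by filter_upwards [hG] with x hx; rw [hx])] at h1
    exact h1

lemma isWeakGradient_zero : IsWeakGradient (0 : Torus d → EuclideanSpace ℝ (Fin d)) 0 where
  integrable := integrable_zero _ _ _
  integrable_grad i j := by simp
  integral_eq i j φ _ := by simp

lemma IsTransportSolution.congr {T p : ℝ} {b b' : ℝ → Torus d → EuclideanSpace ℝ (Fin d)}
    {Db Db' : ℝ → Torus d → Matrix (Fin d) (Fin d) ℝ} {u₀ : Torus d → ℝ} {u : ℝ → Torus d → ℝ}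
    (h : IsTransportSolution T p b Db u₀ u)
    (hb : ∀ᵐ z ∂spaceTime d T, b z.1 z.2 = b' z.1 z.2)
    (hDb : ∀ᵐ z ∂spaceTime d T, (Db z.1 z.2).trace = (Db' z.1 z.2).trace) :
    IsTransportSolution T p b' Db' u₀ u where
  aestronglyMeasurable := h.aestronglyMeasurable
  memLp := h.memLp
  bounded := h.bounded
  weaklyContinuous := h.weaklyContinuous
  integrable φ hφ := (h.integrable φ hφ).congr (by
    filter_upwards [hb, hDb] with z h1 h2; rw [h1, h2])
  integral_eq φ hφ t ht := by
    rw [h.integral_eq φ hφ t ht]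
    have h1 := Measure.ae_ae_of_ae_prod hb
    have h2 := Measure.ae_ae_of_ae_prod hDb
    rw [intervalIntegral.integral_of_le ht.1, intervalIntegral.integral_of_le ht.1]
    refine integral_congr_ae ?_
    have h3 : Ioc 0 t ⊆ Icc 0 T := fun s hs => ⟨hs.1.le, hs.2.trans ht.2⟩
    filter_upwards [ae_restrict_of_ae_restrict_of_subset h3 h1,
      ae_restrict_of_ae_restrict_of_subset h3 h2] with s h4 h5
    refine integral_congr_ae ?_
    filter_upwards [h4, h5] with x h6 h7
    rw [h6, h7]

lemma ae_spaceTime_of_ae {T : ℝ} {p : ℝ × Torus d → Prop} (hp : MeasurableSet {z | p z})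
    (h : ∀ t, ∀ᵐ x, p (t, x)) : ∀ᵐ z ∂spaceTime d T, p z := by
  rw [spaceTime, Measure.ae_prod_iff_ae_ae hp]
  exact Eventually.of_forall h

lemma exists_isSobolevField {T β : ℝ} {K L : ℝ≥0}
    {b : ℝ → Torus d → EuclideanSpace ℝ (Fin d)}
    {Db : ℝ → Torus d → Matrix (Fin d) (Fin d) ℝ} (hT : 0 < T) (hβ : 0 < β)
    (hb : Integrable (fun z : ℝ × Torus d => b z.1 z.2) (spaceTime d T))
    (hDb : ∀ i j, AEStronglyMeasurable (fun z : ℝ × Torus d => Db z.1 z.2 i j) (spaceTime d T))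
    (hG : ∀ t ∈ Icc 0 T, IsWeakGradient (b t) (Db t))
    (hK : (⨆ t ∈ Icc 0 T, ∫⁻ x, ENNReal.ofReal (Real.exp (β * matNorm (Db t x)))) = K)
    (hL : eLpNorm (fun z : ℝ × Torus d => (Db z.1 z.2).trace) ∞ (spaceTime d T) = L) :
    ∃ (b' : ℝ → Torus d → EuclideanSpace ℝ (Fin d))
      (G : ℝ → Torus d → Matrix (Fin d) (Fin d) ℝ), IsSobolevField T β K L b' G ∧
      (∀ᵐ z ∂spaceTime d T, b z.1 z.2 = b' z.1 z.2) ∧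
      ∀ᵐ z ∂spaceTime d T, (Db z.1 z.2).trace = (G z.1 z.2).trace := by
  set b₁ := hb.1.mk _ with hb₁
  set G₁ : ℝ × Torus d → Matrix (Fin d) (Fin d) ℝ := fun z i j => (hDb i j).mk _ z with hG₁
  have hb₁m : Measurable b₁ := hb.1.stronglyMeasurable_mk.measurable
  have hG₁m : ∀ i j, Measurable fun z => G₁ z i j := fun i j =>
    (hDb i j).stronglyMeasurable_mk.measurable
  have hbe : ∀ᵐ z ∂spaceTime d T, b z.1 z.2 = b₁ z := hb.1.ae_eq_mk
  have hGe : ∀ᵐ z ∂spaceTime d T, Db z.1 z.2 = G₁ z := by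
    have h1 : ∀ᵐ z ∂spaceTime d T, ∀ i j, Db z.1 z.2 i j = G₁ z i j :=
      ae_all_iff.2 fun i => ae_all_iff.2 fun j => (hDb i j).ae_eq_mk
    filter_upwards [h1] with z hz
    ext i j
    exact hz i j
  have hLe : ∀ᵐ z ∂spaceTime d T, |(Db z.1 z.2).trace| ≤ L := by
    have h1 := ae_le_eLpNormEssSup (f := fun z : ℝ × Torus d => (Db z.1 z.2).trace)
      (μ := spaceTime d T)
    rw [← eLpNorm_exponent_top, hL] at h1
    filter_upwards [h1] with z hz
    rw [← Real.norm_eq_abs]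
    exact_mod_cast enorm_le_coe.1 hz
  have hgood : ∀ᵐ t ∂volume, t ∈ Icc 0 T → ((∀ᵐ x, b t x = b₁ (t, x)) ∧
      (∀ᵐ x, Db t x = G₁ (t, x)) ∧ ∀ᵐ x, |(Db t x).trace| ≤ L) := by
    rw [← ae_restrict_iff' measurableSet_Icc]
    filter_upwards [Measure.ae_ae_of_ae_prod hbe, Measure.ae_ae_of_ae_prod hGe,
      Measure.ae_ae_of_ae_prod hLe] with t h1 h2 h3 using ⟨h1, h2, h3⟩
  obtain ⟨S, hS, hSm, hS0⟩ := exists_measurable_superset_of_null (ae_iff.1 hgood)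
  set A : Set ℝ := Icc 0 T \ S with hA
  have hAm : MeasurableSet A := measurableSet_Icc.diff hSm
  have hAgood : ∀ t ∈ A, t ∈ Icc 0 T ∧ (∀ᵐ x, b t x = b₁ (t, x)) ∧
      (∀ᵐ x, Db t x = G₁ (t, x)) ∧ ∀ᵐ x, |(Db t x).trace| ≤ L := by
    intro t ht
    refine ⟨ht.1, ?_⟩
    by_contra h
    exact ht.2 (hS fun h' => h (h' ht.1))
  have hAe : ∀ᵐ z ∂spaceTime d T, z.1 ∈ A := by
    have h1 : ∀ᵐ t ∂volume.restrict (Icc 0 T), t ∈ A := by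
      filter_upwards [ae_restrict_mem measurableSet_Icc,
        ae_restrict_of_ae (measure_eq_zero_iff_ae_notMem.1 hS0)] with t h1 h2 using ⟨h1, h2⟩
    exact Measure.quasiMeasurePreserving_fst.ae h1
  have hfst : MeasurableSet {z : ℝ × Torus d | z.1 ∈ A} := measurable_fst hAm
  set b' : ℝ × Torus d → EuclideanSpace ℝ (Fin d) := {z | z.1 ∈ A}.indicator b₁ with hb'
  set G : ℝ × Torus d → Matrix (Fin d) (Fin d) ℝ := fun z i j =>
    {z : ℝ × Torus d | z.1 ∈ A}.indicator (fun z => G₁ z i j) z with hGdef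
  have hin : ∀ t ∈ A, (∀ x, b' (t, x) = b₁ (t, x)) ∧ ∀ x, G (t, x) = G₁ (t, x) := fun t ht =>
    ⟨fun x => indicator_of_mem (show (t, x) ∈ {z : ℝ × Torus d | z.1 ∈ A} from ht) _,
      fun x => by
        ext i j
        exact indicator_of_mem (show (t, x) ∈ {z : ℝ × Torus d | z.1 ∈ A} from ht) _⟩
  have hout : ∀ t ∉ A, (∀ x, b' (t, x) = 0) ∧ ∀ x, G (t, x) = 0 := fun t ht =>
    ⟨fun x => indicator_of_notMem (show (t, x) ∉ {z : ℝ × Torus d | z.1 ∈ A} from ht) _,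
      fun x => by
        ext i j
        exact indicator_of_notMem (show (t, x) ∉ {z : ℝ × Torus d | z.1 ∈ A} from ht) _⟩
  have hKt : ∀ t ∈ Icc 0 T, ∫⁻ x, expGrad β (Db t) x ≤ K := fun t ht =>
    (le_iSup₂ (f := fun t (_ : t ∈ Icc 0 T) =>
      ∫⁻ x, ENNReal.ofReal (Real.exp (β * matNorm (Db t x)))) t ht).trans hK.le
  have hK1 : (1 : ℝ≥0∞) ≤ K := by
    refine le_trans ?_ (hKt 0 ⟨le_rfl, hT.le⟩)
    calc (1 : ℝ≥0∞) = ∫⁻ _x : Torus d, 1 := by simp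
      _ ≤ _ := lintegral_mono fun x => one_le_expGrad hβ x
  have hbb' : ∀ᵐ z ∂spaceTime d T, b z.1 z.2 = b' z := by
    filter_upwards [hbe, hAe] with z h1 h2
    rw [h1, (hin z.1 h2).1 z.2]
  have hGG' : ∀ᵐ z ∂spaceTime d T, Db z.1 z.2 = G z := by
    filter_upwards [hGe, hAe] with z h1 h2
    rw [h1, (hin z.1 h2).2 z.2]
  refine ⟨fun t x => b' (t, x), fun t x => G (t, x), ?_, hbb', ?_⟩
  swap
  · filter_upwards [hGG'] with z hz
    rw [hz]
  refine ⟨hβ, hb₁m.indicator hfst, fun i j => (hG₁m i j).indicator hfst, fun t => ?_, fun t => ?_,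
    fun t => ?_, ?_, fun t ht => ?_⟩
  · by_cases ht : t ∈ A
    · obtain ⟨h0, h1, h2, _⟩ := hAgood t ht
      refine (hG t h0).congr ?_ ?_
      · filter_upwards [h1] with x hx
        rw [hx, (hin t ht).1 x]
      · filter_upwards [h2] with x hx
        rw [hx, (hin t ht).2 x]
    · convert isWeakGradient_zero (d := d) using 1
      · exact funext (hout t ht).1
      · exact funext (hout t ht).2
  · by_cases ht : t ∈ A
    · obtain ⟨h0, h1, h2, _⟩ := hAgood t ht
      rw [ENNReal.ofReal_coe_nnreal]
      refine le_trans (le_of_eq (lintegral_congr_ae ?_)) (hKt t h0)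
      filter_upwards [h2] with x hx
      rw [expGrad, expGrad, hx, (hin t ht).2 x]
    · have h0 : ∀ x, expGrad β (fun x => G (t, x)) x = 1 := fun x => by
        simp [expGrad, (hout t ht).2 x, matNorm]
      simp_rw [h0]
      simpa using hK1
  · by_cases ht : t ∈ A
    · obtain ⟨h0, h1, h2, h3⟩ := hAgood t ht
      filter_upwards [h2, h3] with x hx hx'
      rwa [(hin t ht).2 x, ← hx]
    · refine Eventually.of_forall fun x => ?_
      rw [(hout t ht).2 x]
      simp
  · have h1 : Integrable b' (spaceTime d T) := hb.congr hbb'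
    have h2 : spaceTime d T =
        ((volume : Measure ℝ).prod (volume : Measure (Torus d))).restrict (Icc 0 T ×ˢ univ) := by
      rw [spaceTime, ← Measure.prod_restrict, Measure.restrict_univ]
    rw [h2] at h1
    have h3 : Integrable b' ((volume : Measure ℝ).prod (volume : Measure (Torus d))) := by
      have h4 := (integrable_indicator_iff (measurableSet_Icc.prod MeasurableSet.univ)).2 h1
      refine h4.congr (Eventually.of_forall fun z => ?_)
      by_cases hz : z ∈ (Icc 0 T ×ˢ univ : Set (ℝ × Torus d))
      · rw [indicator_of_mem hz]
      · rw [indicator_of_notMem hz]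
        refine ((hout z.1 fun h => hz ⟨h.1, mem_univ _⟩).1 z.2).symm
    exact h3
  · exact funext (hout t fun h => ht h.1).1

end

end TorusTransport


namespace TorusTransport

noncomputable section

variable {d : ℕ}

/-! ### A first order expansion in duality with smooth functions -/

/-- A function whose increments are dominated by the squares of the increments of a continuous
function is nonincreasing. -/
lemma le_of_increments_le_sq {f M : ℝ → ℝ} {a b C : ℝ} (hab : a ≤ b) (hM : ContinuousOn M (Icc a b))
    (hC : 0 ≤ C) (hmono : MonotoneOn M (Icc a b))
    (h : ∀ s ∈ Icc a b, ∀ t ∈ Icc a b, s ≤ t → f t - f s ≤ C * (M t - M s) ^ 2) : f b ≤ f a := by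
  have key : ∀ ε > 0, f b - f a ≤ C * ε * (M b - M a) := by
    intro ε hε
    obtain ⟨δ, hδ, hδ'⟩ := Metric.uniformContinuousOn_iff.1
      (isCompact_Icc.uniformContinuousOn_of_continuous hM) ε hε
    obtain ⟨N, hN⟩ := exists_nat_gt ((b - a) / δ)
    have hN0 : (0 : ℝ) < N := (div_nonneg (sub_nonneg.2 hab) hδ.le).trans_lt hN
    rw [div_lt_iff₀ hδ] at hN
    set t : ℕ → ℝ := fun i => a + i * ((b - a) / N) with ht
    have hstep : ∀ i, t (i + 1) = t i + (b - a) / N := fun i => by simp [ht]; ring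
    have hpos : 0 ≤ (b - a) / N := div_nonneg (sub_nonneg.2 hab) hN0.le
    have htN : t N = b := by simp [ht]; field_simp; ring
    have ht0 : t 0 = a := by simp [ht]
    have hmem : ∀ i, i ≤ N → t i ∈ Icc a b := by
      intro i hi
      refine ⟨by simp only [ht]; have : 0 ≤ (i : ℝ) * ((b - a) / N) := by positivity
                 linarith, ?_⟩
      rw [← htN]
      simp only [ht]
      gcongr
    have hind : ∀ i, i ≤ N → f (t i) - f a ≤ C * ε * (M (t i) - M a) := by
      intro i
      induction i with
      | zero => intro _; rw [ht0]; simp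
      | succ i ih =>
        intro hi
        have h1 := hmem i (by omega)
        have h2 := hmem (i + 1) hi
        have hle : t i ≤ t (i + 1) := by rw [hstep]; linarith
        have h3 := h _ h1 _ h2 hle
        have h4 : dist (M (t i)) (M (t (i + 1))) < ε := by
          refine hδ' _ h1 _ h2 ?_
          rw [Real.dist_eq, hstep, sub_add_cancel_left, abs_neg, abs_of_nonneg hpos,
            div_lt_iff₀ hN0]
          linarith
        have h5 : 0 ≤ M (t (i + 1)) - M (t i) := sub_nonneg.2 (hmono h1 h2 hle)
        rw [Real.dist_eq, abs_sub_comm, abs_of_nonneg h5] at h4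
        have h6 : C * (M (t (i + 1)) - M (t i)) ^ 2 ≤ C * ε * (M (t (i + 1)) - M (t i)) := by
          rw [sq, ← mul_assoc]
          gcongr
        linarith [ih (by omega)]
    have := hind N le_rfl
    rwa [htN] at this
  have h1 : Tendsto (fun ε : ℝ => C * ε * (M b - M a)) (𝓝[>] 0) (𝓝 (C * 0 * (M b - M a))) := by
    have : Continuous fun ε : ℝ => C * ε * (M b - M a) := by fun_prop
    exact (this.tendsto 0).mono_left nhdsWithin_le_nhds
  have h2 := ge_of_tendsto h1 (eventually_nhdsWithin_of_forall fun ε hε => key ε hε)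
  linarith

/-- The function `D · ∇φ + δ φ`. -/
def divTest (D : Torus d → EuclideanSpace ℝ (Fin d)) (δ φ : Torus d → ℝ) (x : Torus d) : ℝ :=
  (∑ i, D x i * partialDeriv i φ x) + δ x * φ x

/-- The divergence of a smooth field. -/
def divergence (D : Torus d → EuclideanSpace ℝ (Fin d)) (x : Torus d) : ℝ :=
  ∑ i, partialDeriv i (fun y => D y i) x

lemma abs_gradForm_le {f : Torus d → ℝ} (hf : IsSmooth f) {ℓ : ℝ} (hℓ : 0 ≤ ℓ)
    (hfl : ∀ x w, |f (x + eproj w) - f x| ≤ ℓ * ‖w‖) (x : Torus d)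
    (w : EuclideanSpace ℝ (Fin d)) : |gradForm f x w.ofLp| ≤ ℓ * ‖w‖ := by
  have h1 := hf.hasDerivAt_line x w.ofLp 0
  rw [zero_smul, proj_zero, add_zero] at h1
  refine h1.le_of_lip' (by positivity) (Eventually.of_forall fun h => ?_)
  have h2 := hfl x (h • w)
  rw [norm_smul] at h2
  rw [zero_smul, proj_zero, add_zero, sub_zero, Real.norm_eq_abs]
  calc _ ≤ ℓ * (‖h‖ * ‖w‖) := h2
    _ = _ := by ring

lemma continuous_of_isSmooth {D : Torus d → EuclideanSpace ℝ (Fin d)}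
    (hD : ∀ i, IsSmooth fun x => D x i) : Continuous D := by
  have h : Continuous fun x => (D x).ofLp := continuous_pi fun i => (hD i).continuous
  exact (PiLp.continuous_toLp 2 _).comp h

lemma continuous_gradForm {f : Torus d → ℝ} (hf : IsSmooth f) : Continuous (gradForm f) := by
  unfold gradForm
  exact continuous_finsetSum _ fun j _ => (hf.partialDeriv j).continuous.smul continuous_const

lemma continuous_divTest {D : Torus d → EuclideanSpace ℝ (Fin d)} (hD : Continuous D)
    {δ φ : Torus d → ℝ} (hδ : Continuous δ) (hφ : IsSmooth φ) : Continuous (divTest D δ φ) := by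
  unfold divTest
  refine (continuous_finsetSum _ fun i _ => ?_).add (hδ.mul hφ.continuous)
  exact ((EuclideanSpace.proj (𝕜 := ℝ) i).continuous.comp hD).mul (hφ.partialDeriv i).continuous

lemma continuous_divergence {D : Torus d → EuclideanSpace ℝ (Fin d)}
    (hD : ∀ i, IsSmooth fun x => D x i) : Continuous (divergence D) :=
  continuous_finsetSum _ fun i _ => ((hD i).partialDeriv i).continuous

lemma integral_gradForm_mul {f φ : Torus d → ℝ} (hf : IsSmooth f) (hφ : IsSmooth φ)
    {D : Torus d → EuclideanSpace ℝ (Fin d)} (hD : ∀ i, IsSmooth fun x => D x i) :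
    ∫ x, gradForm f x (D x).ofLp * φ x = -∫ x, f x * divTest D (divergence D) φ x := by
  have h1 : ∀ x, gradForm f x (D x).ofLp * φ x + f x * divTest D (divergence D) φ x =
      ∑ i, partialDeriv i (fun y => f y * (D y i * φ y)) x := by
    intro x
    rw [gradForm_apply, divTest, divergence, Finset.sum_mul, Finset.sum_mul,
      ← Finset.sum_add_distrib, Finset.mul_sum, ← Finset.sum_add_distrib]
    refine Finset.sum_congr rfl fun i _ => ?_
    rw [partialDeriv_mul i hf ((hD i).mul hφ), partialDeriv_mul i (hD i) hφ]
    ring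
  have hDc := continuous_of_isSmooth hD
  have h2 : Integrable fun x => gradForm f x (D x).ofLp * φ x :=
    integrable_of_continuous (((continuous_gradForm hf).clm_apply
      ((PiLp.continuous_ofLp 2 _).comp hDc)).mul hφ.continuous)
  have h3 : Integrable fun x => f x * divTest D (divergence D) φ x :=
    integrable_of_continuous (hf.continuous.mul
      (continuous_divTest hDc (continuous_divergence hD) hφ))
  rw [eq_neg_iff_add_eq_zero, ← integral_add h2 h3, integral_congr_ae (Eventually.of_forall h1),
    integral_finsetSum]
  · exact Finset.sum_eq_zero fun i _ => integral_partialDeriv i (hf.mul ((hD i).mul hφ))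
  · exact fun i _ => integrable_of_continuous ((hf.mul ((hD i).mul hφ)).partialDeriv i).continuous

lemma isSmooth_shift {f : Torus d → ℝ} (hf : IsSmooth f)
    {D : Torus d → EuclideanSpace ℝ (Fin d)} (hD : ∀ i, IsSmooth fun x => D x i) (τ : ℝ) :
    IsSmooth fun x => f (x - eproj (τ • D x)) := by
  have h1 : ContDiff ℝ ((⊤ : ℕ∞) : WithTop ℕ∞) fun v : Fin d → ℝ => v - τ • (D (proj v)).ofLp :=
    contDiff_id.sub ((contDiff_pi.2 fun i => (hD i).contDiff).const_smul τ)
  exact hf.contDiff.comp h1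

lemma abs_integral_shift_sub_le_of_isSmooth {f φ : Torus d → ℝ} (hf : IsSmooth f)
    (hφ : IsSmooth φ) {D : Torus d → EuclideanSpace ℝ (Fin d)} (hD : ∀ i, IsSmooth fun x => D x i)
    {ℓ a a' A B : ℝ} (hℓ : 0 ≤ ℓ) (ha'0 : 0 ≤ a')
    (hfl : ∀ x w, |f (x + eproj w) - f x| ≤ ℓ * ‖w‖)
    (ha : ∀ x, ‖D x‖ ≤ a) (ha' : ∀ x w, ‖D (x + eproj w) - D x‖ ≤ a' * ‖w‖)
    (hA : ∀ x, |φ x| ≤ A) (hB : ∀ x, |divTest D (divergence D) φ x| ≤ B) :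
    |(∫ x, f (x - eproj (D x)) * φ x) - (∫ x, f x * φ x) -
      ∫ x, f x * divTest D (divergence D) φ x| ≤ ℓ * a * (a' * A + B) := by
  have ha0 : 0 ≤ a := (norm_nonneg _).trans (ha 0)
  have hA0 : 0 ≤ A := (abs_nonneg _).trans (hA 0)
  have hDc := continuous_of_isSmooth hD
  have hDo : Continuous fun x => (D x).ofLp := (PiLp.continuous_ofLp 2 _).comp hDc
  have hTc := continuous_divTest hDc (continuous_divergence hD) hφ
  set g : ℝ → Torus d → ℝ := fun τ x => f (x - eproj (τ • D x)) with hg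
  set k : ℝ → Torus d → ℝ := fun τ x => gradForm f (x - eproj (τ • D x)) (-D x).ofLp with hk
  have hgs : ∀ τ, IsSmooth (g τ) := fun τ => isSmooth_shift hf hD τ
  have hshift : ∀ (τ : ℝ) x, x - eproj (τ • D x) = x + proj (τ • (-D x).ofLp) := fun τ x => by
    rw [sub_eq_add_neg, ← eproj_neg, ← smul_neg]; rfl
  have hkc : ∀ τ, Continuous (k τ) := fun τ =>
    ((continuous_gradForm hf).comp (continuous_id.sub (continuous_eproj.comp
      (hDc.const_smul τ)))).clm_apply hDo.neg
  have hk_le : ∀ τ x, |k τ x| ≤ ℓ * a := fun τ x => by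
    refine (abs_gradForm_le hf hℓ hfl _ (-D x)).trans ?_
    rw [norm_neg]
    gcongr
    exact ha x
  have hkg : ∀ τ ∈ Icc (0 : ℝ) 1, ∀ x, |gradForm (g τ) x (D x).ofLp + k τ x| ≤ ℓ * (a' * a) := by
    intro τ hτ x
    have h1 := (hgs τ).hasDerivAt_line x (D x).ofLp 0
    have h2 := ((hf.hasDerivAt_line x (D x).ofLp (0 - τ)).comp (0 : ℝ)
      ((hasDerivAt_id (0 : ℝ)).sub_const τ))
    have h3 := h1.sub h2
    have h4 : gradForm (g τ) (x + proj ((0 : ℝ) • (D x).ofLp)) (D x).ofLp -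
        gradForm f (x + proj ((0 - τ) • (D x).ofLp)) (D x).ofLp * 1 =
        gradForm (g τ) x (D x).ofLp + k τ x := by
      rw [zero_smul, proj_zero, add_zero, mul_one, sub_eq_add_neg, hk]
      simp only
      rw [hshift, ← map_neg, zero_sub, neg_smul, ← smul_neg]
      rfl
    rw [h4] at h3
    rw [← Real.norm_eq_abs]
    refine h3.le_of_lip' (by positivity) (Eventually.of_forall fun h => ?_)
    simp only [Pi.sub_apply, Function.comp, id]
    have h5 : g τ (x + proj ((0 : ℝ) • (D x).ofLp)) - f (x + proj ((0 - τ) • (D x).ofLp)) = 0 := by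
      rw [zero_smul, proj_zero, add_zero, zero_sub, neg_smul, ← smul_neg, hg]
      simp only
      rw [hshift]
      exact sub_self _
    rw [h5, sub_zero, sub_zero]
    have h6 := hfl (x + proj ((h - τ) • (D x).ofLp)) (-(τ • (D (x + eproj (h • D x)) - D x)))
    have h7 : x + proj ((h - τ) • (D x).ofLp) + eproj (-(τ • (D (x + eproj (h • D x)) - D x))) =
        x + proj (h • (D x).ofLp) - eproj (τ • D (x + proj (h • (D x).ofLp))) := by
      have h8 : proj ((h - τ) • (D x).ofLp) = eproj (h • D x) - eproj (τ • D x) := by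
        rw [sub_smul, proj_sub]; rfl
      have h9 : proj (h • (D x).ofLp) = eproj (h • D x) := rfl
      rw [h8, h9, eproj_neg, smul_sub, eproj_sub]
      abel
    rw [h7] at h6
    refine h6.trans ?_
    rw [norm_neg, norm_smul, Real.norm_of_nonneg hτ.1, mul_assoc]
    refine mul_le_mul_of_nonneg_left ?_ hℓ
    have h10 := ha' x (h • D x)
    rw [norm_smul] at h10
    calc τ * ‖D (x + eproj (h • D x)) - D x‖ ≤ 1 * (a' * (‖h‖ * a)) := by
          refine mul_le_mul hτ.2 (h10.trans ?_) (norm_nonneg _) zero_le_one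
          gcongr
          exact ha x
      _ = a' * a * ‖h‖ := by ring
  set I := ∫ x, f x * divTest D (divergence D) φ x with hI
  have hderiv : ∀ τ, HasDerivAt (fun τ => (∫ x, g τ x * φ x) - τ * I)
      ((∫ x, k τ x * φ x) - I) τ := by
    intro τ
    have h1 := (hasDerivAt_integral_of_dominated_loc_of_deriv_le
      (μ := (volume : Measure (Torus d))) (F := fun τ x => g τ x * φ x)
      (F' := fun τ x => k τ x * φ x) (x₀ := τ) (bound := fun _ => ℓ * a * A) univ_mem
      (Eventually.of_forall fun s =>
        ((hgs s).continuous.mul hφ.continuous).aestronglyMeasurable)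
      (integrable_of_continuous ((hgs τ).continuous.mul hφ.continuous))
      ((hkc τ).mul hφ.continuous).aestronglyMeasurable
      (Eventually.of_forall fun x s _ => by
        rw [norm_mul]
        exact mul_le_mul (hk_le s x) (hA x) (norm_nonneg _) (by positivity))
      (integrable_const _)
      (Eventually.of_forall fun x s _ => by
        have h2 := (hf.hasDerivAt_line x (-D x).ofLp s).mul_const (φ x)
        simp_rw [← hshift] at h2
        exact h2)).2
    have h2 := h1.sub ((hasDerivAt_id τ).mul_const I)
    rw [one_mul] at h2
    exact h2
  have hbound : ∀ τ ∈ Ico (0 : ℝ) 1, ‖(∫ x, k τ x * φ x) - I‖ ≤ ℓ * a * (a' * A + B) := by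
    intro τ hτ
    have hτ' : τ ∈ Icc (0 : ℝ) 1 := ⟨hτ.1, hτ.2.le⟩
    have hgr : Continuous fun x => gradForm (g τ) x (D x).ofLp :=
      (continuous_gradForm (hgs τ)).clm_apply hDo
    have h1 : (∫ x, k τ x * φ x) - I = (∫ x, (gradForm (g τ) x (D x).ofLp + k τ x) * φ x) +
        ∫ x, (g τ x - f x) * divTest D (divergence D) φ x := by
      have h2 := integral_gradForm_mul (hgs τ) hφ hD
      simp_rw [add_mul, sub_mul]
      have i1 : Integrable fun x => gradForm (g τ) x (D x).ofLp * φ x :=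
        integrable_of_continuous (hgr.mul hφ.continuous)
      have i2 : Integrable fun x => k τ x * φ x :=
        integrable_of_continuous ((hkc τ).mul hφ.continuous)
      have i3 : Integrable fun x => g τ x * divTest D (divergence D) φ x :=
        integrable_of_continuous ((hgs τ).continuous.mul hTc)
      have i4 : Integrable fun x => f x * divTest D (divergence D) φ x :=
        integrable_of_continuous (hf.continuous.mul hTc)
      rw [integral_add i1 i2, integral_sub i3 i4, h2]
      ring
    rw [h1]
    have h3 : ‖∫ x, (gradForm (g τ) x (D x).ofLp + k τ x) * φ x‖ ≤ ℓ * (a' * a) * A := by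
      refine (norm_integral_le_of_norm_le_const (Eventually.of_forall fun x => ?_)).trans
        (by simp : (ℓ * (a' * a) * A) * (volume : Measure (Torus d)).real univ ≤ _)
      rw [norm_mul]
      exact mul_le_mul (hkg τ hτ' x) (hA x) (norm_nonneg _) (by positivity)
    have h4 : ‖∫ x, (g τ x - f x) * divTest D (divergence D) φ x‖ ≤ ℓ * a * B := by
      refine (norm_integral_le_of_norm_le_const (Eventually.of_forall fun x => ?_)).trans
        (by simp : (ℓ * a * B) * (volume : Measure (Torus d)).real univ ≤ _)
      rw [norm_mul]
      refine mul_le_mul ?_ (hB x) (norm_nonneg _) (by positivity)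
      have h5 := hfl x (-(τ • D x))
      rw [norm_neg, norm_smul, Real.norm_of_nonneg hτ.1, eproj_neg, ← sub_eq_add_neg] at h5
      refine h5.trans (mul_le_mul_of_nonneg_left ?_ hℓ)
      calc τ * ‖D x‖ ≤ 1 * a := mul_le_mul hτ.2.le (ha x) (norm_nonneg _) zero_le_one
        _ = a := one_mul a
    refine (norm_add_le _ _).trans ((add_le_add h3 h4).trans (le_of_eq ?_))
    ring
  have h := norm_image_sub_le_of_norm_deriv_le_segment_01'
    (fun τ _ => (hderiv τ).hasDerivWithinAt) hbound
  simp only [hg, one_smul, zero_smul, eproj_zero, sub_zero, one_mul, zero_mul] at h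
  rw [← Real.norm_eq_abs, sub_right_comm]
  exact h

lemma abs_mollify_sub_le {c r : ℝ} {ρ : Torus d → ℝ} (hρ : IsMollifier c r ρ) {f : Torus d → ℝ}
    (hf : Continuous f) {ℓ : ℝ} (hfl : ∀ x w, |f (x + eproj w) - f x| ≤ ℓ * ‖w‖) (x : Torus d)
    (w : EuclideanSpace ℝ (Fin d)) :
    |mollify ρ f (x + eproj w) - mollify ρ f x| ≤ ℓ * ‖w‖ := by
  have hi : ∀ x, Integrable fun y => ρ y • f (x - y) := fun x =>
    integrable_of_continuous (hρ.smooth.continuous.smul (by fun_prop))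
  rw [mollify_eq, mollify_eq, ← integral_sub (hi _) (hi _)]
  have h3 : ∫ y, ρ y * (ℓ * ‖w‖) = ℓ * ‖w‖ := by
    rw [integral_mul_const, hρ.integral_eq_one, one_mul]
  rw [← Real.norm_eq_abs, ← h3]
  refine norm_integral_le_of_norm_le (hρ.integrable.mul_const _) (Eventually.of_forall fun y => ?_)
  rw [← smul_sub, norm_smul, Real.norm_of_nonneg (hρ.nonneg y)]
  refine mul_le_mul_of_nonneg_left ?_ (hρ.nonneg y)
  rw [add_sub_right_comm]
  exact hfl _ w

lemma continuous_of_lipschitz {f : Torus d → ℝ} {ℓ : ℝ} (hℓ : 0 ≤ ℓ)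
    (hfl : ∀ x w, |f (x + eproj w) - f x| ≤ ℓ * ‖w‖) : Continuous f := by
  refine LipschitzWith.continuous (K := (ℓ * Real.sqrt d).toNNReal)
    (LipschitzWith.of_dist_le_mul fun y x => ?_)
  obtain ⟨w, rfl, hw⟩ := exists_elift_small x y
  rw [Real.coe_toNNReal _ (by positivity), Real.dist_eq, mul_assoc, dist_comm]
  exact (hfl x w).trans (mul_le_mul_of_nonneg_left hw hℓ)

/-- Pulling a Lipschitz function back by the identity minus a small smooth field, to first order. -/
lemma abs_integral_shift_sub_le {f φ : Torus d → ℝ}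
    (hφ : IsSmooth φ) {D : Torus d → EuclideanSpace ℝ (Fin d)} (hD : ∀ i, IsSmooth fun x => D x i)
    {ℓ a a' A B : ℝ} (hℓ : 0 ≤ ℓ) (ha'0 : 0 ≤ a')
    (hfl : ∀ x w, |f (x + eproj w) - f x| ≤ ℓ * ‖w‖)
    (ha : ∀ x, ‖D x‖ ≤ a) (ha' : ∀ x w, ‖D (x + eproj w) - D x‖ ≤ a' * ‖w‖)
    (hA : ∀ x, |φ x| ≤ A) (hB : ∀ x, |divTest D (divergence D) φ x| ≤ B) :
    |(∫ x, f (x - eproj (D x)) * φ x) - (∫ x, f x * φ x) -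
      ∫ x, f x * divTest D (divergence D) φ x| ≤ ℓ * a * (a' * A + B) := by
  have hfc := continuous_of_lipschitz hℓ hfl
  have hDc := continuous_of_isSmooth hD
  have hTc := continuous_divTest hDc (continuous_divergence hD) hφ
  set F : ℕ → Torus d → ℝ := fun n => mollify (stdMollifier d n) f with hF
  have hFs : ∀ n, IsSmooth (F n) := fun n =>
    (isMollifier_stdMollifier n).smooth.mollify (integrable_of_continuous hfc)
  have hFf : ∀ n x, ‖F n x - f x‖ ≤ ℓ * Real.sqrt d * Real.exp (-n) := by
    intro n x
    refine norm_mollify_sub_self_le (isMollifier_stdMollifier n) (integrable_of_continuous hfc)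
      (fun x y hxy => ?_) x
    obtain ⟨w, rfl, hw⟩ := exists_elift_small x y
    refine (hfl x w).trans ?_
    rw [mul_assoc]
    exact mul_le_mul_of_nonneg_left (hw.trans (by gcongr)) hℓ
  have hlim : ∀ (S : Torus d → Torus d) (h : Torus d → ℝ), Continuous S → Continuous h →
      Tendsto (fun n => ∫ x, F n (S x) * h x) atTop (𝓝 (∫ x, f (S x) * h x)) := by
    intro S h hS hh
    refine tendsto_integral_of_dominated_convergence
      (fun x => (ℓ * Real.sqrt d + ‖f (S x)‖) * ‖h x‖)
      (fun n => (((hFs n).continuous.comp hS).mul hh).aestronglyMeasurable)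
      (integrable_of_continuous (by fun_prop)) (fun n => Eventually.of_forall fun x => ?_)
      (Eventually.of_forall fun x => ?_)
    · rw [norm_mul]
      gcongr
      have h1 := hFf n (S x)
      have h2 : ℓ * Real.sqrt d * Real.exp (-n) ≤ ℓ * Real.sqrt d * 1 := by
        gcongr
        exact Real.exp_le_one_iff.2 (by simp)
      linarith [norm_le_norm_sub_add (F n (S x)) (f (S x))]
    · refine Tendsto.mul_const _ ?_
      rw [tendsto_iff_norm_sub_tendsto_zero]
      refine squeeze_zero (fun n => norm_nonneg _) (fun n => hFf n (S x)) ?_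
      simpa using (tendsto_exp_neg_nat).const_mul (ℓ * Real.sqrt d)
  refine le_of_tendsto' (((hlim (fun x => x - eproj (D x)) φ
    (continuous_id.sub (continuous_eproj.comp hDc)) hφ.continuous).sub
    (hlim id φ continuous_id hφ.continuous)).sub (hlim id _ continuous_id hTc)).abs fun n => ?_
  exact abs_integral_shift_sub_le_of_isSmooth (hFs n) hφ hD hℓ ha'0
    (abs_mollify_sub_le (isMollifier_stdMollifier n) hfc hfl) ha ha' hA hB

end

end TorusTransport


namespace TorusTransport

noncomputable section

variable {d : ℕ}

/-! ### Weak formulation for smooth fields -/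

lemma HasFlow.exists_lipschitz {C : ℝ} {m : ℝ → ℝ} {b : ℝ → Torus d → EuclideanSpace ℝ (Fin d)}
    (h : HasFlow b) (hb : IsVelocity C m b) {Λ : ℝ} (hΛ : 0 ≤ Λ)
    (hlip : ∀ t x w, ‖b t (x + eproj w) - b t x‖ ≤ Λ * ‖w‖) (s t : ℝ) (x : Torus d)
    (w : EuclideanSpace ℝ (Fin d)) : ∃ v : EuclideanSpace ℝ (Fin d),
      flow b s t (x + eproj w) = flow b s t x + eproj v ∧
        ‖v‖ ≤ Real.exp (Λ * |t - s|) * ‖w‖ := by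
  have hZ := h.isTraj s x
  have hZ' := h.isTraj s (x + eproj w)
  refine ⟨_, hZ.eq_gap hb hb hZ' t, ?_⟩
  set Z := fun t => flow b s t x
  set Z' := fun t => flow b s t (x + eproj w)
  have hi : Integrable fun σ => b σ (Z' σ) - b σ (Z σ) :=
    (hb.integrable_comp hZ'.continuous).sub (hb.integrable_comp hZ.continuous)
  have hcont : Continuous fun t => gap b b Z Z' s w t := continuous_add_primitive hi w s
  have h1 := gronwall_abs hcont.norm (fun t => norm_nonneg _) (norm_nonneg w) hΛ le_rfl (s := s)
    (fun t => by
      refine (norm_add_le _ _).trans (add_le_add le_rfl ?_)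
      refine intervalIntegral.norm_integral_le_abs_of_norm_le (Eventually.of_forall fun σ => ?_)
        (Continuous.intervalIntegrable (by fun_prop) _ _)
      rw [hZ.eq_gap hb hb hZ' σ, add_zero]
      exact hlip _ _ _) t
  simpa [mul_comm] using h1

lemma HasFlow.exists_displacement {C : ℝ} {m : ℝ → ℝ}
    {b : ℝ → Torus d → EuclideanSpace ℝ (Fin d)}
    (h : HasFlow b) (hb : IsVelocity C m b) (s t : ℝ) (x : Torus d) :
    ∃ v : EuclideanSpace ℝ (Fin d), flow b s t x = x + eproj v ∧ ‖v‖ ≤ |∫ σ in s..t, m σ| :=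
  ⟨_, (h.isTraj s x).eq t, intervalIntegral.norm_integral_le_abs_of_norm_le
    (Eventually.of_forall fun _ => hb.norm_le _ _) hb.integrable.intervalIntegrable⟩

/-- A bound for `D · ∇φ + δ φ`. -/
lemma exists_divTest_le {φ : Torus d → ℝ} (hφ : IsSmooth φ) : ∃ A : ℝ, 0 ≤ A ∧
    (∀ x, |φ x| ≤ A) ∧ ∀ (D : Torus d → EuclideanSpace ℝ (Fin d)) (δ : Torus d → ℝ) (x : Torus d),
      |divTest D δ φ x| ≤ A * (‖D x‖ + |δ x|) := by
  have h1 : ∀ i, ∃ C : ℝ, 0 ≤ C ∧ ∀ x, ‖partialDeriv i φ x‖ ≤ C := fun i =>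
    exists_bound_of_continuous (hφ.partialDeriv i).continuous
  choose A hA0 hA using h1
  obtain ⟨A', hA'0, hA'⟩ := exists_bound_of_continuous hφ.continuous
  have hs : 0 ≤ ∑ i, A i := Finset.sum_nonneg fun i _ => hA0 i
  refine ⟨(∑ i, A i) + A', by positivity, fun x => ?_, fun D δ x => ?_⟩
  · have := hA' x
    rw [Real.norm_eq_abs] at this
    linarith
  · rw [divTest]
    have h2 : |∑ i, D x i * partialDeriv i φ x| ≤ (∑ i, A i) * ‖D x‖ := by
      refine (Finset.abs_sum_le_sum_abs _ _).trans ?_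
      rw [Finset.sum_mul]
      refine Finset.sum_le_sum fun i _ => ?_
      rw [abs_mul, mul_comm]
      exact mul_le_mul (hA i x) (PiLp.norm_apply_le (D x) i) (abs_nonneg _) (hA0 i)
    have h3 : |δ x * φ x| ≤ |δ x| * A' := by
      rw [abs_mul]
      exact mul_le_mul_of_nonneg_left (hA' x) (abs_nonneg _)
    refine (abs_add_le _ _).trans ((add_le_add h2 h3).trans ?_)
    nlinarith [norm_nonneg (D x), abs_nonneg (δ x)]

lemma mollify_intervalIntegral {h : ℝ → Torus d → ℝ}
    (hh : Integrable (fun z : ℝ × Torus d => h z.1 z.2) (volume.prod volume)) {κ : Torus d → ℝ}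
    (hκ : Continuous κ) {s t : ℝ} (hst : s ≤ t) (x : Torus d) :
    mollify κ (fun y => ∫ σ in s..t, h σ y) x = ∫ σ in s..t, mollify κ (h σ) x := by
  obtain ⟨C, _, hC⟩ := exists_bound_of_continuous hκ
  simp_rw [mollify, intervalIntegral.integral_of_le hst, ← integral_smul]
  refine integral_integral_swap ?_
  have h1 : Integrable (fun z : Torus d × ℝ => h z.2 z.1)
      (volume.prod (volume.restrict (Ioc s t))) := by
    have h2 := hh.swap
    refine h2.mono_measure ?_
    rw [← Measure.restrict_univ (μ := (volume : Measure (Torus d))), Measure.prod_restrict]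
    exact Measure.restrict_le_self.trans (by rw [Measure.restrict_univ])
  exact h1.bdd_smul C ((hκ.comp (continuous_const.sub continuous_fst)).aestronglyMeasurable)
    (Eventually.of_forall fun z => hC _)

namespace IsSobolevField

variable {T β K L : ℝ} {b : ℝ → Torus d → EuclideanSpace ℝ (Fin d)}
    {G : ℝ → Torus d → Matrix (Fin d) (Fin d) ℝ}

/-- The displacement field between two times along the mollified field frozen in space. -/
def _root_.TorusTransport.approxDisp (b : ℝ → Torus d → EuclideanSpace ℝ (Fin d)) (n : ℕ)
    (s t : ℝ) (x : Torus d) : EuclideanSpace ℝ (Fin d) := ∫ σ in s..t, approxField b n σ x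

/-- The divergence of the mollified field. -/
def _root_.TorusTransport.approxDiv (G : ℝ → Torus d → Matrix (Fin d) (Fin d) ℝ) (n : ℕ) (t : ℝ) :
    Torus d → ℝ := mollify (stdMollifier d n) fun y => (G t y).trace

lemma divergence_approxField (hb : IsSobolevField T β K L b G) (n : ℕ) (t : ℝ) :
    divergence (approxField b n t) = approxDiv G n t :=
  funext fun x => hb.sum_partialDeriv_approxField n t x

lemma measurable_approxDiv (hb : IsSobolevField T β K L b G) (n : ℕ) :
    Measurable (Function.uncurry (approxDiv G n)) := by
  have h1 : StronglyMeasurable fun q : (ℝ × Torus d) × Torus d =>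
      stdMollifier d n (q.1.2 - q.2) • (G q.1.1 q.2).trace := by
    have h2 := (isMollifier_stdMollifier (d := d) n).smooth.continuous.measurable
    have h3 : Measurable fun q : (ℝ × Torus d) × Torus d => (G q.1.1 q.2).trace :=
      hb.measurable_trace.comp ((measurable_fst.comp measurable_fst).prodMk measurable_snd)
    exact ((h2.comp ((measurable_snd.comp measurable_fst).sub measurable_snd)).smul
      h3).stronglyMeasurable
  exact h1.integral_prod_right'.measurable

lemma intervalIntegrable_approxField (hb : IsSobolevField T β K L b G) (n : ℕ) (x : Torus d)
    (s t : ℝ) : IntervalIntegrable (fun σ => approxField b n σ x) volume s t :=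
  ((hb.isVelocity_approxField n).integrable_comp (Z := fun _ => x)
    continuous_const).intervalIntegrable

lemma integrable_coord (hb : IsSobolevField T β K L b G) (i : Fin d) :
    Integrable (fun z : ℝ × Torus d => b z.1 z.2 i) (volume.prod volume) :=
  (EuclideanSpace.proj (𝕜 := ℝ) i).integrable_comp hb.integrable

lemma integrable_timeAverage (hb : IsSobolevField T β K L b G) {s t : ℝ} (hst : s ≤ t)
    (i : Fin d) : Integrable fun y => ∫ σ in s..t, b σ y i := by
  simp_rw [intervalIntegral.integral_of_le hst]
  have h2 := (hb.integrable_coord i).swap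
  have h3 : Integrable (fun z : Torus d × ℝ => b z.2 z.1 i)
      (volume.prod (volume.restrict (Ioc s t))) := by
    refine h2.mono_measure ?_
    rw [← Measure.restrict_univ (μ := (volume : Measure (Torus d))), Measure.prod_restrict]
    exact Measure.restrict_le_self.trans (by rw [Measure.restrict_univ])
  exact h3.integral_prod_left

lemma approxDisp_apply (hb : IsSobolevField T β K L b G) (n : ℕ) {s t : ℝ} (hst : s ≤ t)
    (i : Fin d) : (fun x => approxDisp b n s t x i) =
      mollify (stdMollifier d n) fun y => ∫ σ in s..t, b σ y i := by
  funext x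
  have hρ := (isMollifier_stdMollifier (d := d) n).smooth.continuous
  rw [mollify_intervalIntegral (h := fun σ y => b σ y i) (hb.integrable_coord i) hρ hst]
  have h1 := (EuclideanSpace.proj (𝕜 := ℝ) i).intervalIntegral_comp_comm
    (hb.intervalIntegrable_approxField n x s t)
  refine h1.symm.trans (intervalIntegral.integral_congr fun σ _ => ?_)
  exact mollify_apply hρ (hb.isWeakGradient σ).integrable x i

lemma isSmooth_approxDisp (hb : IsSobolevField T β K L b G) (n : ℕ) {s t : ℝ} (hst : s ≤ t)
    (i : Fin d) : IsSmooth fun x => approxDisp b n s t x i := by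
  rw [hb.approxDisp_apply n hst]
  exact (isMollifier_stdMollifier n).smooth.mollify (hb.integrable_timeAverage hst i)

lemma intervalIntegrable_of_le_fieldBound (hb : IsSobolevField T β K L b G) {V : Type*}
    [NormedAddCommGroup V] {f : ℝ → V} (hf : AEStronglyMeasurable f) {A : ℝ}
    (h : ∀ σ, ‖f σ‖ ≤ A * (fieldBound T β K b σ + 1)) (s t : ℝ) :
    IntervalIntegrable f volume s t := by
  have h1 : IntervalIntegrable (fun σ => A * (fieldBound T β K b σ + 1)) volume s t :=
    (hb.integrable_fieldBound.intervalIntegrable.add intervalIntegrable_const).const_mul A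
  exact h1.mono_fun hf.restrict (Eventually.of_forall fun σ =>
    (h σ).trans (le_abs_self _))

lemma divTest_approxDisp (hb : IsSobolevField T β K L b G) (n : ℕ) {s t : ℝ} (hst : s ≤ t)
    {φ : Torus d → ℝ} (x : Torus d) :
    divTest (approxDisp b n s t) (divergence (approxDisp b n s t)) φ x =
      ∫ σ in s..t, divTest (approxField b n σ) (approxDiv G n σ) φ x := by
  have hρ := (isMollifier_stdMollifier (d := d) n).smooth
  have hdi : ∀ i, IntervalIntegrable (fun σ => approxField b n σ x i) volume s t := fun i =>
    ((EuclideanSpace.proj (𝕜 := ℝ) i).integrable_comp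
      ((hb.isVelocity_approxField n).integrable_comp (Z := fun _ => x)
        continuous_const)).intervalIntegrable
  have hdv : ∀ y, IntervalIntegrable (fun σ => approxDiv G n σ y) volume s t := fun y => by
    refine hb.intervalIntegrable_of_le_fieldBound (A := L)
      ((hb.measurable_approxDiv n).comp measurable_prodMk_right).aestronglyMeasurable
      (fun σ => ?_) s t
    refine (hb.abs_mollify_trace_le n σ y).trans ?_
    have := (hb.isVelocity).nonneg σ
    nlinarith [hb.nonneg]
  have h1 : divergence (approxDisp b n s t) x = ∫ σ in s..t, approxDiv G n σ x := by
    rw [divergence]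
    simp_rw [hb.approxDisp_apply n hst, partialDeriv_mollify hρ (hb.integrable_timeAverage hst _),
      mollify_intervalIntegral (h := fun σ y => b σ y _) (hb.integrable_coord _)
        (hρ.partialDeriv _).continuous hst]
    rw [← intervalIntegral.integral_finsetSum]
    · refine intervalIntegral.integral_congr fun σ _ => ?_
      rw [← congrFun (hb.divergence_approxField n σ) x, divergence]
      refine Finset.sum_congr rfl fun i _ => ?_
      have h2 : (fun x => approxField b n σ x i) = mollify (stdMollifier d n) fun y => b σ y i :=
        funext fun x => mollify_apply hρ.continuous (hb.isWeakGradient σ).integrable x i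
      rw [h2, partialDeriv_mollify hρ (integrable_apply (hb.isWeakGradient σ).integrable i)]
    · intro i _
      obtain ⟨C, _, hC⟩ := exists_bound_of_continuous (hρ.partialDeriv i).continuous
      have h3 : StronglyMeasurable fun σ => mollify (partialDeriv i (stdMollifier d n))
          (fun y => b σ y i) x := by
        have h4 : Measurable fun q : ℝ × Torus d =>
            partialDeriv i (stdMollifier d n) (x - q.2) • b q.1 q.2 i := by
          have h5 : Measurable fun q : ℝ × Torus d => b q.1 q.2 i :=
            (EuclideanSpace.proj (𝕜 := ℝ) i).continuous.measurable.comp hb.measurable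
          exact ((hρ.partialDeriv i).continuous.measurable.comp
            (measurable_const.sub measurable_snd)).smul h5
        exact h4.stronglyMeasurable.integral_prod_right'
      have h6 : Integrable fun σ => C * ∫ y, ‖b σ y i‖ :=
        (hb.integrable_coord i).integral_norm_prod_left.const_mul C
      refine (h6.mono' h3.aestronglyMeasurable (Eventually.of_forall fun σ => ?_)).intervalIntegrable
      exact norm_mollify_le hC (integrable_apply (hb.isWeakGradient σ).integrable i) x
  have h2 : ∀ i, approxDisp b n s t x i = ∫ σ in s..t, approxField b n σ x i := fun i =>
    ((EuclideanSpace.proj (𝕜 := ℝ) i).intervalIntegral_comp_comm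
      (hb.intervalIntegrable_approxField n x s t)).symm
  simp only [divTest, h1, h2]
  rw [intervalIntegral.integral_add, intervalIntegral.integral_finsetSum]
  · simp_rw [intervalIntegral.integral_mul_const]
  · exact fun i _ => (hdi i).mul_const _
  · have h := IntervalIntegrable.sum Finset.univ
      (f := fun i σ => approxField b n σ x i * partialDeriv i φ x) fun i _ => (hdi i).mul_const _
    rwa [Finset.sum_fn] at h
  · exact (hdv x).mul_const _

end IsSobolevField

end

end TorusTransport


namespace TorusTransport

noncomputable section

variable {d : ℕ}

/-! ### Weak formulation for functions transported by a mollified field -/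

lemma integral_mul_intervalIntegral_swap {f : Torus d → ℝ} {q : ℝ → Torus d → ℝ} {A : ℝ}
    (hf : Measurable f) (hfA : ∀ x, |f x| ≤ A) (hq : Measurable (Function.uncurry q)) {m : ℝ → ℝ}
    {s t : ℝ} (hst : s ≤ t) (hm : IntervalIntegrable m volume s t)
    (hqm : ∀ σ x, |q σ x| ≤ m σ) :
    ∫ x, f x * ∫ σ in s..t, q σ x = ∫ σ in s..t, ∫ x, f x * q σ x := by
  simp_rw [intervalIntegral.integral_of_le hst, ← integral_const_mul]
  refine integral_integral_swap ?_
  have h1 : Integrable (fun z : Torus d × ℝ => A * m z.2)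
      (volume.prod (volume.restrict (Ioc s t))) :=
    (((intervalIntegrable_iff_integrableOn_Ioc_of_le hst).1 hm).const_mul A).comp_snd _
  refine h1.mono' (((hf.comp measurable_fst).mul (hq.comp
    (measurable_snd.prodMk measurable_fst))).aestronglyMeasurable)
    (Eventually.of_forall fun z => ?_)
  simp only [Function.uncurry]
  rw [norm_mul]
  exact mul_le_mul (hfA _) (hqm _ _) (norm_nonneg _) ((abs_nonneg _).trans (hfA 0))

namespace IsSobolevField

variable {T β K L : ℝ} {b : ℝ → Torus d → EuclideanSpace ℝ (Fin d)}
    {G : ℝ → Torus d → Matrix (Fin d) (Fin d) ℝ}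

lemma measurable_divTest {b : ℝ → Torus d → EuclideanSpace ℝ (Fin d)} {δ : ℝ → Torus d → ℝ}
    (hb : Measurable (Function.uncurry b)) (hδ : Measurable (Function.uncurry δ)) {φ : Torus d → ℝ}
    (hφ : IsSmooth φ) : Measurable (Function.uncurry fun σ x => divTest (b σ) (δ σ) φ x) := by
  have h1 : ∀ i, Measurable fun z : ℝ × Torus d => b z.1 z.2 i := fun i =>
    (EuclideanSpace.proj (𝕜 := ℝ) i).continuous.measurable.comp hb
  refine Measurable.add (Finset.measurable_sum _ fun i _ => (h1 i).mul ?_) (hδ.mul ?_)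
  · exact (hφ.partialDeriv i).continuous.measurable.comp measurable_snd
  · exact hφ.continuous.measurable.comp measurable_snd

lemma approxField_lipschitzConst_nonneg (hb : IsSobolevField T β K L b G) (n : ℕ) :
    0 ≤ mollConst d / Real.exp (-n) ^ d * (K / β) := by
  have h1 := three_le_mollConst d
  have h2 := hb.one_le
  have h3 := hb.pos
  positivity

lemma abs_divTest_approxField_le (hb : IsSobolevField T β K L b G) {φ : Torus d → ℝ} {A : ℝ}
    (hA0 : 0 ≤ A) (hA : ∀ (D : Torus d → EuclideanSpace ℝ (Fin d)) (δ : Torus d → ℝ) (x : Torus d),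
      |divTest D δ φ x| ≤ A * (‖D x‖ + |δ x|)) (n : ℕ) (σ : ℝ) (x : Torus d) :
    |divTest (approxField b n σ) (approxDiv G n σ) φ x| ≤
      A * (1 + L) * (fieldBound T β K b σ + 1) := by
  refine (hA _ _ x).trans ?_
  have h1 := hb.norm_approxField_le n σ x
  have h2 : |approxDiv G n σ x| ≤ L := hb.abs_mollify_trace_le n σ x
  have h3 := hb.isVelocity.nonneg σ
  have h4 := hb.nonneg
  rw [mul_assoc]
  refine mul_le_mul_of_nonneg_left ?_ hA0
  nlinarith

set_option maxHeartbeats 1000000 in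
lemma approx_weakForm (hb : IsSobolevField T β K L b G) (n : ℕ) {ψ φ : Torus d → ℝ} {ℓ : ℝ}
    (hℓ : 0 ≤ ℓ) (hψ : ∀ x w, |ψ (x + eproj w) - ψ x| ≤ ℓ * ‖w‖) (hφ : IsSmooth φ) (r : ℝ)
    {a e : ℝ} (hae : a ≤ e) :
    (∫ x, ψ (flow (approxField b n) e r x) * φ x) - ∫ x, ψ (flow (approxField b n) a r x) * φ x =
      ∫ σ in a..e, ∫ x, ψ (flow (approxField b n) σ r x) *
        divTest (approxField b n σ) (approxDiv G n σ) φ x := by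
  set B := approxField b n with hB
  set m := fieldBound T β K b with hm
  have hv := hb.isVelocity_approxField n
  have hfl := hb.hasFlow_approxField n
  set Λ := mollConst d / Real.exp (-n) ^ d * (K / β) with hΛdef
  have hΛ : 0 ≤ Λ := hb.approxField_lipschitzConst_nonneg n
  have hlip := hb.approxField_lipschitz n
  have hm0 : ∀ σ, 0 ≤ m σ := hv.nonneg
  have hψc := continuous_of_lipschitz hℓ hψ
  obtain ⟨P, hP0, hP⟩ := exists_bound_of_continuous hψc
  obtain ⟨A, hA0, hAφ, hA⟩ := exists_divTest_le hφ
  have hL := hb.nonneg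
  set η : ℝ → Torus d → ℝ := fun s x => ψ (flow B s r x) with hη
  set q : ℝ → Torus d → ℝ := fun σ x => divTest (B σ) (approxDiv G n σ) φ x with hq
  set A' := A * (1 + L) with hA'
  have hA'0 : 0 ≤ A' := by positivity
  have hqle : ∀ σ x, |q σ x| ≤ A' * (m σ + 1) := hb.abs_divTest_approxField_le hA0 hA n
  have hqm : Measurable (Function.uncurry q) :=
    measurable_divTest (hb.measurable_approxField n) (hb.measurable_approxDiv n) hφ
  have hηcont : Continuous (Function.uncurry η) := by
    have h1 := hfl.continuous hv
    have h2 : Continuous fun z : ℝ × Torus d => (z.1, r, z.2) := by fun_prop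
    exact hψc.comp (h1.comp h2)
  have hηs : ∀ s, Continuous (η s) := fun s => hηcont.comp (by fun_prop : Continuous fun x => (s, x))
  have hηP : ∀ s x, |η s x| ≤ P := fun s x => hP _
  set ℓ' := ℓ * Real.exp (Λ * (|a - r| + |e - r|)) with hℓ'
  have hℓ'0 : 0 ≤ ℓ' := by positivity
  have hηl : ∀ s ∈ Icc a e, ∀ x w, |η s (x + eproj w) - η s x| ≤ ℓ' * ‖w‖ := by
    intro s hs x w
    obtain ⟨v, hv1, hv2⟩ := hfl.exists_lipschitz hv hΛ hlip s r x w
    simp only [hη]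
    rw [hv1]
    refine (hψ _ v).trans ?_
    rw [hℓ', mul_assoc]
    refine mul_le_mul_of_nonneg_left (hv2.trans ?_) hℓ
    gcongr
    rw [abs_sub_comm]
    rcases le_total s r with h | h
    · rw [abs_of_nonpos (sub_nonpos.2 h)]
      linarith [neg_le_abs (a - r), abs_nonneg (e - r), hs.1]
    · rw [abs_of_nonneg (sub_nonneg.2 h)]
      linarith [le_abs_self (e - r), abs_nonneg (a - r), hs.2]
  have hηcomp : ∀ s t x, η s (flow B t s x) = η t x := fun s t x => by
    simp only [hη]
    rw [hfl.comp hv]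
  have hmi : ∀ s t, IntervalIntegrable (fun σ => m σ + 1) volume s t := fun s t =>
    hv.integrable.intervalIntegrable.add intervalIntegrable_const
  have hmi' : ∀ s t, IntervalIntegrable m volume s t := fun s t => hv.integrable.intervalIntegrable
  set M : ℝ → ℝ := fun s => ∫ σ in a..s, (m σ + 1) with hM
  have hMsub : ∀ s t, M t - M s = ∫ σ in s..t, (m σ + 1) := fun s t =>
    intervalIntegral.integral_interval_sub_left (hmi _ _) (hmi _ _)
  have hMge : ∀ s t σ, s ≤ σ → σ ≤ t → |∫ σ in σ..s, m σ| ≤ M t - M s := by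
    intro s t σ h1 h2
    rw [intervalIntegral.integral_symm, abs_neg, abs_of_nonneg
      (intervalIntegral.integral_nonneg_of_forall h1 hm0), hMsub]
    calc ∫ σ in s..σ, m σ ≤ ∫ σ in s..σ, (m σ + 1) :=
          intervalIntegral.integral_mono_on h1 (hmi' _ _) (hmi _ _) fun τ _ => by linarith
      _ ≤ ∫ σ in s..t, (m σ + 1) := by
          rw [← intervalIntegral.integral_add_adjacent_intervals (hmi s σ) (hmi σ t)]
          have := intervalIntegral.integral_nonneg_of_forall (f := fun σ => m σ + 1) (μ := volume)
            h2 fun τ => by linarith [hm0 τ]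
          linarith
  have hMge' : ∀ s t, s ≤ t → t - s ≤ M t - M s := by
    intro s t h
    rw [hMsub]
    have := intervalIntegral.integral_mono_on h (f := fun _ => (1 : ℝ)) intervalIntegrable_const
      (hmi s t) fun τ _ => by linarith [hm0 τ]
    simpa using this
  have hηt : ∀ s ∈ Icc a e, ∀ t σ, s ≤ σ → σ ≤ t → ∀ x, |η s x - η σ x| ≤ ℓ' * (M t - M s) := by
    intro s hs t σ h1 h2 x
    obtain ⟨v, hv1, hv2⟩ := hfl.exists_displacement hv σ s x
    rw [← hηcomp s σ x, hv1, abs_sub_comm]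
    refine (hηl s hs x v).trans (mul_le_mul_of_nonneg_left (hv2.trans (hMge s t σ h1 h2)) hℓ'0)
  set J : ℝ → ℝ := fun σ => ∫ x, η σ x * q σ x with hJ
  have hηqm : Measurable fun z : ℝ × Torus d => η z.1 z.2 * q z.1 z.2 := hηcont.measurable.mul hqm
  have hJi : ∀ s t, IntervalIntegrable J volume s t := by
    refine hb.intervalIntegrable_of_le_fieldBound (A := P * A')
      hηqm.stronglyMeasurable.integral_prod_right'.aestronglyMeasurable fun σ => ?_
    refine (norm_integral_le_of_norm_le_const (C := P * (A' * (m σ + 1)))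
      (Eventually.of_forall fun x => ?_)).trans ?_
    · rw [norm_mul]
      exact mul_le_mul (hηP σ x) (hqle σ x) (norm_nonneg _) hP0
    · simp [mul_assoc, hm]
  set F : ℝ → ℝ := fun s => (∫ x, η s x * φ x) - ∫ σ in a..s, J σ with hF
  set C := ℓ' * Λ * A + ℓ' * (Λ * A + A') + ℓ' * A' with hC
  have hC0 : 0 ≤ C := by positivity
  have hqslice : ∀ σ, Measurable (q σ) := fun σ => hqm.of_uncurry_left
  have key : ∀ s ∈ Icc a e, ∀ t ∈ Icc a e, s ≤ t → |F t - F s| ≤ C * (M t - M s) ^ 2 := by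
    intro s hs t ht hst
    set Δ := M t - M s with hΔ
    have hΔ0 : 0 ≤ Δ := (sub_nonneg.2 hst).trans (hMge' s t hst)
    set D := approxDisp b n s t with hD
    have hDs : ∀ i, IsSmooth fun x => D x i := fun i => hb.isSmooth_approxDisp n hst i
    have hDc := continuous_of_isSmooth hDs
    have hbi : ∀ x, IntervalIntegrable (fun σ => B σ x) volume s t := fun x =>
      hb.intervalIntegrable_approxField n x s t
    have hDle : ∀ x, ‖D x‖ ≤ Δ := fun x => by
      refine (intervalIntegral.norm_integral_le_abs_of_norm_le
        (Eventually.of_forall fun σ => hv.norm_le σ x) (hmi' s t)).trans ?_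
      rw [intervalIntegral.integral_symm, abs_neg]
      exact hMge s t t hst le_rfl
    have hDlip : ∀ x w, ‖D (x + eproj w) - D x‖ ≤ (Λ * Δ) * ‖w‖ := fun x w => by
      have h1 : D (x + eproj w) - D x = ∫ σ in s..t, (B σ (x + eproj w) - B σ x) :=
        (intervalIntegral.integral_sub (hbi _) (hbi _)).symm
      rw [h1]
      refine (intervalIntegral.norm_integral_le_of_norm_le_const
        (fun σ _ => hlip σ x w)).trans ?_
      rw [abs_of_nonneg (sub_nonneg.2 hst)]
      have := hMge' s t hst
      calc Λ * ‖w‖ * (t - s) ≤ Λ * ‖w‖ * Δ := by gcongr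
        _ = _ := by ring
    have hDdiv : ∀ x, divTest D (divergence D) φ x = ∫ σ in s..t, q σ x := fun x =>
      hb.divTest_approxDisp n hst x
    have hDdivle : ∀ x, |divTest D (divergence D) φ x| ≤ A' * Δ := fun x => by
      rw [hDdiv, ← Real.norm_eq_abs]
      refine (intervalIntegral.norm_integral_le_of_norm_le hst
        (Eventually.of_forall fun σ _ => hqle σ x) ((hmi s t).const_mul A')).trans ?_
      rw [intervalIntegral.integral_const_mul, hΔ, hMsub]
    have hT1 : |∫ x, (η t x - η s (x - eproj (D x))) * φ x| ≤ ℓ' * Λ * A * Δ ^ 2 := by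
      rw [← Real.norm_eq_abs]
      refine (norm_integral_le_of_norm_le_const (C := ℓ' * Λ * A * Δ ^ 2)
        (Eventually.of_forall fun x => ?_)).trans (by simp)
      rw [norm_mul]
      have h1 : |η t x - η s (x - eproj (D x))| ≤ ℓ' * (Λ * Δ * Δ) := by
        have h2 := (hfl.isTraj t x).eq s
        have h3 : flow B t s x = (x - eproj (D x)) +
            eproj (∫ σ in s..t, (B σ x - B σ (flow B t σ x))) := by
          rw [intervalIntegral.integral_sub (hbi x)
            (hv.integrable_comp (hfl.isTraj t x).continuous).intervalIntegrable, eproj_sub, h2,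
            intervalIntegral.integral_symm s t, eproj_neg]
          simp only [hD, approxDisp, hB]
          abel
        rw [← hηcomp s t x, h3]
        refine (hηl s hs _ _).trans (mul_le_mul_of_nonneg_left ?_ hℓ'0)
        refine (intervalIntegral.norm_integral_le_of_norm_le_const
          (C := Λ * Δ) (fun σ hσ => ?_)).trans ?_
        · rw [uIoc_of_le hst] at hσ
          have hts : flow B t σ x = x + eproj (∫ τ in t..σ, B τ (flow B t τ x)) :=
            (hfl.isTraj t x).eq σ
          rw [norm_sub_rev, hts]
          refine (hlip σ x _).trans (mul_le_mul_of_nonneg_left ?_ hΛ)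
          refine (intervalIntegral.norm_integral_le_abs_of_norm_le
            (Eventually.of_forall fun σ => hv.norm_le σ _) (hmi' _ _)).trans ?_
          rw [intervalIntegral.integral_symm, abs_neg, abs_of_nonneg
            (intervalIntegral.integral_nonneg_of_forall hσ.2 hm0)]
          have h4 := hMge s t t hst le_rfl
          rw [intervalIntegral.integral_symm, abs_neg, abs_of_nonneg
            (intervalIntegral.integral_nonneg_of_forall hst hm0),
            ← intervalIntegral.integral_add_adjacent_intervals (hmi' s σ) (hmi' σ t)] at h4
          have h5 := intervalIntegral.integral_nonneg_of_forall (μ := volume) hσ.1.le hm0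
          linarith
        · rw [abs_of_nonneg (sub_nonneg.2 hst)]
          gcongr
          exact hMge' s t hst
      calc |η t x - η s (x - eproj (D x))| * ‖φ x‖ ≤ ℓ' * (Λ * Δ * Δ) * A :=
            mul_le_mul h1 (hAφ x) (norm_nonneg _) (by positivity)
        _ = _ := by ring
    have hT2 := abs_integral_shift_sub_le (f := η s) hφ hDs hℓ'0 (show 0 ≤ Λ * Δ by positivity)
      (hηl s hs) hDle hDlip hAφ hDdivle
    have hswap : ∫ x, η s x * divTest D (divergence D) φ x = ∫ σ in s..t, ∫ x, η s x * q σ x := by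
      simp_rw [hDdiv]
      exact integral_mul_intervalIntegral_swap (hηs s).measurable (hηP s) hqm hst
        ((hmi s t).const_mul A') hqle
    have hqi : ∀ s σ, Integrable fun x => η s x * q σ x := fun s σ => by
      refine Integrable.of_bound (C := P * (A' * (m σ + 1)))
        ((hηs s).measurable.mul (hqslice σ)).aestronglyMeasurable (Eventually.of_forall fun x => ?_)
      rw [norm_mul]
      exact mul_le_mul (hηP s x) (hqle σ x) (norm_nonneg _) hP0
    have hJs : IntervalIntegrable (fun σ => ∫ x, η s x * q σ x) volume s t := by
      have h1 : Measurable fun z : ℝ × Torus d => η s z.2 * q z.1 z.2 :=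
        ((hηs s).measurable.comp measurable_snd).mul hqm
      refine hb.intervalIntegrable_of_le_fieldBound (A := P * A')
        h1.stronglyMeasurable.integral_prod_right'.aestronglyMeasurable (fun σ => ?_) s t
      refine (norm_integral_le_of_norm_le_const (C := P * (A' * (m σ + 1)))
        (Eventually.of_forall fun x => ?_)).trans ?_
      · rw [norm_mul]
        exact mul_le_mul (hηP s x) (hqle σ x) (norm_nonneg _) hP0
      · simp [mul_assoc, hm]
    have hT3 : |(∫ σ in s..t, ∫ x, η s x * q σ x) - ∫ σ in s..t, J σ| ≤ ℓ' * A' * Δ ^ 2 := by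
      rw [← intervalIntegral.integral_sub hJs (hJi s t), ← Real.norm_eq_abs]
      refine (intervalIntegral.norm_integral_le_of_norm_le hst
        (g := fun σ => ℓ' * Δ * A' * (m σ + 1)) (Eventually.of_forall fun σ hσ => ?_)
        ((hmi s t).const_mul _)).trans ?_
      · simp only [hJ]
        rw [← integral_sub (hqi s σ) (hqi σ σ)]
        refine (norm_integral_le_of_norm_le_const (C := ℓ' * Δ * A' * (m σ + 1))
          (Eventually.of_forall fun x => ?_)).trans (by simp)
        rw [← sub_mul, norm_mul, mul_assoc (ℓ' * Δ)]
        exact mul_le_mul (hηt s hs t σ hσ.1.le hσ.2 x) (hqle σ x) (norm_nonneg _) (by positivity)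
      · rw [intervalIntegral.integral_const_mul, ← hMsub]
        exact le_of_eq (by ring)
    have hsplit : F t - F s = (∫ x, (η t x - η s (x - eproj (D x))) * φ x) +
        ((∫ x, η s (x - eproj (D x)) * φ x) - (∫ x, η s x * φ x) -
          ∫ x, η s x * divTest D (divergence D) φ x) +
        ((∫ σ in s..t, ∫ x, η s x * q σ x) - ∫ σ in s..t, J σ) := by
      have i1 : Integrable fun x => η t x * φ x :=
        integrable_of_continuous ((hηs t).mul hφ.continuous)
      have i2 : Integrable fun x => η s (x - eproj (D x)) * φ x :=
        integrable_of_continuous (((hηs s).comp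
          (continuous_id.sub (continuous_eproj.comp hDc))).mul hφ.continuous)
      have h1 : (∫ σ in a..t, J σ) - ∫ σ in a..s, J σ = ∫ σ in s..t, J σ :=
        intervalIntegral.integral_interval_sub_left (hJi _ _) (hJi _ _)
      simp_rw [sub_mul]
      rw [integral_sub i1 i2, hswap, ← h1]
      simp only [hF]
      ring
    rw [hsplit]
    refine (abs_add_three _ _ _).trans ((add_le_add (add_le_add hT1 hT2) hT3).trans (le_of_eq ?_))
    rw [hC]
    ring
  have hMc : Continuous M := intervalIntegral.continuous_primitive (fun s t => hmi s t) a
  have hMm : MonotoneOn M (Icc a e) := fun s _ t _ hst => by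
    have := hMge' s t hst
    linarith
  have h1 : F e ≤ F a := le_of_increments_le_sq hae hMc.continuousOn hC0 hMm
    fun s hs t ht hst => (le_abs_self _).trans (key s hs t ht hst)
  have h2 : -F e ≤ -F a := le_of_increments_le_sq (f := fun s => -F s) hae hMc.continuousOn hC0 hMm
    fun s hs t ht hst => by
      have := (neg_le_abs _).trans (key s hs t ht hst)
      linarith
  have h3 : F e = F a := le_antisymm h1 (by linarith)
  simp only [hF, intervalIntegral.integral_same, sub_zero] at h3
  change (∫ x, η e x * φ x) - ∫ x, η a x * φ x = ∫ σ in a..e, J σ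
  linarith

end IsSobolevField

end

end TorusTransport


namespace TorusTransport

noncomputable section

variable {d : ℕ}

/-! ### Weak formulation and compressibility of the flow -/

lemma IsSmooth.exists_lipschitz {φ : Torus d → ℝ} (hφ : IsSmooth φ) :
    ∃ ℓ : ℝ, 0 ≤ ℓ ∧ ∀ x w, |φ (x + eproj w) - φ x| ≤ ℓ * ‖w‖ := by
  have h1 : ∀ i, ∃ C : ℝ, 0 ≤ C ∧ ∀ x, ‖TorusTransport.partialDeriv i φ x‖ ≤ C := fun i =>
    exists_bound_of_continuous (hφ.partialDeriv i).continuous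
  choose A hA0 hA using h1
  refine ⟨∑ i, A i, Finset.sum_nonneg fun i _ => hA0 i, fun x w => ?_⟩
  have h2 := norm_image_sub_le_of_norm_deriv_le_segment_01' (C := (∑ i, A i) * ‖w‖)
    (fun τ _ => (hφ.hasDerivAt_line x w.ofLp τ).hasDerivWithinAt) (fun τ _ => by
      rw [gradForm_apply, Finset.sum_mul]
      refine (norm_sum_le _ _).trans (Finset.sum_le_sum fun i _ => ?_)
      rw [norm_mul]
      exact mul_le_mul (hA i _) (PiLp.norm_apply_le w i) (norm_nonneg _) (hA0 i))
  simpa [proj_zero, eproj] using h2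

lemma integral_abs_le_of_abs_le {f : Torus d → ℝ} {C : ℝ} (h : ∀ x, |f x| ≤ C) :
    |∫ x, f x| ≤ C := by
  rw [← Real.norm_eq_abs]
  exact (norm_integral_le_of_norm_le_const (Eventually.of_forall h)).trans (by simp)

namespace IsSobolevField

variable {T β K L : ℝ} {b : ℝ → Torus d → EuclideanSpace ℝ (Fin d)}
    {G : ℝ → Torus d → Matrix (Fin d) (Fin d) ℝ}

lemma tendsto_flow_approxField (hb : IsSobolevField T β K L b G) (s t : ℝ) (x : Torus d) :
    Tendsto (fun n => flow (approxField b n) s t x) atTop (𝓝 (flow (velocity b) s t x)) := by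
  rw [Metric.tendsto_nhds]
  intro ε hε
  obtain ⟨δ, hδ, hgap⟩ := exists_gap_le (d := d) hb.logLipConst_pos |t - s| (half_pos hε)
  filter_upwards [(tendsto_approxRate (d := d) β K).eventually (ge_mem_nhds hδ)] with n hn
  have h1 := hb.hasFlow.isTraj s x
  have h2 : IsTraj (approxField b n) s (x + eproj 0) fun t => flow (approxField b n) s t x := by
    rw [eproj_zero, add_zero]
    exact (hb.hasFlow_approxField n).isTraj s x
  have h3 := hgap _ _ _ _ hb.isVelocity (hb.isVelocity_approxField n)
    (fun t x => (hb.norm_approxField_sub_velocity_le n t x).trans hn) s t x 0 _ _ le_rfl h1 h2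
    (by simpa using hδ.le)
  have h4 := h1.eq_gap hb.isVelocity (hb.isVelocity_approxField n) h2 t
  rw [h4, dist_eq_norm, add_sub_cancel_left]
  exact ((norm_eproj_le _).trans h3).trans_lt (half_lt_self hε)

/-- The divergence of the field applied to a test function. -/
def _root_.TorusTransport.transportTest (b : ℝ → Torus d → EuclideanSpace ℝ (Fin d))
    (G : ℝ → Torus d → Matrix (Fin d) (Fin d) ℝ) (φ : Torus d → ℝ) (σ : ℝ) : Torus d → ℝ :=
  divTest (velocity b σ) (fun x => (G σ x).trace) φ

lemma measurable_transportTest (hb : IsSobolevField T β K L b G) {φ : Torus d → ℝ}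
    (hφ : IsSmooth φ) : Measurable (Function.uncurry (transportTest b G φ)) :=
  measurable_divTest (δ := fun σ x => (G σ x).trace) hb.measurable_velocity hb.measurable_trace hφ

lemma exists_transportTest_le (hb : IsSobolevField T β K L b G) {φ : Torus d → ℝ}
    (hφ : IsSmooth φ) : ∃ A : ℝ, 0 ≤ A ∧ ∀ σ, ∀ᵐ x,
      |transportTest b G φ σ x| ≤ A * (fieldBound T β K b σ + 1) := by
  obtain ⟨A, hA0, _, hA⟩ := exists_divTest_le hφ
  have hL := hb.nonneg
  refine ⟨A * (1 + L), by positivity, fun σ => ?_⟩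
  filter_upwards [hb.trace_le σ] with x hx
  refine (hA _ _ x).trans ?_
  rw [mul_assoc]
  refine mul_le_mul_of_nonneg_left ?_ hA0
  nlinarith [hb.isVelocity.norm_le σ x, hb.isVelocity.nonneg σ]

lemma fieldBound_nonneg (hb : IsSobolevField T β K L b G) (σ : ℝ) : 0 ≤ fieldBound T β K b σ :=
  hb.isVelocity.nonneg σ

lemma abs_integral_mul_transportTest_le {φ : Torus d → ℝ}
    {A : ℝ} (hA : ∀ σ, ∀ᵐ x, |transportTest b G φ σ x| ≤ A * (fieldBound T β K b σ + 1))
    {f : Torus d → ℝ} {P : ℝ} (hf : ∀ x, |f x| ≤ P) (σ : ℝ) :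
    ‖∫ x, f x * transportTest b G φ σ x‖ ≤ P * A * (fieldBound T β K b σ + 1) := by
  refine (norm_integral_le_of_norm_le_const (C := P * A * (fieldBound T β K b σ + 1)) ?_).trans
    (by simp)
  filter_upwards [hA σ] with x hx
  rw [norm_mul, mul_assoc]
  exact mul_le_mul (hf x) hx (norm_nonneg _) ((abs_nonneg _).trans (hf x))

lemma tendsto_integral_mul_transportTest (hb : IsSobolevField T β K L b G) {φ : Torus d → ℝ}
    (hφ : IsSmooth φ) {f : ℕ → ℝ → Torus d → ℝ} {g : ℝ → Torus d → ℝ} {P : ℝ}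
    (hf : ∀ n, Measurable (Function.uncurry (f n))) (hfP : ∀ n σ x, |f n σ x| ≤ P)
    (hfg : ∀ σ x, Tendsto (fun n => f n σ x) atTop (𝓝 (g σ x))) (a e : ℝ) :
    Tendsto (fun n => ∫ σ in a..e, ∫ x, f n σ x * transportTest b G φ σ x) atTop
      (𝓝 (∫ σ in a..e, ∫ x, g σ x * transportTest b G φ σ x)) := by
  obtain ⟨A, hA0, hA⟩ := hb.exists_transportTest_le hφ
  have hqm := hb.measurable_transportTest hφ
  refine intervalIntegral.tendsto_integral_filter_of_dominated_convergence
    (fun σ => P * A * (fieldBound T β K b σ + 1)) (Eventually.of_forall fun n => ?_)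
    (Eventually.of_forall fun n => Eventually.of_forall fun σ _ =>
      abs_integral_mul_transportTest_le hA (hfP n σ) σ)
    ((hb.integrable_fieldBound.intervalIntegrable.add intervalIntegrable_const).const_mul _)
    (Eventually.of_forall fun σ _ => ?_)
  · have h1 : Measurable fun z : ℝ × Torus d => f n z.1 z.2 * transportTest b G φ z.1 z.2 :=
      (hf n).mul hqm
    exact h1.stronglyMeasurable.integral_prod_right'.aestronglyMeasurable
  · refine tendsto_integral_of_dominated_convergence
      (fun _ => P * (A * (fieldBound T β K b σ + 1)))
      (fun n => ((hf n).of_uncurry_left.mul hqm.of_uncurry_left).aestronglyMeasurable)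
      (integrable_const _) (fun n => ?_) (Eventually.of_forall fun x => (hfg σ x).mul_const _)
    filter_upwards [hA σ] with x hx
    rw [norm_mul]
    exact mul_le_mul (hfP n σ x) hx (norm_nonneg _) ((abs_nonneg _).trans (hfP n σ x))

lemma continuous_comp_flow (hb : IsSobolevField T β K L b G) {ψ : Torus d → ℝ}
    (hψ : Continuous ψ) (r : ℝ) :
    Continuous (Function.uncurry fun s x => ψ (flow (velocity b) s r x)) := by
  have h2 : Continuous fun z : ℝ × Torus d => (z.1, r, z.2) := by fun_prop
  exact hψ.comp ((hb.hasFlow.continuous hb.isVelocity).comp h2)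

lemma continuous_comp_flow_approxField (hb : IsSobolevField T β K L b G) (n : ℕ)
    {ψ : Torus d → ℝ} (hψ : Continuous ψ) (r : ℝ) :
    Continuous (Function.uncurry fun s x => ψ (flow (approxField b n) s r x)) := by
  have h2 : Continuous fun z : ℝ × Torus d => (z.1, r, z.2) := by fun_prop
  exact hψ.comp (((hb.hasFlow_approxField n).continuous (hb.isVelocity_approxField n)).comp h2)

lemma tendsto_integral_approxDiv (hb : IsSobolevField T β K L b G) {φ : Torus d → ℝ}
    (hφ : IsSmooth φ) {f : ℕ → Torus d → ℝ} {g : Torus d → ℝ} {P : ℝ}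
    (hf : ∀ n, Measurable (f n)) (hfP : ∀ n x, |f n x| ≤ P)
    (hfg : ∀ x, Tendsto (fun n => f n x) atTop (𝓝 (g x))) (σ : ℝ) :
    Tendsto (fun n => ∫ x, f n x * divTest (approxField b n σ) (approxDiv G n σ) φ x) atTop
      (𝓝 (∫ x, g x * transportTest b G φ σ x)) := by
  obtain ⟨A, hA0, hAφ, hA⟩ := exists_divTest_le hφ
  have hP0 : 0 ≤ P := (abs_nonneg _).trans (hfP 0 0)
  have htr := hb.integrable_trace σ
  have hdc : ∀ n, Continuous (approxDiv G n σ) := fun n =>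
    ((isMollifier_stdMollifier n).smooth.mollify htr).continuous
  have hm1 : ∀ n, Measurable (divTest (approxField b n σ) (fun x => (G σ x).trace) φ) := fun n =>
    (measurable_divTest (δ := fun σ x => (G σ x).trace) (hb.measurable_approxField n)
      hb.measurable_trace hφ).of_uncurry_left
  have h1 : Tendsto (fun n => ∫ x, f n x *
      divTest (approxField b n σ) (fun x => (G σ x).trace) φ x) atTop
      (𝓝 (∫ x, g x * transportTest b G φ σ x)) := by
    refine tendsto_integral_of_dominated_convergence
      (fun x => P * (A * (fieldBound T β K b σ + L)))
      (fun n => ((hf n).mul (hm1 n)).aestronglyMeasurable)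
      (integrable_const _) (fun n => ?_) (Eventually.of_forall fun x => (hfg x).mul ?_)
    · filter_upwards [hb.trace_le σ] with x hx
      rw [norm_mul]
      refine mul_le_mul (hfP n x) ((hA _ _ x).trans ?_) (norm_nonneg _) hP0
      gcongr
      exact hb.norm_approxField_le n σ x
    · refine Tendsto.add_const _ (tendsto_finsetSum _ fun i _ => Tendsto.mul_const _ ?_)
      exact ((EuclideanSpace.proj (𝕜 := ℝ) i).continuous.tendsto _).comp
        (hb.tendsto_approxField σ x)
  have h2 : Tendsto (fun n => ∫ x, f n x * ((approxDiv G n σ x - (G σ x).trace) * φ x)) atTop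
      (𝓝 0) := by
    have h3 := tendsto_lintegral_mollify_sub (fun n => isMollifier_stdMollifier (d := d) n)
      tendsto_exp_neg_nat htr
    have h4 := ((ENNReal.tendsto_toReal ENNReal.zero_ne_top).comp h3).const_mul (P * A)
    rw [ENNReal.toReal_zero, mul_zero] at h4
    refine squeeze_zero_norm (fun n => ?_) h4
    have hi : Integrable fun x => approxDiv G n σ x - (G σ x).trace :=
      (integrable_of_continuous (hdc n)).sub htr
    refine (norm_integral_le_of_norm_le (hi.norm.const_mul (P * A))
      (Eventually.of_forall fun x => ?_)).trans ?_
    · rw [norm_mul, norm_mul]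
      calc ‖f n x‖ * (‖approxDiv G n σ x - (G σ x).trace‖ * ‖φ x‖) ≤
            P * (‖approxDiv G n σ x - (G σ x).trace‖ * A) := by
            gcongr
            · exact hfP n x
            · exact hAφ x
        _ = _ := by ring
    · rw [integral_const_mul, integral_norm_eq_lintegral_enorm hi.1]
      rfl
  have h5 := h1.add h2
  rw [add_zero] at h5
  refine h5.congr fun n => ?_
  rw [← integral_add]
  · refine integral_congr_ae (Eventually.of_forall fun x => ?_)
    simp only [divTest]
    ring
  · refine Integrable.of_bound (C := P * (A * (fieldBound T β K b σ + L)))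
      ((hf n).mul (hm1 n)).aestronglyMeasurable ?_
    filter_upwards [hb.trace_le σ] with x hx
    rw [norm_mul]
    refine mul_le_mul (hfP n x) ((hA _ _ x).trans ?_) (norm_nonneg _) hP0
    gcongr
    exact hb.norm_approxField_le n σ x
  · have hi : Integrable fun x => (approxDiv G n σ x - (G σ x).trace) * φ x :=
      ((integrable_of_continuous (hdc n)).sub htr).mul_bdd (c := A)
        hφ.continuous.aestronglyMeasurable (Eventually.of_forall hAφ)
    exact hi.bdd_mul (c := P) (hf n).aestronglyMeasurable (Eventually.of_forall (hfP n))

lemma weakForm_of_lipschitz (hb : IsSobolevField T β K L b G) {ψ φ : Torus d → ℝ} {ℓ : ℝ}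
    (hℓ : 0 ≤ ℓ) (hψ : ∀ x w, |ψ (x + eproj w) - ψ x| ≤ ℓ * ‖w‖) (hφ : IsSmooth φ) (r : ℝ)
    {a e : ℝ} (hae : a ≤ e) :
    (∫ x, ψ (flow (velocity b) e r x) * φ x) - ∫ x, ψ (flow (velocity b) a r x) * φ x =
      ∫ σ in a..e, ∫ x, ψ (flow (velocity b) σ r x) * transportTest b G φ σ x := by
  have hψc := continuous_of_lipschitz hℓ hψ
  obtain ⟨P, hP0, hP⟩ := exists_bound_of_continuous hψc
  obtain ⟨A, hA0, hAφ, hA⟩ := exists_divTest_le hφ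
  have hcn := fun n => hb.continuous_comp_flow_approxField n hψc r
  have hlim : ∀ s x, Tendsto (fun n => ψ (flow (approxField b n) s r x)) atTop
      (𝓝 (ψ (flow (velocity b) s r x))) := fun s x =>
    (hψc.tendsto _).comp (hb.tendsto_flow_approxField s r x)
  have h1 : ∀ s, Tendsto (fun n => ∫ x, ψ (flow (approxField b n) s r x) * φ x) atTop
      (𝓝 (∫ x, ψ (flow (velocity b) s r x) * φ x)) := fun s => by
    refine tendsto_integral_of_dominated_convergence (fun _ => P * A) (fun n =>
      (((hcn n).comp (by fun_prop : Continuous fun x => (s, x))).mul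
        hφ.continuous).aestronglyMeasurable) (integrable_const _)
      (fun n => Eventually.of_forall fun x => ?_)
      (Eventually.of_forall fun x => (hlim s x).mul_const _)
    rw [norm_mul]
    exact mul_le_mul (hP _) (hAφ x) (norm_nonneg _) hP0
  have h2 : Tendsto (fun n => ∫ σ in a..e, ∫ x, ψ (flow (approxField b n) σ r x) *
      divTest (approxField b n σ) (approxDiv G n σ) φ x) atTop
      (𝓝 (∫ σ in a..e, ∫ x, ψ (flow (velocity b) σ r x) * transportTest b G φ σ x)) := by
    refine intervalIntegral.tendsto_integral_filter_of_dominated_convergence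
      (fun σ => P * (A * (1 + L)) * (fieldBound T β K b σ + 1)) (Eventually.of_forall fun n => ?_)
      (Eventually.of_forall fun n => Eventually.of_forall fun σ _ => ?_)
      ((hb.integrable_fieldBound.intervalIntegrable.add intervalIntegrable_const).const_mul _)
      (Eventually.of_forall fun σ _ => ?_)
    · have h3 : Measurable fun z : ℝ × Torus d => ψ (flow (approxField b n) z.1 r z.2) *
          divTest (approxField b n z.1) (approxDiv G n z.1) φ z.2 :=
        (hcn n).measurable.mul
          (measurable_divTest (hb.measurable_approxField n) (hb.measurable_approxDiv n) hφ)
      exact h3.stronglyMeasurable.integral_prod_right'.aestronglyMeasurable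
    · rw [mul_assoc]
      refine integral_abs_le_of_abs_le fun x => ?_
      rw [abs_mul]
      exact mul_le_mul (hP _) (hb.abs_divTest_approxField_le hA0 hA n σ x) (abs_nonneg _) hP0
    · exact hb.tendsto_integral_approxDiv hφ
        (fun n => ((hcn n).comp (by fun_prop : Continuous fun x => (σ, x))).measurable)
        (fun n x => hP _) (hlim σ) σ
  exact tendsto_nhds_unique (((h1 e).sub (h1 a)).congr fun n =>
    hb.approx_weakForm n hℓ hψ hφ r hae) h2

/-- Continuous functions transported by the flow solve the transport equation in the sense of
distributions. -/
lemma weakForm (hb : IsSobolevField T β K L b G) {ψ φ : Torus d → ℝ} (hψ : Continuous ψ)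
    (hφ : IsSmooth φ) (r : ℝ) {a e : ℝ} (hae : a ≤ e) :
    (∫ x, ψ (flow (velocity b) e r x) * φ x) - ∫ x, ψ (flow (velocity b) a r x) * φ x =
      ∫ σ in a..e, ∫ x, ψ (flow (velocity b) σ r x) * transportTest b G φ σ x := by
  obtain ⟨P, hP0, hP⟩ := exists_bound_of_continuous hψ
  obtain ⟨A, hA0, hAφ, hA⟩ := exists_divTest_le hφ
  set ψn : ℕ → Torus d → ℝ := fun n => mollify (stdMollifier d n) ψ with hψn
  have hψi := integrable_of_continuous hψ
  have hs : ∀ n, IsSmooth (ψn n) := fun n => (isMollifier_stdMollifier n).smooth.mollify hψi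
  have hsP : ∀ n x, |ψn n x| ≤ P := by
    intro n x
    have hρ := isMollifier_stdMollifier (d := d) n
    have h3 : ∫ y, stdMollifier d n y * P = P := by
      rw [integral_mul_const, hρ.integral_eq_one, one_mul]
    rw [hψn]
    simp only
    rw [mollify_eq, ← Real.norm_eq_abs, ← h3]
    refine norm_integral_le_of_norm_le (hρ.integrable.mul_const P)
      (Eventually.of_forall fun y => ?_)
    rw [norm_smul, Real.norm_of_nonneg (hρ.nonneg y)]
    exact mul_le_mul_of_nonneg_left (hP _) (hρ.nonneg y)
  have hlim : ∀ x, Tendsto (fun n => ψn n x) atTop (𝓝 (ψ x)) := by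
    intro x
    rw [Metric.tendsto_nhds]
    intro ε hε
    obtain ⟨δ, hδ, hδ'⟩ := Metric.uniformContinuous_iff.1
      (CompactSpace.uniformContinuous_of_continuous hψ) (ε / 2) (half_pos hε)
    filter_upwards [tendsto_exp_neg_nat.eventually (gt_mem_nhds hδ)] with n hn
    rw [dist_eq_norm]
    refine lt_of_le_of_lt (norm_mollify_sub_self_le (isMollifier_stdMollifier n) hψi
      (fun x y hxy => ?_) x) (half_lt_self hε)
    rw [← dist_eq_norm, dist_comm]
    exact (hδ' (hxy.trans_lt hn)).le
  have hc : ∀ n, Continuous (Function.uncurry fun s x => ψn n (flow (velocity b) s r x)) :=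
    fun n => hb.continuous_comp_flow (hs n).continuous r
  have h1 : ∀ s, Tendsto (fun n => ∫ x, ψn n (flow (velocity b) s r x) * φ x) atTop
      (𝓝 (∫ x, ψ (flow (velocity b) s r x) * φ x)) := fun s => by
    refine tendsto_integral_of_dominated_convergence (fun _ => P * A) (fun n =>
      (((hc n).comp (by fun_prop : Continuous fun x => (s, x))).mul
        hφ.continuous).aestronglyMeasurable) (integrable_const _)
      (fun n => Eventually.of_forall fun x => ?_)
      (Eventually.of_forall fun x => (hlim _).mul_const _)
    rw [norm_mul]
    exact mul_le_mul (hsP n _) (hAφ x) (norm_nonneg _) hP0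
  have h2 := hb.tendsto_integral_mul_transportTest hφ
    (f := fun n σ x => ψn n (flow (velocity b) σ r x))
    (fun n => (hc n).measurable) (fun n σ x => hsP n _) (fun σ x => hlim _) a e
  refine tendsto_nhds_unique (((h1 e).sub (h1 a)).congr fun n => ?_) h2
  obtain ⟨ℓ, hℓ, hlip⟩ := (hs n).exists_lipschitz
  exact hb.weakForm_of_lipschitz hℓ hlip hφ r hae

end IsSobolevField

end

end TorusTransport


namespace TorusTransport

noncomputable section

variable {d : ℕ}

/-! ### Compressibility of the flow and existence of solutions -/

lemma measure_le_of_forall_continuous {μ ν : Measure (Torus d)} [IsFiniteMeasure μ]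
    [IsFiniteMeasure ν] (h : ∀ ψ : Torus d → ℝ≥0, Continuous ψ →
      ∫⁻ x, (ψ x : ℝ≥0∞) ∂μ ≤ ∫⁻ x, (ψ x : ℝ≥0∞) ∂ν) : μ ≤ ν := by
  refine Measure.le_intro fun S hS _ => ?_
  rw [hS.measure_eq_iSup_isClosed_of_ne_top (measure_ne_top μ S)]
  refine iSup_le fun F => iSup_le fun hFS => iSup_le fun hF => le_trans ?_ (measure_mono hFS)
  have hpos : ∀ n : ℕ, (0 : ℝ) < 1 / ((n : ℝ) + 1) := fun n => by positivity
  exact le_of_tendsto_of_tendsto'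
    (tendsto_lintegral_thickenedIndicator_of_isClosed μ hF hpos
      tendsto_one_div_add_atTop_nhds_zero_nat)
    (tendsto_lintegral_thickenedIndicator_of_isClosed ν hF hpos
      tendsto_one_div_add_atTop_nhds_zero_nat)
    fun n => h _ (thickenedIndicator (hpos n) F).continuous

lemma abs_integral_mul_le_eLpNorm {p q : ℝ≥0∞} [ENNReal.HolderConjugate p q]
    {f g : Torus d → ℝ} (hf : MemLp f p volume) (hg : MemLp g q volume) :
    |∫ x, f x * g x| ≤ (eLpNorm f p volume).toReal * (eLpNorm g q volume).toReal := by
  have h1 := eLpNorm_smul_le_mul_eLpNorm (p := p) (q := q) (r := 1) hg.1 hf.1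
  have h2 : Integrable fun x => f x * g x := MemLp.integrable_mul hf hg
  rw [← ENNReal.toReal_mul, ← Real.norm_eq_abs]
  refine (norm_integral_le_integral_norm _).trans ?_
  rw [integral_norm_eq_lintegral_enorm h2.1]
  refine ENNReal.toReal_mono (ENNReal.mul_ne_top hf.2.ne hg.2.ne) ?_
  rw [eLpNorm_one_eq_lintegral_enorm] at h1
  exact h1

namespace IsSobolevField

variable {T β K L : ℝ} {b : ℝ → Torus d → EuclideanSpace ℝ (Fin d)}
    {G : ℝ → Torus d → Matrix (Fin d) (Fin d) ℝ}

lemma continuous_flow (hb : IsSobolevField T β K L b G) (s t : ℝ) :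
    Continuous (flow (velocity b) s t) := by
  have h1 := hb.hasFlow.continuous hb.isVelocity
  have h2 : Continuous fun x : Torus d => (s, t, x) := by fun_prop
  exact h1.comp h2

lemma transportTest_one (x : Torus d) (σ : ℝ) :
    transportTest b G (fun _ => 1) σ x = (G σ x).trace := by
  simp [transportTest, divTest, partialDeriv_const]

lemma integral_comp_flow_le (hb : IsSobolevField T β K L b G) {ψ : Torus d → ℝ}
    (hψ : Continuous ψ) (hψ0 : ∀ x, 0 ≤ ψ x) (s r : ℝ) :
    ∫ x, ψ (flow (velocity b) s r x) ≤ Real.exp (L * |s - r|) * ∫ x, ψ x := by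
  obtain ⟨P, hP0, hP⟩ := exists_bound_of_continuous hψ
  have hc := hb.continuous_comp_flow hψ r
  set h : ℝ → ℝ := fun s => ∫ x, ψ (flow (velocity b) s r x) with hh
  have hcont : Continuous h := by
    refine continuous_of_dominated (bound := fun _ => P)
      (fun s => (hc.comp (by fun_prop : Continuous fun x => (s, x))).aestronglyMeasurable)
      (fun s => Eventually.of_forall fun x => hP _) (integrable_const _)
      (Eventually.of_forall fun x => hc.comp (by fun_prop : Continuous fun s => (s, x)))
  have h0 : ∀ s, 0 ≤ h s := fun s => integral_nonneg fun x => hψ0 _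
  have hstep : ∀ a e, a ≤ e → |h e - h a| ≤ ∫ σ in a..e, L * h σ := by
    intro a e hae
    have h1 := hb.weakForm hψ (isSmooth_const 1) r hae
    simp_rw [mul_one] at h1
    rw [show h e - h a = _ from h1, ← Real.norm_eq_abs]
    refine intervalIntegral.norm_integral_le_of_norm_le hae (Eventually.of_forall fun σ _ => ?_)
      ((hcont.const_mul L).intervalIntegrable _ _)
    rw [hh]
    simp only
    rw [← integral_const_mul]
    refine norm_integral_le_of_norm_le (integrable_of_continuous
      ((hc.comp (by fun_prop : Continuous fun x => (σ, x))).const_mul L)) ?_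
    filter_upwards [hb.trace_le σ] with x hx
    rw [transportTest_one, norm_mul, mul_comm, Real.norm_of_nonneg (hψ0 _)]
    exact mul_le_mul_of_nonneg_right hx (hψ0 _)
  have hr : h r = ∫ x, ψ x := by
    simp only [hh]
    simp_rw [hb.hasFlow.self]
  have h2 := gronwall_abs hcont h0 (s := r) (A := h r) (h0 r) hb.nonneg le_rfl (fun t => by
    simp_rw [add_zero]
    rcases le_total r t with hrt | hrt
    · have := (le_abs_self _).trans (hstep r t hrt)
      linarith [le_abs_self (∫ σ in r..t, L * h σ)]
    · have := (neg_le_abs _).trans (hstep t r hrt)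
      rw [intervalIntegral.integral_symm, abs_neg]
      linarith [le_abs_self (∫ σ in t..r, L * h σ)]) s
  rw [hr] at h2
  simp only [zero_mul, add_zero] at h2
  rwa [mul_comm] at h2

/-- The flow compresses volumes by a factor of at most `e^{L |s - r|}`. -/
lemma map_flow_le (hb : IsSobolevField T β K L b G) (s r : ℝ) :
    (volume : Measure (Torus d)).map (flow (velocity b) s r) ≤
      ENNReal.ofReal (Real.exp (L * |s - r|)) • volume := by
  have hm := (hb.continuous_flow s r).measurable
  have : IsFiniteMeasure (ENNReal.ofReal (Real.exp (L * |s - r|)) •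
      (volume : Measure (Torus d))) := Measure.smul_finite _ ENNReal.ofReal_ne_top
  refine measure_le_of_forall_continuous fun ψ hψ => ?_
  have hψm : Measurable fun x => (ψ x : ℝ≥0∞) := hψ.measurable.coe_nnreal_ennreal
  rw [lintegral_map hψm hm, lintegral_smul_measure]
  have hψr : Continuous fun x => (ψ x : ℝ) := NNReal.continuous_coe.comp hψ
  have h1 := hb.integral_comp_flow_le hψr (fun x => (ψ x).2) s r
  have h2 : ∀ (S : Torus d → Torus d), Continuous S →
      ∫⁻ x, (ψ (S x) : ℝ≥0∞) = ENNReal.ofReal (∫ x, (ψ (S x) : ℝ)) := fun S hS => by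
    have hi : Integrable fun x => (ψ (S x) : ℝ) := integrable_of_continuous (hψr.comp hS)
    rw [ofReal_integral_eq_lintegral_ofReal hi
      (Eventually.of_forall fun x => (ψ (S x)).2)]
    simp
  rw [h2 _ (hb.continuous_flow s r), h2 (fun x => x) continuous_id, smul_eq_mul,
    ← ENNReal.ofReal_mul (by positivity)]
  exact ENNReal.ofReal_le_ofReal h1

lemma quasiMeasurePreserving_flow (hb : IsSobolevField T β K L b G) (s r : ℝ) :
    Measure.QuasiMeasurePreserving (flow (velocity b) s r) volume volume :=
  ⟨(hb.continuous_flow s r).measurable, (Measure.absolutelyContinuous_of_le (hb.map_flow_le s r)).trans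
    Measure.smul_absolutelyContinuous⟩

lemma lintegral_comp_flow_le (hb : IsSobolevField T β K L b G) (s r : ℝ) {h : Torus d → ℝ≥0∞}
    (hh : AEMeasurable h volume) : ∫⁻ x, h (flow (velocity b) s r x) ≤
      ENNReal.ofReal (Real.exp (L * |s - r|)) * ∫⁻ x, h x := by
  rw [← lintegral_map' (hh.mono_ac (hb.quasiMeasurePreserving_flow s r).absolutelyContinuous)
    (hb.continuous_flow s r).aemeasurable]
  refine (lintegral_mono' (hb.map_flow_le s r) le_rfl).trans ?_
  rw [lintegral_smul_measure, smul_eq_mul]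

lemma eLpNorm_comp_flow_le (hb : IsSobolevField T β K L b G) (s r : ℝ) {f : Torus d → ℝ}
    (hf : AEStronglyMeasurable f volume) {p : ℝ≥0∞} (hp : p ≠ ∞) :
    eLpNorm (fun x => f (flow (velocity b) s r x)) p volume ≤
      ENNReal.ofReal (Real.exp (L * |s - r|)) ^ (1 / p.toReal) * eLpNorm f p volume := by
  have hX := (hb.continuous_flow s r).aemeasurable (μ := volume)
  have h1 := eLpNorm_map_measure (p := p)
    (hf.mono_ac (hb.quasiMeasurePreserving_flow s r).absolutelyContinuous) hX
  change eLpNorm (f ∘ flow (velocity b) s r) p volume ≤ _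
  rw [← h1]
  refine (eLpNorm_mono_measure f (hb.map_flow_le s r)).trans (le_of_eq ?_)
  rw [eLpNorm_smul_measure_of_ne_top hp, smul_eq_mul]
  simp

lemma memLp_comp_flow (hb : IsSobolevField T β K L b G) (s r : ℝ) {f : Torus d → ℝ} {p : ℝ≥0∞}
    (hp : p ≠ ∞) (hf : MemLp f p volume) :
    MemLp (fun x => f (flow (velocity b) s r x)) p volume :=
  ⟨hf.1.comp_quasiMeasurePreserving (hb.quasiMeasurePreserving_flow s r),
    (hb.eLpNorm_comp_flow_le s r hf.1 hp).trans_lt (ENNReal.mul_lt_top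
      (ENNReal.rpow_lt_top_of_nonneg (by positivity) ENNReal.ofReal_ne_top) hf.2)⟩

lemma integrable_comp_flow (hb : IsSobolevField T β K L b G) (s r : ℝ) {f : Torus d → ℝ}
    (hf : Integrable f) : Integrable fun x => f (flow (velocity b) s r x) :=
  memLp_one_iff_integrable.1
    (hb.memLp_comp_flow s r ENNReal.one_ne_top (memLp_one_iff_integrable.2 hf))

lemma integral_norm_comp_flow_le (hb : IsSobolevField T β K L b G) (s r : ℝ) {f : Torus d → ℝ}
    (hf : Integrable f) : ∫ x, ‖f (flow (velocity b) s r x)‖ ≤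
      Real.exp (L * |s - r|) * ∫ x, ‖f x‖ := by
  have h1 := hb.lintegral_comp_flow_le s r hf.1.enorm
  rw [← ofReal_integral_norm_eq_lintegral_enorm hf, ← ENNReal.ofReal_mul (by positivity),
    ← ofReal_integral_norm_eq_lintegral_enorm (hb.integrable_comp_flow s r hf)] at h1
  exact (ENNReal.ofReal_le_ofReal_iff (by positivity)).1 h1

lemma norm_integral_comp_flow_mul_le (hb : IsSobolevField T β K L b G) (s r : ℝ)
    {f q : Torus d → ℝ} (hf : Integrable f) {A : ℝ} (hq : ∀ᵐ x, |q x| ≤ A) :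
    ‖∫ x, f (flow (velocity b) s r x) * q x‖ ≤ A * (Real.exp (L * |s - r|) * ∫ x, ‖f x‖) := by
  have hA : 0 ≤ A := by
    obtain ⟨x, hx⟩ := hq.exists
    exact (abs_nonneg _).trans hx
  refine (norm_integral_le_of_norm_le ((hb.integrable_comp_flow s r hf).norm.const_mul A) ?_).trans
    ?_
  · filter_upwards [hq] with x hx
    rw [norm_mul, mul_comm]
    exact mul_le_mul_of_nonneg_right hx (norm_nonneg _)
  · rw [integral_const_mul]
    exact mul_le_mul_of_nonneg_left (hb.integral_norm_comp_flow_le s r hf) hA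

lemma measurable_comp_flow (hb : IsSobolevField T β K L b G) (r : ℝ) {f : Torus d → ℝ}
    (hf : Measurable f) : Measurable fun z : ℝ × Torus d => f (flow (velocity b) z.1 r z.2) := by
  have h2 : Continuous fun z : ℝ × Torus d => (z.1, r, z.2) := by fun_prop
  exact hf.comp ((hb.hasFlow.continuous hb.isVelocity).comp h2).measurable

lemma intervalIntegrable_comp_flow_mul (hb : IsSobolevField T β K L b G) {f φ : Torus d → ℝ}
    (hfm : Measurable f) (hf : Integrable f) (hφ : IsSmooth φ) {t : ℝ} (ht : 0 ≤ t) :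
    IntervalIntegrable (fun σ => ∫ x, f (flow (velocity b) σ 0 x) * transportTest b G φ σ x)
      volume 0 t := by
  obtain ⟨A, hA0, hA⟩ := hb.exists_transportTest_le hφ
  have h1 : IntervalIntegrable (fun σ => A * (fieldBound T β K b σ + 1) *
      (Real.exp (L * |t|) * ∫ x, ‖f x‖)) volume 0 t :=
    ((hb.integrable_fieldBound.intervalIntegrable.add intervalIntegrable_const).const_mul
      A).mul_const _
  refine h1.mono_fun' ?_ ?_
  · have h2 : Measurable fun z : ℝ × Torus d => f (flow (velocity b) z.1 0 z.2) *
        transportTest b G φ z.1 z.2 :=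
      (hb.measurable_comp_flow 0 hfm).mul (hb.measurable_transportTest hφ)
    exact h2.stronglyMeasurable.integral_prod_right'.aestronglyMeasurable
  · refine (ae_restrict_iff' measurableSet_uIoc).2 (Eventually.of_forall fun σ hσ => ?_)
    refine (hb.norm_integral_comp_flow_mul_le σ 0 hf (hA σ)).trans ?_
    rw [uIoc_of_le ht] at hσ
    have h3 := hb.fieldBound_nonneg σ
    have h4 := hb.nonneg
    have h5 : 0 ≤ ∫ x, ‖f x‖ := by positivity
    beta_reduce
    gcongr
    · simpa using hσ.1.le
    · simpa using hσ.2

lemma weakForm_of_integrable (hb : IsSobolevField T β K L b G) {f φ : Torus d → ℝ}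
    (hfm : Measurable f) (hf : Integrable f) (hφ : IsSmooth φ) {t : ℝ} (ht : 0 ≤ t) :
    (∫ x, f (flow (velocity b) t 0 x) * φ x) - ∫ x, f x * φ x =
      ∫ σ in (0 : ℝ)..t, ∫ x, f (flow (velocity b) σ 0 x) * transportTest b G φ σ x := by
  obtain ⟨A, hA0, hA⟩ := hb.exists_transportTest_le hφ
  obtain ⟨P, hP0, hP⟩ := exists_bound_of_continuous hφ.continuous
  set E := Real.exp (L * |t|) with hE
  set I := ∫ σ in (0 : ℝ)..t, A * (fieldBound T β K b σ + 1) with hI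
  have hmi : IntervalIntegrable (fun σ => A * (fieldBound T β K b σ + 1)) volume 0 t :=
    (hb.integrable_fieldBound.intervalIntegrable.add intervalIntegrable_const).const_mul A
  have hI0 : 0 ≤ I := intervalIntegral.integral_nonneg_of_forall ht fun σ =>
    mul_nonneg hA0 (by linarith [hb.fieldBound_nonneg σ])
  set D := (∫ x, f (flow (velocity b) t 0 x) * φ x) - (∫ x, f x * φ x) -
    ∫ σ in (0 : ℝ)..t, ∫ x, f (flow (velocity b) σ 0 x) * transportTest b G φ σ x with hD
  have hmulφ : ∀ {h : Torus d → ℝ}, Integrable h → Integrable fun x => h x * φ x := fun hh =>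
    hh.mul_bdd (c := P) hφ.continuous.aestronglyMeasurable (Eventually.of_forall hP)
  have hmulq : ∀ {h : Torus d → ℝ} (σ : ℝ), Integrable h →
      Integrable fun x => h x * transportTest b G φ σ x := fun σ hh =>
    hh.mul_bdd (hb.measurable_transportTest hφ).of_uncurry_left.aestronglyMeasurable (hA σ)
  have key : ∀ ε > 0, |D| ≤ (P * E + P + I * E) * ε := by
    intro ε hε
    obtain ⟨g, hg, _⟩ := (memLp_one_iff_integrable.2 hf).exists_boundedContinuous_eLpNorm_sub_le
      ENNReal.one_ne_top (ε := ENNReal.ofReal ε) (by simpa using hε)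
    have hgi := integrable_of_continuous g.continuous
    have hfg : Integrable fun x => f x - g x := hf.sub hgi
    have hfgm : Measurable fun x => f x - g x := hfm.sub g.continuous.measurable
    have hle : ∫ x, ‖f x - g x‖ ≤ ε := by
      rw [eLpNorm_one_eq_lintegral_enorm] at hg
      have : ENNReal.ofReal (∫ x, ‖f x - g x‖) ≤ ENNReal.ofReal ε := by
        rw [ofReal_integral_norm_eq_lintegral_enorm hfg]
        exact hg
      exact (ENNReal.ofReal_le_ofReal_iff hε.le).1 this
    have hw := hb.weakForm g.continuous hφ 0 ht
    simp_rw [hb.hasFlow.self] at hw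
    have hi1 := hb.integrable_comp_flow t 0 hf
    have hi2 := hb.integrable_comp_flow t 0 hgi
    have hD' : D = (∫ x, (f (flow (velocity b) t 0 x) - g (flow (velocity b) t 0 x)) * φ x) -
        (∫ x, (f x - g x) * φ x) - ∫ σ in (0 : ℝ)..t, ∫ x,
          (f (flow (velocity b) σ 0 x) - g (flow (velocity b) σ 0 x)) *
            transportTest b G φ σ x := by
      have h1 : ∀ σ, ∫ x, (f (flow (velocity b) σ 0 x) - g (flow (velocity b) σ 0 x)) *
          transportTest b G φ σ x = (∫ x, f (flow (velocity b) σ 0 x) * transportTest b G φ σ x) -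
          ∫ x, g (flow (velocity b) σ 0 x) * transportTest b G φ σ x := fun σ => by
        simp_rw [sub_mul]
        exact integral_sub (hmulq σ (hb.integrable_comp_flow σ 0 hf))
          (hmulq σ (hb.integrable_comp_flow σ 0 hgi))
      simp_rw [h1, sub_mul]
      rw [integral_sub (hmulφ hi1) (hmulφ hi2), integral_sub (hmulφ hf) (hmulφ hgi),
        intervalIntegral.integral_sub (hb.intervalIntegrable_comp_flow_mul hfm hf hφ ht)
        (hb.intervalIntegrable_comp_flow_mul g.continuous.measurable hgi hφ ht), ← hw]
      ring
    have hL := hb.nonneg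
    have hnn : 0 ≤ ∫ x, ‖f x - g x‖ := by positivity
    have b1 : |∫ x, (f (flow (velocity b) t 0 x) - g (flow (velocity b) t 0 x)) * φ x| ≤
        P * E * ε := by
      refine (hb.norm_integral_comp_flow_mul_le t 0 hfg (q := φ)
        (Eventually.of_forall hP)).trans ?_
      rw [sub_zero, mul_assoc]
      gcongr
    have b2 : |∫ x, (f x - g x) * φ x| ≤ P * ε := by
      rw [← Real.norm_eq_abs]
      refine (norm_integral_le_of_norm_le (hfg.norm.const_mul P)
        (Eventually.of_forall fun x => ?_)).trans ?_
      · rw [norm_mul, mul_comm]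
        exact mul_le_mul_of_nonneg_right (hP x) (norm_nonneg _)
      · rw [integral_const_mul]
        gcongr
    have b3 : |∫ σ in (0 : ℝ)..t, ∫ x, (f (flow (velocity b) σ 0 x) -
        g (flow (velocity b) σ 0 x)) * transportTest b G φ σ x| ≤ I * E * ε := by
      rw [← Real.norm_eq_abs]
      refine (intervalIntegral.norm_integral_le_of_norm_le ht
        (g := fun σ => A * (fieldBound T β K b σ + 1) * (E * ε))
        (Eventually.of_forall fun σ hσ => ?_) (hmi.mul_const _)).trans ?_
      · refine (hb.norm_integral_comp_flow_mul_le σ 0 hfg (hA σ)).trans ?_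
        have h3 := hb.fieldBound_nonneg σ
        rw [hE, sub_zero]
        gcongr
        exact hσ.1.le
        exact hσ.2
      · rw [intervalIntegral.integral_mul_const, mul_assoc]
    rw [hD']
    refine (abs_sub _ _).trans ((add_le_add ((abs_sub _ _).trans (add_le_add b1 b2)) b3).trans
      (le_of_eq (by ring)))
  have h1 : Tendsto (fun ε : ℝ => (P * E + P + I * E) * ε) (𝓝[>] 0)
      (𝓝 ((P * E + P + I * E) * 0)) := by
    have : Continuous fun ε : ℝ => (P * E + P + I * E) * ε := by fun_prop
    exact (this.tendsto 0).mono_left nhdsWithin_le_nhds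
  have h2 := ge_of_tendsto h1 (eventually_nhdsWithin_of_forall fun ε hε => key ε hε)
  rw [mul_zero] at h2
  have h3 := abs_nonpos_iff.1 h2
  rw [hD] at h3
  linarith

end IsSobolevField

end

end TorusTransport


namespace TorusTransport

noncomputable section

variable {d : ℕ}

namespace IsSobolevField

variable {T β K L : ℝ} {b : ℝ → Torus d → EuclideanSpace ℝ (Fin d)}
    {G : ℝ → Torus d → Matrix (Fin d) (Fin d) ℝ}

lemma isWeaklyContinuous_comp_flow (hb : IsSobolevField T β K L b G) {p q : ℝ≥0∞}
    [ENNReal.HolderConjugate p q] (hp : p ≠ ∞) {f ψ : Torus d → ℝ} (hf : MemLp f p volume)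
    (hψ : MemLp ψ q volume) :
    ContinuousOn (fun t => ∫ x, f (flow (velocity b) t 0 x) * ψ x) (Icc 0 T) := by
  set E := (ENNReal.ofReal (Real.exp (L * T)) ^ (1 / p.toReal)).toReal with hE
  have hE0 : ENNReal.ofReal (Real.exp (L * T)) ^ (1 / p.toReal) ≠ ∞ :=
    (ENNReal.rpow_lt_top_of_nonneg (by positivity) ENNReal.ofReal_ne_top).ne
  set N := (eLpNorm ψ q volume).toReal with hN
  have hψi : Integrable ψ :=
    hψ.integrable (ENNReal.HolderConjugate.symm (p := p) (q := q)).one_le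
  refine continuousOn_of_uniform_approx_of_continuousOn fun U hU => ?_
  obtain ⟨ε, hε, hεU⟩ := Metric.mem_uniformity_dist.1 hU
  set δ := ε / (2 * (E * N + 1)) with hδ
  have hδ0 : 0 < δ := by positivity
  obtain ⟨g, hg, hgp⟩ := hf.exists_boundedContinuous_eLpNorm_sub_le hp
    (ε := ENNReal.ofReal δ) (by simpa using hδ0)
  have hfg : MemLp (fun x => f x - g x) p volume := hf.sub hgp
  obtain ⟨P, hP0, hP⟩ := exists_bound_of_continuous g.continuous
  have hgc := hb.continuous_comp_flow g.continuous 0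
  refine ⟨fun t => ∫ x, g (flow (velocity b) t 0 x) * ψ x, ?_, fun t ht => hεU ?_⟩
  · refine Continuous.continuousOn ?_
    refine continuous_of_dominated (bound := fun x => P * ‖ψ x‖)
      (fun t => (hgc.comp (by fun_prop : Continuous fun x => (t, x))).aestronglyMeasurable.mul
        hψ.1) (fun t => Eventually.of_forall fun x => ?_) (hψi.norm.const_mul P)
      (Eventually.of_forall fun x =>
        (hgc.comp (by fun_prop : Continuous fun t => (t, x))).mul continuous_const)
    rw [norm_mul]
    exact mul_le_mul_of_nonneg_right (hP _) (norm_nonneg _)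
  · have h1 := hb.memLp_comp_flow t 0 hp hf
    have h2 := hb.memLp_comp_flow t 0 hp hgp
    have i1 : Integrable fun x => f (flow (velocity b) t 0 x) * ψ x := MemLp.integrable_mul h1 hψ
    have i2 : Integrable fun x => g (flow (velocity b) t 0 x) * ψ x := MemLp.integrable_mul h2 hψ
    rw [Real.dist_eq, ← integral_sub i1 i2]
    simp_rw [← sub_mul]
    refine (abs_integral_mul_le_eLpNorm (hb.memLp_comp_flow t 0 hp hfg) hψ).trans_lt ?_
    have h3 : (eLpNorm (fun x => f (flow (velocity b) t 0 x) - g (flow (velocity b) t 0 x)) p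
        volume).toReal ≤ E * δ := by
      rw [hE, ← ENNReal.toReal_ofReal hδ0.le, ← ENNReal.toReal_mul]
      refine ENNReal.toReal_mono (ENNReal.mul_ne_top hE0 ENNReal.ofReal_ne_top) ?_
      refine (hb.eLpNorm_comp_flow_le t 0 hfg.1 hp).trans (mul_le_mul' ?_ hg)
      refine ENNReal.rpow_le_rpow (ENNReal.ofReal_le_ofReal ?_) (by positivity)
      rw [sub_zero, abs_of_nonneg ht.1]
      have := hb.nonneg
      gcongr
      exact ht.2
    have hN0 : 0 ≤ N := ENNReal.toReal_nonneg
    have hE0' : 0 ≤ E := ENNReal.toReal_nonneg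
    calc _ ≤ E * δ * N := mul_le_mul_of_nonneg_right h3 hN0
      _ < ε := by
        have h4 : δ * (2 * (E * N + 1)) = ε := by rw [hδ]; field_simp
        nlinarith [mul_nonneg hE0' hN0]

/-- Composition with the flow solves the transport equation. -/
lemma isTransportSolution_comp_flow (hb : IsSobolevField T β K L b G) {p : ℝ}
    (hp : 1 ≤ p) {u₀ f : Torus d → ℝ} (hfm : Measurable f)
    (hf : MemLp f (ENNReal.ofReal p) volume) (hfu : f =ᵐ[volume] u₀) :
    IsTransportSolution T p (velocity b) G u₀ fun t x => f (flow (velocity b) t 0 x) := by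
  have hp1 : (1 : ℝ≥0∞) ≤ ENNReal.ofReal p := by rwa [ENNReal.one_le_ofReal]
  have hpt : ENNReal.ofReal p ≠ ∞ := ENNReal.ofReal_ne_top
  have hfi : Integrable f := hf.integrable hp1
  refine ⟨(hb.measurable_comp_flow 0 hfm).aestronglyMeasurable,
    fun t _ => hb.memLp_comp_flow t 0 hpt hf, ?_, fun q _ ψ hψ =>
    hb.isWeaklyContinuous_comp_flow hpt hf hψ, fun φ hφ => ?_, fun φ hφ t ht => ?_⟩
  · set M : ℝ≥0∞ := ENNReal.ofReal (Real.exp (L * T)) ^ (1 / (ENNReal.ofReal p).toReal) *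
      eLpNorm f (ENNReal.ofReal p) volume with hM
    have hMt : M ≠ ∞ := ENNReal.mul_ne_top
      (ENNReal.rpow_lt_top_of_nonneg (by positivity) ENNReal.ofReal_ne_top).ne hf.2.ne
    refine ⟨M.toNNReal, fun t ht => ?_⟩
    rw [ENNReal.coe_toNNReal hMt]
    refine (hb.eLpNorm_comp_flow_le t 0 hf.1 hpt).trans (mul_le_mul' ?_ le_rfl)
    refine ENNReal.rpow_le_rpow (ENNReal.ofReal_le_ofReal ?_) (by positivity)
    rw [sub_zero, abs_of_nonneg ht.1]
    have := hb.nonneg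
    gcongr
    exact ht.2
  · obtain ⟨A, hA0, hA⟩ := hb.exists_transportTest_le hφ
    have hm : Measurable fun z : ℝ × Torus d => f (flow (velocity b) z.1 0 z.2) *
        transportTest b G φ z.1 z.2 :=
      (hb.measurable_comp_flow 0 hfm).mul (hb.measurable_transportTest hφ)
    change Integrable (fun z : ℝ × Torus d => f (flow (velocity b) z.1 0 z.2) *
        transportTest b G φ z.1 z.2) (spaceTime d T)
    rw [spaceTime, integrable_prod_iff hm.aestronglyMeasurable]
    have hsl : ∀ σ, Integrable fun x => f (flow (velocity b) σ 0 x) * transportTest b G φ σ x :=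
      fun σ => (hb.integrable_comp_flow σ 0 hfi).mul_bdd
        (hb.measurable_transportTest hφ).of_uncurry_left.aestronglyMeasurable (hA σ)
    refine ⟨Eventually.of_forall hsl, ?_⟩
    have h1 : Integrable (fun σ => A * (fieldBound T β K b σ + 1) *
        (Real.exp (L * T) * ∫ x, ‖f x‖)) (volume.restrict (Icc 0 T)) :=
      ((hb.integrable_fieldBound.restrict.add (integrable_const _)).const_mul A).mul_const _
    refine h1.mono' hm.norm.stronglyMeasurable.integral_prod_right'.aestronglyMeasurable ?_
    refine (ae_restrict_iff' measurableSet_Icc).2 (Eventually.of_forall fun σ hσ => ?_)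
    rw [Real.norm_of_nonneg (by positivity)]
    have h3 := hb.fieldBound_nonneg σ
    have h5 : 0 ≤ ∫ x, ‖f x‖ := by positivity
    have h6 := hb.nonneg
    calc ∫ x, ‖f (flow (velocity b) σ 0 x) * transportTest b G φ σ x‖
        ≤ ∫ x, A * (fieldBound T β K b σ + 1) * ‖f (flow (velocity b) σ 0 x)‖ := by
          refine integral_mono_ae (hsl σ).norm
            ((hb.integrable_comp_flow σ 0 hfi).norm.const_mul _) ?_
          filter_upwards [hA σ] with x hx
          rw [norm_mul, mul_comm]
          exact mul_le_mul_of_nonneg_right hx (norm_nonneg _)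
      _ ≤ A * (fieldBound T β K b σ + 1) * (Real.exp (L * |σ - 0|) * ∫ x, ‖f x‖) := by
          rw [integral_const_mul]
          exact mul_le_mul_of_nonneg_left (hb.integral_norm_comp_flow_le σ 0 hfi) (by positivity)
      _ ≤ _ := by
          rw [sub_zero, abs_of_nonneg hσ.1]
          gcongr
          exact hσ.2
  · have h1 : ∫ x, u₀ x * φ x = ∫ x, f x * φ x :=
      integral_congr_ae (by filter_upwards [hfu] with x hx; rw [hx])
    rw [h1]
    exact hb.weakForm_of_integrable hfm hfi hφ ht.1

end IsSobolevField

end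

end TorusTransport


namespace TorusTransport

noncomputable section

variable {d : ℕ}

/-- A function with infinitesimal increments relative to `M` is nonincreasing. -/
lemma le_of_small_increments {f M : ℝ → ℝ} {a b : ℝ} (hab : a ≤ b)
    (h : ∀ ε > 0, ∃ δ > 0, ∀ s ∈ Icc a b, ∀ t ∈ Icc a b, s ≤ t → t - s ≤ δ →
      f t - f s ≤ ε * (M t - M s)) : f b ≤ f a := by
  have key : ∀ ε > 0, f b - f a ≤ ε * (M b - M a) := by
    intro ε hε
    obtain ⟨δ, hδ, hfM⟩ := h ε hε
    obtain ⟨N, hN⟩ := exists_nat_gt ((b - a) / δ)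
    have hN0 : (0 : ℝ) < N := lt_of_le_of_lt (div_nonneg (sub_nonneg.2 hab) hδ.le) hN
    set p : ℕ → ℝ := fun k => a + k * ((b - a) / N) with hp
    have hstep : 0 ≤ (b - a) / N := div_nonneg (sub_nonneg.2 hab) hN0.le
    have hp0 : p 0 = a := by simp [hp]
    have hpN : p N = b := by simp only [hp]; field_simp; ring
    have hmem : ∀ k ≤ N, p k ∈ Icc a b := by
      intro k hk
      refine ⟨by simp only [hp]; nlinarith [mul_nonneg (Nat.cast_nonneg (α := ℝ) k) hstep], ?_⟩
      rw [← hpN]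
      simp only [hp]
      gcongr
    have h1 : ∀ k ∈ Finset.range N, f (p (k + 1)) - f (p k) ≤ ε * M (p (k + 1)) - ε * M (p k) := by
      intro k hk
      have hk' := Finset.mem_range.1 hk
      have h2 : p (k + 1) - p k = (b - a) / N := by simp only [hp]; push_cast; ring
      have h3 : (b - a) / N ≤ δ := by
        rw [div_le_iff₀ hN0]
        have := (div_lt_iff₀ hδ).1 hN
        linarith
      have := hfM _ (hmem k hk'.le) _ (hmem (k + 1) hk') (by linarith) (by linarith)
      linarith
    have h4 := Finset.sum_le_sum h1
    rw [Finset.sum_range_sub (fun k => f (p k)), Finset.sum_range_sub (fun k => ε * M (p k)), hp0,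
      hpN] at h4
    linarith
  refine sub_nonpos.1 (le_of_forall_pos_le_add fun ε hε => ?_)
  have h1 : 0 < |M b - M a| + 1 := by positivity
  refine (key (ε / (|M b - M a| + 1)) (by positivity)).trans ?_
  rw [zero_add, div_mul_eq_mul_div, div_le_iff₀ h1]
  have := le_abs_self (M b - M a)
  nlinarith

lemma integral_mul_mollify {κ : Torus d → ℝ} (hκ : Continuous κ) {f g : Torus d → ℝ}
    (hf : Integrable f) (hg : Integrable g) :
    ∫ x, f x * mollify κ g x = ∫ x, g x * mollify (fun z => κ (-z)) f x := by
  obtain ⟨C, _, hC⟩ := exists_bound_of_continuous hκ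
  simp only [mollify, ← integral_const_mul, smul_eq_mul]
  rw [integral_integral_swap]
  · refine integral_congr_ae (Eventually.of_forall fun y => integral_congr_ae
      (Eventually.of_forall fun x => ?_))
    simp only [neg_sub]
    ring
  · have h1 : Continuous fun z : Torus d × Torus d => κ (z.1 - z.2) := by fun_prop
    refine ((hf.mul_prod hg).bdd_mul h1.aestronglyMeasurable
      (Eventually.of_forall fun z => hC _)).congr (Eventually.of_forall fun z => ?_)
    simp only [Function.uncurry]
    ring

lemma mollify_neg_kernel {κ : Torus d → ℝ} (f : Torus d → ℝ) (x : Torus d) :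
    mollify (fun z => -κ z) f x = -mollify κ f x := by
  simp [mollify, integral_neg]

namespace IsMollifier

variable {c r : ℝ} {ρ : Torus d → ℝ}

lemma partialDeriv_neg (hρ : IsMollifier c r ρ) (j : Fin d) (x : Torus d) :
    TorusTransport.partialDeriv j ρ (-x) = -TorusTransport.partialDeriv j ρ x := by
  have h := partialDeriv_comp_sub_left j hρ.smooth 0 x
  simp only [zero_sub] at h
  rw [eq_neg_iff_add_eq_zero, ← neg_eq_zero, neg_add, ← h]
  simp only [hρ.even]
  ring

lemma integral_mul_mollify (hρ : IsMollifier c r ρ) {f g : Torus d → ℝ}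
    (hf : Integrable f) (hg : Integrable g) :
    ∫ x, f x * mollify ρ g x = ∫ x, g x * mollify ρ f x := by
  rw [TorusTransport.integral_mul_mollify hρ.smooth.continuous hf hg]
  simp only [hρ.even]

lemma integral_mul_mollify_partialDeriv (hρ : IsMollifier c r ρ) (j : Fin d) {f g : Torus d → ℝ}
    (hf : Integrable f) (hg : Integrable g) :
    ∫ x, f x * mollify (TorusTransport.partialDeriv j ρ) g x =
      -∫ x, g x * mollify (TorusTransport.partialDeriv j ρ) f x := by
  rw [TorusTransport.integral_mul_mollify (hρ.smooth.partialDeriv j).continuous hf hg, ← integral_neg]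
  simp only [hρ.partialDeriv_neg, mollify_neg_kernel, mul_neg]

lemma abs_mollify_le_of_ae (hρ : IsMollifier c r ρ) {f : Torus d → ℝ} {A : ℝ}
    (hf : ∀ᵐ x, |f x| ≤ A) (x : Torus d) : |mollify ρ f x| ≤ A := by
  have hi : Integrable fun y => ρ (x - y) :=
    integrable_of_continuous (hρ.smooth.comp_sub_left x).continuous
  have h3 : ∫ y, ρ (x - y) * A = A := by
    rw [integral_mul_const, integral_sub_left_eq_self ρ, hρ.integral_eq_one, one_mul]
  rw [mollify, ← Real.norm_eq_abs]
  conv_rhs => rw [← h3]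
  refine norm_integral_le_of_norm_le (hi.mul_const A) ?_
  filter_upwards [hf] with y hy
  rw [norm_smul, Real.norm_of_nonneg (hρ.nonneg _)]
  exact mul_le_mul_of_nonneg_left hy (hρ.nonneg _)

lemma abs_mollify_partialDeriv_le (hρ : IsMollifier c r ρ) (hc : 0 ≤ c) (hr : 0 < r) (j : Fin d)
    {x : Torus d} {h : Torus d → ℝ} {A : ℝ} (hA : 0 ≤ A) (hh : ∀ y, dist x y ≤ r → |h y| ≤ A) :
    |mollify (TorusTransport.partialDeriv j ρ) h x| ≤ c * 2 ^ d / r * A := by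
  have hv : (volume (Metric.closedBall x r)).toReal ≤ (2 * r) ^ d :=
    ENNReal.toReal_le_of_le_ofReal (by positivity) (volume_closedBall_torus_le x hr.le)
  have h1 : Integrable ((Metric.closedBall x r).indicator fun _ : Torus d => c / r ^ (d + 1) * A) :=
    (integrable_const _).indicator Metric.isClosed_closedBall.measurableSet
  rw [mollify, ← Real.norm_eq_abs]
  refine (norm_integral_le_of_norm_le h1 (Eventually.of_forall fun y => ?_)).trans ?_
  · by_cases hy : dist x y ≤ r
    · rw [indicator_of_mem (by rwa [Metric.mem_closedBall, dist_comm]), norm_smul]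
      exact mul_le_mul (hρ.partialDeriv_le j _) (hh y hy) (norm_nonneg _) (by positivity)
    · have h2 : TorusTransport.partialDeriv j ρ (x - y) = 0 := by
        by_contra h3
        exact hy (by rw [dist_eq_norm]; exact hρ.partialDeriv_support j _ h3)
      rw [h2, zero_smul, norm_zero]
      exact indicator_nonneg (fun _ _ => by positivity) _
  · rw [integral_indicator Metric.isClosed_closedBall.measurableSet, setIntegral_const, smul_eq_mul,
      Measure.real]
    calc (volume (Metric.closedBall x r)).toReal * (c / r ^ (d + 1) * A)
        ≤ (2 * r) ^ d * (c / r ^ (d + 1) * A) := by gcongr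
      _ = _ := by rw [mul_pow, pow_succ]; field_simp

end IsMollifier

lemma abs_divTest_sub_le {D : Torus d → EuclideanSpace ℝ (Fin d)} {δ φ φ' : Torus d → ℝ}
    {x : Torus d} {ε : ℝ} (h : |φ x - φ' x| ≤ ε)
    (h' : ∀ i, |partialDeriv i φ x - partialDeriv i φ' x| ≤ ε) :
    |divTest D δ φ x - divTest D δ φ' x| ≤ ε * (d * ‖D x‖ + |δ x|) := by
  have h1 : divTest D δ φ x - divTest D δ φ' x =
      (∑ i, D x i * (partialDeriv i φ x - partialDeriv i φ' x)) + δ x * (φ x - φ' x) := by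
    simp only [divTest, mul_sub, Finset.sum_sub_distrib]
    ring
  rw [h1]
  have hε : 0 ≤ ε := (abs_nonneg _).trans h
  have h2 : |∑ i, D x i * (partialDeriv i φ x - partialDeriv i φ' x)| ≤ ∑ _i : Fin d, ‖D x‖ * ε :=
    (Finset.abs_sum_le_sum_abs _ _).trans (Finset.sum_le_sum fun i _ => by
      rw [abs_mul]
      exact mul_le_mul (PiLp.norm_apply_le (D x) i) (h' i) (abs_nonneg _) (norm_nonneg _))
  rw [Finset.sum_const, Finset.card_univ, Fintype.card_fin, nsmul_eq_mul] at h2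
  have h3 : |δ x * (φ x - φ' x)| ≤ |δ x| * ε := by
    rw [abs_mul]
    exact mul_le_mul_of_nonneg_left h (abs_nonneg _)
  have := abs_add_le (∑ i, D x i * (partialDeriv i φ x - partialDeriv i φ' x)) (δ x * (φ x - φ' x))
  nlinarith

namespace IsSobolevField

variable {T β K L : ℝ} {b : ℝ → Torus d → EuclideanSpace ℝ (Fin d)}
  {G : ℝ → Torus d → Matrix (Fin d) (Fin d) ℝ}

lemma continuous_velocity (hb : IsSobolevField T β K L b G) (t : ℝ) : Continuous (velocity b t) :=
  hb.isVelocity.continuous t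

lemma sum_mollify_partialDeriv_velocity (hb : IsSobolevField T β K L b G) {ρ : Torus d → ℝ}
    (hρ : IsSmooth ρ) (t : ℝ) (x : Torus d) :
    ∑ i, mollify (partialDeriv i ρ) (fun y => velocity b t y i) x =
      mollify ρ (fun y => (G t y).trace) x := by
  have h1 : ∀ i, mollify (partialDeriv i ρ) (fun y => velocity b t y i) x =
      mollify ρ (fun y => G t y i i) x := by
    intro i
    rw [← (hb.isWeakGradient t).mollify_partialDeriv hρ i i x]
    refine integral_congr_ae ?_
    filter_upwards [hb.velocity_ae_eq t] with y hy
    rw [hy]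
  simp_rw [h1, mollify]
  rw [← integral_finsetSum _ fun i _ => integrable_mollify_integrand hρ.continuous
    ((hb.isWeakGradient t).integrable_grad i i) x]
  refine integral_congr_ae (Eventually.of_forall fun y => ?_)
  simp only [Matrix.trace, Matrix.diag, smul_eq_mul, Finset.mul_sum]

/-- The commutator of the mollification and of the transport operator, at one point. -/
lemma abs_commutator_le (hb : IsSobolevField T β K L b G) {c r : ℝ} {ρ : Torus d → ℝ}
    (hρ : IsMollifier c r ρ) (hc : 0 ≤ c) (hr : 0 < r) (t : ℝ) {η : Torus d → ℝ} {P o e : ℝ}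
    (hη : Continuous η) (hP : ∀ x, |η x| ≤ P) (ho : ∀ x y, dist x y ≤ r → |η y - η x| ≤ o)
    (he : ∀ x y, dist x y ≤ r → ‖velocity b t y - velocity b t x‖ ≤ e) (x : Torus d) :
    |∑ i, (velocity b t x i * mollify (partialDeriv i ρ) η x -
      mollify (partialDeriv i ρ) (fun y => η y * velocity b t y i) x)| ≤
      L * P + d * (c * 2 ^ d / r * (o * e)) := by
  have hvc : ∀ i, Continuous fun y => velocity b t y i := fun i =>
    (EuclideanSpace.proj (𝕜 := ℝ) i).continuous.comp (hb.continuous_velocity t)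
  have h0 : ∀ i, ∫ y, partialDeriv i ρ (x - y) = 0 := fun i => by
    rw [integral_sub_left_eq_self (partialDeriv i ρ), integral_partialDeriv i hρ.smooth]
  have h1 : ∀ i, velocity b t x i * mollify (partialDeriv i ρ) η x -
      mollify (partialDeriv i ρ) (fun y => η y * velocity b t y i) x =
      -mollify (partialDeriv i ρ)
        (fun y => (η y - η x) * (velocity b t y i - velocity b t x i)) x -
      η x * mollify (partialDeriv i ρ) (fun y => velocity b t y i) x := by
    intro i
    have hk : Continuous fun y => partialDeriv i ρ (x - y) :=
      ((hρ.smooth.partialDeriv i).comp_sub_left x).continuous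
    have e1 : Integrable fun y => partialDeriv i ρ (x - y) * (η y * velocity b t y i) :=
      integrable_of_continuous (hk.mul (hη.mul (hvc i)))
    have e2 : Integrable fun y => velocity b t x i * (partialDeriv i ρ (x - y) * η y) :=
      integrable_of_continuous (continuous_const.mul (hk.mul hη))
    have e3 : Integrable fun y => η x * (partialDeriv i ρ (x - y) * velocity b t y i) :=
      integrable_of_continuous (continuous_const.mul (hk.mul (hvc i)))
    have e4 : Integrable fun y => η x * velocity b t x i * partialDeriv i ρ (x - y) :=
      integrable_of_continuous (continuous_const.mul hk)
    have h2 : mollify (partialDeriv i ρ)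
        (fun y => (η y - η x) * (velocity b t y i - velocity b t x i)) x =
        ∫ y, (partialDeriv i ρ (x - y) * (η y * velocity b t y i) -
          velocity b t x i * (partialDeriv i ρ (x - y) * η y) -
          η x * (partialDeriv i ρ (x - y) * velocity b t y i) +
          η x * velocity b t x i * partialDeriv i ρ (x - y)) := by
      refine integral_congr_ae (Eventually.of_forall fun y => ?_)
      simp only [smul_eq_mul]
      ring
    have e12 : Integrable fun y => partialDeriv i ρ (x - y) * (η y * velocity b t y i) -
          velocity b t x i * (partialDeriv i ρ (x - y) * η y) := e1.sub e2
    have e123 : Integrable fun y => partialDeriv i ρ (x - y) * (η y * velocity b t y i) -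
          velocity b t x i * (partialDeriv i ρ (x - y) * η y) -
          η x * (partialDeriv i ρ (x - y) * velocity b t y i) := e12.sub e3
    rw [h2, integral_add e123 e4, integral_sub e12 e3, integral_sub e1 e2, integral_const_mul,
      integral_const_mul, integral_const_mul, h0]
    simp only [mollify, smul_eq_mul]
    ring
  simp_rw [h1]
  rw [Finset.sum_sub_distrib, ← Finset.mul_sum, hb.sum_mollify_partialDeriv_velocity hρ.smooth]
  have h3 : |η x * mollify ρ (fun y => (G t y).trace) x| ≤ P * L := by
    rw [abs_mul]
    exact mul_le_mul (hP x) (hρ.abs_mollify_le_of_ae (hb.trace_le t) x) (abs_nonneg _)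
      ((abs_nonneg _).trans (hP x))
  have ho0 : 0 ≤ o := (abs_nonneg _).trans (ho x x (by simpa using hr.le))
  have he0 : 0 ≤ e := (norm_nonneg _).trans (he x x (by simpa using hr.le))
  have h4 : |∑ i, -mollify (partialDeriv i ρ)
        (fun y => (η y - η x) * (velocity b t y i - velocity b t x i)) x| ≤
      ∑ _i : Fin d, c * 2 ^ d / r * (o * e) := by
    refine (Finset.abs_sum_le_sum_abs _ _).trans (Finset.sum_le_sum fun i _ => ?_)
    rw [abs_neg]
    refine hρ.abs_mollify_partialDeriv_le hc hr i (mul_nonneg ho0 he0) fun y hy => ?_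
    rw [abs_mul]
    refine mul_le_mul (ho x y hy) ?_ (abs_nonneg _) ho0
    exact (PiLp.norm_apply_le (velocity b t y - velocity b t x) i).trans (he x y hy)
  rw [Finset.sum_const, Finset.card_univ, Fintype.card_fin, nsmul_eq_mul] at h4
  have := abs_sub (∑ i, -mollify (partialDeriv i ρ)
        (fun y => (η y - η x) * (velocity b t y i - velocity b t x i)) x)
    (η x * mollify ρ (fun y => (G t y).trace) x)
  linarith

/-- The mollified product of an integrable function and of a continuous one is almost transported:
only divergence terms remain, up to a commutator. -/
lemma abs_integral_transportTest_add_le (hb : IsSobolevField T β K L b G) {c r : ℝ}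
    {ρ : Torus d → ℝ} (hρ : IsMollifier c r ρ) (hc : 0 ≤ c) (hr : 0 < r) (t : ℝ)
    {f η : Torus d → ℝ} {P o e : ℝ} (hf : Integrable f)
    (hη : Continuous η) (hP : ∀ x, |η x| ≤ P) (ho : ∀ x y, dist x y ≤ r → |η y - η x| ≤ o)
    (he : ∀ x y, dist x y ≤ r → ‖velocity b t y - velocity b t x‖ ≤ e) :
    |(∫ x, f x * transportTest b G (mollify ρ η) t x) +
      ∫ x, η x * transportTest b G (mollify ρ f) t x| ≤
      (3 * (L * P) + d * (c * 2 ^ d / r * (o * e))) * ∫ x, ‖f x‖ := by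
  have hvc : ∀ i, Continuous fun y => velocity b t y i := fun i =>
    (EuclideanSpace.proj (𝕜 := ℝ) i).continuous.comp (hb.continuous_velocity t)
  have hηi := integrable_of_continuous hη
  have hP0 : 0 ≤ P := (abs_nonneg _).trans (hP 0)
  have htr := hb.integrable_trace t
  have hηδ : Integrable fun x => η x * (G t x).trace :=
    htr.bdd_mul hη.aestronglyMeasurable (Eventually.of_forall hP)
  have hmf := (hρ.smooth.mollify hf)
  have hmη := (hρ.smooth.mollify hηi)
  set B : Torus d → ℝ := fun x => (∑ i, (velocity b t x i * mollify (partialDeriv i ρ) η x -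
      mollify (partialDeriv i ρ) (fun y => η y * velocity b t y i) x)) +
      ((G t x).trace * mollify ρ η x + mollify ρ (fun y => η y * (G t y).trace) x) with hB
  have hmc : ∀ i {g : Torus d → ℝ}, Integrable g → Continuous (mollify (partialDeriv i ρ) g) :=
    fun i g hg => ((hρ.smooth.partialDeriv i).mollify hg).continuous
  have hηv : ∀ i, Integrable fun y => η y * velocity b t y i := fun i =>
    integrable_of_continuous (hη.mul (hvc i))
  have hfc : ∀ {g : Torus d → ℝ}, Continuous g → Integrable fun x => f x * g x := by
    intro g hg
    obtain ⟨C, _, hC⟩ := exists_bound_of_continuous hg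
    exact hf.mul_bdd hg.aestronglyMeasurable (Eventually.of_forall hC)
  have i1 : ∀ i, Integrable fun x => f x * (velocity b t x i * mollify (partialDeriv i ρ) η x) :=
    fun i => hfc ((hvc i).mul (hmc i hηi))
  have i2 : ∀ i, Integrable fun x =>
      f x * mollify (partialDeriv i ρ) (fun y => η y * velocity b t y i) x :=
    fun i => hfc (hmc i (hηv i))
  have i3 : Integrable fun x => f x * ((G t x).trace * mollify ρ η x) := by
    have h1 : Integrable fun x => f x * mollify ρ η x := hfc hmη.continuous
    have h2 : Integrable fun x => f x * mollify ρ η x * (G t x).trace :=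
      h1.mul_bdd htr.1 (hb.trace_le t)
    exact h2.congr (Eventually.of_forall fun x => by simp only; ring)
  have i4 : Integrable fun x => f x * mollify ρ (fun y => η y * (G t y).trace) x :=
    hfc (hρ.smooth.mollify hηδ).continuous
  have i5 : ∀ i, Integrable fun x => η x * velocity b t x i * mollify (partialDeriv i ρ) f x :=
    fun i => integrable_of_continuous ((hη.mul (hvc i)).mul (hmc i hf))
  have i6 : Integrable fun x => η x * (G t x).trace * mollify ρ f x := by
    obtain ⟨C, _, hC⟩ := exists_bound_of_continuous hmf.continuous
    exact hηδ.mul_bdd hmf.continuous.aestronglyMeasurable (Eventually.of_forall hC)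
  have hA1 : ∫ x, f x * transportTest b G (mollify ρ η) t x =
      (∑ i, ∫ x, f x * (velocity b t x i * mollify (partialDeriv i ρ) η x)) +
        ∫ x, f x * ((G t x).trace * mollify ρ η x) := by
    rw [← integral_finsetSum _ fun i _ => i1 i, ← integral_add (integrable_finsetSum _ fun i _ => i1 i)
      i3]
    refine integral_congr_ae (Eventually.of_forall fun x => ?_)
    simp only [transportTest, divTest, partialDeriv_mollify hρ.smooth hηi, mul_add, Finset.mul_sum]
  have hA2 : ∫ x, η x * transportTest b G (mollify ρ f) t x =
      (∑ i, -∫ x, f x * mollify (partialDeriv i ρ) (fun y => η y * velocity b t y i) x) +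
        ∫ x, f x * mollify ρ (fun y => η y * (G t y).trace) x := by
    rw [← hρ.integral_mul_mollify hηδ hf]
    simp_rw [← hρ.integral_mul_mollify_partialDeriv _ (hηv _) hf]
    rw [← integral_finsetSum _ fun i _ => i5 i, ← integral_add (integrable_finsetSum _ fun i _ => i5 i)
      i6]
    refine integral_congr_ae (Eventually.of_forall fun x => ?_)
    simp only [transportTest, divTest, partialDeriv_mollify hρ.smooth hf, mul_add, Finset.mul_sum,
      mul_assoc]
  have hA : (∫ x, f x * transportTest b G (mollify ρ η) t x) +
      (∫ x, η x * transportTest b G (mollify ρ f) t x) = ∫ x, f x * B x := by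
    have i34 : Integrable fun x => f x * ((G t x).trace * mollify ρ η x) +
      f x * mollify ρ (fun y => η y * (G t y).trace) x := i3.add i4
    have i12 : ∀ i, Integrable fun x => f x * (velocity b t x i * mollify (partialDeriv i ρ) η x) -
      f x * mollify (partialDeriv i ρ) (fun y => η y * velocity b t y i) x :=
      fun i => (i1 i).sub (i2 i)
    have h1 : ∫ x, f x * B x = ∫ x, ((∑ i, (f x * (velocity b t x i * mollify (partialDeriv i ρ) η x) -
      f x * mollify (partialDeriv i ρ) (fun y => η y * velocity b t y i) x)) +
      (f x * ((G t x).trace * mollify ρ η x) +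
      f x * mollify ρ (fun y => η y * (G t y).trace) x)) := by
      refine integral_congr_ae (Eventually.of_forall fun x => ?_)
      simp only [hB, mul_add, Finset.mul_sum, mul_sub]
    rw [h1, integral_add (integrable_finsetSum _ fun i _ => i12 i) i34, integral_add i3 i4,
      integral_finsetSum _ fun i _ => i12 i, hA1, hA2]
    simp_rw [fun i => integral_sub (i1 i) (i2 i)]
    rw [Finset.sum_sub_distrib, Finset.sum_neg_distrib]
    ring
  rw [hA, ← integral_const_mul, ← Real.norm_eq_abs]
  refine norm_integral_le_of_norm_le (hf.norm.const_mul _) ?_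
  filter_upwards [hb.trace_le t] with x hx
  rw [norm_mul, mul_comm]
  refine mul_le_mul_of_nonneg_right ?_ (norm_nonneg _)
  have h1 := hb.abs_commutator_le hρ hc hr t hη hP ho he x
  have h2 : |(G t x).trace * mollify ρ η x| ≤ L * P := by
    rw [abs_mul]
    exact mul_le_mul hx (hρ.abs_mollify_le_of_ae (Eventually.of_forall hP) x) (abs_nonneg _)
      hb.nonneg
  have h3 : |mollify ρ (fun y => η y * (G t y).trace) x| ≤ L * P := by
    refine hρ.abs_mollify_le_of_ae ?_ x
    filter_upwards [hb.trace_le t] with y hy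
    rw [abs_mul, mul_comm]
    exact mul_le_mul hy (hP y) (abs_nonneg _) hb.nonneg
  rw [Real.norm_eq_abs, hB]
  refine (abs_add_le _ _).trans ?_
  have := abs_add_le ((G t x).trace * mollify ρ η x) (mollify ρ (fun y => η y * (G t y).trace) x)
  linarith

end IsSobolevField

end

end TorusTransport


namespace TorusTransport

noncomputable section

variable {d : ℕ}

lemma tendsto_integral_mul_mollify {c : ℝ} {r : ℕ → ℝ} {ρ : ℕ → Torus d → ℝ}
    (hρ : ∀ n, IsMollifier c (r n) (ρ n)) (hr : Tendsto r atTop (𝓝 0)) {f g : Torus d → ℝ}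
    (hf : Integrable f) (hg : AEStronglyMeasurable g volume) (hg1 : ∀ x, |g x| ≤ 1) :
    Tendsto (fun n => ∫ x, g x * mollify (ρ n) f x) atTop (𝓝 (∫ x, g x * f x)) := by
  have hm : ∀ n, Integrable (mollify (ρ n) f) := fun n =>
    integrable_of_continuous ((hρ n).smooth.mollify hf).continuous
  have hi : ∀ n, Integrable fun x => mollify (ρ n) f x - f x := fun n => (hm n).sub hf
  have h1 : Tendsto (fun n => ∫ x, ‖mollify (ρ n) f x - f x‖) atTop (𝓝 0) := by
    have h2 := (ENNReal.tendsto_toReal ENNReal.zero_ne_top).comp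
      (tendsto_lintegral_mollify_sub hρ hr hf)
    refine h2.congr fun n => ?_
    rw [Function.comp_apply, ← ofReal_integral_norm_eq_lintegral_enorm (hi n),
      ENNReal.toReal_ofReal (by positivity)]
  rw [tendsto_iff_norm_sub_tendsto_zero]
  refine squeeze_zero (fun n => norm_nonneg _) (fun n => ?_) h1
  have hgm : ∀ {h : Torus d → ℝ}, Integrable h → Integrable fun x => g x * h x := fun hh =>
    hh.bdd_mul hg (Eventually.of_forall hg1)
  rw [← integral_sub (hgm (hm n)) (hgm hf)]
  refine norm_integral_le_of_norm_le (hi n).norm (Eventually.of_forall fun x => ?_)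
  rw [← mul_sub, norm_mul]
  exact mul_le_of_le_one_left (norm_nonneg _) (hg1 x)

/-- Duality for the `L¹` norm, with smooth test functions. -/
lemma integral_norm_le_of_forall_smooth {f : Torus d → ℝ} (hf : Integrable f) {A : ℝ}
    (h : ∀ ψ, IsSmooth ψ → (∀ x, |ψ x| ≤ 1) → ∫ x, ψ x * f x ≤ A) : ∫ x, ‖f x‖ ≤ A := by
  set g : Torus d → ℝ := fun x => f x / |f x| with hg
  have hgm : AEStronglyMeasurable g volume :=
    (hf.1.aemeasurable.div hf.1.aemeasurable.abs).aestronglyMeasurable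
  have hg1 : ∀ x, |g x| ≤ 1 := fun x => by
    simp only [hg, abs_div, abs_abs]
    exact div_self_le_one _
  have hgi : Integrable g := (integrable_const (1 : ℝ)).mono' hgm (Eventually.of_forall hg1)
  have h1 := tendsto_integral_mul_mollify (fun n => isMollifier_stdMollifier (d := d) n)
    tendsto_exp_neg_nat hf hgm hg1
  have h2 : ∫ x, g x * f x = ∫ x, ‖f x‖ := by
    refine integral_congr_ae (Eventually.of_forall fun x => ?_)
    simp only [hg, Real.norm_eq_abs]
    rcases eq_or_ne (f x) 0 with h0 | h0
    · simp [h0]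
    · rw [div_mul_eq_mul_div, ← abs_mul_abs_self, mul_div_assoc, div_self (abs_ne_zero.2 h0), mul_one]
  rw [h2] at h1
  refine le_of_tendsto' h1 fun n => ?_
  have hρ := isMollifier_stdMollifier (d := d) n
  rw [hρ.integral_mul_mollify hgi hf]
  simp_rw [mul_comm (f _)]
  exact h _ (hρ.smooth.mollify hgi) (hρ.abs_mollify_le_of_ae (Eventually.of_forall hg1))

/-- If the mollifications of the curve `g` by smooth kernels are equicontinuous in time, then so are
the values of the test operator. -/
lemma eventually_divTest_mollify_sub_le {g : ℝ → Torus d → ℝ} {a e : ℝ}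
    (hg : ∀ t ∈ Icc a e, Integrable (g t))
    (h : ∀ κ : Torus d → ℝ, IsSmooth κ → ∀ ε > 0, ∀ᶠ δ : ℝ in 𝓝[>] 0, ∀ s ∈ Icc a e, ∀ t ∈ Icc a e,
      s ≤ t → t - s ≤ δ → ∀ x, |mollify κ (g t) x - mollify κ (g s) x| ≤ ε)
    {ρ : Torus d → ℝ} (hρ : IsSmooth ρ) {ε : ℝ} (hε : 0 < ε) :
    ∀ᶠ δ : ℝ in 𝓝[>] 0, ∀ s ∈ Icc a e, ∀ t ∈ Icc a e, s ≤ t → t - s ≤ δ →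
      ∀ (D : Torus d → EuclideanSpace ℝ (Fin d)) (q : Torus d → ℝ) (x : Torus d),
        |divTest D q (mollify ρ (g t)) x - divTest D q (mollify ρ (g s)) x| ≤
          ε * (d * ‖D x‖ + |q x|) := by
  filter_upwards [h ρ hρ ε hε, eventually_all.2 fun i => h _ (hρ.partialDeriv i) ε hε] with δ h1 h2
    s hs t ht hst hδ D q x
  refine abs_divTest_sub_le (h1 s hs t ht hst hδ x) fun i => ?_
  rw [partialDeriv_mollify hρ (hg t ht), partialDeriv_mollify hρ (hg s hs)]
  exact h2 i s hs t ht hst hδ x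

namespace IsSobolevField

variable {T β K L : ℝ} {b : ℝ → Torus d → EuclideanSpace ℝ (Fin d)}
  {G : ℝ → Torus d → Matrix (Fin d) (Fin d) ℝ}

lemma norm_velocity_sub_le_osc (hb : IsSobolevField T β K L b G) (t : ℝ) {n : ℕ} (hn : 1 ≤ n)
    {x y : Torus d} (hxy : dist x y ≤ Real.exp (-n)) :
    ‖velocity b t y - velocity b t x‖ ≤
      logLipConst d (mollConst d) β K * ((n * Real.sqrt d + 1) * Real.exp (-n)) := by
  obtain ⟨w, rfl, hw⟩ := exists_elift_small x y
  refine (hb.isVelocity.osc t x w n (by exact_mod_cast hn)).trans ?_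
  have := hb.logLipConst_pos
  have h1 : ‖w‖ ≤ Real.sqrt d * Real.exp (-n) := hw.trans (by gcongr)
  calc _ ≤ logLipConst d (mollConst d) β K *
        (n * (Real.sqrt d * Real.exp (-n)) + Real.exp (-n)) := by gcongr
    _ = _ := by ring

/-- For short times the flow is Hölder continuous of exponent `1 / 2`. -/
lemma abs_comp_flow_sub_le (hb : IsSobolevField T β K L b G) {ψ : Torus d → ℝ} {ℓ : ℝ} (hℓ : 0 ≤ ℓ)
    (hψ : ∀ x w, |ψ (x + eproj w) - ψ x| ≤ ℓ * ‖w‖) {s t : ℝ}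
    (hst : logLipConst d (mollConst d) β K * |t - s| ≤ 1 / 2) {n : ℕ} (hn : 1 ≤ n)
    {x y : Torus d} (hxy : dist x y ≤ Real.exp (-n)) :
    |ψ (flow (velocity b) s t y) - ψ (flow (velocity b) s t x)| ≤
      ℓ * ((Real.sqrt d + 1) * Real.exp (-n / 2)) := by
  obtain ⟨w, rfl, hw⟩ := exists_elift_small x y
  have hZ := hb.hasFlow.isTraj s x
  have hZ' := hb.hasFlow.isTraj s (x + eproj w)
  have h1 := hZ.eq_gap hb.isVelocity hb.isVelocity hZ' t
  rw [h1]
  refine (hψ _ _).trans (mul_le_mul_of_nonneg_left ?_ hℓ)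
  have ho := hZ.osgoodIneq_gap hb.isVelocity hb.isVelocity (e := 0) (fun t x => by simp) hZ'
  have h2 := ho.le_of_short hb.logLipConst_pos le_rfl (lam := n) (by exact_mod_cast hn) hst
  simp only [gap_self] at h2
  refine h2.trans ?_
  have h3 : ‖w‖ ≤ Real.sqrt d * Real.exp (-n) := hw.trans (by gcongr)
  have h4 : (logLipConst d (mollConst d) β K * Real.exp (-n) + 0) * |t - s| ≤ Real.exp (-n) := by
    rw [add_zero, mul_right_comm]
    exact mul_le_of_le_one_left (Real.exp_pos _).le (by linarith)
  calc _ ≤ (Real.sqrt d * Real.exp (-n) + Real.exp (-n)) * Real.exp (n / 2) := by gcongr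
    _ = (Real.sqrt d + 1) * (Real.exp (-n) * Real.exp (n / 2)) := by ring
    _ = _ := by rw [← Real.exp_add]; congr 2; ring

lemma eventually_comp_flow_sub_le (hb : IsSobolevField T β K L b G) {ψ : Torus d → ℝ}
    (hψ : Continuous ψ) (r a e : ℝ) {ε : ℝ} (hε : 0 < ε) :
    ∀ᶠ δ : ℝ in 𝓝[>] 0, ∀ s ∈ Icc a e, ∀ t ∈ Icc a e, s ≤ t → t - s ≤ δ →
      ∀ x, |ψ (flow (velocity b) t r x) - ψ (flow (velocity b) s r x)| ≤ ε := by
  have h1 := (isCompact_Icc (a := a) (b := e)).prod (isCompact_univ (X := Torus d))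
  have h2 := h1.uniformContinuousOn_of_continuous (hb.continuous_comp_flow hψ r).continuousOn
  obtain ⟨δ, hδ, h3⟩ := Metric.uniformContinuousOn_iff_le.1 h2 ε hε
  filter_upwards [Ioc_mem_nhdsGT hδ] with δ' hδ' s hs t ht hst hle x
  have := h3 (t, x) ⟨ht, mem_univ _⟩ (s, x) ⟨hs, mem_univ _⟩ (by
    rw [Prod.dist_eq, dist_self, Real.dist_eq, abs_of_nonneg (by linarith : 0 ≤ t - s)]
    exact max_le (hle.trans hδ'.2) hδ.le)
  simpa [Real.dist_eq, Function.uncurry] using this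

end IsSobolevField

/-- Integrable curves solving the transport equation on the time interval `[a, e]`. -/
structure IsIntegrableSolution (b : ℝ → Torus d → EuclideanSpace ℝ (Fin d))
    (G : ℝ → Torus d → Matrix (Fin d) (Fin d) ℝ) (w : ℝ → Torus d → ℝ) (a e : ℝ) : Prop where
  integrable : ∀ t ∈ Icc a e, Integrable (w t)
  intervalIntegrable : ∀ φ : Torus d → ℝ, IsSmooth φ →
    IntervalIntegrable (fun σ => ∫ x, w σ x * transportTest b G φ σ x) volume a e
  eq : ∀ φ : Torus d → ℝ, IsSmooth φ → ∀ s ∈ Icc a e, ∀ t ∈ Icc a e, s ≤ t →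
    (∫ x, w t x * φ x) - ∫ x, w s x * φ x =
      ∫ σ in s..t, ∫ x, w σ x * transportTest b G φ σ x

end

end TorusTransport


namespace TorusTransport

noncomputable section

variable {d : ℕ}

lemma exists_divTest_comp_sub_le {κ : Torus d → ℝ} (hκ : IsSmooth κ) : ∃ A : ℝ, 0 ≤ A ∧
    ∀ (D : Torus d → EuclideanSpace ℝ (Fin d)) (q : Torus d → ℝ) (x y : Torus d),
      |divTest D q (fun z => κ (x - z)) y| ≤ A * (‖D y‖ + |q y|) := by
  obtain ⟨A, hA0, -, hA⟩ := exists_divTest_le hκ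
  refine ⟨A, hA0, fun D q x y => ?_⟩
  have h1 : divTest D q (fun z => κ (x - z)) y =
      divTest (fun _ => -D y) (fun _ => q y) κ (x - y) := by
    simp [divTest, partialDeriv_comp_sub_left _ hκ]
  rw [h1]
  simpa using hA (fun _ => -D y) (fun _ => q y) (x - y)

namespace IsIntegrableSolution

variable {b : ℝ → Torus d → EuclideanSpace ℝ (Fin d)}
  {G : ℝ → Torus d → Matrix (Fin d) (Fin d) ℝ} {w : ℝ → Torus d → ℝ} {a e : ℝ}

lemma mono (h : IsIntegrableSolution b G w a e) {a' e' : ℝ} (hae : a ≤ e) (hae' : a' ≤ e')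
    (ha : a ≤ a') (he : e' ≤ e) : IsIntegrableSolution b G w a' e' where
  integrable t ht := h.integrable t ⟨ha.trans ht.1, ht.2.trans he⟩
  intervalIntegrable φ hφ := (h.intervalIntegrable φ hφ).mono_set (by
    rw [uIcc_of_le hae, uIcc_of_le hae']
    exact Icc_subset_Icc ha he)
  eq φ hφ s hs t ht := h.eq φ hφ s ⟨ha.trans hs.1, hs.2.trans he⟩ t ⟨ha.trans ht.1, ht.2.trans he⟩

variable {T β K L : ℝ}

lemma eventually_mollify_sub_le (h : IsIntegrableSolution b G w a e)
    (hb : IsSobolevField T β K L b G) {W : ℝ} (hW : ∀ t ∈ Icc a e, ∫ x, ‖w t x‖ ≤ W)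
    {κ : Torus d → ℝ} (hκ : IsSmooth κ) {ε : ℝ} (hε : 0 < ε) :
    ∀ᶠ δ : ℝ in 𝓝[>] 0, ∀ s ∈ Icc a e, ∀ t ∈ Icc a e, s ≤ t → t - s ≤ δ →
      ∀ x, |mollify κ (w t) x - mollify κ (w s) x| ≤ ε := by
  obtain ⟨A, hA0, hA⟩ := exists_divTest_comp_sub_le hκ
  have hN : Integrable (fieldBound T β K b) := hb.integrable_fieldBound
  set N : ℝ → ℝ := fun σ => A * (1 + L) * (fieldBound T β K b σ + 1) * W with hNdef
  have hNi : ∀ s t, IntervalIntegrable N volume s t := fun s t =>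
    ((hN.intervalIntegrable.add intervalIntegrable_const).const_mul _).mul_const _
  have hM : Continuous fun t => ∫ σ in a..t, N σ :=
    intervalIntegral.continuous_primitive hNi a
  obtain ⟨δ, hδ, hMδ⟩ := Metric.uniformContinuousOn_iff_le.1
    ((isCompact_Icc (a := a) (b := e)).uniformContinuousOn_of_continuous hM.continuousOn) ε hε
  filter_upwards [Ioc_mem_nhdsGT hδ] with δ' hδ' s hs t ht hst hle x
  have h1 := h.eq _ (hκ.comp_sub_left x) s hs t ht hst
  have h2 : ∀ u, mollify κ (w u) x = ∫ y, w u y * κ (x - y) := fun u => by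
    simp only [mollify, smul_eq_mul, mul_comm]
  rw [h2, h2, h1, ← Real.norm_eq_abs]
  have h3 : ‖∫ σ in s..t, ∫ y, w σ y * transportTest b G (fun z => κ (x - z)) σ y‖ ≤
      ∫ σ in s..t, N σ := by
    refine intervalIntegral.norm_integral_le_of_norm_le hst (Eventually.of_forall fun σ hσ => ?_)
      (hNi s t)
    have hσ' : σ ∈ Icc a e := ⟨hs.1.trans hσ.1.le, hσ.2.trans ht.2⟩
    have hm := hb.fieldBound_nonneg σ
    have hL := hb.nonneg
    calc _ ≤ ∫ y, A * (1 + L) * (fieldBound T β K b σ + 1) * ‖w σ y‖ := by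
          refine norm_integral_le_of_norm_le ((h.integrable σ hσ').norm.const_mul _) ?_
          filter_upwards [hb.trace_le σ] with y hy
          rw [norm_mul, mul_comm]
          refine mul_le_mul_of_nonneg_right ?_ (norm_nonneg _)
          refine (hA _ _ x y).trans ?_
          rw [mul_assoc]
          refine mul_le_mul_of_nonneg_left ?_ hA0
          have := hb.isVelocity.norm_le σ y
          nlinarith [mul_nonneg hL hm]
      _ ≤ _ := by
          rw [integral_const_mul]
          exact mul_le_mul_of_nonneg_left (hW σ hσ') (by positivity)
  refine h3.trans ?_
  have h4 := hMδ t ht s hs (by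
    rw [Real.dist_eq, abs_of_nonneg (by linarith : 0 ≤ t - s)]
    exact hle.trans hδ'.2)
  rw [Real.dist_eq, intervalIntegral.integral_interval_sub_left (hNi a t) (hNi a s)] at h4
  exact (le_abs_self _).trans h4

lemma _root_.TorusTransport.IsSobolevField.eventually_mollify_comp_flow_sub_le
    (hb : IsSobolevField T β K L b G) {ψ : Torus d → ℝ}
    (hψ : Continuous ψ) (r a e : ℝ) {κ : Torus d → ℝ} (hκ : IsSmooth κ) {ε : ℝ} (hε : 0 < ε) :
    ∀ᶠ δ : ℝ in 𝓝[>] 0, ∀ s ∈ Icc a e, ∀ t ∈ Icc a e, s ≤ t → t - s ≤ δ →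
      ∀ x, |mollify κ (fun y => ψ (flow (velocity b) t r y)) x -
        mollify κ (fun y => ψ (flow (velocity b) s r y)) x| ≤ ε := by
  obtain ⟨C, hC0, hC⟩ := exists_bound_of_continuous hκ.continuous
  have hη : ∀ t, Integrable fun y => ψ (flow (velocity b) t r y) := fun t =>
    integrable_of_continuous (hψ.comp (hb.continuous_flow t r))
  filter_upwards [hb.eventually_comp_flow_sub_le hψ r a e (ε := ε / (C + 1)) (by positivity)] with
    δ h1 s hs t ht hst hle x
  rw [← mollify_sub hκ.continuous (hη t) (hη s), ← Real.norm_eq_abs]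
  refine (norm_mollify_le hC ((hη t).sub (hη s)) x).trans ?_
  have h2 : ∫ y, ‖ψ (flow (velocity b) t r y) - ψ (flow (velocity b) s r y)‖ ≤ ε / (C + 1) :=
    (le_abs_self _).trans (integral_abs_le_of_abs_le fun y => by
      rw [Real.norm_eq_abs, abs_abs]; exact h1 s hs t ht hst hle y)
  calc _ ≤ C * (ε / (C + 1)) := mul_le_mul_of_nonneg_left h2 hC0
    _ ≤ ε := by rw [mul_div_assoc', div_le_iff₀ (by positivity)]; nlinarith

lemma _root_.TorusTransport.IsSobolevField.abs_integral_mul_transportTest_sub_le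
    (hb : IsSobolevField T β K L b G) {ε : ℝ} (hε : 0 ≤ ε) {σ : ℝ} {f φ φ' : Torus d → ℝ}
    (hf : Integrable f) (hφ : IsSmooth φ) (hφ' : IsSmooth φ')
    (h : ∀ (D : Torus d → EuclideanSpace ℝ (Fin d)) (q : Torus d → ℝ) (x : Torus d),
        |divTest D q φ x - divTest D q φ' x| ≤ ε * (d * ‖D x‖ + |q x|)) :
    |(∫ x, f x * transportTest b G φ σ x) - ∫ x, f x * transportTest b G φ' σ x| ≤
      ε * (d + L) * (fieldBound T β K b σ + 1) * ∫ x, ‖f x‖ := by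
  have hi : ∀ {φ : Torus d → ℝ}, IsSmooth φ → Integrable fun x => f x * transportTest b G φ σ x := by
    intro φ hφ
    obtain ⟨A, hA0, hA⟩ := hb.exists_transportTest_le hφ
    exact hf.mul_bdd (hb.measurable_transportTest hφ).of_uncurry_left.aestronglyMeasurable (hA σ)
  rw [← integral_sub (hi hφ) (hi hφ'), ← integral_const_mul, ← Real.norm_eq_abs]
  refine norm_integral_le_of_norm_le (hf.norm.const_mul _) ?_
  filter_upwards [hb.trace_le σ] with x hx
  rw [← mul_sub, norm_mul, mul_comm]
  refine mul_le_mul_of_nonneg_right ?_ (norm_nonneg _)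
  refine (h _ _ x).trans ?_
  rw [mul_assoc]
  refine mul_le_mul_of_nonneg_left ?_ hε
  have h1 := hb.isVelocity.norm_le σ x
  have h2 := hb.nonneg
  have h3 := hb.fieldBound_nonneg σ
  have h4 : (d : ℝ) * ‖velocity b σ x‖ ≤ d * fieldBound T β K b σ := by gcongr
  nlinarith [mul_nonneg h2 h3, Nat.cast_nonneg (α := ℝ) d]

/-- The doubling estimate: the pairing of a mollified solution with the transported test function
grows at most through the divergence, up to the commutator. -/
lemma integral_mul_mollify_le (h : IsIntegrableSolution b G w a e)
    (hb : IsSobolevField T β K L b G) (hae : a ≤ e) {W : ℝ}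
    (hW : ∀ t ∈ Icc a e, ∫ x, ‖w t x‖ ≤ W) (hwa : w a =ᵐ[volume] 0)
    {ψ : Torus d → ℝ} (hψ : Continuous ψ) {P : ℝ} (hP : ∀ x, |ψ x| ≤ P) {c r o : ℝ}
    {ρ : Torus d → ℝ} (hρ : IsMollifier c r ρ) (hc : 0 ≤ c) (hr : 0 < r) {q : ℝ}
    (ho : ∀ t ∈ Icc a e, ∀ x y, dist x y ≤ r →
      |ψ (flow (velocity b) t e y) - ψ (flow (velocity b) t e x)| ≤ o)
    (hq : ∀ t x y, dist x y ≤ r → ‖velocity b t y - velocity b t x‖ ≤ q) :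
    ∫ x, ψ x * mollify ρ (w e) x ≤
      (3 * (L * P) + d * (c * 2 ^ d / r * (o * q))) * W * (e - a) := by
  set η : ℝ → Torus d → ℝ := fun t x => ψ (flow (velocity b) t e x) with hη
  have hηc : ∀ t, Continuous (η t) := fun t => hψ.comp (hb.continuous_flow t e)
  have hηi : ∀ t, Integrable (η t) := fun t => integrable_of_continuous (hηc t)
  have hηP : ∀ t x, |η t x| ≤ P := fun t x => hP _
  have hP0 : 0 ≤ P := (abs_nonneg _).trans (hP 0)
  have hae0 : a ∈ Icc a e := ⟨le_rfl, hae⟩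
  have hW0 : 0 ≤ W := (by positivity : (0 : ℝ) ≤ ∫ x, ‖w a x‖).trans (hW a hae0)
  set B := (3 * (L * P) + d * (c * 2 ^ d / r * (o * q))) * W with hB
  set N : ℝ → ℝ := fun σ => fieldBound T β K b σ + 1 with hN
  have hNi : ∀ s t, IntervalIntegrable N volume s t := fun s t =>
    hb.integrable_fieldBound.intervalIntegrable.add intervalIntegrable_const
  have hL := hb.nonneg
  have hmain : (∫ x, η e x * mollify ρ (w e) x) - B * (e - a) ≤
      (∫ x, η a x * mollify ρ (w a) x) - B * (a - a) := by
    refine le_of_small_increments (f := fun t => (∫ x, η t x * mollify ρ (w t) x) - B * (t - a))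
      (M := fun t => ∫ σ in a..t, N σ) hae fun ε hε => ?_
    set ε' := ε / ((W + P + 1) * (d + L + 1)) with hε'
    have hε'0 : 0 < ε' := by positivity
    obtain ⟨δ, ⟨hδw, hδη⟩, hδ⟩ := (((eventually_divTest_mollify_sub_le h.integrable
      (fun κ hκ ε hε => h.eventually_mollify_sub_le hb hW hκ hε) hρ.smooth hε'0).and
      (eventually_divTest_mollify_sub_le (fun t _ => hηi t)
      (fun κ hκ ε hε => hb.eventually_mollify_comp_flow_sub_le hψ e a e hκ hε) hρ.smooth
      hε'0)).and self_mem_nhdsWithin).exists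
    refine ⟨δ, hδ, fun s hs t ht hst hle => ?_⟩
    have hsw := hρ.smooth.mollify (h.integrable s hs)
    have hsη := hρ.smooth.mollify (hηi t)
    have e1 := h.eq _ hsη s hs t ht hst
    rw [hρ.integral_mul_mollify (h.integrable t ht) (hηi t),
      hρ.integral_mul_mollify (h.integrable s hs) (hηi t)] at e1
    have e2 := hb.weakForm hψ hsw e hst
    obtain ⟨A, hA0, hA⟩ := hb.exists_transportTest_le hsw
    have i1 : IntervalIntegrable (fun σ => ∫ x, w σ x * transportTest b G (mollify ρ (η t)) σ x)
        volume s t := (h.intervalIntegrable _ hsη).mono_set (by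
      rw [uIcc_of_le hst, uIcc_of_le hae]
      exact Icc_subset_Icc hs.1 ht.2)
    have i2 : IntervalIntegrable (fun σ => ∫ x, η σ x * transportTest b G (mollify ρ (w s)) σ x)
        volume s t := by
      refine hb.intervalIntegrable_of_le_fieldBound (A := P * A) ?_ (fun σ =>
        IsSobolevField.abs_integral_mul_transportTest_le hA (hηP σ) σ) s t
      have hm : Measurable fun z : ℝ × Torus d => η z.1 z.2 *
          transportTest b G (mollify ρ (w s)) z.1 z.2 :=
        (hb.continuous_comp_flow hψ e).measurable.mul (hb.measurable_transportTest hsw)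
      exact hm.stronglyMeasurable.integral_prod_right'.aestronglyMeasurable
    have e3 : (∫ x, η t x * mollify ρ (w t) x) - ∫ x, η s x * mollify ρ (w s) x =
        ∫ σ in s..t, ((∫ x, w σ x * transportTest b G (mollify ρ (η t)) σ x) +
          ∫ x, η σ x * transportTest b G (mollify ρ (w s)) σ x) := by
      rw [intervalIntegral.integral_add i1 i2, ← e1, ← e2]
      ring
    have e4 : ‖∫ σ in s..t, ((∫ x, w σ x * transportTest b G (mollify ρ (η t)) σ x) +
          ∫ x, η σ x * transportTest b G (mollify ρ (w s)) σ x)‖ ≤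
        ∫ σ in s..t, (B + ε * N σ) := by
      refine intervalIntegral.norm_integral_le_of_norm_le hst (Eventually.of_forall fun σ hσ => ?_)
        (intervalIntegrable_const.add ((hNi s t).const_mul ε))
      have hσ' : σ ∈ Icc a e := ⟨hs.1.trans hσ.1.le, hσ.2.trans ht.2⟩
      have hwσ := h.integrable σ hσ'
      have f1 := hb.abs_integral_transportTest_add_le hρ hc hr σ hwσ (hηc σ) (hηP σ) (ho σ hσ') (hq σ)
      have f2 := hb.abs_integral_mul_transportTest_sub_le (σ := σ) hε'0.le hwσ hsη
        (hρ.smooth.mollify (hηi σ)) (hδη σ hσ' t ht hσ.2 (by linarith [hσ.1]))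
      have f3 := hb.abs_integral_mul_transportTest_sub_le (σ := σ) hε'0.le (hηi σ)
        (hρ.smooth.mollify hwσ) hsw (hδw s hs σ hσ' hσ.1.le (by linarith [hσ.2]))
      have f4 := hW σ hσ'
      have f5 : ∫ x, ‖η σ x‖ ≤ P := (le_abs_self _).trans (integral_abs_le_of_abs_le fun x => by
        rw [Real.norm_eq_abs, abs_abs]; exact hηP σ x)
      have hNσ : 0 ≤ N σ := by have := hb.fieldBound_nonneg σ; simp only [hN]; positivity
      have hcoef : 0 ≤ 3 * (L * P) + d * (c * 2 ^ d / r * (o * q)) := by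
        have h1 := (abs_nonneg _).trans (ho σ hσ' 0 0 (by simpa using hr.le))
        have h2 := (norm_nonneg _).trans (hq σ 0 0 (by simpa using hr.le))
        positivity
      have g1 : |(∫ x, w σ x * transportTest b G (mollify ρ (η σ)) σ x) +
          ∫ x, η σ x * transportTest b G (mollify ρ (w σ)) σ x| ≤ B :=
        f1.trans (mul_le_mul_of_nonneg_left f4 hcoef)
      have g2 : ε' * (d + L) * N σ * (∫ x, ‖w σ x‖) ≤ ε' * (d + L) * N σ * W := by gcongr
      have g3 : ε' * (d + L) * N σ * (∫ x, ‖η σ x‖) ≤ ε' * (d + L) * N σ * P := by gcongr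
      have g4 : ε' * (d + L) * N σ * W + ε' * (d + L) * N σ * P ≤ ε * N σ := by
        have : ε = ε' * ((W + P + 1) * (d + L + 1)) := by rw [hε']; field_simp
        rw [this]
        have h1 : (d + L) * (W + P) ≤ (d + L + 1) * (W + P + 1) :=
          mul_le_mul (by linarith) (by linarith) (by positivity) (by positivity)
        have h2 := mul_le_mul_of_nonneg_left h1 (mul_nonneg hε'0.le hNσ)
        linarith
      have g5 := f2.trans g2
      have g6 := f3.trans g3
      rw [Real.norm_eq_abs]
      rw [abs_le] at g1 g5 g6 ⊢
      constructor <;> linarith [g1.1, g1.2, g5.1, g5.2, g6.1, g6.2]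
    rw [intervalIntegral.integral_add intervalIntegrable_const ((hNi s t).const_mul ε),
      intervalIntegral.integral_const, intervalIntegral.integral_const_mul, smul_eq_mul, ← e3] at e4
    have e5 := (le_abs_self _).trans e4
    have e6 := intervalIntegral.integral_interval_sub_left (hNi a t) (hNi a s)
    rw [e6]
    linarith
  have h0 : ∫ x, η a x * mollify ρ (w a) x = 0 := by
    rw [← hρ.integral_mul_mollify (h.integrable a hae0) (hηi a)]
    refine integral_eq_zero_of_ae ?_
    filter_upwards [hwa] with x hx
    simp [hx]
  have h1 : η e = ψ := funext fun x => by simp only [hη, hb.hasFlow.self]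
  rw [h0, h1] at hmain
  linarith

end IsIntegrableSolution

end

end TorusTransport


namespace TorusTransport

noncomputable section

variable {d : ℕ}

namespace IsIntegrableSolution

variable {b : ℝ → Torus d → EuclideanSpace ℝ (Fin d)}
  {G : ℝ → Torus d → Matrix (Fin d) (Fin d) ℝ} {w : ℝ → Torus d → ℝ} {a e : ℝ}
  {T β K L : ℝ}

/-- For a short time, the `L¹` norm of a solution vanishing initially is at most half of any of its
uniform bounds. -/
lemma integral_norm_le_half (h : IsIntegrableSolution b G w a e)
    (hb : IsSobolevField T β K L b G) (hae : a ≤ e) {W : ℝ}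
    (hW : ∀ t ∈ Icc a e, ∫ x, ‖w t x‖ ≤ W) (hwa : w a =ᵐ[volume] 0)
    (hC : logLipConst d (mollConst d) β K * (e - a) ≤ 1 / 2) (hL : 3 * L * (e - a) ≤ 1 / 2) :
    ∫ x, ‖w e x‖ ≤ W / 2 := by
  have hwe := h.integrable e ⟨hae, le_rfl⟩
  have hW0 : 0 ≤ W := (by positivity : (0 : ℝ) ≤ ∫ x, ‖w a x‖).trans (hW a ⟨le_rfl, hae⟩)
  refine (integral_norm_le_of_forall_smooth hwe (A := 3 * L * (e - a) * W) fun ψ hψ hψ1 => ?_).trans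
    (by nlinarith)
  obtain ⟨ℓ, hℓ0, hℓ⟩ := hψ.exists_lipschitz
  have hc := three_le_mollConst d
  have hCp := hb.logLipConst_pos
  set C := logLipConst d (mollConst d) β K with hCdef
  set κ : ℕ → ℝ := fun n => d * (mollConst d * 2 ^ d / Real.exp (-n) *
    (ℓ * ((Real.sqrt d + 1) * Real.exp (-n / 2)) *
      (C * ((n * Real.sqrt d + 1) * Real.exp (-n))))) with hκ
  have h1 : ∀ n : ℕ, 1 ≤ n → ∫ x, ψ x * mollify (stdMollifier d n) (w e) x ≤
      (3 * (L * 1) + κ n) * W * (e - a) := by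
    intro n hn
    refine h.integral_mul_mollify_le hb hae hW hwa hψ.continuous hψ1 (isMollifier_stdMollifier n)
      (by linarith) (Real.exp_pos _) (fun t ht x y hxy => ?_)
      (fun t x y hxy => hb.norm_velocity_sub_le_osc t hn hxy)
    refine hb.abs_comp_flow_sub_le hℓ0 hℓ ?_ hn hxy
    rw [abs_of_nonneg (by linarith [ht.2])]
    exact (mul_le_mul_of_nonneg_left (by linarith [ht.1]) hCp.le).trans hC
  have h2 : Tendsto κ atTop (𝓝 0) := by
    have g1 := (Real.tendsto_pow_mul_exp_neg_atTop_nhds_zero 1).comp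
      ((tendsto_natCast_atTop_atTop (R := ℝ)).atTop_div_const (r := 2) (by norm_num))
    have g2 := Real.tendsto_exp_neg_atTop_nhds_zero.comp
      ((tendsto_natCast_atTop_atTop (R := ℝ)).atTop_div_const (r := 2) (by norm_num))
    have g3 := ((g1.const_mul (2 * Real.sqrt d)).add g2).const_mul
      (d * (mollConst d * 2 ^ d) * ℓ * (Real.sqrt d + 1) * C)
    simp only [mul_zero, add_zero] at g3
    refine g3.congr fun n => ?_
    simp only [hκ, Function.comp_apply, pow_one]
    have := Real.exp_pos (-(n : ℝ))
    rw [neg_div]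
    field_simp
  have h3 : Tendsto (fun n => (3 * (L * 1) + κ n) * W * (e - a)) atTop
      (𝓝 ((3 * (L * 1) + 0) * W * (e - a))) :=
    ((h2.const_add _).mul_const _).mul_const _
  have h4 := tendsto_integral_mul_mollify (fun n => isMollifier_stdMollifier (d := d) n)
    tendsto_exp_neg_nat hwe hψ.continuous.aestronglyMeasurable hψ1
  have h5 := le_of_tendsto_of_tendsto h4 h3 (eventually_atTop.2 ⟨1, h1⟩)
  linarith

lemma ae_eq_zero_of_short (h : IsIntegrableSolution b G w a e)
    (hb : IsSobolevField T β K L b G) {W : ℝ}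
    (hW : ∀ t ∈ Icc a e, ∫ x, ‖w t x‖ ≤ W) (hwa : w a =ᵐ[volume] 0)
    (hC : logLipConst d (mollConst d) β K * (e - a) ≤ 1 / 2) (hL : 3 * L * (e - a) ≤ 1 / 2)
    {t : ℝ} (ht : t ∈ Icc a e) : w t =ᵐ[volume] 0 := by
  have hae := ht.1.trans ht.2
  have key : ∀ k : ℕ, ∀ t ∈ Icc a e, ∫ x, ‖w t x‖ ≤ W / 2 ^ k := by
    intro k
    induction k with
    | zero => simpa using hW
    | succ k ih =>
      intro t ht
      have hle : t - a ≤ e - a := by linarith [ht.2]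
      have := (h.mono hae ht.1 le_rfl ht.2).integral_norm_le_half hb ht.1
        (fun s hs => ih s ⟨hs.1, hs.2.trans ht.2⟩) hwa
        ((mul_le_mul_of_nonneg_left hle hb.logLipConst_pos.le).trans hC)
        ((mul_le_mul_of_nonneg_left hle (by linarith [hb.nonneg])).trans hL)
      rw [pow_succ, ← div_div]
      exact this
  have h1 : Tendsto (fun k : ℕ => W / 2 ^ k) atTop (𝓝 0) :=
    tendsto_const_nhds.div_atTop (tendsto_pow_atTop_atTop_of_one_lt one_lt_two)
  have h2 : ∫ x, ‖w t x‖ ≤ 0 := ge_of_tendsto' h1 fun k => key k t ht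
  have h3 := (integral_eq_zero_iff_of_nonneg (fun x => norm_nonneg _) (h.integrable t ht).norm).1
    (le_antisymm h2 (by positivity))
  filter_upwards [h3] with x hx
  simpa using hx

/-- Integrable solutions with zero initial datum vanish. -/
theorem ae_eq_zero (h : IsIntegrableSolution b G w 0 T) (hb : IsSobolevField T β K L b G) {W : ℝ}
    (hW : ∀ t ∈ Icc 0 T, ∫ x, ‖w t x‖ ≤ W) (hw0 : w 0 =ᵐ[volume] 0) {t : ℝ} (ht : t ∈ Icc 0 T) :
    w t =ᵐ[volume] 0 := by
  have hCp := hb.logLipConst_pos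
  have hL := hb.nonneg
  set C := logLipConst d (mollConst d) β K with hC
  set τ := 1 / (2 * (C + 3 * L)) with hτ
  have hτ0 : 0 < τ := by positivity
  have hCL : (C + 3 * L) * τ = 1 / 2 := by rw [hτ]; field_simp
  have h0T := ht.1.trans ht.2
  have key : ∀ k : ℕ, ∀ t ∈ Icc 0 T, t ≤ k * τ → w t =ᵐ[volume] 0 := by
    intro k
    induction k with
    | zero =>
      intro t ht htk
      rw [Nat.cast_zero, zero_mul] at htk
      rwa [le_antisymm htk ht.1]
    | succ k ih =>
      intro t ht htk
      rcases le_total t (k * τ) with h1 | h1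
      · exact ih t ht h1
      · have hk0 : 0 ≤ k * τ := by positivity
        have h2 : t - k * τ ≤ τ := by push_cast at htk; linarith
        have h3 : 0 ≤ t - k * τ := by linarith
        refine (h.mono h0T h1 hk0 ht.2).ae_eq_zero_of_short hb
          (fun s hs => hW s ⟨hk0.trans hs.1, hs.2.trans ht.2⟩) (ih _ ⟨hk0, h1.trans ht.2⟩ le_rfl)
          ?_ ?_ ⟨h1, le_rfl⟩
        · nlinarith
        · nlinarith
  obtain ⟨k, hk⟩ := exists_nat_ge (t / τ)
  exact key k t ht ((div_le_iff₀ hτ0).1 hk)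

end IsIntegrableSolution

namespace IsSobolevField

variable {T β K L : ℝ} {b : ℝ → Torus d → EuclideanSpace ℝ (Fin d)}
  {G : ℝ → Torus d → Matrix (Fin d) (Fin d) ℝ}

lemma integrable_mul_transportTest (hb : IsSobolevField T β K L b G) {f φ : Torus d → ℝ}
    (hf : Integrable f) (hφ : IsSmooth φ) (σ : ℝ) :
    Integrable fun x => f x * transportTest b G φ σ x := by
  obtain ⟨A, hA0, hA⟩ := hb.exists_transportTest_le hφ
  exact hf.mul_bdd (hb.measurable_transportTest hφ).of_uncurry_left.aestronglyMeasurable (hA σ)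

lemma isIntegrableSolution_of_isTransportSolution {p : ℝ} (hp : 1 ≤ p) {u₀ : Torus d → ℝ}
    {u : ℝ → Torus d → ℝ} (hT : 0 ≤ T)
    (hu : IsTransportSolution T p (velocity b) G u₀ u) : IsIntegrableSolution b G u 0 T where
  integrable t ht := (hu.memLp t ht).integrable (by simpa using hp)
  intervalIntegrable φ hφ := by
    have h1 := (hu.integrable φ hφ).integral_prod_left
    exact (intervalIntegrable_iff_integrableOn_Icc_of_le hT).2 h1
  eq φ hφ s hs t ht hst := by
    have h1 := (hu.integrable φ hφ).integral_prod_left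
    have h2 : ∀ t ∈ Icc 0 T, IntervalIntegrable
        (fun σ => ∫ x, u σ x * transportTest b G φ σ x) volume 0 t := fun t ht =>
      (intervalIntegrable_iff_integrableOn_Icc_of_le ht.1).2
        (IntegrableOn.mono_set h1 (Icc_subset_Icc le_rfl ht.2))
    rw [← intervalIntegral.integral_interval_sub_left (h2 t ht) (h2 s hs)]
    have e1 := hu.integral_eq φ hφ t ht
    have e2 := hu.integral_eq φ hφ s hs
    change _ = ∫ σ in (0 : ℝ)..t, ∫ x, u σ x * transportTest b G φ σ x at e1
    change _ = ∫ σ in (0 : ℝ)..s, ∫ x, u σ x * transportTest b G φ σ x at e2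
    rw [← e1, ← e2]
    ring

lemma _root_.TorusTransport.IsIntegrableSolution.sub {u v : ℝ → Torus d → ℝ} {a e : ℝ}
    (hb : IsSobolevField T β K L b G)
    (hu : IsIntegrableSolution b G u a e) (hv : IsIntegrableSolution b G v a e) (hae : a ≤ e) :
    IsIntegrableSolution b G (fun t x => u t x - v t x) a e := by
  have hsub : ∀ φ : Torus d → ℝ, IsSmooth φ → ∀ σ ∈ Icc a e,
      ∫ x, (u σ x - v σ x) * transportTest b G φ σ x =
        (∫ x, u σ x * transportTest b G φ σ x) - ∫ x, v σ x * transportTest b G φ σ x := by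
    intro φ hφ σ hσ
    simp only [sub_mul]
    exact integral_sub (hb.integrable_mul_transportTest (hu.integrable σ hσ) hφ σ)
      (hb.integrable_mul_transportTest (hv.integrable σ hσ) hφ σ)
  have hφi : ∀ {f φ : Torus d → ℝ}, Integrable f → IsSmooth φ → Integrable fun x => f x * φ x := by
    intro f φ hf hφ
    obtain ⟨C, _, hC⟩ := exists_bound_of_continuous hφ.continuous
    exact hf.mul_bdd hφ.continuous.aestronglyMeasurable (Eventually.of_forall hC)
  refine ⟨fun t ht => (hu.integrable t ht).sub (hv.integrable t ht), fun φ hφ => ?_,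
    fun φ hφ s hs t ht hst => ?_⟩
  · refine ((hu.intervalIntegrable φ hφ).sub (hv.intervalIntegrable φ hφ)).congr fun σ hσ => ?_
    rw [uIoc_of_le hae] at hσ
    exact (hsub φ hφ σ ⟨hσ.1.le, hσ.2⟩).symm
  · have hsu : uIcc s t ⊆ uIcc a e := by
      rw [uIcc_of_le hst, uIcc_of_le hae]
      exact Icc_subset_Icc hs.1 ht.2
    rw [intervalIntegral.integral_congr (g := fun σ => (∫ x, u σ x * transportTest b G φ σ x) -
      ∫ x, v σ x * transportTest b G φ σ x) fun σ hσ => by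
        rw [uIcc_of_le hst] at hσ
        exact hsub φ hφ σ ⟨hs.1.trans hσ.1, hσ.2.trans ht.2⟩,
      intervalIntegral.integral_sub ((hu.intervalIntegrable φ hφ).mono_set hsu)
        ((hv.intervalIntegrable φ hφ).mono_set hsu), ← hu.eq φ hφ s hs t ht hst,
      ← hv.eq φ hφ s hs t ht hst]
    simp only [sub_mul]
    rw [integral_sub (hφi (hu.integrable t ht) hφ) (hφi (hv.integrable t ht) hφ),
      integral_sub (hφi (hu.integrable s hs) hφ) (hφi (hv.integrable s hs) hφ)]
    ring

lemma _root_.TorusTransport.IsTransportSolution.exists_integral_norm_le {p : ℝ} (hp : 1 ≤ p)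
    {b : ℝ → Torus d → EuclideanSpace ℝ (Fin d)} {u₀ : Torus d → ℝ}
    {u : ℝ → Torus d → ℝ} (hu : IsTransportSolution T p b G u₀ u) :
    ∃ W : ℝ, ∀ t ∈ Icc 0 T, ∫ x, ‖u t x‖ ≤ W := by
  obtain ⟨M, hM⟩ := hu.bounded
  refine ⟨M, fun t ht => ?_⟩
  have hp1 : 1 ≤ ENNReal.ofReal p := by simpa using hp
  have h1 := (hu.memLp t ht).integrable hp1
  have h2 := (eLpNorm_le_eLpNorm_of_exponent_le hp1 h1.1).trans (hM t ht)
  rw [eLpNorm_one_eq_lintegral_enorm, ← ofReal_integral_norm_eq_lintegral_enorm h1] at h2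
  simpa using (ENNReal.ofReal_le_iff_le_toReal ENNReal.coe_ne_top).1 h2

/-- Uniqueness for the transport equation. -/
theorem ae_eq_of_isTransportSolution (hb : IsSobolevField T β K L b G) {p : ℝ} (hp : 1 ≤ p)
    {u₀ : Torus d → ℝ} {u v : ℝ → Torus d → ℝ}
    (hu : IsTransportSolution T p (velocity b) G u₀ u)
    (hv : IsTransportSolution T p (velocity b) G u₀ v) {t : ℝ} (ht : t ∈ Icc 0 T) :
    u t =ᵐ[volume] v t := by
  have hT := ht.1.trans ht.2
  have hu' := isIntegrableSolution_of_isTransportSolution hp hT hu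
  have hv' := isIntegrableSolution_of_isTransportSolution hp hT hv
  have hw := hu'.sub hb hv' hT
  obtain ⟨W, hW⟩ := hu.exists_integral_norm_le hp
  obtain ⟨W', hW'⟩ := hv.exists_integral_norm_le hp
  have h0 : (0 : ℝ) ∈ Icc 0 T := ⟨le_rfl, hT⟩
  have hw0 : (fun x => u 0 x - v 0 x) =ᵐ[volume] 0 := by
    have h1 : ∫ x, ‖u 0 x - v 0 x‖ ≤ 0 := by
      refine integral_norm_le_of_forall_smooth (hw.integrable 0 h0) fun ψ hψ _ => ?_
      have e1 := hu.integral_eq ψ hψ 0 h0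
      have e2 := hv.integral_eq ψ hψ 0 h0
      rw [intervalIntegral.integral_same] at e1 e2
      obtain ⟨C, _, hC⟩ := exists_bound_of_continuous hψ.continuous
      have hi : ∀ {f : Torus d → ℝ}, Integrable f → Integrable fun x => ψ x * f x := fun hf =>
        hf.bdd_mul hψ.continuous.aestronglyMeasurable (Eventually.of_forall hC)
      simp only [mul_sub]
      rw [integral_sub (hi (hu'.integrable 0 h0)) (hi (hv'.integrable 0 h0))]
      simp only [mul_comm (ψ _)]
      linarith
    have h3 := (integral_eq_zero_iff_of_nonneg (fun x => norm_nonneg _)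
      (hw.integrable 0 h0).norm).1 (le_antisymm h1 (by positivity))
    filter_upwards [h3] with x hx
    simpa using hx
  have := hw.ae_eq_zero hb (W := W + W') (fun t ht => ?_) hw0 ht
  · filter_upwards [this] with x hx
    exact sub_eq_zero.1 hx
  · have h1 := hu'.integrable t ht
    have h2 := hv'.integrable t ht
    calc ∫ x, ‖u t x - v t x‖ ≤ ∫ x, (‖u t x‖ + ‖v t x‖) :=
          integral_mono (h1.sub h2).norm (h1.norm.add h2.norm) fun x => norm_sub_le _ _
      _ = (∫ x, ‖u t x‖) + ∫ x, ‖v t x‖ := integral_add h1.norm h2.norm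
      _ ≤ _ := add_le_add (hW t ht) (hW' t ht)

end IsSobolevField

end

end TorusTransport


namespace TorusTransport

noncomputable section

variable {d : ℕ}

/-- Grönwall's inequality, backwards in time, with an integrable coefficient. -/
lemma gronwall_backward {r k : ℝ → ℝ} {t : ℝ} (ht : 0 ≤ t) (hr : Continuous r) (hr0 : ∀ s, 0 ≤ r s)
    (hk : IntervalIntegrable k volume 0 t) (hk0 : ∀ s, 0 ≤ k s)
    (h : ∀ s ∈ Icc 0 t, ∀ s' ∈ Icc 0 t, s ≤ s' → r s ≤ r s' + ∫ σ in s..s', k σ * r σ) :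
    r 0 ≤ r t * Real.exp (∫ σ in (0 : ℝ)..t, k σ) := by
  set κ : ℝ → ℝ := fun s => ∫ σ in (0 : ℝ)..s, k σ with hκ
  have hki : ∀ s ∈ Icc 0 t, ∀ s' ∈ Icc 0 t, IntervalIntegrable k volume s s' := fun s hs s' hs' =>
    hk.mono_set (by
      rw [uIcc_of_le ht]
      exact uIcc_subset_Icc hs hs')
  have h0 : (0 : ℝ) ∈ Icc 0 t := ⟨le_rfl, ht⟩
  have htt : t ∈ Icc 0 t := ⟨ht, le_rfl⟩
  have hκsub : ∀ s ∈ Icc 0 t, ∀ s' ∈ Icc 0 t, κ s' - κ s = ∫ σ in s..s', k σ := fun s hs s' hs' =>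
    intervalIntegral.integral_interval_sub_left (hki 0 h0 s' hs') (hki 0 h0 s hs)
  have hκmono : ∀ s ∈ Icc 0 t, ∀ s' ∈ Icc 0 t, s ≤ s' → κ s ≤ κ s' := fun s hs s' hs' hss => by
    have : 0 ≤ ∫ σ in s..s', k σ := intervalIntegral.integral_nonneg_of_forall hss hk0
    linarith [hκsub s hs s' hs']
  have hmain : -(r t * Real.exp (κ t)) ≤ -(r 0 * Real.exp (κ 0)) := by
    refine le_of_small_increments (f := fun s => -(r s * Real.exp (κ s))) (M := κ) ht fun ε hε => ?_
    obtain ⟨δ, hδ, hrδ⟩ := Metric.uniformContinuousOn_iff_le.1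
      ((isCompact_Icc (a := (0 : ℝ)) (b := t)).uniformContinuousOn_of_continuous hr.continuousOn)
      (ε / Real.exp (κ t)) (by positivity)
    refine ⟨δ, hδ, fun s hs s' hs' hss hle => ?_⟩
    set ω := ε / Real.exp (κ t) with hω
    have h1 : ∫ σ in s..s', k σ * r σ ≤ ∫ σ in s..s', k σ * (r s' + ω) := by
      refine intervalIntegral.integral_mono_on hss ((hki s hs s' hs').mul_continuousOn
        hr.continuousOn) ((hki s hs s' hs').mul_const _) fun σ hσ => ?_
      refine mul_le_mul_of_nonneg_left ?_ (hk0 σ)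
      have := hrδ σ ⟨hs.1.trans hσ.1, hσ.2.trans hs'.2⟩ s' hs' (by
        rw [Real.dist_eq, abs_sub_comm, abs_of_nonneg (by linarith [hσ.2])]
        linarith [hσ.1])
      rw [Real.dist_eq] at this
      linarith [le_abs_self (r σ - r s')]
    rw [intervalIntegral.integral_mul_const, ← hκsub s hs s' hs'] at h1
    have h2 := h s hs s' hs' hss
    set Δ := κ s' - κ s with hΔ
    have hΔ0 : 0 ≤ Δ := by linarith [hκmono s hs s' hs' hss]
    have h3 : Δ + 1 ≤ Real.exp Δ := Real.add_one_le_exp Δ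
    have h4 : r s ≤ r s' * Real.exp Δ + Δ * ω := by nlinarith [hr0 s']
    have h5 : Real.exp (κ s) * Real.exp Δ = Real.exp (κ s') := by
      rw [← Real.exp_add]; congr 1; rw [hΔ]; ring
    have h6 : Real.exp (κ s) * ω ≤ ε := by
      have := Real.exp_le_exp.2 (hκmono s hs t htt hs.2)
      rw [hω, mul_div_assoc', div_le_iff₀ (Real.exp_pos _), mul_comm]
      exact mul_le_mul_of_nonneg_left this hε.le
    have h7 := mul_le_mul_of_nonneg_right h4 (Real.exp_pos (κ s)).le
    have h8 := mul_le_mul_of_nonneg_left h6 hΔ0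
    have h9 : (r s' * Real.exp Δ + Δ * ω) * Real.exp (κ s) =
        r s' * Real.exp (κ s') + Δ * (Real.exp (κ s) * ω) := by rw [← h5]; ring
    linarith
  have hκ0 : κ 0 = 0 := intervalIntegral.integral_same
  rw [hκ0, Real.exp_zero, mul_one] at hmain
  linarith

/-- Jensen's inequality for the logarithm. -/
lemma intervalIntegral_log_le {θ : ℝ → ℝ≥0∞} (hθ : Measurable θ) (hθ1 : ∀ s, 1 ≤ θ s) {t : ℝ}
    (ht : 0 < t) (hI : ∫⁻ s in Ioc 0 t, θ s ≠ ∞) :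
    IntervalIntegrable (fun s => Real.log (θ s).toReal) volume 0 t ∧
      ∫ s in (0 : ℝ)..t, Real.log (θ s).toReal ≤
        t * Real.log ((ENNReal.ofReal t)⁻¹ * ∫⁻ s in Ioc 0 t, θ s).toReal := by
  have hfin : ∀ᵐ s ∂volume.restrict (Ioc 0 t), θ s < ∞ := ae_lt_top hθ hI
  have hθi : IntegrableOn (fun s => (θ s).toReal) (Ioc 0 t) :=
    integrable_toReal_of_lintegral_ne_top hθ.aemeasurable hI
  have hone : ∀ s, θ s < ∞ → 1 ≤ (θ s).toReal := fun s hs => by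
    simpa using ENNReal.toReal_mono hs.ne (hθ1 s)
  have hlogm : Measurable fun s => Real.log (θ s).toReal := Real.measurable_log.comp hθ.ennreal_toReal
  have hlog : IntegrableOn (fun s => Real.log (θ s).toReal) (Ioc 0 t) := by
    refine hθi.mono' hlogm.aestronglyMeasurable ?_
    filter_upwards [hfin] with s hs
    rw [Real.norm_of_nonneg (Real.log_nonneg (hone s hs))]
    exact (Real.log_le_sub_one_of_pos (by linarith [hone s hs])).trans (by linarith)
  refine ⟨(intervalIntegrable_iff_integrableOn_Ioc_of_le ht.le).2 hlog, ?_⟩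
  rw [intervalIntegral.integral_of_le ht.le, ENNReal.toReal_mul, ENNReal.toReal_inv,
    ENNReal.toReal_ofReal ht.le, ← integral_toReal hθ.aemeasurable hfin]
  set A := t⁻¹ * ∫ s in Ioc 0 t, (θ s).toReal with hA
  have h1 : t ≤ ∫ s in Ioc 0 t, (θ s).toReal := by
    calc t = ∫ _s in Ioc 0 t, (1 : ℝ) := by simp [ht.le]
      _ ≤ _ := by
        refine integral_mono_ae (integrable_const _) hθi ?_
        filter_upwards [hfin] with s hs using hone s hs
  have hA0 : 0 < A := mul_pos (inv_pos.2 ht) (ht.trans_le h1)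
  have h2 : ∀ᵐ s ∂volume.restrict (Ioc 0 t),
      Real.log (θ s).toReal ≤ (Real.log A - 1) + A⁻¹ * (θ s).toReal := by
    filter_upwards [hfin] with s hs
    have h3 : 0 < (θ s).toReal := by linarith [hone s hs]
    have := Real.log_le_sub_one_of_pos (mul_pos (inv_pos.2 hA0) h3)
    rw [Real.log_mul (inv_pos.2 hA0).ne' h3.ne', Real.log_inv] at this
    linarith
  have h4 := integral_mono_ae hlog ((integrable_const (Real.log A - 1)).add (hθi.const_mul A⁻¹)) h2
  refine h4.trans_eq ?_
  have h5 : ∫ s in Ioc 0 t, (θ s).toReal = t * A := by rw [hA]; field_simp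
  simp only [Pi.add_apply]
  rw [integral_add (integrable_const _) (hθi.const_mul _), integral_const_mul, h5]
  simp only [integral_const, MeasurableSet.univ, measureReal_restrict_apply, univ_inter,
    Real.volume_real_Ioc_of_le ht.le, sub_zero, smul_eq_mul]
  field_simp
  ring

/-- The square root of the normalized maximal function of the exponential of the gradient. -/
def sqrtMaxFun (β : ℝ) (G : Torus d → Matrix (Fin d) (Fin d) ℝ) (x : Torus d) : ℝ≥0∞ :=
  (ENNReal.ofReal (mollConst d * 4 ^ d) * maxFun (expGrad β G) x) ^ (1 / 2 : ℝ)

lemma one_le_sqrtMaxFun {β : ℝ} (hβ : 0 < β) (G : Torus d → Matrix (Fin d) (Fin d) ℝ)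
    (x : Torus d) : 1 ≤ sqrtMaxFun β G x := by
  have h1 : (1 : ℝ) ≤ mollConst d * 4 ^ d :=
    one_le_mul_of_one_le_of_one_le (by linarith [three_le_mollConst d]) (one_le_pow₀ (by norm_num))
  rw [sqrtMaxFun]
  refine ENNReal.one_le_rpow (one_le_mul ?_ (one_le_maxFun (one_le_expGrad hβ) x)) (by norm_num)
  simpa using h1

lemma maxFun_ne_top_of_sqrtMaxFun {β : ℝ} {G : Torus d → Matrix (Fin d) (Fin d) ℝ} {x : Torus d}
    (h : sqrtMaxFun β G x < ∞) : maxFun (expGrad β G) x ≠ ∞ := by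
  intro h1
  have h2 : ENNReal.ofReal (mollConst d * 4 ^ d) ≠ 0 := by
    have := three_le_mollConst d
    simp only [ne_eq, ENNReal.ofReal_eq_zero, not_le]
    positivity
  rw [sqrtMaxFun, h1, ENNReal.mul_top h2, ENNReal.top_rpow_of_pos (by norm_num)] at h
  exact lt_irrefl _ h

lemma lusinLip_eq {β : ℝ} (G : Torus d → Matrix (Fin d) (Fin d) ℝ) (x : Torus d) :
    lusinLip (mollConst d) β G x =
      2 * Real.sqrt d / β * Real.log (sqrtMaxFun β G x).toReal := by
  have h0 : 0 ≤ mollConst d * 4 ^ d := by have := three_le_mollConst d; positivity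
  rw [lusinLip, sqrtMaxFun, ← ENNReal.toReal_rpow, ENNReal.toReal_mul, ENNReal.toReal_ofReal h0]
  rcases (mul_nonneg h0 ENNReal.toReal_nonneg :
    0 ≤ mollConst d * 4 ^ d * (maxFun (expGrad β G) x).toReal).eq_or_lt with h | h
  · rw [← h, Real.zero_rpow (by norm_num), Real.log_zero]
    ring
  · rw [Real.log_rpow h]
    ring

lemma lusinLip_nonneg {β : ℝ} (hβ : 0 < β) (G : Torus d → Matrix (Fin d) (Fin d) ℝ) (x : Torus d) :
    0 ≤ lusinLip (mollConst d) β G x := by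
  rw [lusinLip_eq]
  rcases eq_or_ne (sqrtMaxFun β G x) ∞ with h | h
  · simp [h]
  · have h1 : 1 ≤ (sqrtMaxFun β G x).toReal := by
      simpa using ENNReal.toReal_mono h (one_le_sqrtMaxFun hβ G x)
    have := Real.log_nonneg h1
    positivity

/-- The constant `C` such that `∫ sqrtMaxFun ≤ C K`. -/
def sqrtMaxConst (d : ℕ) : ℝ := Real.sqrt (mollConst d * 4 ^ d) * (1 + 4 * 8 ^ d)

lemma sqrtMaxConst_pos (d : ℕ) : 0 < sqrtMaxConst d := by
  have := three_le_mollConst d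
  rw [sqrtMaxConst]
  positivity

namespace IsSobolevField

variable {T β K L : ℝ} {b : ℝ → Torus d → EuclideanSpace ℝ (Fin d)}
  {G : ℝ → Torus d → Matrix (Fin d) (Fin d) ℝ}

lemma lintegral_sqrtMaxFun_le (hb : IsSobolevField T β K L b G) (s : ℝ) :
    ∫⁻ x, sqrtMaxFun β (G s) x ≤ ENNReal.ofReal (sqrtMaxConst d * K) := by
  have h0 : 0 ≤ mollConst d * 4 ^ d := by have := three_le_mollConst d; positivity
  have hm := measurable_expGrad (β := β) (hb.measurable_grad_slice s)
  have hK := hb.one_le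
  simp only [sqrtMaxFun, ENNReal.mul_rpow_of_nonneg _ _ (by norm_num : (0 : ℝ) ≤ 1 / 2)]
  rw [lintegral_const_mul _ ((measurable_maxFun hm).pow_const _),
    ENNReal.ofReal_rpow_of_nonneg h0 (by norm_num), ← Real.sqrt_eq_rpow, sqrtMaxConst, mul_assoc,
    ENNReal.ofReal_mul (Real.sqrt_nonneg _)]
  refine mul_le_mul' le_rfl ((lintegral_sqrt_maxFun_le hm).trans ?_)
  calc 1 + 4 * (ENNReal.ofReal (8 ^ d) * ∫⁻ x, expGrad β (G s) x)
      ≤ 1 + 4 * (ENNReal.ofReal (8 ^ d) * ENNReal.ofReal K) := by gcongr; exact hb.lintegral_exp_le s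
    _ = ENNReal.ofReal (1 + 4 * (8 ^ d * K)) := by
        rw [ENNReal.ofReal_add zero_le_one (by positivity), ENNReal.ofReal_mul (by norm_num),
          ENNReal.ofReal_mul (by positivity)]
        norm_num
    _ ≤ _ := ENNReal.ofReal_le_ofReal (by nlinarith)

lemma measurable_sqrtMaxFun_flow (hb : IsSobolevField T β K L b G) (t : ℝ) :
    Measurable fun z : Torus d × ℝ => sqrtMaxFun β (G z.2) (flow (velocity b) t z.2 z.1) := by
  have h1 : Measurable (Function.uncurry fun s => expGrad β (G s)) := by
    have hm : Measurable fun z : ℝ × Torus d => matNorm (G z.1 z.2) := by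
      simp only [matNorm]
      exact (Finset.measurable_sum _ fun i _ => Finset.measurable_sum _ fun j _ =>
        (hb.measurable_grad i j).pow_const 2).sqrt
    exact (Real.measurable_exp.comp (hm.const_mul β)).ennreal_ofReal
  have h2 : Continuous fun z : Torus d × ℝ => flow (velocity b) t z.2 z.1 :=
    (hb.hasFlow.continuous hb.isVelocity).comp
      (continuous_const.prodMk (continuous_snd.prodMk continuous_fst))
  exact (((measurable_maxFun_param h1).comp (measurable_snd.prodMk h2.measurable)).const_mul
    _).pow_const _

lemma measurable_sqrtMaxFun_path (hb : IsSobolevField T β K L b G) (t : ℝ) (x : Torus d) :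
    Measurable fun s => sqrtMaxFun β (G s) (flow (velocity b) t s x) :=
  Measurable.of_uncurry_left (f := fun x s => sqrtMaxFun β (G s) (flow (velocity b) t s x))
    (hb.measurable_sqrtMaxFun_flow t)

/-- The time average of the maximal function along the backward trajectory. -/
def _root_.TorusTransport.pathAverage (β : ℝ) (b : ℝ → Torus d → EuclideanSpace ℝ (Fin d))
    (G : ℝ → Torus d → Matrix (Fin d) (Fin d) ℝ) (t : ℝ) (x : Torus d) : ℝ≥0∞ :=
  (ENNReal.ofReal t)⁻¹ * ∫⁻ s in Ioc 0 t, sqrtMaxFun β (G s) (flow (velocity b) t s x)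

lemma measurable_pathAverage (hb : IsSobolevField T β K L b G) (t : ℝ) :
    Measurable (pathAverage β b G t) :=
  (hb.measurable_sqrtMaxFun_flow t).lintegral_prod_right'.const_mul _

lemma lintegral_pathAverage_le (hb : IsSobolevField T β K L b G) {t : ℝ} (ht : 0 < t) :
    ∫⁻ x, pathAverage β b G t x ≤
      ENNReal.ofReal (Real.exp (L * t) * (sqrtMaxConst d * K)) := by
  have ht0 : ENNReal.ofReal t ≠ 0 := by simpa using ht
  have hm := hb.measurable_sqrtMaxFun_flow t
  have hL := hb.nonneg
  simp only [pathAverage]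
  rw [lintegral_const_mul _ hm.lintegral_prod_right', lintegral_lintegral_swap hm.aemeasurable]
  have h1 : ∫⁻ s in Ioc 0 t, ∫⁻ x, sqrtMaxFun β (G s) (flow (velocity b) t s x) ≤
      ∫⁻ _s in Ioc 0 t, ENNReal.ofReal (Real.exp (L * t) * (sqrtMaxConst d * K)) := by
    refine setLIntegral_mono measurable_const fun s hs => ?_
    have h2 : Measurable (sqrtMaxFun β (G s)) :=
      ((measurable_maxFun (measurable_expGrad (hb.measurable_grad_slice s))).const_mul _).pow_const _
    refine (hb.lintegral_comp_flow_le t s h2.aemeasurable).trans ?_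
    rw [ENNReal.ofReal_mul (Real.exp_pos _).le]
    refine mul_le_mul' (ENNReal.ofReal_le_ofReal (Real.exp_le_exp.2 ?_))
      (hb.lintegral_sqrtMaxFun_le s)
    rw [abs_of_nonneg (by linarith [hs.2])]
    exact mul_le_mul_of_nonneg_left (by linarith [hs.1]) hL
  calc _ ≤ (ENNReal.ofReal t)⁻¹ *
        ∫⁻ _s in Ioc 0 t, ENNReal.ofReal (Real.exp (L * t) * (sqrtMaxConst d * K)) :=
        mul_le_mul' le_rfl h1
    _ = _ := by
      rw [setLIntegral_const, Real.volume_Ioc, sub_zero, mul_comm (ENNReal.ofReal (_ * _)),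
        ← mul_assoc, ENNReal.inv_mul_cancel ht0 ENNReal.ofReal_ne_top, one_mul]

lemma pathAverage_ne_top (ht : ℝ) {x : Torus d} (h : pathAverage β b G ht x ≠ ∞) :
    ∫⁻ s in Ioc 0 ht, sqrtMaxFun β (G s) (flow (velocity b) ht s x) ≠ ∞ := by
  intro h1
  rw [pathAverage, h1, ENNReal.mul_top (ENNReal.inv_ne_zero.2 ENNReal.ofReal_ne_top)] at h
  exact h rfl

lemma one_le_pathAverage (hb : IsSobolevField T β K L b G) {t : ℝ} (ht : 0 < t) (x : Torus d) :
    1 ≤ pathAverage β b G t x := by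
  have ht0 : ENNReal.ofReal t ≠ 0 := by simpa using ht
  have h1 : ∫⁻ _s in Ioc 0 t, 1 ≤
      ∫⁻ s in Ioc 0 t, sqrtMaxFun β (G s) (flow (velocity b) t s x) :=
    lintegral_mono fun s => one_le_sqrtMaxFun hb.pos _ _
  rw [setLIntegral_const, Real.volume_Ioc, sub_zero, one_mul] at h1
  calc (1 : ℝ≥0∞) = (ENNReal.ofReal t)⁻¹ * ENNReal.ofReal t :=
        (ENNReal.inv_mul_cancel ht0 ENNReal.ofReal_ne_top).symm
    _ ≤ _ := mul_le_mul' le_rfl h1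

lemma lusinLip_flow (hb : IsSobolevField T β K L b G) {t : ℝ} (ht : 0 < t) {x : Torus d}
    (hx : pathAverage β b G t x ≠ ∞) :
    IntervalIntegrable (fun s => lusinLip (mollConst d) β (G s) (flow (velocity b) t s x))
      volume 0 t ∧
    ∫ s in (0 : ℝ)..t, lusinLip (mollConst d) β (G s) (flow (velocity b) t s x) ≤
      2 * Real.sqrt d / β * (t * Real.log (pathAverage β b G t x).toReal) := by
  have hβ := hb.pos
  have h1 := intervalIntegral_log_le
    (θ := fun s => sqrtMaxFun β (G s) (flow (velocity b) t s x))
    (hb.measurable_sqrtMaxFun_path t x) (fun s => one_le_sqrtMaxFun hβ _ _) ht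
    (pathAverage_ne_top t hx)
  simp only [lusinLip_eq]
  refine ⟨h1.1.const_mul _, ?_⟩
  rw [intervalIntegral.integral_const_mul]
  exact mul_le_mul_of_nonneg_left h1.2 (by positivity)

/-- The Lusin-Lipschitz estimate for the backward flow map. -/
theorem torusDist_flow_le (hb : IsSobolevField T β K L b G) {t : ℝ} (ht : 0 < t) {x y : Torus d}
    (hx : pathAverage β b G t x ≠ ∞) (hy : pathAverage β b G t y ≠ ∞) :
    torusDist (flow (velocity b) t 0 x) (flow (velocity b) t 0 y) ≤ torusDist x y *
      ((pathAverage β b G t x).toReal ^ (2 * Real.sqrt d / β * t) *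
        (pathAverage β b G t y).toReal ^ (2 * Real.sqrt d / β * t)) := by
  obtain ⟨w, rfl, hw, -⟩ := exists_elift x y
  set y := x + eproj w with hy'
  set Z := fun s => flow (velocity b) t s x with hZdef
  set Z' := fun s => flow (velocity b) t s y with hZ'def
  have hv := hb.isVelocity
  have hZ : IsTraj (velocity b) t x Z := hb.hasFlow.isTraj t x
  have hZ' : IsTraj (velocity b) t y Z' := hb.hasFlow.isTraj t y
  set D := gap (velocity b) (velocity b) Z Z' t w with hD
  obtain ⟨hkx, hlx⟩ := hb.lusinLip_flow ht hx
  obtain ⟨hky, hly⟩ := hb.lusinLip_flow ht hy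
  set k : ℝ → ℝ := fun s => lusinLip (mollConst d) β (G s) (Z s) +
    lusinLip (mollConst d) β (G s) (Z' s) with hk
  have hki : IntervalIntegrable k volume 0 t := hkx.add hky
  have hk0 : ∀ s, 0 ≤ k s := fun s => add_nonneg (lusinLip_nonneg hb.pos _ _)
    (lusinLip_nonneg hb.pos _ _)
  have hdiff : Integrable fun σ => velocity b σ (Z' σ) - velocity b σ (Z σ) :=
    (hv.integrable_comp hZ'.continuous).sub (hv.integrable_comp hZ.continuous)
  have hDc : Continuous D := continuous_add_primitive hdiff w t
  have hdist : ∀ s, torusDist (Z s) (Z' s) ≤ ‖D s‖ := fun s => by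
    rw [hZ.eq_gap hv hv hZ' s]
    exact torusDist_add_eproj_le _ _
  have hfinx := ae_lt_top (hb.measurable_sqrtMaxFun_path t x)
    (pathAverage_ne_top t hx)
  have hfiny := ae_lt_top (hb.measurable_sqrtMaxFun_path t y)
    (pathAverage_ne_top t hy)
  have hpt : ∀ᵐ s ∂volume.restrict (Ioc 0 t),
      ‖velocity b s (Z' s) - velocity b s (Z s)‖ ≤ k s * ‖D s‖ := by
    filter_upwards [hfinx, hfiny] with s h1 h2
    have := hb.norm_velocity_sub_le s (maxFun_ne_top_of_sqrtMaxFun h1)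
      (maxFun_ne_top_of_sqrtMaxFun h2)
    rw [norm_sub_rev]
    refine this.trans ?_
    rw [mul_comm]
    exact mul_le_mul_of_nonneg_left (hdist s) (hk0 s)
  have hgr := gronwall_backward ht.le hDc.norm (fun s => norm_nonneg _) hki hk0
    (fun s hs s' hs' hss => by
      have h1 : D s' = D s + ∫ σ in s..s', (velocity b σ (Z' σ) - velocity b σ (Z σ)) :=
        gap_sub hv hv hZ.continuous hZ'.continuous t w s s'
      have h2 : ‖∫ σ in s..s', (velocity b σ (Z' σ) - velocity b σ (Z σ))‖ ≤
          ∫ σ in s..s', k σ * ‖D σ‖ := by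
        have hsub : Ioc s s' ⊆ Ioc 0 t := Ioc_subset_Ioc hs.1 hs'.2
        refine intervalIntegral.norm_integral_le_of_norm_le hss ?_ ?_
        · exact (ae_restrict_iff' measurableSet_Ioc).1
            (ae_restrict_of_ae_restrict_of_subset hsub hpt)
        · refine (hki.mono_set ?_).mul_continuousOn hDc.norm.continuousOn
          rw [uIcc_of_le hss, uIcc_of_le ht.le]
          exact Icc_subset_Icc hs.1 hs'.2
      have h3 : D s = D s' - ∫ σ in s..s', (velocity b σ (Z' σ) - velocity b σ (Z σ)) := by
        rw [h1, add_sub_cancel_right]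
      calc ‖D s‖ ≤ ‖D s'‖ + ‖∫ σ in s..s', (velocity b σ (Z' σ) - velocity b σ (Z σ))‖ := by
            rw [h3]; exact norm_sub_le _ _
        _ ≤ _ := add_le_add le_rfl h2)
  have hDt : D t = w := gap_self _ _ _ _
  rw [hDt, hw] at hgr
  refine (hdist 0).trans (hgr.trans (mul_le_mul_of_nonneg_left ?_ (torusDist_nonneg _ _)))
  have hone : ∀ {z}, pathAverage β b G t z ≠ ∞ → 0 < (pathAverage β b G t z).toReal := fun hz =>
    lt_of_lt_of_le one_pos (by simpa using ENNReal.toReal_mono hz (hb.one_le_pathAverage ht _))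
  rw [Real.rpow_def_of_pos (hone hx), Real.rpow_def_of_pos (hone hy), ← Real.exp_add,
    intervalIntegral.integral_add hkx hky]
  refine Real.exp_le_exp.2 ?_
  linarith

end IsSobolevField

end

end TorusTransport


namespace TorusTransport

noncomputable section

variable {d : ℕ}

/-! ### The seminorm along the flow -/

lemma torusDist_pos {x y : Torus d} (h : x ≠ y) : 0 < torusDist x y := by
  obtain ⟨i, hi⟩ := Function.ne_iff.1 h
  refine Real.sqrt_pos.2 (Finset.sum_pos' (fun i _ => by positivity) ⟨i, Finset.mem_univ i, ?_⟩)
  have : 0 < ‖x i - y i‖ := norm_pos_iff.2 (sub_ne_zero.2 hi)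
  positivity

lemma seminormF_le_of_ae_eq {α : ℝ} {p : ℝ≥0∞} {f f' : Torus d → ℝ} (h : f =ᵐ[volume] f') :
    seminormF α p f' ≤ seminormF α p f := by
  obtain ⟨S, hS, hSm, hS0⟩ := exists_measurable_superset_of_null (ae_iff.1 h)
  refine le_iInf fun g => le_iInf fun hg => le_iInf fun hfg => ?_
  have hae : (fun x => S.indicator (fun _ => ∞) x + g x) =ᵐ[volume] g := by
    filter_upwards [measure_eq_zero_iff_ae_notMem.1 hS0] with x hx
    rw [indicator_of_notMem hx, zero_add]
  rw [← eLpNorm_congr_ae hae]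
  refine iInf_le_of_le _ (iInf_le_of_le (hg.congr hae.symm) (iInf_le _ fun x y => ?_))
  rcases eq_or_ne x y with rfl | hxy
  · simp
  have hpos : ENNReal.ofReal (torusDist x y ^ α) ≠ 0 := by
    simpa using Real.rpow_pos_of_pos (torusDist_pos hxy) α
  by_cases hx : x ∈ S
  · rw [indicator_of_mem hx, top_add, top_add, ENNReal.mul_top hpos]
    exact le_top
  by_cases hy : y ∈ S
  · rw [indicator_of_mem hy, top_add, add_top, ENNReal.mul_top hpos]
    exact le_top
  have hfx : ∀ {z}, z ∉ S → f z = f' z := fun hz => by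
    by_contra h0
    exact hz (hS h0)
  rw [indicator_of_notMem hx, indicator_of_notMem hy, zero_add, zero_add, ← hfx hx, ← hfx hy]
  exact hfg x y

lemma seminormF_congr_ae {α : ℝ} {p : ℝ≥0∞} {f f' : Torus d → ℝ} (h : f =ᵐ[volume] f') :
    seminormF α p f = seminormF α p f' :=
  le_antisymm (seminormF_le_of_ae_eq h.symm) (seminormF_le_of_ae_eq h)

lemma rpow_mul_rpow_mul_add_le {X Y : ℝ≥0∞} (hX : X ≠ ∞) (hY : Y ≠ ∞) {a s : ℝ} (ha : 0 ≤ a)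
    (hs : 0 ≤ s) : X ^ a * Y ^ a * (X ^ s + Y ^ s) ≤ X ^ (2 * a + s) + Y ^ (2 * a + s) := by
  lift X to ℝ≥0 using hX
  lift Y to ℝ≥0 using hY
  have h2 : ∀ Z : ℝ≥0, Z ^ (2 * a + s) = Z ^ a * Z ^ (a + s) := fun Z => by
    rw [← NNReal.rpow_add_of_nonneg _ ha (by positivity)]
    congr 1
    ring
  have h3 : ∀ Z : ℝ≥0, Z ^ (a + s) = Z ^ a * Z ^ s := fun Z => NNReal.rpow_add_of_nonneg _ ha hs
  have key : X ^ a * Y ^ a * (X ^ s + Y ^ s) ≤ X ^ (2 * a + s) + Y ^ (2 * a + s) := by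
    rw [h2, h2]
    have h1 : X ^ a * Y ^ a * (X ^ s + Y ^ s) = X ^ a * Y ^ (a + s) + Y ^ a * X ^ (a + s) := by
      rw [h3, h3]
      ring
    rw [h1]
    rcases le_total X Y with h | h
    · exact mul_add_mul_le_mul_add_mul (NNReal.rpow_le_rpow h ha)
        (NNReal.rpow_le_rpow h (by positivity))
    · exact mul_add_mul_le_mul_add_mul' (NNReal.rpow_le_rpow h ha)
        (NNReal.rpow_le_rpow h (by positivity))
  have h0 : 0 ≤ 2 * a + s := by positivity
  rw [← ENNReal.coe_rpow_of_nonneg _ ha, ← ENNReal.coe_rpow_of_nonneg _ ha,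
    ← ENNReal.coe_rpow_of_nonneg _ hs, ← ENNReal.coe_rpow_of_nonneg _ hs,
    ← ENNReal.coe_rpow_of_nonneg _ h0, ← ENNReal.coe_rpow_of_nonneg _ h0]
  exact_mod_cast key

lemma eLpNorm_ofReal_eq {g : Torus d → ℝ≥0∞} {p : ℝ} (hp : 0 < p) :
    eLpNorm g (ENNReal.ofReal p) volume = (∫⁻ x, g x ^ p) ^ (1 / p) := by
  rw [eLpNorm_eq_lintegral_rpow_enorm_toReal (by simpa using hp) ENNReal.ofReal_ne_top,
    ENNReal.toReal_ofReal hp.le]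
  simp only [enorm_eq_self]

namespace IsSobolevField

variable {T β K L : ℝ} {b : ℝ → Torus d → EuclideanSpace ℝ (Fin d)}
  {G : ℝ → Torus d → Matrix (Fin d) (Fin d) ℝ}

lemma ofReal_torusDist_flow_rpow_le (hb : IsSobolevField T β K L b G) {t α : ℝ} (ht : 0 < t)
    (hα : 0 ≤ α) {x y : Torus d} (hx : pathAverage β b G t x ≠ ∞)
    (hy : pathAverage β b G t y ≠ ∞) :
    ENNReal.ofReal (torusDist (flow (velocity b) t 0 x) (flow (velocity b) t 0 y) ^ α) ≤
      ENNReal.ofReal (torusDist x y ^ α) *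
        (pathAverage β b G t x ^ (2 * Real.sqrt d / β * t * α) *
          pathAverage β b G t y ^ (2 * Real.sqrt d / β * t * α)) := by
  have hβ := hb.pos
  have ha : 0 ≤ 2 * Real.sqrt d / β * t * α := by positivity
  set X := pathAverage β b G t x with hX
  set Y := pathAverage β b G t y with hY
  have h1 := Real.rpow_le_rpow (torusDist_nonneg _ _) (hb.torusDist_flow_le ht hx hy) hα
  rw [Real.mul_rpow (torusDist_nonneg _ _) (by positivity), Real.mul_rpow (by positivity)
    (by positivity), ← Real.rpow_mul ENNReal.toReal_nonneg, ← Real.rpow_mul ENNReal.toReal_nonneg,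
    ← hX, ← hY] at h1
  refine (ENNReal.ofReal_le_ofReal h1).trans_eq ?_
  rw [ENNReal.ofReal_mul (by have := torusDist_nonneg x y; positivity),
    ENNReal.ofReal_mul (by positivity), ENNReal.toReal_rpow, ENNReal.toReal_rpow,
    ENNReal.ofReal_toReal (ENNReal.rpow_ne_top_of_nonneg ha hx),
    ENNReal.ofReal_toReal (ENNReal.rpow_ne_top_of_nonneg ha hy)]

/-- The losing regularity estimate for the transport by the flow. -/
theorem seminormF_comp_flow_le (hb : IsSobolevField T β K L b G) {t α p pt : ℝ} (ht : 0 < t)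
    (hα : 0 ≤ α) (hp : 0 < p) (hpt0 : 0 < pt)
    (hpt : 1 / pt = 2 * (2 * Real.sqrt d / β * t * α) + 1 / p) (f : Torus d → ℝ) :
    seminormF α (ENNReal.ofReal pt) (fun x => f (flow (velocity b) t 0 x)) ≤
      seminormF α (ENNReal.ofReal p) f *
        ENNReal.ofReal ((Real.exp (L * t) * (sqrtMaxConst d + 3) * K) ^ (1 / pt)) := by
  have hβ := hb.pos
  have hK := hb.one_le
  have hs0 := sqrtMaxConst_pos d
  set a := 2 * Real.sqrt d / β * t * α with ha
  have ha0 : 0 ≤ a := by positivity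
  have hE : 0 < Real.exp (L * t) * (sqrtMaxConst d + 3) * K := by positivity
  set C := ENNReal.ofReal ((Real.exp (L * t) * (sqrtMaxConst d + 3) * K) ^ (1 / pt)) with hC
  have hC0 : C ≠ 0 := by simpa [hC] using Real.rpow_pos_of_pos hE _
  have hCtop : C ≠ ∞ := ENNReal.ofReal_ne_top
  rw [← ENNReal.div_le_iff hC0 hCtop]
  refine le_of_forall_gt_imp_ge_of_dense fun N hN => ?_
  rcases eq_or_ne N ∞ with rfl | hNtop
  · exact le_top
  have hN0 : N ≠ 0 := (zero_le.trans_lt hN).ne'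
  rw [ENNReal.div_le_iff hC0 hCtop]
  simp only [seminormF, iInf_lt_iff] at hN
  obtain ⟨g, hg, hfg, hgN⟩ := hN
  set Y := flow (velocity b) t 0 with hY
  set H := pathAverage β b G t with hH
  set c : Torus d → ℝ≥0∞ := fun x => g (Y x) / N with hc
  set M : Torus d → ℝ≥0∞ := fun x => max (H x) (c x ^ p) with hM
  have hHm : Measurable H := hb.measurable_pathAverage t
  have hcm : AEMeasurable c volume :=
    (hg.comp_quasiMeasurePreserving (hb.quasiMeasurePreserving_flow t 0)).div_const N
  have hMm : AEMeasurable M volume := hHm.aemeasurable.max (hcm.pow_const p)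
  have hadm : ∀ x y, ENNReal.ofReal |f (Y x) - f (Y y)| ≤ ENNReal.ofReal (torusDist x y ^ α) *
      (N * M x ^ (1 / pt) + N * M y ^ (1 / pt)) := by
    intro x y
    rcases eq_or_ne x y with rfl | hxy
    · simp
    have hpos : ENNReal.ofReal (torusDist x y ^ α) ≠ 0 := by
      simpa using Real.rpow_pos_of_pos (torusDist_pos hxy) α
    have hptinv : 0 < 1 / pt := by positivity
    rcases eq_or_ne (M x) ∞ with hMx | hMx
    · rw [hMx, ENNReal.top_rpow_of_pos hptinv, ENNReal.mul_top hN0, top_add, ENNReal.mul_top hpos]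
      exact le_top
    rcases eq_or_ne (M y) ∞ with hMy | hMy
    · rw [hMy, ENNReal.top_rpow_of_pos hptinv, ENNReal.mul_top hN0, add_top, ENNReal.mul_top hpos]
      exact le_top
    have hH' : ∀ {z}, M z ≠ ∞ → H z ≠ ∞ := fun hz => ne_top_of_le_ne_top hz (le_max_left _ _)
    have hcM : ∀ z, g (Y z) ≤ N * M z ^ (1 / p) := fun z => by
      have h1 : g (Y z) = N * c z := (ENNReal.mul_div_cancel hN0 hNtop).symm
      rw [h1]
      refine mul_le_mul' le_rfl ?_
      calc c z = (c z ^ p) ^ (1 / p) := by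
            rw [← ENNReal.rpow_mul, mul_one_div_cancel hp.ne', ENNReal.rpow_one]
        _ ≤ _ := ENNReal.rpow_le_rpow (le_max_right _ _) (by positivity)
    calc ENNReal.ofReal |f (Y x) - f (Y y)|
        ≤ ENNReal.ofReal (torusDist (Y x) (Y y) ^ α) * (g (Y x) + g (Y y)) := hfg _ _
      _ ≤ ENNReal.ofReal (torusDist x y ^ α) * (H x ^ a * H y ^ a) *
          (N * M x ^ (1 / p) + N * M y ^ (1 / p)) :=
          mul_le_mul' (hb.ofReal_torusDist_flow_rpow_le ht hα (hH' hMx) (hH' hMy))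
            (add_le_add (hcM x) (hcM y))
      _ ≤ ENNReal.ofReal (torusDist x y ^ α) * (M x ^ a * M y ^ a) *
          (N * M x ^ (1 / p) + N * M y ^ (1 / p)) := by
          gcongr <;> exact le_max_left _ _
      _ = ENNReal.ofReal (torusDist x y ^ α) * (N * (M x ^ a * M y ^ a *
          (M x ^ (1 / p) + M y ^ (1 / p)))) := by ring
      _ ≤ ENNReal.ofReal (torusDist x y ^ α) * (N * (M x ^ (1 / pt) + M y ^ (1 / pt))) := by
          refine mul_le_mul' le_rfl (mul_le_mul' le_rfl ?_)
          rw [hpt]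
          exact rpow_mul_rpow_mul_add_le hMx hMy ha0 (by positivity)
      _ = _ := by rw [mul_add]
  refine iInf_le_of_le (fun x => N * M x ^ (1 / pt)) (iInf_le_of_le
    ((hMm.pow_const _).const_mul N) (iInf_le_of_le hadm ?_))
  have hpow : ∀ x, (N * M x ^ (1 / pt)) ^ pt = N ^ pt * M x := fun x => by
    rw [ENNReal.mul_rpow_of_nonneg _ _ hpt0.le, ← ENNReal.rpow_mul, one_div_mul_cancel hpt0.ne',
      ENNReal.rpow_one]
  rw [eLpNorm_ofReal_eq hpt0]
  simp_rw [hpow]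
  rw [lintegral_const_mul' _ _ (ENNReal.rpow_ne_top_of_nonneg hpt0.le hNtop),
    ENNReal.mul_rpow_of_nonneg _ _ (by positivity), ← ENNReal.rpow_mul,
    mul_one_div_cancel hpt0.ne', ENNReal.rpow_one]
  refine mul_le_mul' le_rfl ?_
  rw [hC, ← ENNReal.ofReal_rpow_of_pos hE]
  refine ENNReal.rpow_le_rpow ?_ (by positivity)
  have hgp : ∫⁻ x, (g x / N) ^ p ≤ 1 := by
    have h1 : ∫⁻ x, g x ^ p ≤ N ^ p := by
      rw [eLpNorm_ofReal_eq hp] at hgN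
      have := ENNReal.rpow_le_rpow hgN.le hp.le
      rwa [← ENNReal.rpow_mul, one_div_mul_cancel hp.ne', ENNReal.rpow_one] at this
    have h2 : ∀ x, (g x / N) ^ p = g x ^ p * (N ^ p)⁻¹ := fun x => by
      rw [ENNReal.div_rpow_of_nonneg _ _ hp.le, div_eq_mul_inv]
    simp_rw [h2]
    rw [lintegral_mul_const' _ _ (ENNReal.inv_ne_top.2 (by
      simp [ENNReal.rpow_eq_zero_iff, hN0, hNtop])), ← div_eq_mul_inv]
    exact ENNReal.div_le_of_le_mul (by simpa using h1)
  have hcp : ∫⁻ x, c x ^ p ≤ ENNReal.ofReal (Real.exp (L * t)) := by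
    refine (hb.lintegral_comp_flow_le t 0 (h := fun z => (g z / N) ^ p)
      ((hg.div_const N).pow_const p)).trans ?_
    rw [sub_zero, abs_of_pos ht]
    exact mul_le_of_le_one_right' hgp
  calc ∫⁻ x, M x ≤ ∫⁻ x, (H x + c x ^ p) :=
        lintegral_mono fun x => max_le (le_add_right le_rfl) (le_add_left le_rfl)
    _ = (∫⁻ x, H x) + ∫⁻ x, c x ^ p := lintegral_add_left hHm _
    _ ≤ ENNReal.ofReal (Real.exp (L * t) * (sqrtMaxConst d * K)) +
        ENNReal.ofReal (Real.exp (L * t)) := add_le_add (hb.lintegral_pathAverage_le ht) hcp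
    _ = ENNReal.ofReal (Real.exp (L * t) * (sqrtMaxConst d * K) + Real.exp (L * t)) :=
        (ENNReal.ofReal_add (by positivity) (by positivity)).symm
    _ ≤ _ := by
        refine ENNReal.ofReal_le_ofReal ?_
        have := Real.exp_pos (L * t)
        nlinarith

end IsSobolevField

end

end TorusTransport


namespace TorusTransport

noncomputable section

variable {d : ℕ}

namespace IsSobolevField

variable {T β K L : ℝ} {b : ℝ → Torus d → EuclideanSpace ℝ (Fin d)}
  {G : ℝ → Torus d → Matrix (Fin d) (Fin d) ℝ}

/-- The regularity estimate along the flow, for all times. -/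
theorem memF_comp_flow (hb : IsSobolevField T β K L b G) {t α p pt : ℝ} (ht : 0 ≤ t)
    (hα : 0 ≤ α) (hp : 1 ≤ p) (hpt : pt = p / (1 + β⁻¹ * α * p * (4 * Real.sqrt d) * t))
    {f : Torus d → ℝ} (hf : MemF α (ENNReal.ofReal p) f) :
    MemF α (ENNReal.ofReal pt) (fun x => f (flow (velocity b) t 0 x)) ∧
      seminormF α (ENNReal.ofReal pt) (fun x => f (flow (velocity b) t 0 x)) ≤
        seminormF α (ENNReal.ofReal p) f *
          ENNReal.ofReal ((Real.exp (L * t) * (sqrtMaxConst d + 3) * K) ^ (1 / pt)) := by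
  have hβ := hb.pos
  have hK := hb.one_le
  have hs := sqrtMaxConst_pos d
  have hp0 : 0 < p := by linarith
  have hz : 0 ≤ β⁻¹ * α * p * (4 * Real.sqrt d) * t := by positivity
  have hpt0 : 0 < pt := by rw [hpt]; positivity
  have hptp : pt ≤ p := by
    rw [hpt]
    exact div_le_self hp0.le (by linarith)
  have key : seminormF α (ENNReal.ofReal pt) (fun x => f (flow (velocity b) t 0 x)) ≤
      seminormF α (ENNReal.ofReal p) f *
        ENNReal.ofReal ((Real.exp (L * t) * (sqrtMaxConst d + 3) * K) ^ (1 / pt)) := by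
    rcases ht.eq_or_lt with rfl | ht'
    · have h1 : pt = p := by rw [hpt]; simp
      simp only [hb.hasFlow.self, h1]
      refine le_mul_of_one_le_right' ?_
      have h2 : 1 ≤ Real.exp (L * 0) * (sqrtMaxConst d + 3) * K := by
        rw [mul_zero, Real.exp_zero]
        nlinarith
      simpa using Real.one_le_rpow h2 (by positivity : 0 ≤ 1 / p)
    · refine hb.seminormF_comp_flow_le ht' hα hp0 hpt0 ?_ f
      rw [hpt]
      field_simp
      ring
  refine ⟨⟨?_, key.trans_lt (ENNReal.mul_lt_top hf.2 ENNReal.ofReal_lt_top)⟩, key⟩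
  exact (hb.memLp_comp_flow t 0 ENNReal.ofReal_ne_top hf.1).mono_exponent
    (ENNReal.ofReal_le_ofReal hptp)

end IsSobolevField

lemma memF_congr_ae {α : ℝ} {p : ℝ≥0∞} {f f' : Torus d → ℝ} (h : f =ᵐ[volume] f')
    (hf : MemF α p f) : MemF α p f' :=
  ⟨hf.1.ae_eq h, (seminormF_congr_ae h) ▸ hf.2⟩

end

end TorusTransport



theorem theorem1p1 (d : ℕ) (hd : 1 ≤ d) :
    ∃ C₁ C₂ : ℝ, 0 < C₁ ∧ 2 < C₂ ∧
      ∀ (T β : ℝ) (K L : ℝ≥0) (b : ℝ → Torus d → EuclideanSpace ℝ (Fin d))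
        (Db : ℝ → Torus d → Matrix (Fin d) (Fin d) ℝ),
        0 < T → 0 < β →
        Integrable (fun z : ℝ × Torus d => b z.1 z.2) (spaceTime d T) →
        (∀ i j, AEStronglyMeasurable (fun z : ℝ × Torus d => Db z.1 z.2 i j) (spaceTime d T)) →
        (∀ t ∈ Icc 0 T, IsWeakGradient (b t) (Db t)) →
        (⨆ t ∈ Icc 0 T, ∫⁻ x, ENNReal.ofReal (Real.exp (β * matNorm (Db t x)))) = K →
        eLpNorm (fun z : ℝ × Torus d => (Db z.1 z.2).trace) ∞ (spaceTime d T) = L →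
        ∀ (α p : ℝ) (u₀ : Torus d → ℝ), 0 < α → α ≤ 1 → 1 ≤ p → MemF α (ENNReal.ofReal p) u₀ →
          (∃ u, IsTransportSolution T p b Db u₀ u) ∧
          (∀ u v, IsTransportSolution T p b Db u₀ u → IsTransportSolution T p b Db u₀ v →
            ∀ t ∈ Icc 0 T, u t =ᵐ[volume] v t) ∧
          ∀ u, IsTransportSolution T p b Db u₀ u → ∀ t ∈ Icc 0 T, ∀ pt : ℝ,
            pt = p / (1 + β⁻¹ * α * p * C₁ * t) →
            MemF α (ENNReal.ofReal pt) (u t) ∧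
            seminormF α (ENNReal.ofReal pt) (u t) ≤
              seminormF α (ENNReal.ofReal p) u₀ *
                ENNReal.ofReal ((Real.exp (L * t) * C₂ * K) ^ (1 / pt)) := by
  have hd0 : 0 < Real.sqrt d := Real.sqrt_pos.2 (by exact_mod_cast hd)
  refine ⟨4 * Real.sqrt d, sqrtMaxConst d + 3, by positivity,
    by linarith [sqrtMaxConst_pos d], ?_⟩
  intro T β K L b Db hT hβ hbi hDb hG hK hL α p u₀ hα _ hp hu₀
  obtain ⟨b', G, hb, hbb, hGG⟩ := exists_isSobolevField hT hβ hbi hDb hG hK hL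
  have hvel : ∀ᵐ z ∂spaceTime d T, b z.1 z.2 = velocity b' z.1 z.2 := by
    have h1 : ∀ᵐ z ∂spaceTime d T, velocity b' z.1 z.2 = b' z.1 z.2 :=
      ae_spaceTime_of_ae (measurableSet_eq_fun hb.measurable_velocity hb.measurable)
        fun t => hb.velocity_ae_eq t
    filter_upwards [hbb, h1] with z h2 h3
    rw [h2, h3]
  have hto : ∀ {u}, IsTransportSolution T p b Db u₀ u →
      IsTransportSolution T p (velocity b') G u₀ u := fun hu => hu.congr hvel hGG
  have hfrom : ∀ {u}, IsTransportSolution T p (velocity b') G u₀ u →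
      IsTransportSolution T p b Db u₀ u := fun hu =>
    hu.congr (hvel.mono fun _ h => h.symm) (hGG.mono fun _ h => h.symm)
  set f : Torus d → ℝ := hu₀.1.1.mk u₀ with hf
  have hfm : Measurable f := hu₀.1.1.stronglyMeasurable_mk.measurable
  have hfu : u₀ =ᵐ[volume] f := hu₀.1.1.ae_eq_mk
  have hfF : MemF α (ENNReal.ofReal p) f := memF_congr_ae hfu hu₀
  have hsol := hb.isTransportSolution_comp_flow hp hfm hfF.1 hfu.symm
  refine ⟨⟨_, hfrom hsol⟩,
    fun u v hu hv t ht => hb.ae_eq_of_isTransportSolution hp (hto hu) (hto hv) ht,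
    fun u hu t ht pt hpt => ?_⟩
  have hu_eq := hb.ae_eq_of_isTransportSolution hp hsol (hto hu) ht
  obtain ⟨h1, h2⟩ := hb.memF_comp_flow ht.1 hα.le hp hpt hfF
  refine ⟨memF_congr_ae hu_eq h1, ?_⟩
  rw [← seminormF_congr_ae hu_eq, seminormF_congr_ae hfu]
  exact h2
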